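/- **Setting.** Points of $\mathbb R^3$ are written $\vec x=(x,z)$, with $x\in\mathbb R^2$ (cross-range) and $z\in\mathbb R$ (range, along the beam axis). The parameters are a wavelength $\lambda$, a mean inter-particle distance $\ell$, a particle radius $a$, a beam waist radius $r_o$, a cross-range $L_x$, a range $L_z$, an aperture diameter $d_A$ and a damping $k_d$ (all positive), and a reflectivity $\sigma\in\mathbb R$. Put $k=2\pi/\lambda$, $\rho=\ell^{-3}$, $\eta=\sigma\,\frac{4\pi a^3}{3}$, $$G(\vec x,\vec y)=\frac{e^{(ik-k_d)|\vec x-\vec y|}}{4\pi|\vec x-\vec y|},\qquad R_z=r_o\Big(1+\frac{2iz}{kr_o^2}\Big)^{1/2},\qquad u_b(\vec y)=\mathbf 1_{\{z>0\}}\,\frac{r_o^2}{R_z^2}\exp\Big(-\frac{|y|^2}{R_z^2}+ikz-k_dz\Big)\ \text{ for }\vec y=(y,z).$$ Let $\{\vec x_j\}$ be a homogeneous Poisson point process on $\mathbb R^3$ with intensity $\rho$. The field scattered by the small particles, in the single-scattering approximation, is $$u_s(\vec x)=\sum_j s_j(\vec x),\qquad s_j(\vec x)=k^2\eta\,G(\vec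 x,\vec x_j)\,u_b(\vec x_j).$$ For $\delta>0$ we say that the parameters are in the *$\delta$-scaling regime* if $$\lambda\le\delta\ell,\quad \ell\le\delta r_o,\quad r_o\le\delta L_x,\quad L_x\le\delta L_z,\quad \lambda\le\delta d_A,\quad d_A\le\delta r_o,\quad L_z\le\delta\,\frac{kr_o^2}{2},\quad k_dL_x\le\delta,\quad ka\le\delta .$$ For $C\ge1$, a camera aperture is a set $A\subset\mathbb R^3$ any two points of which are at distance at most $d_A$, and such that every $(x,z)\in A$ satisfies $L_x/C\le|x|\le CL_x$ and $L_z/C\le z\le CL_z$. For $\vec X=(X,Z)$ with $X\ne0$ let $\hat X=X/|X|$, let $\hat X^\perp$ be $\hat X$ rotated counterclockwise by ninety degrees, and put $$I(\vec X)=\frac{\eta^2k^4\rho r_o^2e^{-2k_dZ}}{32|X|},\qquad \Psi(\chi,\xi,\zeta)=\frac1\pi\int_0^\pi\exp\Big(i(\chi\sin\alpha+\zeta\cos\alpha)-\frac{\xi^2}{2}\sin^2\alpha\Big)d\alpha,$$ and, for $\vec x=(x,z)$, $$K(\vec X,\vec x)=I(\vec X)\,\Psi\Big(k\hat X\cdot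 x,\ \frac{kr_o}{2|X|}\hat X^\perp\cdot x,\ kz\Big).$$ **Proposition.** For all $C\ge1$ and $\varepsilon>0$ there is $\delta>0$, depending only on $C$ and $\varepsilon$, such that for all parameters in the $\delta$-scaling regime, every camera aperture $A$, and every Poisson process as above: 1. for every $\vec x\in A$ the series defining $u_s(\vec x)$ converges absolutely almost surely, and $u_s(\vec x)$ is square integrable; 2. (mean) for every $\vec x\in A$ the variable $\sum_j|s_j(\vec x)|$ is integrable and $\big|\mathbb E[u_s(\vec x)]\big|\le\varepsilon\,\mathbb E\big[\sum_j|s_j(\vec x)|\big]$; 3. (covariance) for all $\vec X,\vec x\in\mathbb R^3$ such that $\vec x_1=\vec X+\vec x/2$ and $\vec x_2=\vec X-\vec x/2$ lie in $A$, $$\Big|\mathbb E\Big[\big(u_s(\vec x_1)-\mathbb E[u_s(\vec x_1)]\big)\overline{\big(u_s(\vec x_2)-\mathbb E[u_s(\vec x_2)]\big)}\Big]-K(\vec X,\vec x)\Big|\le\varepsilon\,I(\vec X);$$ 4. if moreover $\log(r_o/\ell)\le\delta\,(L_x/r_o)^2$, then the mean is negligible with respect to the standard deviation, $\big|\mathbb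 E[u_s(\vec x)]\big|\le\varepsilon\sqrt{I(\vec x)}$ for every $\vec x\in A$, and the second moment has the same approximation: for all $\vec X,\vec x$ as in 3, $$\Big|\mathbb E\big[u_s(\vec x_1)\overline{u_s(\vec x_2)}\big]-K(\vec X,\vec x)\Big|\le\varepsilon\,I(\vec X).$$ -/

import Mathlib

open MeasureTheory ProbabilityTheory Filter
open scoped ENNReal NNReal ComplexConjugate

noncomputable section

namespace LaserBeam

/-- Physical space `ℝ³`; the third coordinate (index `2`) is the range, along the beam axis. -/
abbrev Space : Type := EuclideanSpace ℝ (Fin 3)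

/-- The cross-range plane, orthogonal to the beam axis. -/
abbrev Plane : Type := EuclideanSpace ℝ (Fin 2)

/-- Cross-range component `𝐱` of `(𝐱, z)`. -/
def cross (x : Space) : Plane := !₂[x 0, x 1]

/-- Range component `z` of `(𝐱, z)`. -/
def range (x : Space) : ℝ := x 2

/-- Counterclockwise rotation by ninety degrees in the cross-range plane. -/
def rot (u : Plane) : Plane := !₂[-u 1, u 0]

/-- The unit vector `u / |u|`. -/
def unit (u : Plane) : Plane := ‖u‖⁻¹ • u

/-- The physical parameters: wavelength, mean distance between particles, particle radius,
particle reflectivity, beam radius at the waist, typical cross-range and range of the camera,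
diameter of the camera aperture, damping coefficient. -/
structure Params where
  lam : ℝ
  ell : ℝ
  a : ℝ
  sigma : ℝ
  ro : ℝ
  Lx : ℝ
  Lz : ℝ
  dA : ℝ
  kd : ℝ

namespace Params

/-- The wavenumber. -/
def k (p : Params) : ℝ := 2 * Real.pi / p.lam

/-- The intensity of the cloud: mean number of particles per unit volume. -/
def rho (p : Params) : ℝ := 1 / p.ell ^ 3

/-- The isotropic scattering strength of a small particle (reflectivity times volume). -/
def eta (p : Params) : ℝ := p.sigma * (4 * Real.pi * p.a ^ 3 / 3)

/-- The Rayleigh length. -/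
def rayleigh (p : Params) : ℝ := p.k * p.ro ^ 2 / 2

end Params

/-- The scaling regime, with every `A ≪ B` read as `A ≤ δ * B` for a small `δ`. -/
structure Regime (δ : ℝ) (p : Params) : Prop where
  lam_pos : 0 < p.lam
  ell_pos : 0 < p.ell
  a_pos : 0 < p.a
  ro_pos : 0 < p.ro
  Lx_pos : 0 < p.Lx
  Lz_pos : 0 < p.Lz
  dA_pos : 0 < p.dA
  kd_pos : 0 < p.kd
  lam_ell : p.lam ≤ δ * p.ell
  ell_ro : p.ell ≤ δ * p.ro
  ro_Lx : p.ro ≤ δ * p.Lx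
  Lx_Lz : p.Lx ≤ δ * p.Lz
  lam_dA : p.lam ≤ δ * p.dA
  dA_ro : p.dA ≤ δ * p.ro
  Lz_rayleigh : p.Lz ≤ δ * p.rayleigh
  kd_Lx : p.kd * p.Lx ≤ δ
  /-- small particles -/
  k_a : p.k * p.a ≤ δ

/-- The (complex) beam radius `R_z = r_o (1 + 2 i z / (k r_o²))^{1/2}`. -/
def beamRadius (p : Params) (z : ℝ) : ℂ :=
  (p.ro : ℂ) *
    (1 + 2 * Complex.I * (z : ℂ) / ((p.k : ℂ) * (p.ro : ℂ) ^ 2)) ^ (1 / 2 : ℂ)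

/-- The laser beam. The source lies in the plane `z = 0` and radiates into the half-space
`z > 0`, so the field is set to zero for `z ≤ 0`. -/
def beam (p : Params) (y : Space) : ℂ :=
  if 0 < range y then
    (p.ro : ℂ) ^ 2 / beamRadius p (range y) ^ 2 *
      Complex.exp (-((‖cross y‖ : ℂ) ^ 2 / beamRadius p (range y) ^ 2)
        + Complex.I * (p.k : ℂ) * (range y : ℂ) - (p.kd : ℂ) * (range y : ℂ))
  else 0

/-- The damped outgoing Green's function of the Helmholtz equation. -/
def green (p : Params) (x y : Space) : ℂ :=
  1 / (4 * (Real.pi : ℂ) * (‖x - y‖ : ℂ)) *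
    Complex.exp ((Complex.I * (p.k : ℂ) - (p.kd : ℂ)) * (‖x - y‖ : ℂ))

/-- The field at `x` scattered by one small particle at `y`, in the Born approximation. -/
def singleScatter (p : Params) (x y : Space) : ℂ :=
  (p.k : ℂ) ^ 2 * (p.eta : ℂ) * green p x y * beam p y

/-- The number of points of the configuration that lie in `B`. -/
def count {Ω : Type*} (pts : ℕ → Ω → Space) (B : Set Space) (ω : Ω) : ℝ≥0∞ :=
  ∑' j, B.indicator (fun _ => (1 : ℝ≥0∞)) (pts j ω)

/-- `pts` enumerates a homogeneous Poisson point process on `ℝ³` with intensity `ρ`: the number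
of points in a set of finite volume has the Poisson law with mean `ρ` times the volume, and the
numbers of points in disjoint sets are independent. -/
structure IsPoissonCloud {Ω : Type*} [MeasurableSpace Ω] (P : Measure Ω) (ρ : ℝ)
    (pts : ℕ → Ω → Space) : Prop where
  measurable : ∀ j, Measurable (pts j)
  law : ∀ B : Set Space, MeasurableSet B → volume B < ∞ →
    P.map (count pts B) =
      (poissonMeasure (ENNReal.ofReal ρ * volume B).toNNReal).map (fun n : ℕ => (n : ℝ≥0∞))
  indep : ∀ (n : ℕ) (B : Fin n → Set Space), (∀ i, MeasurableSet (B i)) →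
    (∀ i, volume (B i) < ∞) → Pairwise (Function.onFun Disjoint B) →
    iIndepFun (fun i => count pts (B i)) P

/-- The field scattered by the cloud of small particles, in the Born approximation. -/
def scattered (p : Params) {Ω : Type*} (pts : ℕ → Ω → Space) (x : Space) (ω : Ω) : ℂ :=
  ∑' j, singleScatter p x (pts j ω)

/-- `A` is a camera aperture of diameter at most `d_A`, whose cross-range offset from the beam
axis is of order `L_x` and whose range is of order `L_z` (up to the factor `C`). -/
structure IsAperture (C : ℝ) (p : Params) (A : Set Space) : Prop where
  dist_le : ∀ x ∈ A, ∀ y ∈ A, dist x y ≤ p.dA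
  le_cross : ∀ x ∈ A, p.Lx / C ≤ ‖cross x‖
  cross_le : ∀ x ∈ A, ‖cross x‖ ≤ C * p.Lx
  le_range : ∀ x ∈ A, p.Lz / C ≤ range x
  range_le : ∀ x ∈ A, range x ≤ C * p.Lz

/-- The correlation profile `Ψ(χ, ξ, ζ)`. -/
def Psi (χ ξ ζ : ℝ) : ℂ :=
  1 / (Real.pi : ℂ) * ∫ α in (0 : ℝ)..Real.pi,
    Complex.exp (Complex.I * ((Real.sin α : ℂ) * (χ : ℂ) + (Real.cos α : ℂ) * (ζ : ℂ))) *
      Complex.exp (-((ξ : ℂ) ^ 2 / 2) * (Real.sin α : ℂ) ^ 2)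

/-- The amplitude `η² k⁴ ρ r_o² e^{-2 k_d Z} / (32 |𝐗|)` at the point `(𝐗, Z)`. -/
def meanIntensity (p : Params) (X : Space) : ℝ :=
  p.eta ^ 2 * p.k ^ 4 * p.rho * p.ro ^ 2 * Real.exp (-2 * p.kd * range X) / (32 * ‖cross X‖)

/-- The asymptotic covariance function of the scattered field, at midpoint `X` and offset `x`. -/
def covModel (p : Params) (X x : Space) : ℂ :=
  (meanIntensity p X : ℂ) *
    Psi (p.k * inner ℝ (unit (cross X)) (cross x))
      (p.k * p.ro / (2 * ‖cross X‖) * inner ℝ (rot (unit (cross X))) (cross x))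
      (p.k * range x)

end LaserBeam

end

open MeasureTheory ProbabilityTheory Filter
open scoped ENNReal NNReal ComplexConjugate

noncomputable section

namespace LaserBeam

/-! ### Moment formulas for the Poisson cloud -/

/-! For a Poisson process, Campbell's formulas reduce every moment in the statement to a
deterministic integral. With g_x(y) = G(x,y) u_b(y), the mean of u_s(x) is ρ k² η ∫ g_x, the mean of
the sum of the moduli is ρ |k² η| ∫ |g_x|, the covariance at (x₁, x₂) is ρ (k² η)² ∫ g_{x₁} conj
g_{x₂}, and the second moment exceeds the covariance by the product of the means. The formulas need
g_x in L¹ and in L²: the damping gives decay at infinity, and in dimension three the singularity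
1/|x - y| is locally square integrable.

Mean. The integrand carries the rapid phase k(|x - y| + z_y). Writing y = x + w and replacing w by ζ
w, where ζ goes from 1 to 1 + i/4, turns this oscillation into exponential decay. The rotation needs
no explicit contour: ζ^n times the rotated integral is holomorphic and constant along rays, hence
constant (`integral_eq_integral_rotated`). Beyond the camera all three variables are rotated
(`norm_integral_farIntegrand_le`); in each slice between the source and the camera only the two
cross-range variables are (`norm_integral_slice_le`). The result is O(Z/k + 1/k²) e^{-k_d Z}, with
the additional factor exp(-|X|²/(64 r_o²)) because the camera lies off the beam. A cylinder around
the beam gives ∫ |g_x| ≥ c r_o² e^{-k_d Z} (`le_integral_norm_greenBeam`), and Z ≪ k r_o² makes the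
mean relatively small. The exponential factor also beats the number of particles per r_o³, provided
log(r_o/ℓ) is small compared with (L_x/r_o)²; this is the last item.

Covariance. The phase of the beam cancels in g_{x₁} conj g_{x₂}, so only the beam intensity and the
phase k(|x₁ - y| - |x₂ - y|) remain. Put y = (r_o v, r_o v', Z - R t) with R = |X|, in the frame of
the midpoint. The difference of distances is an affine form divided by the mean distance
(`rad_sub_rad_eq`), and in the scaling limit the integrand becomes e^{-2(v² + v'²)} (1 + t²)^{-1}
exp(i(χ - 2ξv' + ζt)/√(1 + t²)). The Gaussian integral in v' and the substitution t = tan θ produce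
Ψ, and the constants combine into r_o²/(32 R).

The difficulty is uniformity. Only λ ≪ d_A is known, so the frequencies χ, ξ, ζ are unbounded and a
small error in the geometry may be a large error in the phase. `exists_norm_corr_sub_le` resolves
this by a dichotomy. If some frequency is large, the true and the limit integrals are both small: by
oscillation in t when χ or ζ dominates, and by oscillation in v' when ξ dominates. If all
frequencies are bounded, the two phases are close. Both cases of oscillation rest on
`norm_integral_oscillatory_le`, a non-stationary phase bound that tolerates a short set of nearly
stationary points.

What lies outside a large box in (v, v', t) is controlled without oscillation, by the inverse square
decay in range, the Gaussian decay in cross-range, and the smallness of the beam near the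
observation points (`Narrow.norm_integral_compl_le`). -/

lemma lintegral_poisson_mul (r : ℝ≥0) (f : ℕ → ℝ≥0∞) :
    ∫⁻ n, (n : ℝ≥0∞) * f n ∂poissonMeasure r = r * ∫⁻ n, f (n + 1) ∂poissonMeasure r := by
  simp only [poissonMeasure, lintegral_sum_measure, lintegral_smul_measure, lintegral_dirac,
    smul_eq_mul]
  -- The term n = 0 vanishes, and n rⁿ/n! = r · rⁿ⁻¹/(n-1)! shifts all the others by one.
  rw [tsum_eq_zero_add' ENNReal.summable, ← ENNReal.tsum_mul_left]
  simp only [Nat.cast_zero, zero_mul, mul_zero, zero_add]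
  refine tsum_congr fun n => ?_
  rw [← mul_assoc, ← mul_assoc]
  congr 1
  have h : (r : ℝ≥0∞) = ENNReal.ofReal r := by simp
  have h2 : ((n + 1 : ℕ) : ℝ≥0∞) = ENNReal.ofReal (n + 1 : ℕ) := by
    rw [ENNReal.ofReal_natCast]
  rw [h, h2, ← ENNReal.ofReal_mul (by positivity), ← ENNReal.ofReal_mul (by positivity)]
  congr 1
  rw [Nat.factorial_succ, pow_succ]
  push_cast
  have : (n.factorial : ℝ) ≠ 0 := by positivity
  field_simp

lemma lintegral_poisson_id (r : ℝ≥0) :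
    ∫⁻ n, (n : ℝ≥0∞) ∂poissonMeasure r = r := by
  simpa using lintegral_poisson_mul r (fun _ => 1)

lemma lintegral_poisson_sq (r : ℝ≥0) :
    ∫⁻ n, (n : ℝ≥0∞) * n ∂poissonMeasure r = r * (r + 1) := by
  rw [lintegral_poisson_mul r (fun n => (n : ℝ≥0∞))]
  push_cast
  rw [lintegral_add_left (by fun_prop), lintegral_poisson_id]
  simp

lemma count_union {Ω : Type*} {pts : ℕ → Ω → Space} {A B : Set Space} (hd : Disjoint A B) (ω : Ω) :
    count pts (A ∪ B) ω = count pts A ω + count pts B ω := by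
  unfold count
  rw [← ENNReal.tsum_add]
  refine tsum_congr fun j => ?_
  rw [Set.indicator_union_of_disjoint hd]

section Campbell

variable {Ω : Type*} [MeasurableSpace Ω] {P : Measure Ω} {ρ : ℝ}
  {pts : ℕ → Ω → Space}

lemma measurable_count (hm : ∀ j, Measurable (pts j)) {B : Set Space} (hB : MeasurableSet B) :
    Measurable (count pts B) := by
  unfold count
  refine Measurable.tsum fun j => ?_
  exact (measurable_const.indicator hB).comp (hm j)

lemma IsPoissonCloud.lintegral_count (h : IsPoissonCloud P ρ pts) {B : Set Space}
    (hB : MeasurableSet B) (hv : volume B < ∞) :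
    ∫⁻ ω, count pts B ω ∂P = ENNReal.ofReal ρ * volume B := by
  have hfin : ENNReal.ofReal ρ * volume B ≠ ∞ := ENNReal.mul_ne_top (by simp) hv.ne
  have := lintegral_map (μ := P) (f := fun x => x) measurable_id (measurable_count h.measurable hB)
  rw [← this, h.law B hB hv, lintegral_map (f := fun x => x) measurable_id (by fun_prop),
    lintegral_poisson_id,
    ENNReal.coe_toNNReal hfin]

lemma IsPoissonCloud.lintegral_count_sq (h : IsPoissonCloud P ρ pts) {B : Set Space}
    (hB : MeasurableSet B) (hv : volume B < ∞) :
    ∫⁻ ω, count pts B ω * count pts B ω ∂P =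
      (ENNReal.ofReal ρ * volume B) * (ENNReal.ofReal ρ * volume B + 1) := by
  have hfin : ENNReal.ofReal ρ * volume B ≠ ∞ := ENNReal.mul_ne_top (by simp) hv.ne
  have := lintegral_map (μ := P) (f := fun x => x * x) (by fun_prop)
    (measurable_count h.measurable hB)
  rw [← this, h.law B hB hv, lintegral_map (by fun_prop) (by fun_prop), lintegral_poisson_sq,
    ENNReal.coe_toNNReal hfin]

lemma IsPoissonCloud.lintegral_count_mul_of_disjoint (h : IsPoissonCloud P ρ pts) {A B : Set Space}
    (hA : MeasurableSet A) (hB : MeasurableSet B) (hvA : volume A < ∞) (hvB : volume B < ∞)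
    (hd : Disjoint A B) :
    ∫⁻ ω, count pts A ω * count pts B ω ∂P =
      (ENNReal.ofReal ρ * volume A) * (ENNReal.ofReal ρ * volume B) := by
  have hi := h.indep 2 ![A, B] (by simp [Fin.forall_fin_two, hA, hB])
    (by simp [Fin.forall_fin_two, hvA, hvB]) (by
      intro i j hij
      fin_cases i <;> fin_cases j <;> simp_all [Function.onFun, hd.symm])
  have hi2 : IndepFun (count pts A) (count pts B) P := by
    simpa using hi.indepFun (i := 0) (j := 1) (by simp)
  have := lintegral_mul_eq_lintegral_mul_lintegral_of_indepFun (measurable_count h.measurable hA)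
    (measurable_count h.measurable hB) hi2
  simp only [Pi.mul_apply] at this
  rw [this, h.lintegral_count hA hvA, h.lintegral_count hB hvB]

/-- Cutting the two sets into their common part and their two differences gives three disjoint
pieces with independent counts. All products factor except the square of the count of the common
part, whose excess is the Poisson variance ρ |A ∩ B|. -/
lemma IsPoissonCloud.lintegral_count_mul (h : IsPoissonCloud P ρ pts) {A B : Set Space}
    (hA : MeasurableSet A) (hB : MeasurableSet B) (hvA : volume A < ∞) (hvB : volume B < ∞) :
    ∫⁻ ω, count pts A ω * count pts B ω ∂P =
      (ENNReal.ofReal ρ * volume A) * (ENNReal.ofReal ρ * volume B)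
        + ENNReal.ofReal ρ * volume (A ∩ B) := by
  have hI := hA.inter hB
  have hAd := hA.diff hB
  have hBd := hB.diff hA
  have vI : volume (A ∩ B) < ∞ := (measure_mono Set.inter_subset_left).trans_lt hvA
  have vA : volume (A \ B) < ∞ := (measure_mono Set.sdiff_subset).trans_lt hvA
  have vB : volume (B \ A) < ∞ := (measure_mono Set.sdiff_subset).trans_lt hvB
  have e1 : A = (A ∩ B) ∪ (A \ B) := (Set.inter_union_sdiff A B).symm
  have e2 : B = (A ∩ B) ∪ (B \ A) := by
    rw [Set.inter_comm]; exact (Set.inter_union_sdiff B A).symm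
  have d1 : Disjoint (A ∩ B) (A \ B) := by
    rw [Set.disjoint_left]; intro x hx hx'; exact hx'.2 hx.2
  have d2 : Disjoint (A ∩ B) (B \ A) := by
    rw [Set.disjoint_left]; intro x hx hx'; exact hx'.2 hx.1
  have d3 : Disjoint (A \ B) (B \ A) := by
    rw [Set.disjoint_left]; intro x hx hx'; exact hx'.2 hx.1
  have mI := measurable_count h.measurable hI
  have mA := measurable_count h.measurable hAd
  have mB := measurable_count h.measurable hBd
  have hmA : volume A = volume (A ∩ B) + volume (A \ B) := (measure_inter_add_sdiff A hB).symm
  have hmB : volume B = volume (A ∩ B) + volume (B \ A) := by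
    rw [Set.inter_comm]; exact (measure_inter_add_sdiff B hA).symm
  have key : ∀ ω, count pts A ω * count pts B ω =
      count pts (A ∩ B) ω * count pts (A ∩ B) ω + count pts (A ∩ B) ω * count pts (B \ A) ω +
      (count pts (A ∩ B) ω * count pts (A \ B) ω + count pts (A \ B) ω * count pts (B \ A) ω) := by
    intro ω
    have c1 : count pts A ω = count pts (A ∩ B) ω + count pts (A \ B) ω := by
      rw [← count_union d1, ← e1]
    have c2 : count pts B ω = count pts (A ∩ B) ω + count pts (B \ A) ω := by
      rw [← count_union d2, ← e2]
    rw [c1, c2]; ring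
  simp_rw [key]
  rw [lintegral_add_left (by fun_prop), lintegral_add_left (by fun_prop),
    lintegral_add_left (by fun_prop), h.lintegral_count_sq hI vI,
    h.lintegral_count_mul_of_disjoint hI hBd vI vB d2,
    h.lintegral_count_mul_of_disjoint hI hAd vI vA d1,
    h.lintegral_count_mul_of_disjoint hAd hBd vA vB d3, hmA, hmB]
  ring

/-- The intensity measure of the cloud. -/
lemma IsPoissonCloud.sum_map (h : IsPoissonCloud P ρ pts) :
    Measure.sum (fun j => P.map (pts j)) = ENNReal.ofReal ρ • (volume : Measure Space) := by
  have hfin : ∀ B : Set Space, MeasurableSet B → volume B < ∞ →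
      Measure.sum (fun j => P.map (pts j)) B = ENNReal.ofReal ρ * volume B := by
    intro B hB hv
    rw [← h.lintegral_count hB hv, Measure.sum_apply _ hB]
    unfold count
    rw [lintegral_tsum (f := fun j ω => B.indicator (fun _ => (1 : ℝ≥0∞)) (pts j ω))
      fun j => ((measurable_const.indicator hB).comp (h.measurable j)).aemeasurable]
    refine tsum_congr fun j => ?_
    rw [Measure.map_apply (h.measurable j) hB, ← lintegral_indicator_one (h.measurable j hB)]
    rfl
  -- The total masses may be infinite, so uniqueness is applied on the π-system of sets of finite
  -- volume together with an exhaustion of space by such sets.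
  symm
  refine Measure.ext_of_generateFrom_of_iUnion
    {s | MeasurableSet s ∧ volume s < ∞} (spanningSets (volume : Measure Space)) ?_ ?_ ?_ ?_ ?_ ?_
  · refine le_antisymm ?_ (MeasurableSpace.generateFrom_le fun s hs => hs.1)
    intro s hs
    have : s = ⋃ n, s ∩ spanningSets (volume : Measure Space) n := by
      rw [← Set.inter_iUnion, iUnion_spanningSets, Set.inter_univ]
    rw [this]
    refine MeasurableSet.iUnion fun n => MeasurableSpace.measurableSet_generateFrom
      ⟨hs.inter (measurableSet_spanningSets _ n), ?_⟩
    exact (measure_mono Set.inter_subset_right).trans_lt (measure_spanningSets_lt_top _ n)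
  · rintro s hs t ht -
    exact ⟨hs.1.inter ht.1, (measure_mono Set.inter_subset_left).trans_lt hs.2⟩
  · exact iUnion_spanningSets _
  · exact fun i => ⟨measurableSet_spanningSets _ i, measure_spanningSets_lt_top _ i⟩
  · intro i
    exact ENNReal.mul_ne_top (by simp) (measure_spanningSets_lt_top _ i).ne
  · intro s hs
    rw [hfin s hs.1 hs.2]; rfl

/-- The second moment measure of the cloud. -/
lemma IsPoissonCloud.sum_map_prod (h : IsPoissonCloud P ρ pts) :
    Measure.sum (fun q : ℕ × ℕ => P.map (fun ω => (pts q.1 ω, pts q.2 ω))) =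
      (ENNReal.ofReal ρ * ENNReal.ofReal ρ) • ((volume : Measure Space).prod volume)
        + ENNReal.ofReal ρ • (volume : Measure Space).map (fun y => (y, y)) := by
  have hmeas : ∀ q : ℕ × ℕ, Measurable (fun ω => (pts q.1 ω, pts q.2 ω)) := fun q =>
    (h.measurable q.1).prodMk (h.measurable q.2)
  have hdiag : Measurable (fun y : Space => (y, y)) := by fun_prop
  have hfin : ∀ A B : Set Space, MeasurableSet A → MeasurableSet B → volume A < ∞ → volume B < ∞ →
      Measure.sum (fun q : ℕ × ℕ => P.map (fun ω => (pts q.1 ω, pts q.2 ω))) (A ×ˢ B) =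
        (ENNReal.ofReal ρ * volume A) * (ENNReal.ofReal ρ * volume B)
        + ENNReal.ofReal ρ * volume (A ∩ B) := by
    intro A B hA hB hvA hvB
    rw [← h.lintegral_count_mul hA hB hvA hvB, Measure.sum_apply _ (hA.prod hB)]
    -- Pairs of equal indices are included in the double sum, which is why the second moment measure
    -- has a part carried by the diagonal.
    have : ∀ ω, count pts A ω * count pts B ω = ∑' q : ℕ × ℕ,
        (A ×ˢ B).indicator (fun _ => (1 : ℝ≥0∞)) (pts q.1 ω, pts q.2 ω) := by
      intro ω
      unfold count
      rw [ENNReal.tsum_prod', ← ENNReal.tsum_mul_right]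
      refine tsum_congr fun i => ?_
      rw [← ENNReal.tsum_mul_left]
      refine tsum_congr fun j => ?_
      by_cases h1 : pts i ω ∈ A <;> by_cases h2 : pts j ω ∈ B <;> simp [h1, h2]
    simp_rw [this]
    rw [lintegral_tsum (f := fun (q : ℕ × ℕ) ω =>
      (A ×ˢ B).indicator (fun _ => (1 : ℝ≥0∞)) (pts q.1 ω, pts q.2 ω)) fun q => ((measurable_const.indicator (hA.prod hB)).comp
      (hmeas q)).aemeasurable]
    refine tsum_congr fun q => ?_
    rw [Measure.map_apply (hmeas q) (hA.prod hB),
      ← lintegral_indicator_one (hmeas q (hA.prod hB))]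
    rfl
  have hrect : ∀ A B : Set Space, MeasurableSet A → MeasurableSet B →
      ((ENNReal.ofReal ρ * ENNReal.ofReal ρ) • ((volume : Measure Space).prod volume)
        + ENNReal.ofReal ρ • (volume : Measure Space).map (fun y => (y, y)) :
          Measure (Space × Space)) (A ×ˢ B) =
        (ENNReal.ofReal ρ * volume A) * (ENNReal.ofReal ρ * volume B)
        + ENNReal.ofReal ρ * volume (A ∩ B) := by
    intro A B hA hB
    have : (fun y : Space => (y, y)) ⁻¹' (A ×ˢ B) = A ∩ B := by ext; simp
    simp only [Measure.add_apply, Measure.smul_apply, Measure.prod_prod, smul_eq_mul,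
      Measure.map_apply hdiag (hA.prod hB), this]
    ring
  set C : Set (Set Space) := {s | MeasurableSet s ∧ volume s < ∞} with hC
  have hgen : MeasurableSpace.generateFrom C = (inferInstance : MeasurableSpace Space) := by
    refine le_antisymm (MeasurableSpace.generateFrom_le fun s hs => hs.1) ?_
    intro s hs
    have : s = ⋃ n, s ∩ spanningSets (volume : Measure Space) n := by
      rw [← Set.inter_iUnion, iUnion_spanningSets, Set.inter_univ]
    rw [this]
    refine MeasurableSet.iUnion fun n => MeasurableSpace.measurableSet_generateFrom
      ⟨hs.inter (measurableSet_spanningSets _ n), ?_⟩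
    exact (measure_mono Set.inter_subset_right).trans_lt (measure_spanningSets_lt_top _ n)
  have hpi : IsPiSystem C := by
    rintro s hs t ht -
    exact ⟨hs.1.inter ht.1, (measure_mono Set.inter_subset_left).trans_lt hs.2⟩
  have hspan : IsCountablySpanning C :=
    ⟨spanningSets (volume : Measure Space), fun i => ⟨measurableSet_spanningSets _ i,
      measure_spanningSets_lt_top _ i⟩, iUnion_spanningSets _⟩
  refine Measure.ext_of_generateFrom_of_iUnion (Set.image2 (· ×ˢ ·) C C)
    (fun n => spanningSets (volume : Measure Space) n ×ˢ spanningSets (volume : Measure Space) n)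
    (generateFrom_eq_prod hgen hgen hspan hspan).symm (hpi.prod hpi) ?_ ?_ ?_ ?_
  · rw [Set.iUnion_prod_of_monotone (monotone_spanningSets _) (monotone_spanningSets _),
      iUnion_spanningSets, Set.univ_prod_univ]
  · exact fun i => ⟨_, ⟨measurableSet_spanningSets _ i, measure_spanningSets_lt_top _ i⟩, _,
      ⟨measurableSet_spanningSets _ i, measure_spanningSets_lt_top _ i⟩, rfl⟩
  · intro i
    have hv := measure_spanningSets_lt_top (volume : Measure Space) i
    have hs := measurableSet_spanningSets (volume : Measure Space) i
    rw [hfin _ _ hs hs hv hv, Set.inter_self]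
    have := hv.ne
    finiteness
  · rintro _ ⟨A, hA, B, hB, rfl⟩
    rw [hfin A B hA.1 hB.1 hA.2 hB.2, hrect A B hA.1 hB.1]

end Campbell

/-! ### Random series and integrals against the sum of the laws -/

section SumOfLaws

variable {Ω α ι E : Type*} [MeasurableSpace Ω] [MeasurableSpace α]
  [NormedAddCommGroup E] {P : Measure Ω} {X : ι → Ω → α}
  {F : α → E}

/-- Integrability against the sum of the laws says that the absolute first moments of the terms have
a finite sum, which is the condition for exchanging series and expectation. -/
lemma tsum_lintegral_enorm_comp_ne_top (hX : ∀ i, Measurable (X i))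
    (hF : Integrable F (Measure.sum fun i => P.map (X i))) :
    ∑' i, ∫⁻ ω, ‖F (X i ω)‖ₑ ∂P ≠ ∞ := by
  have h := hF.hasFiniteIntegral
  rw [HasFiniteIntegral, lintegral_sum_measure] at h
  refine ne_of_lt (lt_of_eq_of_lt (tsum_congr fun i => ?_) h)
  have hm : AEStronglyMeasurable F (P.map (X i)) :=
    hF.aestronglyMeasurable.mono_measure (Measure.le_sum _ _)
  rw [lintegral_map' hm.enorm (hX i).aemeasurable]

lemma aestronglyMeasurable_comp_of_sum (hX : ∀ i, Measurable (X i))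
    (hF : Integrable F (Measure.sum fun i => P.map (X i))) (i : ι) :
    AEStronglyMeasurable (fun ω => F (X i ω)) P :=
  (hF.aestronglyMeasurable.mono_measure (Measure.le_sum _ i)).comp_measurable (hX i)

variable [Countable ι]

lemma ae_summable_norm_comp (hX : ∀ i, Measurable (X i))
    (hF : Integrable F (Measure.sum fun i => P.map (X i))) :
    ∀ᵐ ω ∂P, Summable fun i => ‖F (X i ω)‖ := by
  have h := tsum_lintegral_enorm_comp_ne_top hX hF
  rw [← lintegral_tsum fun i => (aestronglyMeasurable_comp_of_sum hX hF i).enorm] at h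
  filter_upwards [ae_lt_top' (AEMeasurable.tsum fun i =>
    (aestronglyMeasurable_comp_of_sum hX hF i).enorm) h] with ω hω
  have := ENNReal.summable_toReal hω.ne
  simpa using this

/-- The family is indexed by an arbitrary countable type because the formula serves twice: for
single points, against the intensity measure, and for pairs of points, against the second moment
measure. -/
lemma integral_tsum_comp [NormedSpace ℝ E] (hX : ∀ i, Measurable (X i))
    (hF : Integrable F (Measure.sum fun i => P.map (X i))) :
    ∫ ω, ∑' i, F (X i ω) ∂P = ∫ y, F y ∂(Measure.sum fun i => P.map (X i)) := by
  rw [integral_tsum (fun i => aestronglyMeasurable_comp_of_sum hX hF i)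
    (tsum_lintegral_enorm_comp_ne_top hX hF), integral_sum_measure hF]
  refine tsum_congr fun i => ?_
  rw [integral_map (hX i).aemeasurable (hF.aestronglyMeasurable.mono_measure (Measure.le_sum _ i))]

lemma integrable_tsum_comp [CompleteSpace E] (hX : ∀ i, Measurable (X i))
    (hF : Integrable F (Measure.sum fun i => P.map (X i))) :
    Integrable (fun ω => ∑' i, F (X i ω)) P := by
  have hm := aestronglyMeasurable_comp_of_sum hX hF
  have hfin := tsum_lintegral_enorm_comp_ne_top hX hF
  have hs := ae_summable_norm_comp hX hF
  refine ⟨?_, ?_⟩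
  · refine aestronglyMeasurable_of_tendsto_ae (u := (atTop : Filter (Finset ι)))
      (f := fun s ω => ∑ i ∈ s, F (X i ω)) (fun s => ?_) ?_
    · exact Finset.aestronglyMeasurable_fun_sum s fun i _ => hm i
    · filter_upwards [hs] with ω hω
      exact hω.of_norm.hasSum
  · rw [HasFiniteIntegral]
    refine lt_of_le_of_lt (lintegral_mono_ae (g := fun ω => ∑' i, ‖F (X i ω)‖ₑ) ?_) ?_
    · filter_upwards [hs] with ω hω
      have h1 := norm_tsum_le_tsum_norm hω
      rw [← ofReal_norm]
      refine (ENNReal.ofReal_le_ofReal h1).trans ?_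
      rw [ENNReal.ofReal_tsum_of_nonneg (fun _ => norm_nonneg _) hω]
      simp
    · rw [lintegral_tsum fun i => (hm i).enorm]
      exact lt_top_iff_ne_top.2 hfin

end SumOfLaws

/-! ### Campbell's formulas of first and second order -/

section Campbell

variable {Ω : Type*} [MeasurableSpace Ω] {P : Measure Ω} {ρ : ℝ} {pts : ℕ → Ω → Space}
  {f g : Space → ℂ}

lemma IsPoissonCloud.integrable_sum_map {E : Type*} [NormedAddCommGroup E]
    (h : IsPoissonCloud P ρ pts) {f : Space → E} (hf : Integrable f) :
    Integrable f (Measure.sum fun j => P.map (pts j)) := by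
  rw [h.sum_map]
  exact hf.smul_measure (by simp)

/-- The product part of the second moment measure requires both functions in L¹, and its diagonal
part requires their product in L¹, hence the additional L² assumption. -/
lemma IsPoissonCloud.integrable_sum_map_prod (h : IsPoissonCloud P ρ pts)
    (hf : Integrable f) (hg : Integrable g) (hf2 : MemLp f 2) (hg2 : MemLp g 2)
    (hfm : Measurable f) (hgm : Measurable g) :
    Integrable (fun q : Space × Space => f q.1 * conj (g q.2))
      (Measure.sum fun q : ℕ × ℕ => P.map (fun ω => (pts q.1 ω, pts q.2 ω))) := by
  rw [h.sum_map_prod, integrable_add_measure]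
  have hg' : MemLp (fun y => conj (g y)) 2 := hg2.star
  have hg1 : Integrable (fun y => conj (g y)) := by
    rw [← memLp_one_iff_integrable] at hg ⊢
    exact hg.star
  refine ⟨(hf.mul_prod hg1).smul_measure (by finiteness), Integrable.smul_measure ?_ (by simp)⟩
  rw [integrable_map_measure]
  · exact hf2.integrable_mul hg'
  · have : Measurable (fun q : Space × Space => f q.1 * conj (g q.2)) := by fun_prop
    exact this.aestronglyMeasurable
  · fun_prop

lemma IsPoissonCloud.integral_tsum_norm (h : IsPoissonCloud P ρ pts) (hρ : 0 ≤ ρ)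
    (hf : Integrable f) :
    ∫ ω, ∑' j, ‖f (pts j ω)‖ ∂P = ρ * ∫ y, ‖f y‖ := by
  rw [integral_tsum_comp (F := fun y => ‖f y‖) h.measurable (h.integrable_sum_map hf.norm),
    h.sum_map, integral_smul_measure, ENNReal.toReal_ofReal hρ, smul_eq_mul]

lemma IsPoissonCloud.integral_tsum (h : IsPoissonCloud P ρ pts) (hρ : 0 ≤ ρ)
    (hf : Integrable f) :
    ∫ ω, ∑' j, f (pts j ω) ∂P = ρ * ∫ y, f y := by
  rw [integral_tsum_comp h.measurable (h.integrable_sum_map hf),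
    h.sum_map, integral_smul_measure, ENNReal.toReal_ofReal hρ, Complex.real_smul]

lemma IsPoissonCloud.tsum_mul_tsum_ae (h : IsPoissonCloud P ρ pts) (hf : Integrable f)
    (hg : Integrable g) :
    ∀ᵐ ω ∂P, (∑' j, f (pts j ω)) * conj (∑' j, g (pts j ω)) =
      ∑' q : ℕ × ℕ, f (pts q.1 ω) * conj (g (pts q.2 ω)) := by
  filter_upwards [ae_summable_norm_comp h.measurable (h.integrable_sum_map hf),
    ae_summable_norm_comp h.measurable (h.integrable_sum_map hg)] with ω h1 h2
  rw [Complex.conj_tsum, tsum_mul_tsum_of_summable_norm h1 (by simpa using h2)]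

/-- The diagonal part of the second moment measure gives the single integral, and the product part
gives the product of the two means. -/
lemma IsPoissonCloud.integral_tsum_mul_conj_tsum (h : IsPoissonCloud P ρ pts) (hρ : 0 ≤ ρ)
    (hf : Integrable f) (hg : Integrable g) (hf2 : MemLp f 2) (hg2 : MemLp g 2)
    (hfm : Measurable f) (hgm : Measurable g) :
    ∫ ω, (∑' j, f (pts j ω)) * conj (∑' j, g (pts j ω)) ∂P =
      ρ * (∫ y, f y * conj (g y)) + (ρ * ∫ y, f y) * conj (ρ * ∫ y, g y) := by
  have hI := h.integrable_sum_map_prod hf hg hf2 hg2 hfm hgm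
  have hm : ∀ q : ℕ × ℕ, Measurable (fun ω => (pts q.1 ω, pts q.2 ω)) := fun q =>
    (h.measurable q.1).prodMk (h.measurable q.2)
  rw [integral_congr_ae (h.tsum_mul_tsum_ae hf hg),
    integral_tsum_comp (F := fun q : Space × Space => f q.1 * conj (g q.2)) hm hI, h.sum_map_prod]
  rw [h.sum_map_prod, integrable_add_measure] at hI
  rw [integral_add_measure hI.1 hI.2, integral_smul_measure, integral_smul_measure,
    integral_map (by fun_prop) (by
      have : Measurable (fun q : Space × Space => f q.1 * conj (g q.2)) := by fun_prop
      exact this.aestronglyMeasurable),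
    integral_prod_mul f (fun y => conj (g y)), ENNReal.toReal_mul, ENNReal.toReal_ofReal hρ,
    Complex.real_smul, Complex.real_smul, integral_conj]
  simp only [map_mul, Complex.conj_ofReal, Complex.ofReal_mul]
  ring

/-- The squared modulus of the series is almost surely an absolutely convergent double series over
pairs of points, whose integrability is that of the kernel f(y) conj f(y') against the second moment
measure. -/
lemma IsPoissonCloud.memLp_tsum (h : IsPoissonCloud P ρ pts)
    (hf : Integrable f) (hf2 : MemLp f 2) (hfm : Measurable f) :
    MemLp (fun ω => ∑' j, f (pts j ω)) 2 P := by
  have h1 := integrable_tsum_comp h.measurable (h.integrable_sum_map hf)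
  rw [memLp_two_iff_integrable_sq_norm h1.aestronglyMeasurable]
  have hm : ∀ q : ℕ × ℕ, Measurable (fun ω => (pts q.1 ω, pts q.2 ω)) := fun q =>
    (h.measurable q.1).prodMk (h.measurable q.2)
  have h2 := (integrable_tsum_comp (F := fun q : Space × Space => f q.1 * conj (f q.2)) hm
    (h.integrable_sum_map_prod hf hf hf2 hf2 hfm hfm)).norm
  refine h2.congr ?_
  filter_upwards [h.tsum_mul_tsum_ae hf hf] with ω hω
  rw [← hω, norm_mul, RCLike.norm_conj, sq]

/-- Campbell's formula for the covariance. -/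
lemma IsPoissonCloud.covariance (h : IsPoissonCloud P ρ pts) [IsProbabilityMeasure P] (hρ : 0 ≤ ρ)
    (hf : Integrable f) (hg : Integrable g) (hf2 : MemLp f 2) (hg2 : MemLp g 2)
    (hfm : Measurable f) (hgm : Measurable g) :
    ∫ ω, (∑' j, f (pts j ω) - ∫ ω', ∑' j, f (pts j ω') ∂P) *
      conj (∑' j, g (pts j ω) - ∫ ω', ∑' j, g (pts j ω') ∂P) ∂P =
      ρ * ∫ y, f y * conj (g y) := by
  have hF := h.memLp_tsum hf hf2 hfm
  have hG := h.memLp_tsum hg hg2 hgm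
  have iF := hF.integrable (by norm_num)
  have iG := hG.integrable (by norm_num)
  have iFG := hF.integrable_mul hG.star
  have key := h.integral_tsum_mul_conj_tsum hρ hf hg hf2 hg2 hfm hgm
  set S := fun ω => ∑' j, f (pts j ω) with hS
  set T := fun ω => ∑' j, g (pts j ω) with hT
  have eS : ∫ ω, S ω ∂P = ρ * ∫ y, f y := h.integral_tsum hρ hf
  have eT : ∫ ω, T ω ∂P = ρ * ∫ y, g y := h.integral_tsum hρ hg
  have iT : Integrable (fun ω => conj (T ω)) P := by
    rw [← memLp_one_iff_integrable] at iG ⊢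
    exact iG.star
  have iFG' : Integrable (fun ω => S ω * conj (T ω)) P := iFG
  have expand : ∀ ω, (S ω - ∫ ω', S ω' ∂P) * conj (T ω - ∫ ω', T ω' ∂P) =
      (S ω * conj (T ω) - S ω * conj (∫ ω', T ω' ∂P)) -
        ((∫ ω', S ω' ∂P) * conj (T ω) - (∫ ω', S ω' ∂P) * conj (∫ ω', T ω' ∂P)) := by
    intro ω; rw [map_sub]; ring
  change ∫ ω, (S ω - ∫ ω', S ω' ∂P) * conj (T ω - ∫ ω', T ω' ∂P) ∂P = _
  simp_rw [expand]
  generalize hm1 : ∫ ω, S ω ∂P = m1 at *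
  generalize hm2 : ∫ ω, T ω ∂P = m2 at *
  have i1 : Integrable (fun ω => S ω * conj (T ω) - S ω * conj m2) P := iFG'.sub (iF.mul_const _)
  have i2 : Integrable (fun ω => m1 * conj (T ω) - m1 * conj m2) P :=
    (iT.const_mul _).sub (integrable_const _)
  change ∫ ω, S ω * conj (T ω) ∂P = _ at key
  rw [integral_sub i1 i2, integral_sub iFG' (iF.mul_const _),
    integral_sub (iT.const_mul _) (integrable_const _),
    integral_mul_const, integral_const_mul, integral_conj, integral_const, key, ← eS, ← eT, hm1, hm2]
  simp

end Campbell

/-! ### Coordinates -/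

/-- The point with cross-range component `q.1` and range component `q.2`. -/
def ofCrossRange (q : Plane × ℝ) : Space := !₂[q.1 0, q.1 1, q.2]

@[simp] lemma cross_ofCrossRange (q : Plane × ℝ) : cross (ofCrossRange q) = q.1 := by
  ext i; fin_cases i <;> simp [cross, ofCrossRange]

@[simp] lemma range_ofCrossRange (q : Plane × ℝ) : range (ofCrossRange q) = q.2 := by
  simp [range, ofCrossRange]

lemma ofCrossRange_cross_range (y : Space) : ofCrossRange (cross y, range y) = y := by
  ext i; fin_cases i <;> simp [cross, range, ofCrossRange]

lemma cross_add (x y : Space) : cross (x + y) = cross x + cross y := by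
  ext i; fin_cases i <;> simp [cross]

lemma cross_sub (x y : Space) : cross (x - y) = cross x - cross y := by
  ext i; fin_cases i <;> simp [cross]

lemma cross_smul (c : ℝ) (x : Space) : cross (c • x) = c • cross x := by
  ext i; fin_cases i <;> simp [cross]

lemma range_add (x y : Space) : range (x + y) = range x + range y := by simp [range]

lemma range_sub (x y : Space) : range (x - y) = range x - range y := by simp [range]

lemma range_smul (c : ℝ) (x : Space) : range (c • x) = c * range x := by simp [range]

lemma norm_sq_eq (y : Space) : ‖y‖ ^ 2 = ‖cross y‖ ^ 2 + range y ^ 2 := by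
  simp [EuclideanSpace.norm_sq_eq, Fin.sum_univ_three, Fin.sum_univ_two, cross, range]

lemma norm_cross_le (y : Space) : ‖cross y‖ ≤ ‖y‖ := by
  refine abs_le_of_sq_le_sq' ?_ (norm_nonneg _) |>.2
  rw [norm_sq_eq y]; nlinarith [sq_nonneg (range y)]

lemma abs_range_le (y : Space) : |range y| ≤ ‖y‖ := by
  refine abs_le_of_sq_le_sq ?_ (norm_nonneg _)
  rw [norm_sq_eq y]; nlinarith [sq_nonneg ‖cross y‖]

@[fun_prop] lemma continuous_cross : Continuous cross := by
  unfold cross; fun_prop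

@[fun_prop] lemma continuous_range : Continuous range := by
  unfold range; fun_prop

@[fun_prop] lemma measurable_cross : Measurable cross := continuous_cross.measurable

@[fun_prop] lemma measurable_range : Measurable range := continuous_range.measurable

lemma measurePreserving_cross_range :
    MeasurePreserving (fun y : Space => (cross y, range y)) volume
      ((volume : Measure Plane).prod volume) := by
  have h1 : MeasurePreserving (@WithLp.ofLp 2 (Fin 3 → ℝ)) := PiLp.volume_preserving_ofLp (Fin 3)
  have h2 := volume_preserving_piFinSuccAbove (fun _ : Fin 3 => ℝ) (Fin.last 2)
  have h3 : MeasurePreserving (Prod.swap : ℝ × (Fin 2 → ℝ) → (Fin 2 → ℝ) × ℝ)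
      (volume.prod volume) (volume.prod volume) := Measure.measurePreserving_swap
  have h4 : MeasurePreserving (@WithLp.toLp 2 (Fin 2 → ℝ)) := PiLp.volume_preserving_toLp (Fin 2)
  have h5 := h4.prod (MeasurePreserving.id (volume : Measure ℝ))
  have := h5.comp (h3.comp (h2.comp h1))
  have e : (fun y : Space => (cross y, range y)) = Prod.map (@WithLp.toLp 2 (Fin 2 → ℝ)) id ∘
      Prod.swap ∘ (MeasurableEquiv.piFinSuccAbove (fun _ : Fin 3 => ℝ) (Fin.last 2)) ∘
      @WithLp.ofLp 2 (Fin 3 → ℝ) := by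
    funext y
    refine Prod.ext ?_ ?_
    · ext i; fin_cases i <;> rfl
    · rfl
  rw [e]
  exact this

lemma measurable_ofCrossRange : Measurable ofCrossRange := by
  unfold ofCrossRange
  have : Measurable fun q : Plane × ℝ => ![q.1 0, q.1 1, q.2] := by
    refine measurable_pi_lambda _ fun i => ?_
    fin_cases i <;> simp <;> fun_prop
  exact (WithLp.measurable_toLp 2 _).comp this

lemma measurePreserving_ofCrossRange :
    MeasurePreserving ofCrossRange ((volume : Measure Plane).prod volume) volume := by
  let e : Space ≃ᵐ Plane × ℝ :=
    { toFun := fun y => (cross y, range y)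
      invFun := ofCrossRange
      left_inv := ofCrossRange_cross_range
      right_inv := fun q => by simp
      measurable_toFun := by
        change Measurable fun y : Space => (cross y, range y)
        fun_prop
      measurable_invFun := measurable_ofCrossRange }
  exact (MeasurePreserving.symm e measurePreserving_cross_range)

lemma measurableEmbedding_ofCrossRange : MeasurableEmbedding ofCrossRange := by
  let e : Plane × ℝ ≃ᵐ Space :=
    { toFun := ofCrossRange
      invFun := fun y => (cross y, range y)
      left_inv := fun q => by simp
      right_inv := ofCrossRange_cross_range
      measurable_toFun := measurable_ofCrossRange
      measurable_invFun := by
        change Measurable fun y : Space => (cross y, range y)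
        fun_prop }
  exact e.measurableEmbedding

/-! ### Radial integrals -/

lemma integrable_exp_neg_norm_div_norm {b : ℝ} (hb : 0 < b) :
    Integrable fun w : Space => Real.exp (-b * ‖w‖) / ‖w‖ := by
  refine (integrable_fun_norm_addHaar (volume : Measure Space)
    (f := fun r => Real.exp (-b * r) / r)).2 ?_
  have h : IntegrableOn (fun y : ℝ => y ^ (1 : ℝ) * Real.exp (-b * y)) (Set.Ioi 0) := by
    refine integrableOn_rpow_mul_exp_neg_mul_rpow (s := 1) (p := 1) (by norm_num) (by norm_num) hb
      |>.congr_fun (fun y _ => by simp) measurableSet_Ioi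
  refine h.congr_fun (fun y hy => ?_) measurableSet_Ioi
  have hy : (0 : ℝ) < y := hy
  simp only [finrank_euclideanSpace, Fintype.card_fin, smul_eq_mul, Real.rpow_one]
  norm_num
  field_simp

lemma integral_exp_neg_norm_div_norm {b : ℝ} (hb : 0 < b) :
    ∫ w : Space, Real.exp (-b * ‖w‖) / ‖w‖ =
      3 * (volume : Measure Space).real (Metric.ball 0 1) / b ^ 2 := by
  rw [integral_fun_norm_addHaar (volume : Measure Space) (fun r => Real.exp (-b * r) / r)]
  have h : ∫ y in Set.Ioi (0 : ℝ), y ^ (3 - 1) • (Real.exp (-b * y) / y) = 1 / b ^ 2 := by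
    have := Real.integral_rpow_mul_exp_neg_mul_Ioi (a := 2) (r := b) (by norm_num) hb
    have h2 : Real.Gamma 2 = 1 := by simp
    rw [h2] at this
    rw [show (1 : ℝ) / b ^ 2 = (1 / b) ^ (2 : ℝ) * 1 by simp, ← this]
    refine setIntegral_congr_fun measurableSet_Ioi fun y hy => ?_
    have hy : (0 : ℝ) < y := hy
    simp only [smul_eq_mul]
    norm_num
    field_simp
  simp only [finrank_euclideanSpace, Fintype.card_fin]
  rw [h]
  simp; ring

/-- The Jacobian r² cancels the singularity exactly. This is what makes the variance of the
scattered field finite although particles may come arbitrarily close to the camera. -/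
lemma integrable_exp_neg_norm_div_norm_sq {b : ℝ} (hb : 0 < b) :
    Integrable fun w : Space => Real.exp (-b * ‖w‖) / ‖w‖ ^ 2 := by
  refine (integrable_fun_norm_addHaar (volume : Measure Space)
    (f := fun r => Real.exp (-b * r) / r ^ 2)).2 ?_
  have h : IntegrableOn (fun y : ℝ => Real.exp (-b * y)) (Set.Ioi 0) :=
    integrableOn_exp_mul_Ioi (by linarith) 0
  refine h.congr_fun (fun y hy => ?_) measurableSet_Ioi
  have hy : (0 : ℝ) < y := hy
  simp only [finrank_euclideanSpace, Fintype.card_fin, smul_eq_mul]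
  norm_num
  field_simp

lemma integrable_exp_neg_norm_plane {b : ℝ} (hb : 0 < b) :
    Integrable fun u : Plane => Real.exp (-b * ‖u‖) := by
  refine (integrable_fun_norm_addHaar (volume : Measure Plane)
    (f := fun r => Real.exp (-b * r))).2 ?_
  have h : IntegrableOn (fun y : ℝ => y ^ (1 : ℝ) * Real.exp (-b * y)) (Set.Ioi 0) := by
    refine integrableOn_rpow_mul_exp_neg_mul_rpow (s := 1) (p := 1) (by norm_num) (by norm_num) hb
      |>.congr_fun (fun y _ => by simp) measurableSet_Ioi
  refine h.congr_fun (fun y hy => ?_) measurableSet_Ioi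
  simp

lemma integrable_exp_neg_norm_div_norm_plane {b : ℝ} (hb : 0 < b) :
    Integrable fun u : Plane => Real.exp (-b * ‖u‖) / ‖u‖ := by
  refine (integrable_fun_norm_addHaar (volume : Measure Plane)
    (f := fun r => Real.exp (-b * r) / r)).2 ?_
  have h : IntegrableOn (fun y : ℝ => Real.exp (-b * y)) (Set.Ioi 0) :=
    integrableOn_exp_mul_Ioi (by linarith) 0
  refine h.congr_fun (fun y hy => ?_) measurableSet_Ioi
  have hy : (0 : ℝ) < y := hy
  simp only [finrank_euclideanSpace, Fintype.card_fin, smul_eq_mul]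
  norm_num
  field_simp

lemma integral_exp_neg_norm_div_norm_plane {b : ℝ} (hb : 0 < b) :
    ∫ u : Plane, Real.exp (-b * ‖u‖) / ‖u‖ =
      2 * (volume : Measure Plane).real (Metric.ball 0 1) / b := by
  rw [integral_fun_norm_addHaar (volume : Measure Plane) (fun r => Real.exp (-b * r) / r)]
  have h : ∫ y in Set.Ioi (0 : ℝ), y ^ (2 - 1) • (Real.exp (-b * y) / y) = 1 / b := by
    have := integral_exp_mul_Ioi (a := -b) (by linarith) 0
    rw [show (1 : ℝ) / b = -Real.exp (-b * 0) / -b by simp, ← this]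
    refine setIntegral_congr_fun measurableSet_Ioi fun y hy => ?_
    have hy : (0 : ℝ) < y := hy
    simp only [smul_eq_mul]
    norm_num
    field_simp
  simp only [finrank_euclideanSpace, Fintype.card_fin]
  rw [h]
  simp; ring

lemma integrable_exp_neg_norm_sq_plane {b : ℝ} (hb : 0 < b) :
    Integrable fun u : Plane => Real.exp (-b * ‖u‖ ^ 2) := by
  by_contra h
  have h1 := GaussianFourier.integral_rexp_neg_mul_sq_norm (V := Plane) hb
  -- A non-integrable function has integral 0 by convention, which contradicts the positive value of
  -- the Gaussian integral.
  rw [integral_undef h] at h1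
  have : (0 : ℝ) < (Real.pi / b) ^ ((Module.finrank ℝ Plane : ℝ) / 2) := by positivity
  linarith

lemma integral_exp_neg_norm_sq_plane {b : ℝ} (hb : 0 < b) :
    ∫ u : Plane, Real.exp (-b * ‖u‖ ^ 2) = Real.pi / b := by
  rw [GaussianFourier.integral_rexp_neg_mul_sq_norm hb]
  simp

lemma integrable_inv_norm_sq_ball (R : ℝ) :
    Integrable fun w : Space => (Set.Iio R).indicator (fun r => 1 / r ^ 2) ‖w‖ := by
  refine (integrable_fun_norm_addHaar (volume : Measure Space)
    (f := (Set.Iio R).indicator (fun r => 1 / r ^ 2))).2 ?_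
  have h : IntegrableOn (fun _ : ℝ => (1 : ℝ)) (Set.Ioo 0 R) := integrableOn_const (by simp)
  have h' : IntegrableOn ((Set.Iio R).indicator (fun _ : ℝ => (1 : ℝ))) (Set.Ioi 0) := by
    rw [IntegrableOn, integrable_indicator_iff measurableSet_Iio, IntegrableOn,
      Measure.restrict_restrict measurableSet_Iio, Set.inter_comm, Set.Ioi_inter_Iio]
    exact h
  refine h'.congr_fun (fun y hy => ?_) measurableSet_Ioi
  have hy : (0 : ℝ) < y := hy
  by_cases hR : y < R
  · simp [hR]; field_simp
  · simp [hR]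

lemma integral_inv_norm_sq_ball {R : ℝ} (hR0 : 0 ≤ R) :
    ∫ w : Space, (Set.Iio R).indicator (fun r => 1 / r ^ 2) ‖w‖ =
      3 * (volume : Measure Space).real (Metric.ball 0 1) * R := by
  rw [integral_fun_norm_addHaar (volume : Measure Space)
    ((Set.Iio R).indicator (fun r => 1 / r ^ 2))]
  have h : ∫ y in Set.Ioi (0 : ℝ), y ^ (3 - 1) • (Set.Iio R).indicator (fun r => 1 / r ^ 2) y = R := by
    have : ∫ y in Set.Ioi (0 : ℝ), (Set.Iio R).indicator (fun _ => (1 : ℝ)) y = R := by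
      rw [integral_indicator measurableSet_Iio, Measure.restrict_restrict measurableSet_Iio,
        Set.inter_comm, Set.Ioi_inter_Iio]
      simp [hR0]
    conv_rhs => rw [← this]
    refine setIntegral_congr_fun measurableSet_Ioi fun y hy => ?_
    have hy : (0 : ℝ) < y := hy
    by_cases hR : y < R
    · simp [hR]; field_simp
    · simp [hR]
  simp only [finrank_euclideanSpace, Fintype.card_fin]
  rw [h]
  simp; ring

/-! ### The beam, the Green function and the scattered field of one particle -/

/-- The square of the complex beam radius. -/
def beamSq (p : Params) (z : ℂ) : ℂ := (p.ro : ℂ) ^ 2 + 2 * Complex.I * z / p.k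

/-- The squared modulus of the square of the complex beam radius. -/
def beamNormSq (p : Params) (z : ℝ) : ℝ := (p.ro ^ 2) ^ 2 + (2 * z / p.k) ^ 2

/-- The beam depends on the complex radius only through its square, so the branch of the root is
irrelevant; the square is affine in z and therefore extends to complex z. -/
lemma beamRadius_sq (p : Params) (hro : 0 < p.ro) (z : ℝ) :
    beamRadius p z ^ 2 = beamSq p z := by
  have h2 : (p.ro : ℂ) ≠ 0 := by exact_mod_cast hro.ne'
  unfold beamRadius beamSq
  rw [mul_pow, ← Complex.cpow_nat_mul]
  norm_num
  rw [mul_add, mul_one, mul_div_assoc', mul_comm (p.k : ℂ), mul_div_mul_left _ _ (pow_ne_zero 2 h2)]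

lemma beamSq_re (p : Params) (z : ℂ) : (beamSq p z).re = p.ro ^ 2 - 2 * z.im / p.k := by
  unfold beamSq
  rw [Complex.add_re, Complex.div_ofReal_re]
  simp [Complex.mul_re, Complex.mul_im, ← Complex.ofReal_pow]
  ring

lemma beamSq_im (p : Params) (z : ℂ) : (beamSq p z).im = 2 * z.re / p.k := by
  unfold beamSq
  rw [Complex.add_im, Complex.div_ofReal_im]
  simp [Complex.mul_re, Complex.mul_im, ← Complex.ofReal_pow]

lemma normSq_beamSq (p : Params) (z : ℝ) : Complex.normSq (beamSq p z) = beamNormSq p z := by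
  rw [Complex.normSq_apply, beamSq_re, beamSq_im, beamNormSq]
  simp; ring

lemma beamNormSq_pos (p : Params) (hro : 0 < p.ro) (z : ℝ) : 0 < beamNormSq p z := by
  unfold beamNormSq; positivity

lemma le_beamNormSq (p : Params) (z : ℝ) : (p.ro ^ 2) ^ 2 ≤ beamNormSq p z := by
  unfold beamNormSq; nlinarith [sq_nonneg (2 * z / p.k)]

lemma beam_of_pos (p : Params) (hro : 0 < p.ro) {y : Space} (hy : 0 < range y) :
    beam p y = (p.ro : ℂ) ^ 2 / beamSq p (range y) *
      Complex.exp (-((‖cross y‖ : ℂ) ^ 2 / beamSq p (range y))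
        + Complex.I * (p.k : ℂ) * (range y : ℂ) - (p.kd : ℂ) * (range y : ℂ)) := by
  rw [beam, if_pos hy, beamRadius_sq p hro]

/-- The real part of 1/R_z² is r_o²/|R_z²|², so each section of the intensity is Gaussian, with an
amplitude inversely proportional to its spread. -/
lemma norm_beam_sq (p : Params) (hro : 0 < p.ro) {y : Space} (hy : 0 < range y) :
    ‖beam p y‖ ^ 2 = (p.ro ^ 2) ^ 2 / beamNormSq p (range y) *
      Real.exp (-(2 * p.ro ^ 2 / beamNormSq p (range y)) * ‖cross y‖ ^ 2
        - 2 * p.kd * range y) := by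
  rw [beam_of_pos p hro hy, norm_mul, norm_div, Complex.norm_exp, mul_pow, div_pow,
    ← Complex.normSq_eq_norm_sq (beamSq _ _), normSq_beamSq, ← Real.exp_nat_mul]
  congr 1
  · simp
  · congr 1
    have h1 : (((‖cross y‖ : ℂ) ^ 2 / beamSq p (range y))).re =
        ‖cross y‖ ^ 2 * p.ro ^ 2 / beamNormSq p (range y) := by
      rw [← Complex.ofReal_pow, Complex.div_re, normSq_beamSq, beamSq_re, Complex.ofReal_re,
        Complex.ofReal_im (‖cross y‖ ^ 2)]
      simp
    simp only [Complex.sub_re, Complex.add_re, Complex.neg_re, h1]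
    simp [Complex.mul_re, Complex.mul_im]
    ring

lemma norm_beam_le_one (p : Params) (hro : 0 < p.ro) (hkd : 0 ≤ p.kd) (y : Space) :
    ‖beam p y‖ ≤ 1 := by
  by_cases hy : 0 < range y
  · rw [← sq_le_one_iff₀ (norm_nonneg _), norm_beam_sq p hro hy]
    have hD := beamNormSq_pos p hro (range y)
    have h1 : (p.ro ^ 2) ^ 2 / beamNormSq p (range y) ≤ 1 := by
      rw [div_le_one hD]; exact le_beamNormSq p _
    have h2 : Real.exp (-(2 * p.ro ^ 2 / beamNormSq p (range y)) * ‖cross y‖ ^ 2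
        - 2 * p.kd * range y) ≤ 1 := by
      rw [Real.exp_le_one_iff]
      have : 0 ≤ 2 * p.ro ^ 2 / beamNormSq p (range y) * ‖cross y‖ ^ 2 := by positivity
      nlinarith [mul_nonneg hkd hy.le]
    exact mul_le_one₀ h1 (Real.exp_pos _).le h2
  · simp [beam, hy]

lemma measurable_beam (p : Params) : Measurable (beam p) := by
  unfold beam beamRadius
  refine Measurable.ite (measurableSet_lt measurable_const measurable_range) ?_ measurable_const
  fun_prop

lemma measurable_green (p : Params) (x : Space) : Measurable (green p x) := by
  unfold green
  fun_prop

lemma norm_green (p : Params) (x y : Space) :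
    ‖green p x y‖ = Real.exp (-p.kd * ‖x - y‖) / (4 * Real.pi * ‖x - y‖) := by
  unfold green
  rw [norm_mul, Complex.norm_exp]
  simp [Complex.mul_re, Complex.mul_im, abs_of_pos Real.pi_pos]
  ring

lemma measurable_singleScatter (p : Params) (x : Space) : Measurable (singleScatter p x) := by
  unfold singleScatter
  have := measurable_beam p
  have := measurable_green p x
  fun_prop

lemma integrable_norm_green (p : Params) (hkd : 0 < p.kd) (x : Space) :
    Integrable (fun y => ‖green p x y‖) := by
  simp_rw [norm_green]
  have := (((integrable_exp_neg_norm_div_norm hkd).comp_sub_left x).div_const (4 * Real.pi))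
  refine this.congr (ae_of_all _ fun y => ?_)
  simp only [div_div]; ring_nf

lemma integrable_norm_green_sq (p : Params) (hkd : 0 < p.kd) (x : Space) :
    Integrable (fun y => ‖green p x y‖ ^ 2) := by
  simp_rw [norm_green]
  have := (((integrable_exp_neg_norm_div_norm_sq (b := 2 * p.kd) (by positivity)).comp_sub_left
    x).div_const ((4 * Real.pi) ^ 2))
  refine this.congr (ae_of_all _ fun y => ?_)
  simp only []
  rw [div_pow, ← Real.exp_nat_mul, div_div, mul_pow (4 * Real.pi)]
  push_cast
  ring_nf

/-- The field scattered by one particle, without the scattering amplitude. -/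
def greenBeam (p : Params) (x y : Space) : ℂ := green p x y * beam p y

lemma singleScatter_eq (p : Params) (x y : Space) :
    singleScatter p x y = ((p.k ^ 2 * p.eta : ℝ) : ℂ) * greenBeam p x y := by
  unfold singleScatter greenBeam; push_cast; ring

lemma measurable_greenBeam (p : Params) (x : Space) : Measurable (greenBeam p x) :=
  (measurable_green p x).mul (measurable_beam p)

lemma integrable_greenBeam (p : Params) (hro : 0 < p.ro) (hkd : 0 < p.kd) (x : Space) :
    Integrable (greenBeam p x) := by
  refine (integrable_norm_green p hkd x).mono' (measurable_greenBeam p x).aestronglyMeasurable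
    (ae_of_all _ fun y => ?_)
  rw [greenBeam, norm_mul]
  exact mul_le_of_le_one_right (norm_nonneg _) (norm_beam_le_one p hro hkd.le y)

lemma memLp_greenBeam (p : Params) (hro : 0 < p.ro) (hkd : 0 < p.kd) (x : Space) :
    MemLp (greenBeam p x) 2 := by
  rw [memLp_two_iff_integrable_sq_norm (measurable_greenBeam p x).aestronglyMeasurable]
  refine (integrable_norm_green_sq p hkd x).mono'
    (by have := measurable_greenBeam p x; exact (by fun_prop : Measurable _).aestronglyMeasurable)
    (ae_of_all _ fun y => ?_)
  rw [greenBeam, norm_mul, mul_pow, Real.norm_of_nonneg (by positivity)]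
  exact mul_le_of_le_one_right (by positivity)
    (pow_le_one₀ (norm_nonneg _) (norm_beam_le_one p hro hkd.le y))

lemma integrable_singleScatter (p : Params) (hro : 0 < p.ro) (hkd : 0 < p.kd) (x : Space) :
    Integrable (singleScatter p x) := by
  rw [funext (singleScatter_eq p x)]
  exact (integrable_greenBeam p hro hkd x).const_mul ((p.k ^ 2 * p.eta : ℝ) : ℂ)

lemma memLp_singleScatter (p : Params) (hro : 0 < p.ro) (hkd : 0 < p.kd) (x : Space) :
    MemLp (singleScatter p x) 2 := by
  rw [funext (singleScatter_eq p x)]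
  exact (memLp_greenBeam p hro hkd x).const_mul ((p.k ^ 2 * p.eta : ℝ) : ℂ)

/-! ### Rotation of the integration domain into the complex plane -/

/-- A neighbourhood of the segment from `1` to `1 + i / 4`, in the upper half plane. -/
def rotationDomain : Set ℂ := {ζ | 3 / 4 < ζ.re ∧ ζ.re < 5 / 4 ∧ 0 < ζ.im ∧ ζ.im < 3 / 8}

lemma isOpen_rotationDomain : IsOpen rotationDomain := by
  unfold rotationDomain
  have h1 : Continuous Complex.re := Complex.continuous_re
  have h2 : Continuous Complex.im := Complex.continuous_im
  exact (isOpen_lt continuous_const h1).inter ((isOpen_lt h1 continuous_const).inter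
    ((isOpen_lt continuous_const h2).inter (isOpen_lt h2 continuous_const)))

lemma convex_rotationDomain : Convex ℝ rotationDomain := by
  unfold rotationDomain
  exact (convex_halfSpace_re_gt _).inter ((convex_halfSpace_re_lt _).inter
    ((convex_halfSpace_im_gt _).inter (convex_halfSpace_im_lt _)))

/-- Cauchy's estimate on a small circle bounds the derivative of the integrand by a multiple of the
dominating function, so it is enough to dominate the integrand itself. -/
lemma differentiableAt_integral_of_norm_le {α : Type*} [MeasurableSpace α] {μ : Measure α}
    {U : Set ℂ} (hU : IsOpen U) {f : ℂ → α → ℂ} {g : α → ℝ} (hg : Integrable g μ)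
    (hmeas : ∀ ζ ∈ U, AEStronglyMeasurable (f ζ) μ)
    (hdiff : ∀ᵐ a ∂μ, DifferentiableOn ℂ (fun ζ => f ζ a) U)
    (hbound : ∀ᵐ a ∂μ, ∀ ζ ∈ U, ‖f ζ a‖ ≤ g a) {z : ℂ} (hz : z ∈ U) :
    DifferentiableAt ℂ (fun ζ => ∫ a, f ζ a ∂μ) z := by
  obtain ⟨r, hr, hrU⟩ := Metric.isOpen_iff.1 hU z hz
  have hsub : ∀ ζ ∈ Metric.ball z (r / 2), Metric.closedBall ζ (r / 4) ⊆ U := by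
    intro ζ hζ
    refine subset_trans ?_ hrU
    intro w hw
    rw [Metric.mem_ball] at *
    rw [Metric.mem_closedBall] at hw
    linarith [dist_triangle w ζ z]
  have hderiv : ∀ᵐ a ∂μ, ∀ ζ ∈ Metric.ball z (r / 2), HasDerivAt (fun ζ => f ζ a)
      (deriv (fun ζ => f ζ a) ζ) ζ := by
    filter_upwards [hdiff] with a ha ζ hζ
    have : ζ ∈ U := hsub ζ hζ (Metric.mem_closedBall_self (by positivity))
    exact (ha.differentiableAt (hU.mem_nhds this)).hasDerivAt
  have hb : ∀ᵐ a ∂μ, ∀ ζ ∈ Metric.ball z (r / 2), ‖deriv (fun ζ => f ζ a) ζ‖ ≤ g a / (r / 4) := by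
    filter_upwards [hdiff, hbound] with a ha hba ζ hζ
    refine Complex.norm_deriv_le_of_forall_mem_sphere_norm_le (by positivity) ?_ ?_
    · exact (ha.mono (hsub ζ hζ)).diffContOnCl_ball subset_rfl
    · intro w hw
      exact hba w (hsub ζ hζ (Metric.sphere_subset_closedBall hw))
  have hzb : z ∈ Metric.ball z (r / 2) := Metric.mem_ball_self (by positivity)
  have hmem : ∀ n : ℕ, z + ((r / 2 / (n + 2) : ℝ) : ℂ) ∈ U := by
    intro n
    apply hrU
    rw [Metric.mem_ball, dist_eq_norm, add_sub_cancel_left, Complex.norm_real,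
      Real.norm_of_nonneg (by positivity)]
    rw [div_lt_iff₀ (by positivity)]
    nlinarith [(Nat.cast_nonneg n : (0 : ℝ) ≤ n)]
  -- The derivative in the parameter is measurable as a pointwise limit of difference quotients
  -- along a sequence of increments.
  have hF' : AEStronglyMeasurable (fun a => deriv (fun ζ => f ζ a) z) μ := by
    refine aestronglyMeasurable_of_tendsto_ae (u := (atTop : Filter ℕ))
      (f := fun n a => ((r / 2 / (n + 2) : ℝ) : ℂ)⁻¹ •
        (f (z + ((r / 2 / (n + 2) : ℝ) : ℂ)) a - f z a)) (fun n => ?_) ?_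
    · exact ((hmeas _ (hmem n)).sub (hmeas z hz)).const_smul (((r / 2 / (n + 2) : ℝ) : ℂ)⁻¹)
    · filter_upwards [hderiv] with a ha
      have h1 := (ha z hzb).tendsto_slope_zero
      have h2 : Tendsto (fun n : ℕ => ((r / 2 / (n + 2) : ℝ) : ℂ)) atTop (nhdsWithin 0 {0}ᶜ) := by
        rw [tendsto_nhdsWithin_iff]
        constructor
        · have : Tendsto (fun n : ℕ => (r / 2 / ((n : ℝ) + 2) : ℝ)) atTop (nhds 0) := by
            refine Tendsto.div_atTop tendsto_const_nhds ?_
            exact tendsto_atTop_add_const_right _ _ tendsto_natCast_atTop_atTop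
          have h3 := (Complex.continuous_ofReal.tendsto 0).comp this
          rw [Complex.ofReal_zero] at h3
          exact h3
        · refine Eventually.of_forall fun n => ?_
          have : (r / 2 / ((n : ℝ) + 2) : ℝ) ≠ 0 := by positivity
          simpa only [Set.mem_compl_iff, Set.mem_singleton_iff, Complex.ofReal_eq_zero] using this
      exact h1.comp h2
  refine (hasDerivAt_integral_of_dominated_loc_of_deriv_le (μ := μ) (F := f)
    (F' := fun ζ a => deriv (fun ζ => f ζ a) ζ) (x₀ := z) (bound := fun a => g a / (r / 4))
    (Metric.ball_mem_nhds z (by positivity : (0 : ℝ) < r / 2)) ?_ ?_ hF' hb (hg.div_const _)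
    hderiv).2.differentiableAt
  · filter_upwards [hU.mem_nhds hz] with ζ hζ using hmeas ζ hζ
  · refine hg.mono' (hmeas z hz) ?_
    filter_upwards [hbound] with a ha using ha z hz

/-- A dilation of the parameter by l > 0 is a dilation of the space, so ζ^n ∫ f ζ is invariant along
rays from the origin. Being holomorphic with zero derivative along rays, it is constant. The point 1
is on the boundary of the domain, because parameters with negative imaginary part would turn the
oscillation into growth; its value is recovered by dominated convergence. -/
lemma integral_eq_integral_rotated {E : Type*} [NormedAddCommGroup E] [NormedSpace ℝ E]
    [FiniteDimensional ℝ E] [MeasurableSpace E] [BorelSpace E] (μ : Measure E) [μ.IsAddHaarMeasure]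
    {f : ℂ → E → ℂ} {g : E → ℝ} (hg : Integrable g μ)
    (hmeas : ∀ ζ ∈ rotationDomain, AEStronglyMeasurable (f ζ) μ)
    (hdiff : ∀ᵐ a ∂μ, DifferentiableOn ℂ (fun ζ => f ζ a) rotationDomain)
    (hbound : ∀ᵐ a ∂μ, ∀ ζ ∈ rotationDomain, ‖f ζ a‖ ≤ g a)
    (hcont : ∀ᵐ a ∂μ, Tendsto (fun ζ => f ζ a) (nhdsWithin 1 rotationDomain) (nhds (f 1 a)))
    (hscale : ∀ l : ℝ, 0 < l → ∀ ζ a, f (l * ζ) a = f ζ (l • a)) :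
    ∫ a, f 1 a ∂μ = (1 + Complex.I / 4) ^ Module.finrank ℝ E *
      ∫ a, f (1 + Complex.I / 4) a ∂μ := by
  set n := Module.finrank ℝ E
  set Φ : ℂ → ℂ := fun ζ => ζ ^ n * ∫ a, f ζ a ∂μ with hΦ
  have hΦd : ∀ ζ ∈ rotationDomain, DifferentiableAt ℂ Φ ζ := fun ζ hζ =>
    (differentiableAt_id.pow n).mul
      (differentiableAt_integral_of_norm_le isOpen_rotationDomain hg hmeas hdiff hbound hζ)
  have hray : ∀ l : ℝ, 0 < l → ∀ ζ, Φ (l * ζ) = Φ ζ := by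
    intro l hl ζ
    simp only [hΦ]
    simp_rw [hscale l hl]
    rw [Measure.integral_comp_smul_of_nonneg μ (f ζ) l (hR := hl.le), mul_pow, Complex.real_smul]
    push_cast
    have : (l : ℂ) ^ n ≠ 0 := pow_ne_zero _ (by exact_mod_cast hl.ne')
    change _ * (((l : ℂ) ^ n)⁻¹ * _) = _
    field_simp
  have hderiv : ∀ ζ ∈ rotationDomain, deriv Φ ζ = 0 := by
    intro ζ hζ
    have hζ0 : ζ ≠ 0 := by
      rintro rfl
      have := hζ.1
      norm_num at this
    -- The derivative along the ray through ζ equals ζ times the complex derivative, and it is zero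
    -- by invariance.
    have h1 : HasDerivAt (fun l : ℝ => (l : ℂ) * ζ) ζ 1 := by
      simpa using (Complex.ofRealCLM.hasDerivAt (x := (1 : ℝ))).mul_const ζ
    have h2 : HasDerivAt Φ (deriv Φ ζ) ((1 : ℝ) * ζ) := by
      simpa using (hΦd ζ hζ).hasDerivAt
    have h3 := HasDerivAt.comp (1 : ℝ) h2 h1
    have h4 : HasDerivAt (Φ ∘ fun l : ℝ => (l : ℂ) * ζ) 0 1 := by
      refine (hasDerivAt_const (1 : ℝ) (Φ ζ)).congr_of_eventuallyEq ?_
      filter_upwards [lt_mem_nhds (zero_lt_one : (0 : ℝ) < 1)] with l hl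
      exact hray l hl ζ
    have h5 := h3.unique h4
    exact (mul_eq_zero.1 h5).resolve_right hζ0
  have hone : (1 : ℂ) + Complex.I / 4 ∈ rotationDomain := by
    have h1 : ((1 : ℂ) + Complex.I / 4).re = 1 := by
      simp [show (Complex.I / 4 : ℂ) = ((1 / 4 : ℝ) : ℂ) * Complex.I by push_cast; ring]
    have h2 : ((1 : ℂ) + Complex.I / 4).im = 1 / 4 := by
      simp [show (Complex.I / 4 : ℂ) = ((1 / 4 : ℝ) : ℂ) * Complex.I by push_cast; ring]
    simp only [rotationDomain, Set.mem_ofPred_eq, h1, h2]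
    norm_num
  have hconst : ∀ ζ ∈ rotationDomain, Φ ζ = Φ (1 + Complex.I / 4) := fun ζ hζ =>
    isOpen_rotationDomain.is_const_of_deriv_eq_zero convex_rotationDomain.isPreconnected
      (fun ζ hζ => (hΦd ζ hζ).differentiableWithinAt) (fun ζ hζ => hderiv ζ hζ) hζ hone
  -- A vertical sequence inside the domain that converges to the boundary point 1.
  have hmemseq : ∀ m : ℕ, (1 : ℂ) + ((1 / (4 * ((m : ℝ) + 1)) : ℝ) : ℂ) * Complex.I
      ∈ rotationDomain := by
    intro m
    simp only [rotationDomain, Set.mem_ofPred_eq, Complex.add_re, Complex.add_im,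
      Complex.re_ofReal_mul, Complex.im_ofReal_mul, Complex.I_re, Complex.I_im, Complex.one_re,
      Complex.one_im]
    refine ⟨by norm_num, by norm_num, by positivity, ?_⟩
    have : 1 / (4 * ((m : ℝ) + 1)) ≤ 1 / 4 := by
      apply one_div_le_one_div_of_le (by norm_num)
      nlinarith [(Nat.cast_nonneg m : (0 : ℝ) ≤ m)]
    linarith
  have hlim0 : Tendsto (fun m : ℕ => (1 : ℂ) + ((1 / (4 * ((m : ℝ) + 1)) : ℝ) : ℂ) * Complex.I)
      atTop (nhds 1) := by
    have : Tendsto (fun m : ℕ => (1 / (4 * ((m : ℝ) + 1)) : ℝ)) atTop (nhds 0) := by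
      refine Tendsto.div_atTop tendsto_const_nhds ?_
      exact Tendsto.const_mul_atTop (by norm_num)
        (tendsto_atTop_add_const_right _ _ tendsto_natCast_atTop_atTop)
    have h3 := (Complex.continuous_ofReal.tendsto 0).comp this
    have h4 := (h3.mul_const Complex.I).const_add 1
    simpa using h4
  have hlim : Tendsto (fun m : ℕ => (1 : ℂ) + ((1 / (4 * ((m : ℝ) + 1)) : ℝ) : ℂ) * Complex.I)
      atTop (nhdsWithin 1 rotationDomain) :=
    tendsto_nhdsWithin_iff.2 ⟨hlim0, Eventually.of_forall hmemseq⟩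
  have hI : Tendsto (fun m : ℕ => ∫ a, f ((1 : ℂ) +
      ((1 / (4 * ((m : ℝ) + 1)) : ℝ) : ℂ) * Complex.I) a ∂μ) atTop (nhds (∫ a, f 1 a ∂μ)) := by
    refine tendsto_integral_of_dominated_convergence g (fun m => hmeas _ (hmemseq m)) hg
      (fun m => ?_) ?_
    · filter_upwards [hbound] with a ha using ha _ (hmemseq m)
    · filter_upwards [hcont] with a ha using ha.comp hlim
  have hΦlim : Tendsto (fun m : ℕ => Φ ((1 : ℂ) +
      ((1 / (4 * ((m : ℝ) + 1)) : ℝ) : ℂ) * Complex.I)) atTop (nhds (Φ 1)) :=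
    (hlim0.pow n).mul hI
  have h6 : Tendsto (fun _ : ℕ => Φ (1 + Complex.I / 4)) atTop (nhds (Φ 1)) := by
    refine hΦlim.congr fun m => hconst _ (hmemseq m)
  have h7 := tendsto_nhds_unique h6 tendsto_const_nhds
  simpa [hΦ] using h7

/-! ### Complex square roots -/

/-- The principal square root. -/
def csqrt (w : ℂ) : ℂ := w ^ (1 / 2 : ℂ)

lemma csqrt_sq (w : ℂ) : csqrt w ^ 2 = w := by
  unfold csqrt
  rw [← Complex.cpow_nat_mul]; norm_num

lemma csqrt_re_nonneg (w : ℂ) : 0 ≤ (csqrt w).re := by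
  unfold csqrt
  by_cases hw : w = 0
  · simp [hw]
  · rw [Complex.cpow_def_of_ne_zero hw, Complex.exp_re]
    refine mul_nonneg (Real.exp_pos _).le (Real.cos_nonneg_of_mem_Icc ?_)
    have h : (Complex.log w * (1 / 2)).im = w.arg / 2 := by
      rw [show (1 / 2 : ℂ) = ((1 / 2 : ℝ) : ℂ) by push_cast; rfl, Complex.im_mul_ofReal,
        Complex.log_im]
      ring
    rw [h]
    constructor <;> linarith [Complex.neg_pi_lt_arg w, Complex.arg_le_pi w]

lemma csqrt_ofReal_sq {r : ℝ} (hr : 0 ≤ r) : csqrt ((r : ℂ) ^ 2) = r := by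
  unfold csqrt
  rw [← Complex.ofReal_pow, show (1 / 2 : ℂ) = ((1 / 2 : ℝ) : ℂ) by push_cast; rfl,
    ← Complex.ofReal_cpow (by positivity), ← Real.sqrt_eq_rpow, Real.sqrt_sq hr]

lemma csqrt_re_im (w : ℂ) : (csqrt w).re ^ 2 - (csqrt w).im ^ 2 = w.re ∧
    2 * (csqrt w).re * (csqrt w).im = w.im := by
  have h := csqrt_sq w
  have h1 := congrArg Complex.re h
  have h2 := congrArg Complex.im h
  rw [sq, Complex.mul_re] at h1
  rw [sq, Complex.mul_im] at h2
  constructor <;> nlinarith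

lemma differentiableAt_csqrt {w : ℂ} (hw : 0 < w.re) : DifferentiableAt ℂ csqrt w := by
  unfold csqrt
  exact differentiableAt_id.cpow_const (Or.inl hw)

lemma measurable_csqrt : Measurable csqrt := by
  unfold csqrt; fun_prop

/-! ### The complexified squared distance to the beam axis -/

/-- The analytic continuation of `‖x + ζ u‖ ^ 2` in `ζ`. -/
def shiftSq (x u : Plane) (ζ : ℂ) : ℂ :=
  (‖x‖ ^ 2 : ℝ) + 2 * ζ * (inner ℝ x u : ℝ) + ζ ^ 2 * (‖u‖ ^ 2 : ℝ)

lemma shiftSq_one (x u : Plane) : shiftSq x u 1 = ((‖x + u‖ ^ 2 : ℝ) : ℂ) := by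
  unfold shiftSq
  rw [norm_add_sq_real]
  push_cast; ring

lemma shiftSq_re (x u : Plane) (ζ : ℂ) : (shiftSq x u ζ).re =
    ‖x‖ ^ 2 + 2 * ζ.re * inner ℝ x u + (ζ.re ^ 2 - ζ.im ^ 2) * ‖u‖ ^ 2 := by
  unfold shiftSq
  have h : (ζ ^ 2).re = ζ.re ^ 2 - ζ.im ^ 2 := by rw [sq, Complex.mul_re]; ring
  rw [Complex.add_re, Complex.add_re, Complex.ofReal_re, Complex.re_mul_ofReal,
    Complex.re_mul_ofReal, h]
  simp

lemma shiftSq_im (x u : Plane) (ζ : ℂ) : (shiftSq x u ζ).im =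
    2 * ζ.im * inner ℝ x u + 2 * ζ.re * ζ.im * ‖u‖ ^ 2 := by
  unfold shiftSq
  have h : (ζ ^ 2).im = 2 * ζ.re * ζ.im := by rw [sq, Complex.mul_im]; ring
  rw [Complex.add_im, Complex.add_im, Complex.ofReal_im, Complex.im_mul_ofReal,
    Complex.im_mul_ofReal, h]
  simp

lemma shiftSq_smul (x u : Plane) (l : ℝ) (ζ : ℂ) :
    shiftSq x u (l * ζ) = shiftSq x (l • u) ζ := by
  unfold shiftSq
  rw [inner_smul_right, norm_smul, mul_pow ‖l‖, Real.norm_eq_abs, sq_abs]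
  push_cast; ring

lemma differentiable_shiftSq (x u : Plane) : Differentiable ℂ (shiftSq x u) := by
  unfold shiftSq; fun_prop

lemma measurable_shiftSq (x : Plane) (ζ : ℂ) : Measurable fun u => shiftSq x u ζ := by
  unfold shiftSq
  have : Continuous fun u : Plane => inner ℝ x u := by fun_prop
  have := this.measurable
  fun_prop

/-- The real part of the exponent of the complexified beam. -/
lemma re_neg_shiftSq_div (x u : Plane) (ζ R : ℂ) :
    (-(shiftSq x u ζ / R)).re = -(((shiftSq x u ζ).re * R.re + (shiftSq x u ζ).im * R.im)
      / (R.re ^ 2 + R.im ^ 2)) := by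
  rw [Complex.neg_re, Complex.div_re, ← add_div, Complex.normSq_apply, ← sq, ← sq]

/-! ### Real inequalities for the exponents -/

section RealInequalities

variable {X q m a b : ℝ}

/-- The condition 2b ≤ a is what the shape of `rotationDomain` provides. It leaves at least 3/4 of
the term a²q², enough to complete the square against the cross term and lose only a multiple of X²,
uniformly in q. -/
lemma shift_re_bound (ha : 0 < a) (hb : 0 < b) (hab : 2 * b ≤ a) (hm : |m| ≤ X * q) :
    -X ^ 2 ≤ X ^ 2 + 2 * a * m + (a ^ 2 - b ^ 2) * q ^ 2 := by
  have h1 := (abs_le.1 hm).1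
  have hb2 : b ^ 2 ≤ a ^ 2 / 4 := by nlinarith
  have : -(a * (X * q)) ≤ a * m := by nlinarith
  nlinarith [mul_nonneg (sub_nonneg.2 hb2) (sq_nonneg q), sq_nonneg (X - 3 / 4 * (a * q)),
    sq_nonneg (a * q), sq_nonneg X]

lemma shift_im_bound (hb : 0 < b) (hab : 2 * b ≤ a) (hm : |m| ≤ X * q) :
    -(X ^ 2 / 4) ≤ 2 * b * m + 2 * a * b * q ^ 2 := by
  have h1 := (abs_le.1 hm).1
  have h2 : -(2 * b * (X * q)) ≤ 2 * b * m := by nlinarith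
  have h3 : 2 * b * (X * q) - 2 * a * b * q ^ 2 ≤ X ^ 2 / 4 := by
    have h4 : 4 * b ^ 2 * q ^ 2 ≤ 2 * a * b * q ^ 2 := by
      have : 4 * b ^ 2 ≤ 2 * a * b := by nlinarith
      exact mul_le_mul_of_nonneg_right this (sq_nonneg q)
    nlinarith [sq_nonneg (X / 2 - 2 * b * q)]
  linarith

/-- A lower bound for the exponent of the complexified beam when only the cross-range variables
are complexified. -/
lemma exponent_bound_cross {A B : ℝ} (ha : 0 < a) (hb : 0 < b) (hab : 2 * b ≤ a)
    (hm : |m| ≤ X * q) (hA : 0 < A) (hB : 0 ≤ B) :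
    -(X ^ 2 * (A + B) / A ^ 2) ≤ ((X ^ 2 + 2 * a * m + (a ^ 2 - b ^ 2) * q ^ 2) * A +
      (2 * b * m + 2 * a * b * q ^ 2) * B) / (A ^ 2 + B ^ 2) := by
  have h1 := shift_re_bound ha hb hab hm
  have h2 := shift_im_bound hb hab hm
  have h3 : -(X ^ 2 * (A + B)) ≤ ((X ^ 2 + 2 * a * m + (a ^ 2 - b ^ 2) * q ^ 2) * A +
      (2 * b * m + 2 * a * b * q ^ 2) * B) := by
    nlinarith [mul_le_mul_of_nonneg_right h1 hA.le, mul_le_mul_of_nonneg_right h2 hB,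
      mul_nonneg (sq_nonneg X) hB]
  have h4 : X ^ 2 * (A + B) / (A ^ 2 + B ^ 2) ≤ X ^ 2 * (A + B) / A ^ 2 := by
    apply div_le_div_of_nonneg_left (by positivity) (by positivity)
    nlinarith [sq_nonneg B]
  calc -(X ^ 2 * (A + B) / A ^ 2) ≤ -(X ^ 2 * (A + B) / (A ^ 2 + B ^ 2)) := by linarith
    _ = -(X ^ 2 * (A + B)) / (A ^ 2 + B ^ 2) := by ring
    _ ≤ _ := by gcongr

/-- The same when all variables are complexified; here `t = 2 s / k` and `h = 2 Z / k`. -/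
lemma exponent_bound_full {A t h : ℝ} (ha : 0 < a) (hb : 0 < b) (hab : 2 * b ≤ a)
    (hm : |m| ≤ X * q) (hA : 0 < A) (ht : 0 ≤ t) (hh : 0 ≤ h) :
    A ^ 2 / 2 ≤ (A - b * t) ^ 2 + (h + a * t) ^ 2 ∧
    -(X ^ 2 * (3 * A + 2 * h) / A ^ 2) ≤
      ((X ^ 2 + 2 * a * m + (a ^ 2 - b ^ 2) * q ^ 2) * (A - b * t) +
      (2 * b * m + 2 * a * b * q ^ 2) * (h + a * t)) / ((A - b * t) ^ 2 + (h + a * t) ^ 2) := by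
  have h1 := shift_re_bound ha hb hab hm
  have h2 := shift_im_bound hb hab hm
  set β := b * t with hβ
  have hβ0 : 0 ≤ β := by positivity
  have hat : 2 * β ≤ a * t := by nlinarith
  have hD1 : A ^ 2 / 2 + 3 * β ^ 2 ≤ (A - β) ^ 2 + (h + a * t) ^ 2 := by
    have : (2 * β) ^ 2 ≤ (h + a * t) ^ 2 := by
      apply pow_le_pow_left₀ (by positivity); linarith
    nlinarith [sq_nonneg (A - 2 * β)]
  have hD2 : A ^ 2 / 2 ≤ (A - β) ^ 2 + (h + a * t) ^ 2 := by nlinarith [sq_nonneg β]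
  -- Rotating the range shrinks the real part A - β of the squared beam radius and produces a loss β
  -- X² that is unbounded in β. The denominator also grows at least like A β, so the quotient stays
  -- bounded.
  have hD3 : A * β ≤ (A - β) ^ 2 + (h + a * t) ^ 2 := by
    nlinarith [sq_nonneg (A - 2 * β), sq_nonneg β, sq_nonneg A]
  refine ⟨hD2, ?_⟩
  have hD : 0 < (A - β) ^ 2 + (h + a * t) ^ 2 := by
    have : 0 < A ^ 2 := by positivity
    linarith
  have hid : (X ^ 2 + 2 * a * m + (a ^ 2 - b ^ 2) * q ^ 2) * (A - β) +
      (2 * b * m + 2 * a * b * q ^ 2) * (h + a * t) =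
      (X ^ 2 + 2 * a * m + (a ^ 2 - b ^ 2) * q ^ 2) * A + β * ((a ^ 2 + b ^ 2) * q ^ 2 - X ^ 2)
      + (2 * b * m + 2 * a * b * q ^ 2) * h := by rw [hβ]; ring
  rw [le_div_iff₀ hD, hid]
  have e1 := mul_le_mul_of_nonneg_right h1 hA.le
  have e2 := mul_le_mul_of_nonneg_right h2 hh
  have e3 : -(β * X ^ 2) ≤ β * ((a ^ 2 + b ^ 2) * q ^ 2 - X ^ 2) := by
    have : 0 ≤ β * ((a ^ 2 + b ^ 2) * q ^ 2) := by positivity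
    linarith
  have f0 : -(X ^ 2 * (3 * A + 2 * h) / A ^ 2) * ((A - β) ^ 2 + (h + a * t) ^ 2)
      = -(X ^ 2 / A ^ 2 * (2 * A + 2 * h) * ((A - β) ^ 2 + (h + a * t) ^ 2)
        + X ^ 2 / A * ((A - β) ^ 2 + (h + a * t) ^ 2)) := by field_simp; ring
  have f1 : X ^ 2 * (A + h) ≤ X ^ 2 / A ^ 2 * (2 * A + 2 * h) *
      ((A - β) ^ 2 + (h + a * t) ^ 2) := by
    have : X ^ 2 * (A + h) = X ^ 2 / A ^ 2 * (2 * A + 2 * h) * (A ^ 2 / 2) := by field_simp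
    rw [this]; gcongr
  have f2 : X ^ 2 * β ≤ X ^ 2 / A * ((A - β) ^ 2 + (h + a * t) ^ 2) := by
    have : X ^ 2 * β = X ^ 2 / A * (A * β) := by field_simp
    rw [this]; gcongr
  rw [f0]
  nlinarith [mul_nonneg (sq_nonneg X) hh]

/-- The exponential gain at the end of the rotation of the cross-range variables. -/
lemma exponent_gain_cross {A B k r s : ℝ} (hX : 0 < X) (hq : 0 ≤ q) (hm : |m| ≤ X * q)
    (hA : 0 < A) (hB : 0 ≤ B) (hBA : B ≤ A / 4) (hk : 0 < k) (hs : 0 ≤ s) (hr0 : 0 < r)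
    (hr : r ≤ q + s) (hM : 120 * (X / 2 + s) ≤ k * A) :
    X ^ 2 / (64 * A) ≤ ((X ^ 2 + 2 * m + 15 / 16 * q ^ 2) * A + (m / 2 + q ^ 2 / 2) * B)
      / (A ^ 2 + B ^ 2) + k * q ^ 2 / (10 * r) := by
  have h1 := (abs_le.1 hm).1
  have hQ : -(X ^ 2 / 8) ≤ m / 2 + q ^ 2 / 2 := by nlinarith [sq_nonneg (X - 2 * q)]
  have hD : 0 < A ^ 2 + B ^ 2 := by positivity
  have hX2 : 0 < X ^ 2 := by positivity
  have hkr : 0 ≤ k * q ^ 2 / (10 * r) := by positivity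
  have e2 := mul_le_mul_of_nonneg_right hQ hB
  -- For displacements below X/2 the point is still far from the axis and the Gaussian alone gives
  -- the gain. Beyond X/2 the Gaussian may lose up to 2X²/A, but the decay k q²/(10 r) of the Green
  -- function is at least 3X²/A because k A is large.
  rcases le_total q (X / 2) with hqX | hqX
  · have hP : 15 / 64 * X ^ 2 ≤ X ^ 2 + 2 * m + 15 / 16 * q ^ 2 := by
      nlinarith [mul_nonneg (sub_nonneg.2 hqX) hX.le, mul_nonneg (sub_nonneg.2 hqX) hq]
    have e1 := mul_le_mul_of_nonneg_right hP hA.le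
    have : X ^ 2 / (64 * A) ≤ ((X ^ 2 + 2 * m + 15 / 16 * q ^ 2) * A + (m / 2 + q ^ 2 / 2) * B)
      / (A ^ 2 + B ^ 2) := by
      rw [div_le_div_iff₀ (by positivity) hD]
      have g1 : X ^ 2 * (A ^ 2 + B ^ 2) ≤ X ^ 2 * (2 * A ^ 2) := by
        gcongr; nlinarith
      have g2 : X ^ 2 * A / 8 ≤ (X ^ 2 + 2 * m + 15 / 16 * q ^ 2) * A + (m / 2 + q ^ 2 / 2) * B := by
        nlinarith [mul_le_mul_of_nonneg_left hBA hX2.le]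
      nlinarith [mul_le_mul_of_nonneg_right g2 (by positivity : 0 ≤ 64 * A)]
    linarith
  · have hP : -X ^ 2 ≤ X ^ 2 + 2 * m + 15 / 16 * q ^ 2 := by
      nlinarith [sq_nonneg (X - 15 / 16 * q), sq_nonneg q]
    have e1 := mul_le_mul_of_nonneg_right hP hA.le
    have g1 : -(2 * X ^ 2 / A) ≤ ((X ^ 2 + 2 * m + 15 / 16 * q ^ 2) * A +
        (m / 2 + q ^ 2 / 2) * B) / (A ^ 2 + B ^ 2) := by
      rw [le_div_iff₀ hD]
      have : 2 * X ^ 2 * A ≤ (A ^ 2 + B ^ 2) * (2 * X ^ 2 / A) := by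
        have : 2 * X ^ 2 * A = A ^ 2 * (2 * X ^ 2 / A) := by field_simp
        rw [this]; gcongr; nlinarith [sq_nonneg B]
      nlinarith [mul_le_mul_of_nonneg_left hBA hX2.le]
    have g2 : 3 * X ^ 2 / A ≤ k * q ^ 2 / (10 * r) := by
      rw [div_le_div_iff₀ hA (by positivity)]
      have h5 : 30 * X ^ 2 * (q + s) ≤ k * A * q ^ 2 := by
        have h6 : X ^ 2 * (q + s) ≤ 4 * q ^ 2 * (X / 2 + s) := by
          nlinarith [mul_nonneg (sub_nonneg.2 hqX) hX.le, mul_nonneg (sub_nonneg.2 hqX) hq,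
            mul_nonneg (mul_nonneg (sub_nonneg.2 hqX) hX.le) hq,
            mul_nonneg (mul_nonneg (sub_nonneg.2 hqX) hX.le) hs,
            mul_nonneg (mul_nonneg (sub_nonneg.2 hqX) hq) hs]
        nlinarith [mul_le_mul_of_nonneg_right hM (sq_nonneg q)]
      nlinarith [mul_le_mul_of_nonneg_left hr (by positivity : 0 ≤ 30 * X ^ 2)]
    have g3 : X ^ 2 / (64 * A) ≤ 3 * X ^ 2 / A - 2 * X ^ 2 / A := by
      rw [← sub_div, div_le_div_iff₀ (by positivity) hA]; nlinarith [mul_pos hX2 hA]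
    linarith

/-- P and Q stand for the real and imaginary parts of the complexified squared distance to the axis,
A - β and h + 4β for those of the squared beam radius, and D for the squared modulus of the latter.
Three resources are used in turn: for small displacement and small β the Gaussian gives the gain,
because D ≤ 2A²; for large β the term k²β/2 absorbs the loss; for displacement at least X/2 the term
k r/8 does. The largeness of k A relative to X makes the last two sufficient. -/
lemma exponent_gain_aux {P Q D A k r β h : ℝ} (hX : 0 < X) (hA : 0 < A) (hk : 0 < k) (hβ : 0 ≤ β)
    (hhA : h ≤ A / 16) (hh : 0 ≤ h) (hr0 : 0 ≤ r) (hM : 128 * X ≤ k * A) (hQ : -(X ^ 2 / 8) ≤ Q)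
    (hP : -X ^ 2 ≤ P) (hPr : 15 / 64 * X ^ 2 ≤ P ∨ X / 2 ≤ r) (hPQ : -X ^ 2 ≤ 4 * Q - P)
    (hD1 : A ^ 2 / 2 ≤ D) (hD2 : β ≤ A / 16 → D ≤ 2 * A ^ 2) :
    X ^ 2 / (64 * A) ≤ (P * (A - β) + Q * (h + 4 * β)) / D + (k * r / 8 + k ^ 2 * β / 2) := by
  have hX2 : 0 < X ^ 2 := by positivity
  have hA2 : 0 < A ^ 2 := by positivity
  have hD : 0 < D := by linarith
  have hN : P * A - β * X ^ 2 - X ^ 2 / 8 * (A / 16) ≤ P * (A - β) + Q * (h + 4 * β) := by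
    have e2 := mul_le_mul_of_nonneg_right hQ hh
    have e3 := mul_le_mul_of_nonneg_left hPQ hβ
    have e4 := mul_le_mul_of_nonneg_left hhA (by positivity : 0 ≤ X ^ 2 / 8)
    linarith
  generalize P * (A - β) + Q * (h + 4 * β) = N at hN ⊢
  have lower : ∀ c : ℝ, 0 ≤ c → -c ≤ N → -(2 * c / A ^ 2) ≤ N / D := by
    intro c hc hle
    rw [le_div_iff₀ hD]
    have h1 : c = 2 * c / A ^ 2 * (A ^ 2 / 2) := by field_simp
    have h2 : 2 * c / A ^ 2 * (A ^ 2 / 2) ≤ 2 * c / A ^ 2 * D := by gcongr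
    linarith
  have hk2 : 4096 * (X ^ 2 / A ^ 2 * β) ≤ k ^ 2 * β := by
    rw [← mul_assoc]
    refine mul_le_mul_of_nonneg_right ?_ hβ
    rw [← mul_div_assoc, div_le_iff₀ hA2, ← mul_pow]
    calc 4096 * X ^ 2 = (64 * X) ^ 2 := by ring
      _ ≤ _ := pow_le_pow_left₀ (by positivity) (by linarith) 2
  have g0 : 0 ≤ X ^ 2 / A ^ 2 * β := by positivity
  have hXA : 0 < X ^ 2 * A := mul_pos hX2 hA
  rcases hPr with hP1 | hr1
  · have e1 := mul_le_mul_of_nonneg_right hP1 hA.le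
    have hkr : 0 ≤ k * r / 8 := by positivity
    rcases le_total β (A / 16) with hβA | hβA
    · have g2 : X ^ 2 * A / 8 ≤ N := by
        linarith [mul_le_mul_of_nonneg_left hβA hX2.le]
      have h3 : X ^ 2 / (64 * A) ≤ N / D := by
        rw [div_le_div_iff₀ (by positivity) hD]
        have i1 := mul_le_mul_of_nonneg_left (hD2 hβA) hX2.le
        have i2 := mul_le_mul_of_nonneg_right g2 (by positivity : 0 ≤ 64 * A)
        have i3 := mul_pos hX2 hA2
        linarith
      linarith
    · have g1 := lower (3 * β * X ^ 2) (by positivity) (by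
        linarith [mul_nonneg hβ hX2.le])
      have g3 : X ^ 2 / (64 * A) ≤ X ^ 2 / A ^ 2 * β := by
        have : X ^ 2 / (64 * A) = X ^ 2 / A ^ 2 * (A / 64) := by field_simp
        rw [this]; gcongr; linarith
      have g5 : 2 * (3 * β * X ^ 2) / A ^ 2 = 6 * (X ^ 2 / A ^ 2 * β) := by ring
      linarith
  · have e1 := mul_le_mul_of_nonneg_right hP hA.le
    have g1 := lower (2 * A * X ^ 2 + β * X ^ 2) (by positivity) (by linarith)
    have g2 : 8 * (X ^ 2 / A) ≤ k * r / 8 := by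
      rw [← mul_div_assoc, div_le_iff₀ hA]
      have i1 := mul_le_mul_of_nonneg_right hM (by linarith : 0 ≤ X / 2)
      have i2 := mul_le_mul_of_nonneg_left hr1 (by positivity : 0 ≤ k * A)
      linarith
    have g5 : 2 * (2 * A * X ^ 2 + β * X ^ 2) / A ^ 2 =
        4 * (X ^ 2 / A) + 2 * (X ^ 2 / A ^ 2 * β) := by
      field_simp; ring
    have g7 : X ^ 2 / (64 * A) = X ^ 2 / A / 64 := by field_simp
    have g8 : 0 < X ^ 2 / A := by positivity
    linarith

/-- The exponential gain at the end of the rotation of all variables; here `β = s / (2 k)` and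
`h = 2 Z / k`. -/
lemma exponent_gain_full {A k r β h : ℝ} (hX : 0 < X) (hq : 0 ≤ q) (hm : |m| ≤ X * q)
    (hA : 0 < A) (hk : 0 < k) (hβ : 0 ≤ β) (hh : 0 ≤ h) (hhA : h ≤ A / 16)
    (hr : q ≤ r) (hM : 128 * X ≤ k * A) :
    X ^ 2 / (64 * A) ≤ ((X ^ 2 + 2 * m + 15 / 16 * q ^ 2) * (A - β)
        + (m / 2 + q ^ 2 / 2) * (h + 4 * β)) / ((A - β) ^ 2 + (h + 4 * β) ^ 2)
      + (k * r / 8 + k ^ 2 * β / 2) := by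
  have h1 := (abs_le.1 hm).1
  refine exponent_gain_aux hX hA hk hβ hhA hh (hq.trans hr) hM ?_ ?_ ?_ ?_ ?_ ?_
  · nlinarith [sq_nonneg (X - 2 * q)]
  · nlinarith [sq_nonneg (X - 15 / 16 * q), sq_nonneg q]
  · rcases le_total q (X / 2) with hqX | hqX
    · left
      nlinarith [mul_nonneg (sub_nonneg.2 hqX) hX.le, mul_nonneg (sub_nonneg.2 hqX) hq]
    · exact Or.inr (hqX.trans hr)
  · nlinarith [sq_nonneg q]
  · have : (4 * β) ^ 2 ≤ (h + 4 * β) ^ 2 := by apply pow_le_pow_left₀ (by positivity); linarith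
    nlinarith [sq_nonneg (A - 2 * β), sq_nonneg β]
  · intro hβA
    have i1 : (A - β) ^ 2 ≤ A ^ 2 := pow_le_pow_left₀ (by linarith) (by linarith) 2
    have i2 : (h + 4 * β) ^ 2 ≤ A ^ 2 := pow_le_pow_left₀ (by positivity) (by linarith) 2
    linarith

end RealInequalities

/-! ### Rotation of the cross-range variables -/

lemma one_add_I_div_four_re : ((1 : ℂ) + Complex.I / 4).re = 1 := by
  simp [show (Complex.I / 4 : ℂ) = ((1 / 4 : ℝ) : ℂ) * Complex.I by push_cast; ring]

lemma one_add_I_div_four_im : ((1 : ℂ) + Complex.I / 4).im = 1 / 4 := by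
  simp [show (Complex.I / 4 : ℂ) = ((1 / 4 : ℝ) : ℂ) * Complex.I by push_cast; ring]

lemma one_add_I_div_four_mem : (1 : ℂ) + Complex.I / 4 ∈ rotationDomain := by
  simp only [rotationDomain, Set.mem_ofPred_eq, one_add_I_div_four_re, one_add_I_div_four_im]
  norm_num

lemma norm_one_add_I_div_four_sq : ‖(1 : ℂ) + Complex.I / 4‖ ^ 2 = 17 / 16 := by
  rw [← Complex.normSq_eq_norm_sq, Complex.normSq_apply, one_add_I_div_four_re,
    one_add_I_div_four_im]
  norm_num

lemma norm_one_add_I_div_four_le : ‖(1 : ℂ) + Complex.I / 4‖ ≤ 2 := by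
  have := norm_one_add_I_div_four_sq
  nlinarith [norm_nonneg ((1 : ℂ) + Complex.I / 4)]

/-- The complexified squared distance. -/
def distSq (s q : ℝ) (ζ : ℂ) : ℂ := ζ ^ 2 * (q ^ 2 : ℝ) + (s ^ 2 : ℝ)

lemma distSq_re (s q : ℝ) (ζ : ℂ) :
    (distSq s q ζ).re = (ζ.re ^ 2 - ζ.im ^ 2) * q ^ 2 + s ^ 2 := by
  have h : (ζ ^ 2).re = ζ.re ^ 2 - ζ.im ^ 2 := by rw [sq, Complex.mul_re]; ring
  rw [distSq, Complex.add_re, Complex.re_mul_ofReal, Complex.ofReal_re, h]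

lemma distSq_im (s q : ℝ) (ζ : ℂ) : (distSq s q ζ).im = 2 * ζ.re * ζ.im * q ^ 2 := by
  have h : (ζ ^ 2).im = 2 * ζ.re * ζ.im := by rw [sq, Complex.mul_im]; ring
  rw [distSq, Complex.add_im, Complex.im_mul_ofReal, Complex.ofReal_im, h, add_zero]

lemma distSq_one (s q : ℝ) : distSq s q 1 = ((√(q ^ 2 + s ^ 2) : ℝ) : ℂ) ^ 2 := by
  rw [distSq, ← Complex.ofReal_pow, Real.sq_sqrt (by positivity)]
  push_cast; ring

lemma distSq_re_ge {s q : ℝ} {ζ : ℂ} (hζ : ζ ∈ rotationDomain) :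
    27 / 64 * (q ^ 2 + s ^ 2) ≤ (distSq s q ζ).re := by
  obtain ⟨h1, h2, h3, h4⟩ := hζ
  rw [distSq_re]
  have : 27 / 64 ≤ ζ.re ^ 2 - ζ.im ^ 2 := by nlinarith
  nlinarith [mul_le_mul_of_nonneg_right this (sq_nonneg q), sq_nonneg s]

/-- On the rotation domain ζ² has positive real and imaginary parts, so the complexified squared
distance stays in the first quadrant and so does its root. Hence e^{ikr} does not grow and the
damping e^{-k_d r} still acts. -/
lemma csqrt_distSq_bounds {s q : ℝ} {ζ : ℂ} (hs : 0 < s) (hζ : ζ ∈ rotationDomain) :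
    √(q ^ 2 + s ^ 2) / 2 ≤ (csqrt (distSq s q ζ)).re ∧ 0 ≤ (csqrt (distSq s q ζ)).im := by
  have h1 := csqrt_re_im (distSq s q ζ)
  have h2 := distSq_re_ge (s := s) (q := q) hζ
  have h3 := csqrt_re_nonneg (distSq s q ζ)
  have h4 : √(q ^ 2 + s ^ 2) / 2 ≤ (csqrt (distSq s q ζ)).re := by
    refine abs_le_of_sq_le_sq' ?_ h3 |>.2
    rw [div_pow, Real.sq_sqrt (by positivity)]
    nlinarith [sq_nonneg (csqrt (distSq s q ζ)).im, sq_nonneg q, sq_nonneg s]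
  refine ⟨h4, ?_⟩
  have h5 : 0 < √(q ^ 2 + s ^ 2) := by positivity
  have h6 : 0 ≤ (distSq s q ζ).im := by
    obtain ⟨h1, h2, h3, h4⟩ := hζ
    rw [distSq_im]
    have : 0 < ζ.re := by linarith
    positivity
  have h7 := h1.2
  by_contra hneg
  push Not at hneg
  nlinarith

/-- At ζ = 1 + i/4 twice the product of the real and imaginary parts of the root is q²/2, and the
real part is at most 5/4 of the true distance. The second bound converts the phase k r into decay at
rate k q²/(5 r). -/
lemma csqrt_distSq_end {s q : ℝ} (hs : 0 < s) :
    s ≤ (csqrt (distSq s q (1 + Complex.I / 4))).re ∧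
    q ^ 2 / (5 * √(q ^ 2 + s ^ 2)) ≤ (csqrt (distSq s q (1 + Complex.I / 4))).im := by
  have h1 := csqrt_re_im (distSq s q (1 + Complex.I / 4))
  have h3 := csqrt_re_nonneg (distSq s q (1 + Complex.I / 4))
  obtain ⟨-, h0⟩ := csqrt_distSq_bounds (q := q) hs one_add_I_div_four_mem
  rw [distSq_re, distSq_im, one_add_I_div_four_re, one_add_I_div_four_im] at h1
  obtain ⟨e1, e2⟩ := h1
  set ρ := (csqrt (distSq s q (1 + Complex.I / 4))).re
  set ι := (csqrt (distSq s q (1 + Complex.I / 4))).im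
  have hr : 0 < √(q ^ 2 + s ^ 2) := by positivity
  have hr2 : √(q ^ 2 + s ^ 2) ^ 2 = q ^ 2 + s ^ 2 := Real.sq_sqrt (by positivity)
  have hs' : s ≤ ρ := by
    refine abs_le_of_sq_le_sq' ?_ h3 |>.2
    nlinarith [sq_nonneg ι, sq_nonneg q]
  refine ⟨hs', ?_⟩
  have hρ : ρ ≤ 5 / 4 * √(q ^ 2 + s ^ 2) := by
    refine abs_le_of_sq_le_sq' ?_ (by positivity) |>.2
    rw [mul_pow, hr2]
    have e3 : (ρ ^ 2 + ι ^ 2) ^ 2 = (15 / 16 * q ^ 2 + s ^ 2) ^ 2 + (q ^ 2 / 2) ^ 2 := by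
      have : (ρ ^ 2 + ι ^ 2) ^ 2 = (ρ ^ 2 - ι ^ 2) ^ 2 + (2 * ρ * ι) ^ 2 := by ring
      rw [this, e1, e2]; ring
    have e4 : ρ ^ 2 + ι ^ 2 ≤ 25 / 16 * (q ^ 2 + s ^ 2) := by
      refine abs_le_of_sq_le_sq' ?_ (by positivity) |>.2
      rw [e3]
      nlinarith [sq_nonneg (q ^ 2), sq_nonneg (s ^ 2), mul_nonneg (sq_nonneg q) (sq_nonneg s)]
    linarith [sq_nonneg ι]
  rw [div_le_iff₀ (by positivity)]
  nlinarith

/-- The complexified integrand in the cross-range variables. -/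
def crossIntegrand (p : Params) (x : Plane) (s : ℝ) (R ζ : ℂ) (u : Plane) : ℂ :=
  1 / (4 * (Real.pi : ℂ) * csqrt (distSq s ‖u‖ ζ)) *
    Complex.exp ((Complex.I * (p.k : ℂ) - (p.kd : ℂ)) * csqrt (distSq s ‖u‖ ζ)) *
    Complex.exp (-(shiftSq x u ζ / R))

lemma measurable_crossIntegrand (p : Params) (x : Plane) (s : ℝ) (R ζ : ℂ) :
    Measurable (crossIntegrand p x s R ζ) := by
  unfold crossIntegrand distSq
  have := measurable_shiftSq x ζ
  have := measurable_csqrt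
  fun_prop

lemma differentiableAt_crossIntegrand (p : Params) (x : Plane) {s : ℝ} (R : ℂ) {ζ : ℂ} (u : Plane)
    (h : 0 < (distSq s ‖u‖ ζ).re) :
    DifferentiableAt ℂ (fun ζ => crossIntegrand p x s R ζ u) ζ := by
  have h1 : DifferentiableAt ℂ (fun ζ => csqrt (distSq s ‖u‖ ζ)) ζ := by
    refine (differentiableAt_csqrt h).comp ζ ?_
    unfold distSq; fun_prop
  have h2 : csqrt (distSq s ‖u‖ ζ) ≠ 0 := by
    intro h0
    have := csqrt_sq (distSq s ‖u‖ ζ)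
    rw [h0] at this
    rw [← this] at h
    simp at h
  have h3 := differentiable_shiftSq x u ζ
  have h4 : (4 * (Real.pi : ℂ) * csqrt (distSq s ‖u‖ ζ)) ≠ 0 := by
    have : (Real.pi : ℂ) ≠ 0 := by exact_mod_cast Real.pi_ne_zero
    exact mul_ne_zero (mul_ne_zero (by norm_num) this) h2
  unfold crossIntegrand
  exact (((differentiableAt_const _).div (h1.const_mul _) h4).mul (h1.const_mul _).cexp).mul
    (h3.div_const R).neg.cexp

lemma norm_crossIntegrand (p : Params) (x : Plane) (s : ℝ) (R ζ : ℂ) (u : Plane) :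
    ‖crossIntegrand p x s R ζ u‖ = 1 / (4 * Real.pi * ‖csqrt (distSq s ‖u‖ ζ)‖) *
      Real.exp (-p.k * (csqrt (distSq s ‖u‖ ζ)).im - p.kd * (csqrt (distSq s ‖u‖ ζ)).re) *
      Real.exp (-(((shiftSq x u ζ).re * R.re + (shiftSq x u ζ).im * R.im)
      / (R.re ^ 2 + R.im ^ 2))) := by
  unfold crossIntegrand
  rw [norm_mul, norm_mul, Complex.norm_exp, Complex.norm_exp, re_neg_shiftSq_div]
  congr 3
  · simp [abs_of_pos Real.pi_pos]
  · simp [Complex.mul_re, Complex.mul_im]; ring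

lemma norm_crossIntegrand_le (p : Params) (hk : 0 < p.k) (hkd : 0 < p.kd) (x : Plane) {s : ℝ}
    (hs : 0 < s) {R ζ : ℂ} (hR : 0 < R.re) (hR' : 0 ≤ R.im) (hζ : ζ ∈ rotationDomain) (u : Plane) :
    ‖crossIntegrand p x s R ζ u‖ ≤ 1 / (2 * Real.pi * s) *
      Real.exp (‖x‖ ^ 2 * (R.re + R.im) / R.re ^ 2) * Real.exp (-(p.kd / 2) * ‖u‖) := by
  obtain ⟨h1, h2⟩ := csqrt_distSq_bounds (q := ‖u‖) hs hζ
  have hE := exponent_bound_cross (X := ‖x‖) (q := ‖u‖) (m := inner ℝ x u) (a := ζ.re) (b := ζ.im)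
    (by linarith [hζ.1]) hζ.2.2.1 (by linarith [hζ.1, hζ.2.2.2]) (abs_real_inner_le_norm x u) hR hR'
  rw [norm_crossIntegrand, shiftSq_re, shiftSq_im]
  have hr := Complex.re_le_norm (csqrt (distSq s ‖u‖ ζ))
  set r := csqrt (distSq s ‖u‖ ζ)
  have hsr : s ≤ √(‖u‖ ^ 2 + s ^ 2) := Real.le_sqrt_of_sq_le (by nlinarith [sq_nonneg ‖u‖])
  have hur : ‖u‖ ≤ √(‖u‖ ^ 2 + s ^ 2) := Real.le_sqrt_of_sq_le (by nlinarith [sq_nonneg s])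
  calc _ ≤ 1 / (4 * Real.pi * (s / 2)) * Real.exp (-(p.kd / 2) * ‖u‖) *
        Real.exp (‖x‖ ^ 2 * (R.re + R.im) / R.re ^ 2) := by
        gcongr
        · linarith
        · nlinarith [mul_nonneg hk.le h2]
        · linarith
    _ = _ := by ring

lemma crossIntegrand_smul (p : Params) (x : Plane) (s : ℝ) (R : ℂ) (l : ℝ) (ζ : ℂ)
    (u : Plane) : crossIntegrand p x s R (l * ζ) u = crossIntegrand p x s R ζ (l • u) := by
  have h : distSq s ‖u‖ (l * ζ) = distSq s ‖l • u‖ ζ := by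
    unfold distSq
    rw [norm_smul, mul_pow ‖l‖, Real.norm_eq_abs, sq_abs]
    push_cast; ring
  unfold crossIntegrand
  rw [h, shiftSq_smul]

lemma integral_crossIntegrand (p : Params) (hk : 0 < p.k) (hkd : 0 < p.kd) (x : Plane) {s : ℝ}
    (hs : 0 < s) {R : ℂ} (hR : 0 < R.re) (hR' : 0 ≤ R.im) :
    ∫ u, crossIntegrand p x s R 1 u =
      (1 + Complex.I / 4) ^ 2 * ∫ u, crossIntegrand p x s R (1 + Complex.I / 4) u := by
  have := integral_eq_integral_rotated (volume : Measure Plane) (f := crossIntegrand p x s R)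
    (g := fun u => 1 / (2 * Real.pi * s) *
      Real.exp (‖x‖ ^ 2 * (R.re + R.im) / R.re ^ 2) * Real.exp (-(p.kd / 2) * ‖u‖))
    ((integrable_exp_neg_norm_plane (by positivity)).const_mul _)
    (fun ζ _ => (measurable_crossIntegrand p x s R ζ).aestronglyMeasurable)
    (ae_of_all _ fun u ζ hζ => (differentiableAt_crossIntegrand p x R u (lt_of_lt_of_le
      (by positivity) (distSq_re_ge hζ))).differentiableWithinAt)
    (ae_of_all _ fun u ζ hζ => norm_crossIntegrand_le p hk hkd x hs hR hR' hζ u)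
    (ae_of_all _ fun u => by
      refine (differentiableAt_crossIntegrand p x R u ?_).continuousAt.tendsto.mono_left
        nhdsWithin_le_nhds
      rw [distSq_re]; simp; positivity)
    (fun l _ ζ u => crossIntegrand_smul p x s R l ζ u)
  simpa using this

/-- Two ranges of q: below s the distance is comparable to s and the decay is Gaussian with width
√(s/k); above s it is comparable to q and the decay is exponential. Either term has planar integral
of order 1/k, uniformly in s. -/
lemma exp_div_dist_le {k s q : ℝ} (hk : 0 < k) (hs : 0 < s) (hq : 0 < q) :
    Real.exp (-(k * q ^ 2 / (10 * √(q ^ 2 + s ^ 2)))) / √(q ^ 2 + s ^ 2) ≤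
      1 / s * Real.exp (-(k / (15 * s)) * q ^ 2) + Real.exp (-(k / 15) * q) / q := by
  have hr : 0 < √(q ^ 2 + s ^ 2) := by positivity
  have hsr : s ≤ √(q ^ 2 + s ^ 2) := Real.le_sqrt_of_sq_le (by nlinarith [sq_nonneg q])
  have hur : q ≤ √(q ^ 2 + s ^ 2) := Real.le_sqrt_of_sq_le (by nlinarith [sq_nonneg s])
  rcases le_total q s with h | h
  · have h2 : √(q ^ 2 + s ^ 2) ≤ 3 / 2 * s := by
      refine Real.sqrt_le_iff.2 ⟨by positivity, ?_⟩; nlinarith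
    have h1 : Real.exp (-(k * q ^ 2 / (10 * √(q ^ 2 + s ^ 2)))) / √(q ^ 2 + s ^ 2) ≤
        Real.exp (-(k / (15 * s)) * q ^ 2) / s := by
      refine div_le_div₀ (Real.exp_pos _).le (Real.exp_le_exp.2 ?_) hs hsr
      rw [neg_mul, neg_le_neg_iff, div_mul_eq_mul_div]
      exact div_le_div_of_nonneg_left (by positivity) (by positivity) (by linarith)
    have h3 : 0 ≤ Real.exp (-(k / 15) * q) / q := by positivity
    calc _ ≤ _ := h1
      _ = 1 / s * Real.exp (-(k / (15 * s)) * q ^ 2) := by ring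
      _ ≤ _ := by linarith
  · have h2 : √(q ^ 2 + s ^ 2) ≤ 3 / 2 * q := by
      refine Real.sqrt_le_iff.2 ⟨by positivity, ?_⟩; nlinarith
    have h1 : Real.exp (-(k * q ^ 2 / (10 * √(q ^ 2 + s ^ 2)))) / √(q ^ 2 + s ^ 2) ≤
        Real.exp (-(k / 15) * q) / q := by
      gcongr
      rw [neg_mul, neg_le_neg_iff, le_div_iff₀ (by positivity)]
      have := mul_le_mul_of_nonneg_left h2 (by positivity : 0 ≤ k * q)
      linarith
    have h3 : 0 ≤ 1 / s * Real.exp (-(k / (15 * s)) * q ^ 2) := by positivity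
    linarith

/-- A numerical constant. -/
def crossConst : ℝ := 15 * Real.pi + 30 * (volume : Measure Plane).real (Metric.ball 0 1)

lemma norm_integral_crossIntegrand_le (p : Params) (hk : 0 < p.k) (hkd : 0 < p.kd) {x : Plane}
    (hx : 0 < ‖x‖) {s : ℝ} (hs : 0 < s) {R : ℂ} (hR : 0 < R.re) (hR' : 0 ≤ R.im)
    (hBA : R.im ≤ R.re / 4) (hM : 120 * (‖x‖ / 2 + s) ≤ p.k * R.re) :
    ‖∫ u, crossIntegrand p x s R 1 u‖ ≤
      crossConst / p.k * Real.exp (-p.kd * s) * Real.exp (-(‖x‖ ^ 2 / (64 * R.re))) := by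
  rw [integral_crossIntegrand p hk hkd x hs hR hR', norm_mul, norm_pow, norm_one_add_I_div_four_sq]
  set G : Plane → ℝ := fun u => Real.exp (-p.kd * s) * Real.exp (-(‖x‖ ^ 2 / (64 * R.re))) *
    (1 / s * Real.exp (-(p.k / (15 * s)) * ‖u‖ ^ 2) + Real.exp (-(p.k / 15) * ‖u‖) / ‖u‖) / 4
    with hG
  have i1 := integrable_exp_neg_norm_sq_plane (b := p.k / (15 * s)) (by positivity)
  have i2 := integrable_exp_neg_norm_div_norm_plane (b := p.k / 15) (by positivity)
  have hGi : Integrable G := (((i1.const_mul _).add i2).const_mul _).div_const _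
  have hle : ∀ᵐ u : Plane, ‖crossIntegrand p x s R (1 + Complex.I / 4) u‖ ≤ G u := by
    have : ∀ᵐ u : Plane, u ≠ 0 := by simp [ae_iff, measure_singleton]
    filter_upwards [this] with u hu
    have hq : 0 < ‖u‖ := norm_pos_iff.2 hu
    obtain ⟨h1, -⟩ := csqrt_distSq_bounds (q := ‖u‖) hs one_add_I_div_four_mem
    obtain ⟨h3, h4⟩ := csqrt_distSq_end (q := ‖u‖) hs
    have hr' : 0 < √(‖u‖ ^ 2 + s ^ 2) := by positivity
    have hgain := exponent_gain_cross (m := inner ℝ x u) (r := √(‖u‖ ^ 2 + s ^ 2)) hx hq.le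
      (abs_real_inner_le_norm x u) hR hR' hBA hk hs.le hr' (by
        refine Real.sqrt_le_iff.2 ⟨by positivity, ?_⟩
        nlinarith) hM
    rw [norm_crossIntegrand, shiftSq_re, shiftSq_im, one_add_I_div_four_re, one_add_I_div_four_im]
    have hr := Complex.re_le_norm (csqrt (distSq s ‖u‖ (1 + Complex.I / 4)))
    set r := csqrt (distSq s ‖u‖ (1 + Complex.I / 4))
    have e1 : (‖x‖ ^ 2 + 2 * 1 * inner ℝ x u + ((1 : ℝ) ^ 2 - (1 / 4) ^ 2) * ‖u‖ ^ 2) =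
      ‖x‖ ^ 2 + 2 * inner ℝ x u + 15 / 16 * ‖u‖ ^ 2 := by ring
    have e2 : (2 * (1 / 4) * inner ℝ x u + 2 * 1 * (1 / 4) * ‖u‖ ^ 2) =
      inner ℝ x u / 2 + ‖u‖ ^ 2 / 2 := by ring
    rw [e1, e2]
    set N := ((‖x‖ ^ 2 + 2 * inner ℝ x u + 15 / 16 * ‖u‖ ^ 2) * R.re +
      (inner ℝ x u / 2 + ‖u‖ ^ 2 / 2) * R.im) / (R.re ^ 2 + R.im ^ 2)
    -- Half of the decay of the Green function pays for the gain in the exponent, and the other half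
    -- is kept to make the integral in u converge.
    have hkq : p.k * ‖u‖ ^ 2 / (10 * √(‖u‖ ^ 2 + s ^ 2)) * 2 ≤ p.k * r.im := by
      have := mul_le_mul_of_nonneg_left h4 hk.le
      calc _ = p.k * (‖u‖ ^ 2 / (5 * √(‖u‖ ^ 2 + s ^ 2))) := by field_simp; norm_num
        _ ≤ _ := this
    have hexp : Real.exp (-p.k * r.im - p.kd * r.re) * Real.exp (-N) ≤
        Real.exp (-p.kd * s) * Real.exp (-(‖x‖ ^ 2 / (64 * R.re))) *
          Real.exp (-(p.k * ‖u‖ ^ 2 / (10 * √(‖u‖ ^ 2 + s ^ 2)))) := by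
      rw [← Real.exp_add, ← Real.exp_add, ← Real.exp_add, Real.exp_le_exp]
      have := mul_le_mul_of_nonneg_left h3 hkd.le
      linarith
    have hpi : 1 / (4 * Real.pi * ‖r‖) ≤ 1 / √(‖u‖ ^ 2 + s ^ 2) / 4 := by
      have h5 : √(‖u‖ ^ 2 + s ^ 2) / 2 ≤ ‖r‖ := h1.trans hr
      have h7 : 0 < ‖r‖ := lt_of_lt_of_le (by positivity) h5
      rw [div_div, one_div_le_one_div (by positivity) (by positivity)]
      have h6 := Real.pi_gt_three
      nlinarith
    calc _ = 1 / (4 * Real.pi * ‖r‖) * (Real.exp (-p.k * r.im - p.kd * r.re) * Real.exp (-N)) := by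
          ring
      _ ≤ 1 / √(‖u‖ ^ 2 + s ^ 2) / 4 * (Real.exp (-p.kd * s) *
          Real.exp (-(‖x‖ ^ 2 / (64 * R.re))) *
          Real.exp (-(p.k * ‖u‖ ^ 2 / (10 * √(‖u‖ ^ 2 + s ^ 2))))) := by gcongr
      _ = Real.exp (-p.kd * s) * Real.exp (-(‖x‖ ^ 2 / (64 * R.re))) *
          (Real.exp (-(p.k * ‖u‖ ^ 2 / (10 * √(‖u‖ ^ 2 + s ^ 2)))) / √(‖u‖ ^ 2 + s ^ 2)) / 4 := by
          ring
      _ ≤ _ := by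
          rw [hG]; dsimp only
          gcongr
          exact exp_div_dist_le hk hs hq
  have hint := norm_integral_le_of_norm_le hGi hle
  have hval : ∫ u, G u = Real.exp (-p.kd * s) * Real.exp (-(‖x‖ ^ 2 / (64 * R.re))) *
      (crossConst / p.k) / 4 := by
    simp only [hG]
    rw [integral_div, integral_const_mul, integral_add (i1.const_mul _) i2, integral_const_mul,
      integral_exp_neg_norm_sq_plane (by positivity),
      integral_exp_neg_norm_div_norm_plane (by positivity), crossConst]
    congr 2
    field_simp
    ring
  rw [hval] at hint
  have hpos : 0 ≤ Real.exp (-p.kd * s) * Real.exp (-(‖x‖ ^ 2 / (64 * R.re))) *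
      (crossConst / p.k) := by unfold crossConst; positivity
  calc _ ≤ 17 / 16 * (Real.exp (-p.kd * s) * Real.exp (-(‖x‖ ^ 2 / (64 * R.re))) *
      (crossConst / p.k) / 4) := by gcongr
    _ ≤ Real.exp (-p.kd * s) * Real.exp (-(‖x‖ ^ 2 / (64 * R.re))) *
      (crossConst / p.k) := by linarith
    _ = _ := by ring

/-- On the slice at range distance s before the camera the complex beam radius is a constant, and
the dependence on u is a Gaussian times a Green function. This is why the cross-range variables can
be rotated alone. -/
lemma greenBeam_eq_crossIntegrand (p : Params) (hro : 0 < p.ro) {x : Space} {s : ℝ}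
    (hs' : s < range x) (u : Plane) :
    greenBeam p x (x + ofCrossRange (u, -s)) =
      (p.ro : ℂ) ^ 2 / beamSq p ((range x - s : ℝ) : ℂ) *
      Complex.exp ((Complex.I * (p.k : ℂ) - (p.kd : ℂ)) * ((range x - s : ℝ) : ℂ)) *
      crossIntegrand p (cross x) s (beamSq p ((range x - s : ℝ) : ℂ)) 1 u := by
  have hr : range (x + ofCrossRange (u, -s)) = range x - s := by
    rw [range_add, range_ofCrossRange]; ring
  have hc : cross (x + ofCrossRange (u, -s)) = cross x + u := by
    rw [cross_add, cross_ofCrossRange]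
  have hn : ‖x - (x + ofCrossRange (u, -s))‖ = √(‖u‖ ^ 2 + s ^ 2) := by
    rw [sub_add_cancel_left, norm_neg]
    symm
    rw [Real.sqrt_eq_iff_mul_self_eq (by positivity) (norm_nonneg _), ← sq, norm_sq_eq]
    simp
  have hd : csqrt (distSq s ‖u‖ 1) = ((√(‖u‖ ^ 2 + s ^ 2) : ℝ) : ℂ) := by
    rw [distSq_one, csqrt_ofReal_sq (by positivity)]
  unfold greenBeam
  rw [beam_of_pos p hro (by rw [hr]; linarith), hr, hc, green, hn, crossIntegrand, hd, shiftSq_one]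
  rw [Complex.ofReal_pow]
  have : Complex.exp (-((‖cross x + u‖ : ℂ) ^ 2 / beamSq p ((range x - s : ℝ) : ℂ)) +
      Complex.I * (p.k : ℂ) * ((range x - s : ℝ) : ℂ) - (p.kd : ℂ) * ((range x - s : ℝ) : ℂ)) =
      Complex.exp (-((‖cross x + u‖ : ℂ) ^ 2 / beamSq p ((range x - s : ℝ) : ℂ))) *
      Complex.exp ((Complex.I * (p.k : ℂ) - (p.kd : ℂ)) * ((range x - s : ℝ) : ℂ)) := by
    rw [← Complex.exp_add]; congr 1; ring
  rw [this]
  ring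

/-! ### Rotation of all variables, beyond the camera -/

/-- The complexified integrand beyond the camera. -/
def farIntegrand (p : Params) (x : Space) (ζ : ℂ) (w : Space) : ℂ :=
  if 0 < range w then
    1 / (4 * (Real.pi : ℂ) * (ζ * ‖w‖)) *
    Complex.exp ((Complex.I * (p.k : ℂ) - (p.kd : ℂ)) * (ζ * ‖w‖)) *
    ((p.ro : ℂ) ^ 2 / beamSq p (range x + ζ * range w)) *
    Complex.exp (-(shiftSq (cross x) (cross w) ζ / beamSq p (range x + ζ * range w))) *
    Complex.exp ((Complex.I * (p.k : ℂ) - (p.kd : ℂ)) * (range x + ζ * range w))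
  else 0

lemma farIntegrand_one (p : Params) (hro : 0 < p.ro) {x w : Space} (hx : 0 < range x) :
    farIntegrand p x 1 w = (if 0 < range w then greenBeam p x (x + w) else 0) := by
  unfold farIntegrand
  split_ifs with hw
  · have hr : range (x + w) = range x + range w := range_add x w
    unfold greenBeam
    rw [beam_of_pos p hro (by rw [hr]; linarith), hr, cross_add, green, shiftSq_one,
      sub_add_cancel_left, norm_neg, Complex.ofReal_pow, one_mul, one_mul]
    have : Complex.exp (-((‖cross x + cross w‖ : ℂ) ^ 2 / beamSq p ((range x + range w : ℝ) : ℂ)) +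
      Complex.I * (p.k : ℂ) * ((range x + range w : ℝ) : ℂ)
        - (p.kd : ℂ) * ((range x + range w : ℝ) : ℂ)) =
      Complex.exp (-((‖cross x + cross w‖ : ℂ) ^ 2 / beamSq p ((range x + range w : ℝ) : ℂ))) *
      Complex.exp ((Complex.I * (p.k : ℂ) - (p.kd : ℂ)) * ((range x + range w : ℝ) : ℂ)) := by
      rw [← Complex.exp_add]; congr 1; ring
    rw [this, Complex.ofReal_add]
    ring
  · rfl

/-- The half-space beyond the camera is a cone with apex at the camera, so the cutoff is compatible
with dilations. The cutoff at the source plane would not be. -/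
lemma farIntegrand_smul (p : Params) (x : Space) {l : ℝ} (hl : 0 < l) (ζ : ℂ) (w : Space) :
    farIntegrand p x (l * ζ) w = farIntegrand p x ζ (l • w) := by
  unfold farIntegrand
  have h1 : 0 < range (l • w) ↔ 0 < range w := by rw [range_smul, mul_pos_iff_of_pos_left hl]
  have h2 : ((l : ℂ) * ζ) * (‖w‖ : ℂ) = ζ * (‖l • w‖ : ℂ) := by
    rw [norm_smul, Real.norm_of_nonneg hl.le]; push_cast; ring
  have h3 : ((l : ℂ) * ζ) * (range w : ℂ) = ζ * (range (l • w) : ℂ) := by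
    rw [range_smul]; push_cast; ring
  rw [h2, h3, shiftSq_smul, cross_smul]
  simp only [h1]

lemma measurable_farIntegrand (p : Params) (x : Space) (ζ : ℂ) :
    Measurable (farIntegrand p x ζ) := by
  unfold farIntegrand beamSq
  refine Measurable.ite (measurableSet_lt measurable_const measurable_range) ?_ measurable_const
  have := (measurable_shiftSq (cross x) ζ).comp measurable_cross
  unfold Function.comp at this
  fun_prop

lemma beamSq_far_re (p : Params) (x w : Space) (ζ : ℂ) :
    (beamSq p (range x + ζ * range w)).re = p.ro ^ 2 - ζ.im * (2 * range w / p.k) := by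
  rw [beamSq_re]; simp; ring

lemma beamSq_far_im (p : Params) (x w : Space) (ζ : ℂ) :
    (beamSq p (range x + ζ * range w)).im =
      2 * range x / p.k + ζ.re * (2 * range w / p.k) := by
  rw [beamSq_im]; simp; ring

lemma norm_farIntegrand (p : Params) (x : Space) (ζ : ℂ) {w : Space} (hw : 0 < range w) :
    ‖farIntegrand p x ζ w‖ = 1 / (4 * Real.pi * (‖ζ‖ * ‖w‖)) *
      Real.exp (-p.k * (ζ.im * (‖w‖ + range w)) - p.kd * (ζ.re * (‖w‖ + range w)))
      * Real.exp (-p.kd * range x) * (p.ro ^ 2 / ‖beamSq p (range x + ζ * range w)‖) *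
      Real.exp (-(((shiftSq (cross x) (cross w) ζ).re * (beamSq p (range x + ζ * range w)).re +
        (shiftSq (cross x) (cross w) ζ).im * (beamSq p (range x + ζ * range w)).im)
      / ((beamSq p (range x + ζ * range w)).re ^ 2 +
        (beamSq p (range x + ζ * range w)).im ^ 2))) := by
  unfold farIntegrand
  rw [if_pos hw, norm_mul, norm_mul, norm_mul, norm_mul, Complex.norm_exp, Complex.norm_exp,
    Complex.norm_exp, re_neg_shiftSq_div, norm_div, norm_div, norm_mul, norm_mul, norm_mul,
    norm_pow]
  have e1 : ((Complex.I * (p.k : ℂ) - (p.kd : ℂ)) * (ζ * ‖w‖)).re =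
      -p.k * (ζ.im * ‖w‖) - p.kd * (ζ.re * ‖w‖) := by
    simp [Complex.mul_re, Complex.mul_im]; ring
  have e2 : ((Complex.I * (p.k : ℂ) - (p.kd : ℂ)) * (range x + ζ * range w)).re =
      -p.k * (ζ.im * range w) - p.kd * (range x + ζ.re * range w) := by
    simp [Complex.mul_re, Complex.mul_im]; ring
  have e3 : Real.exp (-p.k * (ζ.im * (‖w‖ + range w)) - p.kd * (ζ.re * (‖w‖ + range w)))
      * Real.exp (-p.kd * range x) = Real.exp (-p.k * (ζ.im * ‖w‖) - p.kd * (ζ.re * ‖w‖)) *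
      Real.exp (-p.k * (ζ.im * range w) - p.kd * (range x + ζ.re * range w)) := by
    rw [← Real.exp_add, ← Real.exp_add]; congr 1; ring
  rw [e1, e2, mul_assoc (1 / (4 * Real.pi * (‖ζ‖ * ‖w‖))), e3]
  simp only [norm_one, Complex.norm_ofNat, Complex.norm_real, Real.norm_eq_abs,
    abs_of_pos Real.pi_pos, abs_norm, sq_abs]
  ring

lemma half_norm_beamSq_far (p : Params) (hk : 0 < p.k) {x w : Space} (hro : 0 < p.ro)
    (hx : 0 < range x) (hw : 0 < range w) {ζ : ℂ} (hζ : ζ ∈ rotationDomain) :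
    p.ro ^ 2 / 2 ≤ ‖beamSq p (range x + ζ * range w)‖ := by
  have h := (exponent_bound_full (X := 0) (q := 0) (m := 0) (a := ζ.re) (b := ζ.im)
    (A := p.ro ^ 2) (t := 2 * range w / p.k) (h := 2 * range x / p.k)
    (by linarith [hζ.1]) hζ.2.2.1 (by linarith [hζ.1, hζ.2.2.2]) (by simp) (by positivity)
    (by positivity) (by positivity)).1
  refine abs_le_of_sq_le_sq' ?_ (norm_nonneg _) |>.2
  rw [← Complex.normSq_eq_norm_sq, Complex.normSq_apply, beamSq_far_re, beamSq_far_im]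
  have : 0 < (p.ro ^ 2) ^ 2 := by positivity
  nlinarith

lemma norm_farIntegrand_le (p : Params) (hk : 0 < p.k) (hkd : 0 < p.kd) (hro : 0 < p.ro)
    {x : Space} (hx : 0 < range x) {ζ : ℂ} (hζ : ζ ∈ rotationDomain) (w : Space) :
    ‖farIntegrand p x ζ w‖ ≤ 2 * Real.exp (‖cross x‖ ^ 2 *
      (3 * p.ro ^ 2 + 2 * (2 * range x / p.k)) / (p.ro ^ 2) ^ 2) *
      (Real.exp (-(p.kd / 2) * ‖w‖) / ‖w‖) := by
  by_cases hw : 0 < range w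
  · have hE := (exponent_bound_full (X := ‖cross x‖) (q := ‖cross w‖)
      (m := inner ℝ (cross x) (cross w)) (a := ζ.re) (b := ζ.im) (A := p.ro ^ 2)
      (t := 2 * range w / p.k) (h := 2 * range x / p.k)
      (by linarith [hζ.1]) hζ.2.2.1 (by linarith [hζ.1, hζ.2.2.2])
      (abs_real_inner_le_norm _ _) (by positivity) (by positivity) (by positivity)).2
    have hR := half_norm_beamSq_far p hk hro hx hw hζ
    have hwn : 0 < ‖w‖ := lt_of_lt_of_le hw ((le_abs_self _).trans (abs_range_le w))
    have hre := Complex.re_le_norm ζ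
    have hζ1 := hζ.1
    have hζ3 := hζ.2.2.1
    rw [norm_farIntegrand p x ζ hw, shiftSq_re, shiftSq_im, beamSq_far_re, beamSq_far_im]
    have b1 : 1 / (4 * Real.pi * (‖ζ‖ * ‖w‖)) ≤ 1 / ‖w‖ := by
      have h3 := Real.pi_gt_three
      have h4 : 0 < ‖ζ‖ := by linarith
      rw [one_div_le_one_div (by positivity) hwn, ← mul_assoc]
      have : 1 ≤ 4 * Real.pi * ‖ζ‖ := by nlinarith
      nlinarith
    have b2 : Real.exp (-p.k * (ζ.im * (‖w‖ + range w)) - p.kd * (ζ.re * (‖w‖ + range w))) ≤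
        Real.exp (-(p.kd / 2) * ‖w‖) := by
      rw [Real.exp_le_exp]
      have i1 : 0 ≤ p.k * (ζ.im * (‖w‖ + range w)) := by positivity
      have i2 : 1 / 2 * ‖w‖ ≤ ζ.re * (‖w‖ + range w) := by nlinarith
      nlinarith [mul_le_mul_of_nonneg_left i2 hkd.le]
    have b3 : p.ro ^ 2 / ‖beamSq p (range x + ζ * range w)‖ ≤ 2 := by
      have : 0 < p.ro ^ 2 := by positivity
      rw [div_le_iff₀ (by linarith)]; linarith
    have b4 : Real.exp (-p.kd * range x) ≤ 1 := by
      rw [Real.exp_le_one_iff]; nlinarith [mul_pos hkd hx]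
    calc _ ≤ 1 / ‖w‖ * Real.exp (-(p.kd / 2) * ‖w‖) * 1 * 2 *
          Real.exp (‖cross x‖ ^ 2 *
            (3 * p.ro ^ 2 + 2 * (2 * range x / p.k)) / (p.ro ^ 2) ^ 2) := by
          gcongr
          linarith
      _ = _ := by ring
  · rw [farIntegrand, if_neg hw, norm_zero]
    positivity

lemma differentiableAt_farIntegrand (p : Params) (x : Space) {ζ : ℂ} (w : Space)
    (hζ : ζ ≠ 0) (h : 0 < range w → beamSq p (range x + ζ * range w) ≠ 0) :
    DifferentiableAt ℂ (fun ζ => farIntegrand p x ζ w) ζ := by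
  unfold farIntegrand
  by_cases hw : 0 < range w
  · simp only [if_pos hw]
    have h1 : DifferentiableAt ℂ (fun ζ : ℂ => beamSq p (range x + ζ * range w)) ζ := by
      unfold beamSq; fun_prop
    have h2 := h hw
    have h3 := differentiable_shiftSq (cross x) (cross w) ζ
    have hwn : (‖w‖ : ℂ) ≠ 0 := by
      have : 0 < ‖w‖ := lt_of_lt_of_le hw ((le_abs_self _).trans (abs_range_le w))
      exact_mod_cast this.ne'
    have h4 : (4 * (Real.pi : ℂ) * (ζ * ‖w‖)) ≠ 0 := by
      have : (Real.pi : ℂ) ≠ 0 := by exact_mod_cast Real.pi_ne_zero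
      exact mul_ne_zero (mul_ne_zero (by norm_num) this) (mul_ne_zero hζ hwn)
    have h5 : DifferentiableAt ℂ (fun ζ : ℂ => ζ * (‖w‖ : ℂ)) ζ := by fun_prop
    have h6 : DifferentiableAt ℂ (fun ζ : ℂ => (range x : ℂ) + ζ * (range w : ℂ)) ζ := by fun_prop
    exact (((((differentiableAt_const _).div (h5.const_mul _) h4).mul (h5.const_mul _).cexp).mul
      ((differentiableAt_const _).div h1 h2)).mul (h3.div h1 h2).neg.cexp).mul
      (h6.const_mul _).cexp
  · simp only [if_neg hw]
    fun_prop

lemma integral_farIntegrand (p : Params) (hk : 0 < p.k) (hkd : 0 < p.kd) (hro : 0 < p.ro)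
    {x : Space} (hx : 0 < range x) :
    ∫ w, farIntegrand p x 1 w =
      (1 + Complex.I / 4) ^ 3 * ∫ w, farIntegrand p x (1 + Complex.I / 4) w := by
  have := integral_eq_integral_rotated (volume : Measure Space) (f := farIntegrand p x)
    (g := fun w => 2 * Real.exp (‖cross x‖ ^ 2 *
      (3 * p.ro ^ 2 + 2 * (2 * range x / p.k)) / (p.ro ^ 2) ^ 2) *
      (Real.exp (-(p.kd / 2) * ‖w‖) / ‖w‖))
    ((integrable_exp_neg_norm_div_norm (by positivity)).const_mul _)
    (fun ζ _ => (measurable_farIntegrand p x ζ).aestronglyMeasurable)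
    (ae_of_all _ fun w ζ hζ => (differentiableAt_farIntegrand p x w
      (by rintro rfl; have := hζ.1; norm_num at this)
      (fun hw => by
        have := half_norm_beamSq_far p hk hro hx hw hζ
        rw [← norm_pos_iff]
        have : 0 < p.ro ^ 2 := by positivity
        linarith)).differentiableWithinAt)
    (ae_of_all _ fun w ζ hζ => norm_farIntegrand_le p hk hkd hro hx hζ w)
    (ae_of_all _ fun w => by
      refine (differentiableAt_farIntegrand p x w one_ne_zero fun _ h0 => ?_
        ).continuousAt.tendsto.mono_left nhdsWithin_le_nhds
      have := congrArg Complex.re h0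
      rw [beamSq_far_re] at this
      simp at this
      exact hro.ne' this)
    (fun l hl ζ w => farIntegrand_smul p x hl ζ w)
  simpa using this

/-- A numerical constant. -/
def farConst : ℝ := 3 * (volume : Measure Space).real (Metric.ball 0 1) * 8 ^ 3

/-- After rotation the integrand is bounded by e^{-k|w|/8}/|w|, so in effect only particles within a
few wavelengths of the camera contribute, with total weight of order 1/k². -/
lemma norm_integral_farIntegrand_le (p : Params) (hk : 0 < p.k) (hkd : 0 < p.kd) (hro : 0 < p.ro)
    {x : Space} (hx : 0 < range x) (hX : 0 < ‖cross x‖)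
    (hhA : 2 * range x / p.k ≤ p.ro ^ 2 / 16) (hM : 128 * ‖cross x‖ ≤ p.k * p.ro ^ 2) :
    ‖∫ w, farIntegrand p x 1 w‖ ≤ farConst / p.k ^ 2 * Real.exp (-p.kd * range x) *
      Real.exp (-(‖cross x‖ ^ 2 / (64 * p.ro ^ 2))) := by
  rw [integral_farIntegrand p hk hkd hro hx, norm_mul, norm_pow]
  set G : Space → ℝ := fun w => Real.exp (-p.kd * range x) *
    Real.exp (-(‖cross x‖ ^ 2 / (64 * p.ro ^ 2))) * (Real.exp (-(p.k / 8) * ‖w‖) / ‖w‖) with hG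
  have i1 := integrable_exp_neg_norm_div_norm (b := p.k / 8) (by positivity)
  have hGi : Integrable G := i1.const_mul _
  have hle : ∀ w : Space, ‖farIntegrand p x (1 + Complex.I / 4) w‖ ≤ G w := by
    intro w
    by_cases hw : 0 < range w
    · have hwn : 0 < ‖w‖ := lt_of_lt_of_le hw ((le_abs_self _).trans (abs_range_le w))
      have hgain := exponent_gain_full (X := ‖cross x‖) (q := ‖cross w‖)
        (m := inner ℝ (cross x) (cross w)) (A := p.ro ^ 2) (k := p.k) (r := ‖w‖)
        (β := range w / (2 * p.k)) (h := 2 * range x / p.k) hX (norm_nonneg _)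
        (abs_real_inner_le_norm _ _) (by positivity) hk (by positivity) (by positivity) hhA
        (norm_cross_le w) hM
      have hR := half_norm_beamSq_far p hk hro hx hw one_add_I_div_four_mem
      rw [norm_farIntegrand p x _ hw, shiftSq_re, shiftSq_im, beamSq_far_re, beamSq_far_im,
        one_add_I_div_four_re, one_add_I_div_four_im]
      have e1 : (‖cross x‖ ^ 2 + 2 * 1 * inner ℝ (cross x) (cross w) +
        ((1 : ℝ) ^ 2 - (1 / 4) ^ 2) * ‖cross w‖ ^ 2) =
        ‖cross x‖ ^ 2 + 2 * inner ℝ (cross x) (cross w) + 15 / 16 * ‖cross w‖ ^ 2 := by ring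
      have e2 : (2 * (1 / 4) * inner ℝ (cross x) (cross w) + 2 * 1 * (1 / 4) * ‖cross w‖ ^ 2) =
        inner ℝ (cross x) (cross w) / 2 + ‖cross w‖ ^ 2 / 2 := by ring
      have e3 : p.ro ^ 2 - 1 / 4 * (2 * range w / p.k) = p.ro ^ 2 - range w / (2 * p.k) := by
        field_simp; ring
      have e4 : 2 * range x / p.k + 1 * (2 * range w / p.k) =
        2 * range x / p.k + 4 * (range w / (2 * p.k)) := by field_simp; ring
      rw [e1, e2, e3, e4]
      set N := ((‖cross x‖ ^ 2 + 2 * inner ℝ (cross x) (cross w) + 15 / 16 * ‖cross w‖ ^ 2) *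
        (p.ro ^ 2 - range w / (2 * p.k)) + (inner ℝ (cross x) (cross w) / 2 + ‖cross w‖ ^ 2 / 2) *
        (2 * range x / p.k + 4 * (range w / (2 * p.k)))) / ((p.ro ^ 2 - range w / (2 * p.k)) ^ 2
        + (2 * range x / p.k + 4 * (range w / (2 * p.k))) ^ 2)
      have e5 : p.k ^ 2 * (range w / (2 * p.k)) / 2 = p.k * range w / 4 := by field_simp; norm_num
      rw [e5] at hgain
      -- The rotated phase supplies the decay k(|w| + w_z)/4. The whole w_z part and half of the |w|
      -- part are spent on the gain; what remains is k|w|/8.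
      have hexp : Real.exp (-p.k * (1 / 4 * (‖w‖ + range w)) - p.kd * (1 * (‖w‖ + range w))) *
          Real.exp (-N) ≤ Real.exp (-(‖cross x‖ ^ 2 / (64 * p.ro ^ 2))) *
          Real.exp (-(p.k / 8) * ‖w‖) := by
        rw [← Real.exp_add, ← Real.exp_add, Real.exp_le_exp]
        have : 0 ≤ p.kd * (1 * (‖w‖ + range w)) := by positivity
        linarith
      have hre := Complex.re_le_norm (1 + Complex.I / 4)
      rw [one_add_I_div_four_re] at hre
      have b1 : 1 / (4 * Real.pi * (‖1 + Complex.I / 4‖ * ‖w‖)) ≤ 1 / ‖w‖ / 2 := by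
        have h3 := Real.pi_gt_three
        rw [div_div, one_div_le_one_div (by positivity) (by positivity), ← mul_assoc, mul_comm ‖w‖]
        gcongr
        nlinarith
      have b3 : p.ro ^ 2 / ‖beamSq p (range x + (1 + Complex.I / 4) * range w)‖ ≤ 2 := by
        have : 0 < p.ro ^ 2 := by positivity
        rw [div_le_iff₀ (by linarith)]; linarith
      calc _ = 1 / (4 * Real.pi * (‖1 + Complex.I / 4‖ * ‖w‖)) * Real.exp (-p.kd * range x) *
            (p.ro ^ 2 / ‖beamSq p (range x + (1 + Complex.I / 4) * range w)‖) *
            (Real.exp (-p.k * (1 / 4 * (‖w‖ + range w)) - p.kd * (1 * (‖w‖ + range w))) *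
          Real.exp (-N)) := by ring
        _ ≤ 1 / ‖w‖ / 2 * Real.exp (-p.kd * range x) * 2 *
          (Real.exp (-(‖cross x‖ ^ 2 / (64 * p.ro ^ 2))) * Real.exp (-(p.k / 8) * ‖w‖)) := by gcongr
        _ = G w := by rw [hG]; ring
    · rw [farIntegrand, if_neg hw, norm_zero, hG]
      positivity
  have hint := norm_integral_le_of_norm_le hGi (ae_of_all _ hle)
  have hval : ∫ w, G w = Real.exp (-p.kd * range x) *
    Real.exp (-(‖cross x‖ ^ 2 / (64 * p.ro ^ 2))) * (farConst / p.k ^ 2) / 8 := by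
    simp only [hG]
    rw [integral_const_mul, integral_exp_neg_norm_div_norm (by positivity), farConst]
    field_simp
  rw [hval] at hint
  have h8 : ‖(1 : ℂ) + Complex.I / 4‖ ^ 3 ≤ 8 := by
    calc _ ≤ (2 : ℝ) ^ 3 := by gcongr; exact norm_one_add_I_div_four_le
      _ = 8 := by norm_num
  have hpos : 0 ≤ Real.exp (-p.kd * range x) *
    Real.exp (-(‖cross x‖ ^ 2 / (64 * p.ro ^ 2))) * (farConst / p.k ^ 2) := by
    unfold farConst; positivity
  calc _ ≤ 8 * (Real.exp (-p.kd * range x) *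
    Real.exp (-(‖cross x‖ ^ 2 / (64 * p.ro ^ 2))) * (farConst / p.k ^ 2) / 8) := by gcongr
    _ = _ := by ring

/-! ### The mean field -/

lemma ro_sq_le_norm_beamSq (p : Params) (z : ℝ) : p.ro ^ 2 ≤ ‖beamSq p z‖ := by
  refine abs_le_of_sq_le_sq' ?_ (norm_nonneg _) |>.2
  rw [← Complex.normSq_eq_norm_sq, normSq_beamSq]
  exact le_beamNormSq p z

/-- The damping of the beam up to the slice and that from the slice to the camera multiply to
e^{-k_d Z}, whatever s is. As the planar integral is O(1/k) uniformly in s, integrating over the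
slices costs only a factor Z. -/
lemma norm_integral_slice_le (p : Params) (hk : 0 < p.k) (hkd : 0 < p.kd) (hro : 0 < p.ro)
    {x : Space} (hX : 0 < ‖cross x‖) (hM : 128 * (‖cross x‖ + range x) ≤ p.k * p.ro ^ 2) {s : ℝ}
    (hs : 0 < s) (hsx : s < range x) :
    ‖∫ u : Plane, greenBeam p x (x + ofCrossRange (u, -s))‖ ≤ crossConst / p.k *
      Real.exp (-p.kd * range x) * Real.exp (-(‖cross x‖ ^ 2 / (64 * p.ro ^ 2))) := by
  have hro2 : 0 < p.ro ^ 2 := by positivity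
  simp_rw [greenBeam_eq_crossIntegrand p hro hsx]
  rw [integral_const_mul, norm_mul]
  have hre : (beamSq p ((range x - s : ℝ) : ℂ)).re = p.ro ^ 2 := by
    rw [beamSq_re, Complex.ofReal_im]; simp
  have him : (beamSq p ((range x - s : ℝ) : ℂ)).im = 2 * (range x - s) / p.k := by
    rw [beamSq_im, Complex.ofReal_re]
  have h1 := norm_integral_crossIntegrand_le p hk hkd hX hs (R := beamSq p ((range x - s : ℝ) : ℂ))
    (by rw [hre]; positivity) (by rw [him]; have : 0 < range x - s := by linarith
                                  positivity)
    (by rw [hre, him, div_le_iff₀ hk]; nlinarith) (by rw [hre]; linarith)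
  rw [hre] at h1
  have h2 : ‖(p.ro : ℂ) ^ 2 / beamSq p ((range x - s : ℝ) : ℂ) *
      Complex.exp ((Complex.I * (p.k : ℂ) - (p.kd : ℂ)) * ((range x - s : ℝ) : ℂ))‖ ≤
      Real.exp (-p.kd * (range x - s)) := by
    rw [norm_mul, Complex.norm_exp, Complex.re_mul_ofReal, norm_div, norm_pow, Complex.norm_real,
      Real.norm_of_nonneg hro.le]
    have h3 := ro_sq_le_norm_beamSq p (range x - s)
    have h4 : p.ro ^ 2 / ‖beamSq p ((range x - s : ℝ) : ℂ)‖ ≤ 1 := by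
      rw [div_le_one (by linarith)]; exact h3
    have h5 : (Complex.I * (p.k : ℂ) - (p.kd : ℂ)).re = -p.kd := by simp
    rw [h5]
    exact mul_le_of_le_one_left (Real.exp_pos _).le h4
  calc _ ≤ Real.exp (-p.kd * (range x - s)) * (crossConst / p.k * Real.exp (-p.kd * s) *
        Real.exp (-(‖cross x‖ ^ 2 / (64 * p.ro ^ 2)))) := by gcongr
    _ = crossConst / p.k * (Real.exp (-p.kd * (range x - s)) * Real.exp (-p.kd * s)) *
        Real.exp (-(‖cross x‖ ^ 2 / (64 * p.ro ^ 2))) := by ring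
    _ = _ := by rw [← Real.exp_add]; congr 3; ring

lemma beam_of_nonpos (p : Params) {y : Space} (hy : range y ≤ 0) : beam p y = 0 := by
  rw [beam, if_neg hy.not_gt]

/-- The mean field is exponentially small in the square of the ratio of the cross-range offset to
the beam radius. -/
lemma norm_integral_greenBeam_le (p : Params) (hk : 0 < p.k) (hkd : 0 < p.kd) (hro : 0 < p.ro)
    {x : Space} (hx : 0 < range x) (hX : 0 < ‖cross x‖)
    (hM : 128 * (‖cross x‖ + range x) ≤ p.k * p.ro ^ 2) :
    ‖∫ y, greenBeam p x y‖ ≤ (crossConst * range x / p.k + farConst / p.k ^ 2) *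
      Real.exp (-p.kd * range x) * Real.exp (-(‖cross x‖ ^ 2 / (64 * p.ro ^ 2))) := by
  set g : Space → ℂ := fun w => greenBeam p x (x + w) with hg
  have hgm : Measurable g := (measurable_greenBeam p x).comp (measurable_const_add x)
  have hgi : Integrable g := (integrable_greenBeam p hro hkd x).comp_add_left x
  have hS : MeasurableSet {w : Space | 0 < range w} :=
    measurableSet_lt measurable_const measurable_range
  have hi1 : Integrable (fun w => if 0 < range w then g w else 0) := by
    refine (hgi.indicator hS).congr (ae_of_all _ fun w => ?_)
    simp [Set.indicator_apply]
  have hi2 : Integrable (fun w => if 0 < range w then 0 else g w) := by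
    refine (hgi.indicator hS.compl).congr (ae_of_all _ fun w => ?_)
    by_cases h : 0 < range w <;> simp [h]
  -- The plane of range Z separates two geometries. Beyond it |w| + w_z ≥ |w|, so rotating all
  -- variables gives full decay. Before it this phase vanishes along the direction opposite to the
  -- beam, and only the cross-range variables are rotated, slice by slice.
  have hsplit : ∫ y, greenBeam p x y = (∫ w, if 0 < range w then g w else 0) +
      ∫ w, if 0 < range w then 0 else g w := by
    rw [← integral_add hi1 hi2, ← integral_add_left_eq_self (greenBeam p x) x]
    refine integral_congr_ae (ae_of_all _ fun w => ?_)
    by_cases h : 0 < range w <;> simp [h, hg]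
  have hfar : ‖∫ w, if 0 < range w then g w else 0‖ ≤ farConst / p.k ^ 2 *
      Real.exp (-p.kd * range x) * Real.exp (-(‖cross x‖ ^ 2 / (64 * p.ro ^ 2))) := by
    have := norm_integral_farIntegrand_le p hk hkd hro hx hX
      (by rw [div_le_iff₀ hk]; linarith) (by linarith)
    simpa only [farIntegrand_one p hro hx] using this
  have hnear : ‖∫ w, if 0 < range w then 0 else g w‖ ≤ crossConst * range x / p.k *
      Real.exp (-p.kd * range x) * Real.exp (-(‖cross x‖ ^ 2 / (64 * p.ro ^ 2))) := by
    set K := crossConst / p.k *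
      Real.exp (-p.kd * range x) * Real.exp (-(‖cross x‖ ^ 2 / (64 * p.ro ^ 2))) with hK
    have hK0 : 0 ≤ K := by rw [hK]; unfold crossConst; positivity
    have hmp := measurePreserving_ofCrossRange
    rw [← hmp.integral_comp measurableEmbedding_ofCrossRange]
    rw [integral_prod_symm]
    · have hbound : ∀ᵐ t : ℝ, ‖∫ u : Plane, if 0 < range (ofCrossRange (u, t)) then 0
          else g (ofCrossRange (u, t))‖ ≤ (Set.Ioo (-range x) 0).indicator (fun _ => K) t := by
        have : ∀ᵐ t : ℝ, t ≠ 0 := by simp [ae_iff, measure_singleton]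
        filter_upwards [this] with t ht
        simp only [range_ofCrossRange]
        rcases lt_or_gt_of_ne ht with h | h
        · simp only [h.not_gt, if_false]
          by_cases h2 : -range x < t
          · rw [Set.indicator_of_mem (Set.mem_Ioo.2 ⟨h2, h⟩)]
            have := norm_integral_slice_le p hk hkd hro hX hM (s := -t) (by linarith) (by linarith)
            simpa only [neg_neg] using this
          · have h3 : ∀ u : Plane, g (ofCrossRange (u, t)) = 0 := by
              intro u
              simp only [hg, greenBeam]
              rw [beam_of_nonpos p (by rw [range_add, range_ofCrossRange]; simp; linarith),
                mul_zero]
            simp [h3, h2]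
        · simp [h, h.not_gt]
      have hint : Integrable ((Set.Ioo (-range x) 0).indicator (fun _ => K)) :=
        (integrable_indicator_iff measurableSet_Ioo).2 (integrableOn_const (by simp))
      refine (norm_integral_le_of_norm_le hint hbound).trans (le_of_eq ?_)
      rw [integral_indicator measurableSet_Ioo, setIntegral_const, measureReal_def,
        Real.volume_Ioo, ENNReal.toReal_ofReal (by linarith), smul_eq_mul, hK]
      ring
    · exact hmp.integrable_comp_of_integrable hi2
  rw [hsplit]
  calc _ ≤ _ := norm_add_le _ _
    _ ≤ _ := add_le_add hfar hnear
    _ = _ := by ring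

/-- A numerical constant. -/
def lowerConst : ℝ := Real.exp (-2) * (volume : Measure Plane).real (Metric.closedBall 0 1) /
  (12 * Real.pi)

lemma lowerConst_pos : 0 < lowerConst := by
  unfold lowerConst
  have : 0 < (volume : Measure Plane).real (Metric.closedBall 0 1) := by
    rw [measureReal_def]
    exact ENNReal.toReal_pos (Metric.measure_closedBall_pos _ _ one_pos).ne'
      measure_closedBall_lt_top.ne
  positivity

/-- On the cylinder of radius r_o around the axis, with range within |X| of that of the camera, the
beam has modulus of order e^{-k_d z} and the Green function is of order 1/|X|. The volume is of
order r_o² |X|, so |X| cancels. -/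
lemma le_integral_norm_greenBeam (p : Params) (hk : 0 < p.k) (hkd : 0 < p.kd) (hro : 0 < p.ro)
    {x : Space} (hXZ : ‖cross x‖ < range x) (hroX : p.ro < ‖cross x‖)
    (hkdX : 4 * (p.kd * ‖cross x‖) ≤ 1)
    (hM : 128 * (‖cross x‖ + range x) ≤ p.k * p.ro ^ 2) :
    lowerConst * p.ro ^ 2 * Real.exp (-p.kd * range x) ≤ ∫ y, ‖greenBeam p x y‖ := by
  have hX : 0 < ‖cross x‖ := by linarith
  set S : Set Space := (fun y => (cross y, range y)) ⁻¹'
    (Metric.closedBall (0 : Plane) p.ro ×ˢ Set.Icc (range x - ‖cross x‖) (range x + ‖cross x‖))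
    with hS
  have hSm : MeasurableSet S := measurePreserving_cross_range.measurable
    (Metric.isClosed_closedBall.measurableSet.prod measurableSet_Icc)
  have hSv : (volume : Measure Space).real S =
      p.ro ^ 2 * (volume : Measure Plane).real (Metric.closedBall 0 1) * (2 * ‖cross x‖) := by
    rw [measureReal_def, hS, measurePreserving_cross_range.measure_preimage
      (Metric.isClosed_closedBall.measurableSet.prod measurableSet_Icc).nullMeasurableSet,
      Measure.prod_prod, ENNReal.toReal_mul, ← measureReal_def, Real.volume_Icc,
      ENNReal.toReal_ofReal (by linarith), measureReal_def,
      Measure.addHaar_closedBall' _ _ hro.le, ENNReal.toReal_mul,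
      ENNReal.toReal_ofReal (by positivity), measureReal_def]
    simp only [finrank_euclideanSpace, Fintype.card_fin]
    ring
  have hSfin : volume S ≠ ∞ := by
    rw [hS, measurePreserving_cross_range.measure_preimage
      (Metric.isClosed_closedBall.measurableSet.prod measurableSet_Icc).nullMeasurableSet,
      Measure.prod_prod, Real.volume_Icc]
    exact ENNReal.mul_ne_top measure_closedBall_lt_top.ne (by simp)
  have hlow : ∀ y ∈ S, Real.exp (-2) / (24 * Real.pi * ‖cross x‖) * Real.exp (-p.kd * range x) ≤
      ‖greenBeam p x y‖ := by
    rintro y ⟨hy1, hy2, hy3⟩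
    simp only [Metric.mem_closedBall, dist_zero_right] at hy1 hy2 hy3
    have hy0 : 0 < range y := by linarith
    have hnorm : ‖x - y‖ ≤ 3 * ‖cross x‖ := by
      refine abs_le_of_sq_le_sq' ?_ (by positivity) |>.2
      rw [norm_sq_eq, cross_sub, range_sub]
      have h1 : ‖cross x - cross y‖ ≤ 2 * ‖cross x‖ := (norm_sub_le _ _).trans (by linarith)
      have h2 : (range x - range y) ^ 2 ≤ ‖cross x‖ ^ 2 := by
        apply sq_le_sq'; linarith; linarith
      nlinarith [norm_nonneg (cross x - cross y)]
    by_cases hxy : x = y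
    · exfalso
      rw [← hxy] at hy1
      linarith
    have hxy0 : 0 < ‖x - y‖ := norm_pos_iff.2 (sub_ne_zero.2 hxy)
    have hA : 0 < p.ro ^ 2 := by positivity
    have hD := beamNormSq_pos p hro (range y)
    have hD1 := le_beamNormSq p (range y)
    have hD2 : beamNormSq p (range y) ≤ 4 * (p.ro ^ 2) ^ 2 := by
      unfold beamNormSq
      have : 2 * range y / p.k ≤ p.ro ^ 2 := by rw [div_le_iff₀ hk]; linarith
      have h0 : 0 ≤ 2 * range y / p.k := by positivity
      nlinarith
    have hb : Real.exp (-1) / 2 * Real.exp (-p.kd * range y) ≤ ‖beam p y‖ := by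
      refine abs_le_of_sq_le_sq' ?_ (norm_nonneg _) |>.2
      rw [norm_beam_sq p hro hy0, mul_pow, div_pow, ← Real.exp_nat_mul, ← Real.exp_nat_mul]
      have e1 : 1 / 4 ≤ (p.ro ^ 2) ^ 2 / beamNormSq p (range y) := by
        rw [div_le_div_iff₀ (by norm_num) hD]; linarith
      have e2 : 2 * p.ro ^ 2 / beamNormSq p (range y) * ‖cross y‖ ^ 2 ≤ 2 := by
        rw [div_mul_eq_mul_div, div_le_iff₀ hD]
        have : ‖cross y‖ ^ 2 ≤ p.ro ^ 2 := by gcongr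
        nlinarith
      calc _ = 1 / 4 * (Real.exp (-2 + -2 * p.kd * range y)) := by
            rw [Real.exp_add]; push_cast; ring_nf
        _ ≤ _ := by gcongr; linarith
    have hgr : Real.exp (-p.kd * (3 * ‖cross x‖)) / (4 * Real.pi * (3 * ‖cross x‖)) ≤
        ‖green p x y‖ := by
      rw [norm_green]
      refine div_le_div₀ (Real.exp_pos _).le (Real.exp_le_exp.2 ?_) (by positivity) (by gcongr)
      nlinarith
    rw [greenBeam, norm_mul]
    calc _ ≤ Real.exp (-p.kd * (3 * ‖cross x‖)) / (4 * Real.pi * (3 * ‖cross x‖)) *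
          (Real.exp (-1) / 2 * Real.exp (-p.kd * range y)) := by
          have e : Real.exp (-2) * Real.exp (-p.kd * range x) ≤
              Real.exp (-p.kd * (3 * ‖cross x‖)) * (Real.exp (-1) * Real.exp (-p.kd * range y)) := by
            rw [← Real.exp_add, ← Real.exp_add, ← Real.exp_add, Real.exp_le_exp]
            nlinarith [mul_le_mul_of_nonneg_left hy3 hkd.le]
          calc _ = Real.exp (-2) * Real.exp (-p.kd * range x) / (24 * Real.pi * ‖cross x‖) := by ring
            _ ≤ Real.exp (-p.kd * (3 * ‖cross x‖)) * (Real.exp (-1) * Real.exp (-p.kd * range y)) /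
                (24 * Real.pi * ‖cross x‖) := by gcongr
            _ = _ := by field_simp; norm_num
      _ ≤ _ := by gcongr
  calc _ = Real.exp (-2) / (24 * Real.pi * ‖cross x‖) * Real.exp (-p.kd * range x) *
        (volume : Measure Space).real S := by
        rw [hSv, lowerConst]; field_simp; ring
    _ = ∫ _ in S, Real.exp (-2) / (24 * Real.pi * ‖cross x‖) * Real.exp (-p.kd * range x) := by
        rw [setIntegral_const, smul_eq_mul, mul_comm]
    _ ≤ ∫ y in S, ‖greenBeam p x y‖ :=
        setIntegral_mono_on (integrableOn_const hSfin)
          (integrable_greenBeam p hro hkd x).norm.integrableOn hSm hlow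
    _ ≤ _ := setIntegral_le_integral (integrable_greenBeam p hro hkd x).norm
        (ae_of_all _ fun _ => norm_nonneg _)

/-! ### One-dimensional oscillatory integrals -/

lemma abs_div_sq_add_sq_le {τ y : ℝ} (hτ : 0 < τ) : |y / (y ^ 2 + τ ^ 2)| ≤ 1 / (2 * τ) := by
  have h : 0 < y ^ 2 + τ ^ 2 := by positivity
  rw [abs_div, abs_of_pos h, div_le_div_iff₀ h (by positivity)]
  nlinarith [sq_nonneg (|y| - τ), sq_abs y]

/-- A quantitative non-stationary phase estimate in which the points where the derivative of the
phase is small are accounted for by the last integral. -/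
lemma norm_integral_oscillatory_le {a b : ℝ} (hab : a ≤ b) {ψ ψ' ψ'' w w' : ℝ → ℝ}
    (hψ : ∀ t, HasDerivAt ψ (ψ' t) t) (hψ' : ∀ t, HasDerivAt ψ' (ψ'' t) t)
    (hw : ∀ t, HasDerivAt w (w' t) t) (hψ''c : Continuous ψ'') (hw'c : Continuous w')
    {K K' : ℝ} (hK : ∀ t ∈ Set.Icc a b, |ψ'' t| ≤ K) (hK' : ∀ t ∈ Set.Icc a b, |w' t| ≤ K')
    (hw1 : ∀ t ∈ Set.Icc a b, |w t| ≤ 1) {L τ : ℝ} (hL : 0 < L) (hτ : 0 < τ) :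
    ‖∫ t in a..b, (w t : ℂ) * Complex.exp (Complex.I * (L * ψ t : ℝ))‖ ≤
      1 / L * (1 / τ + (K' / (2 * τ) + K / τ ^ 2) * (b - a)) +
        ∫ t in a..b, τ ^ 2 / (ψ' t ^ 2 + τ ^ 2) := by
  have cψ : Continuous ψ := continuous_iff_continuousAt.2 fun t => (hψ t).continuousAt
  have cψ' : Continuous ψ' := continuous_iff_continuousAt.2 fun t => (hψ' t).continuousAt
  have cw : Continuous w := continuous_iff_continuousAt.2 fun t => (hw t).continuousAt
  have hD : ∀ t, 0 < ψ' t ^ 2 + τ ^ 2 := fun t => by positivity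
  -- Integration by parts with the regularised multiplier ψ'/(ψ'² + τ²) in place of 1/ψ', which
  -- would be singular at stationary points. Then w = h ψ' + w m with m = τ²/(ψ'² + τ²); the first
  -- part is a derivative up to lower order, and m is not negligible only where ψ' is of order τ or
  -- less.
  set h : ℝ → ℝ := fun t => w t * (ψ' t / (ψ' t ^ 2 + τ ^ 2)) with hh
  set h' : ℝ → ℝ := fun t => w' t * (ψ' t / (ψ' t ^ 2 + τ ^ 2)) +
    w t * (ψ'' t * (τ ^ 2 - ψ' t ^ 2) / (ψ' t ^ 2 + τ ^ 2) ^ 2) with hh'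
  set E : ℝ → ℂ := fun t => Complex.exp (Complex.I * (L * ψ t : ℝ)) with hE
  set m : ℝ → ℝ := fun t => τ ^ 2 / (ψ' t ^ 2 + τ ^ 2) with hm
  have hEn : ∀ t, ‖E t‖ = 1 := fun t => by
    change ‖Complex.exp (Complex.I * ((L * ψ t : ℝ) : ℂ))‖ = 1
    rw [mul_comm]; exact Complex.norm_exp_ofReal_mul_I _
  have cE : Continuous E := by rw [hE]; fun_prop
  have ch : Continuous h := cw.mul (cψ'.div (by fun_prop) fun t => (hD t).ne')
  have cm : Continuous m := continuous_const.div (by fun_prop) fun t => (hD t).ne'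
  have ch' : Continuous h' := by
    refine (hw'c.mul (cψ'.div (by fun_prop) fun t => (hD t).ne')).add (cw.mul ?_)
    exact (hψ''c.mul (by fun_prop)).div (by fun_prop) fun t => (pow_pos (hD t) 2).ne'
  have dh : ∀ t, HasDerivAt h (h' t) t := by
    intro t
    have h1 : HasDerivAt (fun t => ψ' t / (ψ' t ^ 2 + τ ^ 2))
        (ψ'' t * (τ ^ 2 - ψ' t ^ 2) / (ψ' t ^ 2 + τ ^ 2) ^ 2) t := by
      have := (hψ' t).div (((hψ' t).pow 2).add_const (τ ^ 2)) (hD t).ne'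
      refine this.congr_deriv ?_
      congr 1
      simp; ring
    exact (hw t).mul h1
  have dE : ∀ t, HasDerivAt E (E t * (Complex.I * (L * ψ' t : ℝ))) t := by
    intro t
    exact ((((hψ t).const_mul L).ofReal_comp).const_mul Complex.I).cexp
  have dprod : ∀ t, HasDerivAt (fun t => (h t : ℂ) * E t)
      ((h' t : ℂ) * E t + (h t : ℂ) * (E t * (Complex.I * (L * ψ' t : ℝ)))) t := fun t =>
    (dh t).ofReal_comp.mul (dE t)
  have key : ∀ t, (h t : ℂ) * (E t * (Complex.I * (L * ψ' t : ℝ))) =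
      Complex.I * L * ((w t : ℂ) * E t) - Complex.I * L * ((w t * m t : ℝ) * E t) := by
    intro t
    have : h t * ψ' t = w t - w t * m t := by
      rw [hh, hm]; have := (hD t).ne'; dsimp only; field_simp; ring
    have h2 : (h t : ℂ) * (ψ' t : ℂ) = (w t : ℂ) - (w t * m t : ℝ) := by
      rw [← Complex.ofReal_mul, this]; push_cast; ring
    calc _ = Complex.I * L * E t * ((h t : ℂ) * (ψ' t : ℂ)) := by push_cast; ring
      _ = _ := by rw [h2]; ring
  have i1 : IntervalIntegrable (fun t => (h' t : ℂ) * E t) volume a b :=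
    Continuous.intervalIntegrable (by fun_prop) _ _
  have i2 : IntervalIntegrable (fun t => (w t : ℂ) * E t) volume a b :=
    Continuous.intervalIntegrable (by fun_prop) _ _
  have i3 : IntervalIntegrable (fun t => ((w t * m t : ℝ) : ℂ) * E t) volume a b :=
    Continuous.intervalIntegrable (by fun_prop) _ _
  have i4 : IntervalIntegrable m volume a b := cm.intervalIntegrable _ _
  have hftc := intervalIntegral.integral_eq_sub_of_hasDerivAt (fun t _ => dprod t)
    (a := a) (b := b) (Continuous.intervalIntegrable (by fun_prop) _ _)
  simp_rw [key] at hftc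
  rw [intervalIntegral.integral_add i1 ((i2.const_mul _).sub (i3.const_mul _)),
    intervalIntegral.integral_sub (i2.const_mul _) (i3.const_mul _),
    intervalIntegral.integral_const_mul, intervalIntegral.integral_const_mul] at hftc
  have hbh : ∀ t ∈ Set.Icc a b, |h t| ≤ 1 / (2 * τ) := by
    intro t ht
    rw [hh, abs_mul]
    exact (mul_le_of_le_one_left (abs_nonneg _) (hw1 t ht)).trans (abs_div_sq_add_sq_le hτ)
  have hbh' : ∀ t ∈ Set.Icc a b, |h' t| ≤ K' / (2 * τ) + K / τ ^ 2 := by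
    intro t ht
    rw [hh']
    refine (abs_add_le _ _).trans (add_le_add ?_ ?_)
    · rw [abs_mul]
      calc _ ≤ K' * (1 / (2 * τ)) := mul_le_mul (hK' t ht) (abs_div_sq_add_sq_le hτ)
            (abs_nonneg _) ((abs_nonneg _).trans (hK' t ht))
        _ = _ := by ring
    · rw [abs_mul]
      refine (mul_le_of_le_one_left (abs_nonneg _) (hw1 t ht)).trans ?_
      rw [mul_div_assoc, abs_mul]
      have : |(τ ^ 2 - ψ' t ^ 2) / (ψ' t ^ 2 + τ ^ 2) ^ 2| ≤ 1 / τ ^ 2 := by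
        rw [abs_div, abs_of_pos (pow_pos (hD t) 2), div_le_div_iff₀ (pow_pos (hD t) 2)
          (by positivity)]
        have h1 : |τ ^ 2 - ψ' t ^ 2| ≤ ψ' t ^ 2 + τ ^ 2 := by
          rw [abs_le]; constructor <;> nlinarith [sq_nonneg τ, sq_nonneg (ψ' t)]
        have h2 : τ ^ 2 ≤ ψ' t ^ 2 + τ ^ 2 := by nlinarith [sq_nonneg (ψ' t)]
        calc _ ≤ (ψ' t ^ 2 + τ ^ 2) * (ψ' t ^ 2 + τ ^ 2) := by gcongr
          _ = _ := by ring
      calc _ ≤ K * (1 / τ ^ 2) := mul_le_mul (hK t ht) this (abs_nonneg _)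
            ((abs_nonneg _).trans (hK t ht))
        _ = _ := by ring
  have hmain : Complex.I * L * ∫ t in a..b, (w t : ℂ) * E t =
      ((h b : ℂ) * E b - (h a : ℂ) * E a) - (∫ t in a..b, (h' t : ℂ) * E t) +
        Complex.I * L * ∫ t in a..b, ((w t * m t : ℝ) : ℂ) * E t := by
    linear_combination hftc
  have n1 : ‖(h b : ℂ) * E b - (h a : ℂ) * E a‖ ≤ 1 / τ := by
    calc _ ≤ _ := norm_sub_le _ _
      _ ≤ 1 / (2 * τ) + 1 / (2 * τ) := by
        rw [norm_mul, norm_mul, hEn, hEn, mul_one, mul_one, Complex.norm_real, Complex.norm_real]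
        exact add_le_add (hbh b ⟨hab, le_rfl⟩) (hbh a ⟨le_rfl, hab⟩)
      _ = _ := by field_simp; norm_num
  have n2 : ‖∫ t in a..b, (h' t : ℂ) * E t‖ ≤ (K' / (2 * τ) + K / τ ^ 2) * (b - a) := by
    have := intervalIntegral.norm_integral_le_of_norm_le_const (a := a) (b := b)
      (f := fun t => (h' t : ℂ) * E t) (C := K' / (2 * τ) + K / τ ^ 2) (fun t ht => by
        rw [Set.uIoc_of_le hab] at ht
        rw [norm_mul, hEn, mul_one, Complex.norm_real]
        exact hbh' t ⟨ht.1.le, ht.2⟩)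
    rwa [abs_of_nonneg (by linarith)] at this
  have n3 : ‖∫ t in a..b, ((w t * m t : ℝ) : ℂ) * E t‖ ≤ ∫ t in a..b, m t := by
    refine intervalIntegral.norm_integral_le_of_norm_le hab (ae_of_all _ fun t ht => ?_) i4
    rw [norm_mul, hEn, mul_one, Complex.norm_real, Real.norm_eq_abs, abs_mul]
    have hm0 : 0 ≤ m t := by rw [hm]; have := hD t; positivity
    rw [abs_of_nonneg hm0]
    exact mul_le_of_le_one_left hm0 (hw1 t ⟨ht.1.le, ht.2⟩)
  have hn := congrArg norm hmain
  rw [norm_mul, norm_mul, Complex.norm_I, one_mul, Complex.norm_real, Real.norm_of_nonneg hL.le]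
    at hn
  have hle : L * ‖∫ t in a..b, (w t : ℂ) * E t‖ ≤
      1 / τ + (K' / (2 * τ) + K / τ ^ 2) * (b - a) + L * ∫ t in a..b, m t := by
    rw [hn]
    refine (norm_add_le _ _).trans (add_le_add ((norm_sub_le _ _).trans (add_le_add n1 n2)) ?_)
    rw [norm_mul, norm_mul, Complex.norm_I, one_mul, Complex.norm_real, Real.norm_of_nonneg hL.le]
    gcongr
  rw [one_div, ← div_eq_inv_mul, ← sub_le_iff_le_add, le_div_iff₀ hL]
  linarith

/-! ### The normalised phase -/

/-- The Euclidean norm of `(a, b, s)`. -/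
def rad (a b s : ℝ) : ℝ := √(a ^ 2 + b ^ 2 + s ^ 2)

lemma rad_sq (a b s : ℝ) : rad a b s ^ 2 = a ^ 2 + b ^ 2 + s ^ 2 := Real.sq_sqrt (by positivity)

lemma rad_nonneg (a b s : ℝ) : 0 ≤ rad a b s := Real.sqrt_nonneg _

lemma half_le_rad {a b s : ℝ} (ha : 1 / 2 ≤ a) : 1 / 2 ≤ rad a b s :=
  Real.le_sqrt_of_sq_le (by nlinarith [sq_nonneg b, sq_nonneg s])

lemma rad_comm (a b s : ℝ) : rad a b s = rad a s b := by
  unfold rad; congr 1; ring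

lemma abs_third_le_rad (a b s : ℝ) : |s| ≤ rad a b s :=
  Real.le_sqrt_of_sq_le (by rw [sq_abs]; nlinarith [sq_nonneg a, sq_nonneg b])

lemma hasDerivAt_rad {a : ℝ} (ha : 1 / 2 ≤ a) (b s : ℝ) :
    HasDerivAt (fun s => rad a b s) (s / rad a b s) s := by
  have h1 : HasDerivAt (fun s => a ^ 2 + b ^ 2 + s ^ 2) (2 * s) s := by
    simpa using ((hasDerivAt_id s).pow 2).const_add (a ^ 2 + b ^ 2)
  have h2 : a ^ 2 + b ^ 2 + s ^ 2 ≠ 0 := by positivity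
  refine (h1.sqrt h2).congr_deriv ?_
  unfold rad
  field_simp

lemma hasDerivAt_div_rad {a : ℝ} (ha : 1 / 2 ≤ a) (b s : ℝ) :
    HasDerivAt (fun s => s / rad a b s) ((a ^ 2 + b ^ 2) / rad a b s ^ 3) s := by
  have h0 : 0 < rad a b s := lt_of_lt_of_le (by norm_num) (half_le_rad ha)
  refine ((hasDerivAt_id s).div (hasDerivAt_rad ha b s) h0.ne').congr_deriv ?_
  have := rad_sq a b s
  simp only [id]
  field_simp
  linarith

lemma abs_div_rad_le_one {a : ℝ} (ha : 1 / 2 ≤ a) (b s : ℝ) : |s / rad a b s| ≤ 1 := by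
  have h0 : 0 < rad a b s := lt_of_lt_of_le (by norm_num) (half_le_rad ha)
  rw [abs_div, abs_of_pos h0, div_le_one h0]
  exact abs_third_le_rad a b s

lemma abs_sq_div_rad_cube_le {a : ℝ} (ha : 1 / 2 ≤ a) (b s : ℝ) :
    |(a ^ 2 + b ^ 2) / rad a b s ^ 3| ≤ 2 := by
  have h1 := half_le_rad (b := b) (s := s) ha
  have h0 : 0 < rad a b s := by linarith
  rw [abs_of_nonneg (by positivity), div_le_iff₀ (by positivity)]
  have h2 := rad_sq a b s
  calc a ^ 2 + b ^ 2 ≤ rad a b s ^ 2 := by rw [h2]; nlinarith [sq_nonneg s]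
    _ ≤ 2 * rad a b s * rad a b s ^ 2 := by
        apply le_mul_of_one_le_left (by positivity); linarith
    _ = _ := by ring

lemma continuous_rad {f g h : ℝ → ℝ} (hf : Continuous f) (hg : Continuous g) (hh : Continuous h) :
    Continuous fun t => rad (f t) (g t) (h t) := by
  unfold rad; fun_prop

lemma abs_rad_sub_rad_le (a b s a' b' s' : ℝ) :
    |rad a b s - rad a' b' s'| ≤ |a - a'| + |b - b'| + |s - s'| := by
  -- As a Euclidean norm, `rad` is Lipschitz by the triangle inequality.
  have key : ∀ a b s : ℝ, rad a b s = ‖(!₂[a, b, s] : Space)‖ := by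
    intro a b s
    rw [EuclideanSpace.norm_eq, rad]
    simp [Fin.sum_univ_three]
  rw [key, key]
  refine (abs_norm_sub_norm_le _ _).trans ?_
  have : (!₂[a, b, s] : Space) - !₂[a', b', s'] = !₂[a - a', b - b', s - s'] := by
    ext i; fin_cases i <;> simp
  rw [this, ← key]
  unfold rad
  refine Real.sqrt_le_iff.2 ⟨by positivity, ?_⟩
  nlinarith [sq_abs (a - a'), sq_abs (b - b'), sq_abs (s - s'), abs_nonneg (a - a'),
    abs_nonneg (b - b'), abs_nonneg (s - s'), mul_nonneg (abs_nonneg (a - a')) (abs_nonneg (b - b')),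
    mul_nonneg (abs_nonneg (a - a')) (abs_nonneg (s - s')),
    mul_nonneg (abs_nonneg (b - b')) (abs_nonneg (s - s'))]

/-! ### Oscillatory integrals with a phase close to the normalised one -/

lemma integral_indicator_ball_le {a b : ℝ} (hab : a ≤ b) (c : ℝ) {r : ℝ} (hr : 0 ≤ r) :
    ∫ t in a..b, (Metric.ball c r).indicator (fun _ => (1 : ℝ)) t ≤ 2 * r := by
  rw [intervalIntegral.integral_of_le hab]
  calc _ ≤ ∫ t, (Metric.ball c r).indicator (fun _ => (1 : ℝ)) t := by
        refine setIntegral_le_integral ?_ (ae_of_all _ fun t => ?_)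
        · rw [integrable_indicator_iff Metric.isOpen_ball.measurableSet]
          exact integrableOn_const measure_ball_lt_top.ne
        · exact Set.indicator_nonneg (fun _ _ => zero_le_one) _
    _ = 2 * r := by
        rw [integral_indicator Metric.isOpen_ball.measurableSet]
        rw [integral_const, smul_eq_mul, mul_one, measureReal_restrict_apply_univ, Measure.real,
          Real.volume_ball, ENNReal.toReal_ofReal (by positivity)]

/-- If the slope |x| is not too small, the affine function is below σ only within σ/|x| of its zero
b/x. If the slope is small, |b| is close to 1 and the function stays above 1/2 on the whole
interval. -/
lemma exists_ball_of_abs_sub_lt {T x b σ : ℝ} (hT : 1 ≤ T) (hxb : |x| + |b| = 1) (hσ : σ ≤ 1 / 2) :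
    ∃ c, ∀ t ∈ Set.Icc (-T) T, |b - x * t| < σ → t ∈ Metric.ball c (2 * (T + 1) * σ) := by
  by_cases hx : 1 / (2 * (T + 1)) ≤ |x|
  · have hx0 : 0 < |x| := lt_of_lt_of_le (by positivity) hx
    have hx1 : x ≠ 0 := abs_pos.1 hx0
    refine ⟨b / x, fun t _ hlt => ?_⟩
    have hσ0 : 0 < σ := (abs_nonneg _).trans_lt hlt
    rw [Metric.mem_ball, Real.dist_eq]
    have : |t - b / x| = |b - x * t| / |x| := by
      rw [← abs_div, ← abs_neg]; congr 1; field_simp; ring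
    rw [this, div_lt_iff₀ hx0]
    refine hlt.trans_le ?_
    calc σ = 2 * (T + 1) * σ * (1 / (2 * (T + 1))) := by field_simp
      _ ≤ _ := by gcongr
  · refine ⟨0, fun t ht hlt => ?_⟩
    exfalso
    push Not at hx
    have h1 : |b| ≤ |b - x * t| + |x * t| := by
      simpa using abs_add_le (b - x * t) (x * t)
    have h2 : |x * t| ≤ |x| * T := by
      rw [abs_mul]; gcongr; exact abs_le.2 ht
    have h3 : |x| * (2 * (T + 1)) < 1 := by rwa [lt_div_iff₀ (by positivity)] at hx
    nlinarith [abs_nonneg x]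

lemma exists_small_sq {B ε : ℝ} (hB : 0 ≤ B) (hε : 0 < ε) : ∃ s : ℝ, 0 < s ∧ B * s ^ 2 ≤ ε := by
  refine ⟨min 1 (ε / (B + 1)), by positivity, ?_⟩
  set s := min 1 (ε / (B + 1))
  have h1 : s ≤ 1 := min_le_left _ _
  have h2 : s ≤ ε / (B + 1) := min_le_right _ _
  have h0 : 0 < s := by positivity
  rw [le_div_iff₀ (by positivity)] at h2
  nlinarith

lemma sq_div_sq_add_sq_le {m s y : ℝ} (hm : 0 < m) (hs : 0 < s) (h : m ≤ |y|) :
    (m * s) ^ 2 / (y ^ 2 + (m * s) ^ 2) ≤ s ^ 2 := by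
  rw [div_le_iff₀ (by positivity)]
  have h2 : m ^ 2 ≤ y ^ 2 := by rw [← sq_abs y]; gcongr
  calc (m * s) ^ 2 = s ^ 2 * m ^ 2 := by ring
    _ ≤ s ^ 2 * (y ^ 2 + (m * s) ^ 2) := by gcongr; nlinarith [sq_nonneg (m * s)]

lemma sq_div_sq_add_sq_le_one {τ : ℝ} (y : ℝ) (hτ : 0 < τ) : τ ^ 2 / (y ^ 2 + τ ^ 2) ≤ 1 :=
  div_le_one_of_le₀ (by linarith [sq_nonneg y]) (by positivity)

/-- The limit phase (x + z t)/√(1 + t²) has derivative (z - x t)/(1 + t²)^{3/2}, so it is stationary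
only near t = z/x. The deviations of s, s' and α from their limit values perturb this derivative by
at most (6 + T) ω, which is half of the bound available where |z - x t| ≥ σ. -/
lemma le_abs_phase_deriv {T t σ ω x z α s s' : ℝ} (hT : 0 < T) (htT : |t| ≤ T) (hσ : 0 < σ)
    (hω : 0 ≤ ω) (hωσ : ω * (6 + T) ≤ σ / (2 * (1 + T) ^ 3)) (hx : |x| ≤ 1) (hz : |z| ≤ 1)
    (hα : |α - x| ≤ ω) (hs' : |s'| ≤ 4) (h1 : |s - 1 / √(1 + t ^ 2)| ≤ ω)
    (h2 : |s' + t / √(1 + t ^ 2) ^ 3| ≤ ω) (hzx : σ ≤ |z - x * t|) :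
    σ / (2 * (1 + T) ^ 3) ≤ |z * s + (α + z * t) * s'| := by
  set m := σ / (2 * (1 + T) ^ 3) with hm
  set ρ := √(1 + t ^ 2) with hρ
  have hρ2 : ρ ^ 2 = 1 + t ^ 2 := Real.sq_sqrt (by positivity)
  have hρ1 : 1 ≤ ρ := Real.one_le_sqrt.2 (by nlinarith [sq_nonneg t])
  have hρ0 : 0 < ρ := by linarith
  have hρT : ρ ≤ 1 + T := Real.sqrt_le_iff.2 ⟨by positivity, by nlinarith [sq_abs t, abs_nonneg t]⟩
  have e0 : z * s + (α + z * t) * s' = (z - x * t) / ρ ^ 3 +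
      (z * (s - 1 / ρ) + (α - x) * s' + (x + z * t) * (s' + t / ρ ^ 3)) := by
    field_simp
    linear_combination z * hρ2
  have b1 : |z * (s - 1 / ρ)| ≤ ω := by
    rw [abs_mul]; exact (mul_le_of_le_one_left (abs_nonneg _) hz).trans h1
  have b2 : |(α - x) * s'| ≤ ω * 4 := by
    rw [abs_mul]; gcongr
  have b3 : |(x + z * t) * (s' + t / ρ ^ 3)| ≤ (1 + T) * ω := by
    rw [abs_mul]
    have : |x + z * t| ≤ 1 + T := by
      refine (abs_add_le _ _).trans (add_le_add hx ?_)
      rw [abs_mul]; exact (mul_le_of_le_one_left (abs_nonneg _) hz).trans htT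
    gcongr
  have b4 : 2 * m ≤ |(z - x * t) / ρ ^ 3| := by
    rw [abs_div, abs_of_pos (by positivity : 0 < ρ ^ 3)]
    calc 2 * m = σ / (1 + T) ^ 3 := by rw [hm]; field_simp
      _ ≤ |z - x * t| / ρ ^ 3 := by gcongr
  set r := z * (s - 1 / ρ) + (α - x) * s' + (x + z * t) * (s' + t / ρ ^ 3) with hr
  have b5 : |r| ≤ m := by
    have := abs_add_le (z * (s - 1 / ρ) + (α - x) * s') ((x + z * t) * (s' + t / ρ ^ 3))
    have := abs_add_le (z * (s - 1 / ρ)) ((α - x) * s')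
    linarith
  rw [e0]
  have := abs_sub_abs_le_abs_sub ((z - x * t) / ρ ^ 3) (-r)
  rw [abs_neg, sub_neg_eq_add] at this
  linarith

/-- Oscillation in the direction along the beam. -/
lemma exists_norm_integral_along_le {T : ℝ} (hT : 1 ≤ T) {ε : ℝ} (hε : 0 < ε) :
    ∃ ω > 0, ∃ M > 0, ∀ S S' S'' w w' : ℝ → ℝ, (∀ t, HasDerivAt S (S' t) t) →
      (∀ t, HasDerivAt S' (S'' t) t) → Continuous S'' → (∀ t, HasDerivAt w (w' t) t) →
      Continuous w' → (∀ t, |w t| ≤ 1) → (∀ t, |w' t| ≤ 2) → (∀ t, |S' t| ≤ 4) →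
      (∀ t, |S'' t| ≤ 24) →
      (∀ t ∈ Set.Icc (-T) T, |S t - 1 / √(1 + t ^ 2)| ≤ ω) →
      (∀ t ∈ Set.Icc (-T) T, |S' t + t / √(1 + t ^ 2) ^ 3| ≤ ω) →
      ∀ χ ζ a : ℝ, M ≤ |χ| + |ζ| → |a - χ| ≤ ω * (|χ| + |ζ|) →
        ‖∫ t in (-T)..T, (w t : ℂ) * Complex.exp (Complex.I * ((a + ζ * t) * S t : ℝ))‖ ≤ ε := by
  have hT0 : 0 < T := by linarith
  -- Order of the choices: σ makes the nearly stationary interval short, of length at most ε/4; m is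
  -- the resulting lower bound of the phase derivative elsewhere; τ = m s makes the regularising
  -- term contribute at most ε/4 there; the threshold 2Q/ε makes the boundary and derivative terms,
  -- of size Q/L, at most ε/2.
  set σ : ℝ := min (1 / 2) (ε / (16 * (T + 1))) with hσd
  have hσ0 : 0 < σ := by positivity
  have hσ1 : σ ≤ 1 / 2 := min_le_left _ _
  have hσ2 : σ * (16 * (T + 1)) ≤ ε := by
    rw [← le_div_iff₀ (by positivity)]; exact min_le_right _ _
  set m : ℝ := σ / (2 * (1 + T) ^ 3) with hm
  have hm0 : 0 < m := by positivity
  obtain ⟨s, hs0, hs⟩ := exists_small_sq (B := 2 * T) (ε := ε / 4) (by positivity) (by positivity)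
  set τ : ℝ := m * s with hτ
  have hτ0 : 0 < τ := by positivity
  set K : ℝ := 56 + 24 * T + 6 with hK
  set Q : ℝ := 1 / τ + (2 / (2 * τ) + K / τ ^ 2) * (T - -T) with hQ
  have hQ0 : 0 < Q := by
    have : 0 < T - -T := by linarith
    positivity
  refine ⟨min (1 / 4) (m / (6 + T)), by positivity, 2 * Q / ε, by positivity, ?_⟩
  set ω := min (1 / 4) (m / (6 + T)) with hω
  have hω0 : 0 < ω := by positivity
  have hω1 : ω ≤ 1 / 4 := min_le_left _ _
  have hω2 : ω * (6 + T) ≤ m := by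
    rw [← le_div_iff₀ (by positivity)]; exact min_le_right _ _
  intro S S' S'' w w' dS dS' cS'' dw cw' hw hw' hS' hS'' hS0 hS0' χ ζ a hM ha
  set L := |χ| + |ζ| with hL
  have hL0 : 0 < L := lt_of_lt_of_le (by positivity) hM
  have hx : |χ / L| + |ζ / L| = 1 := by
    rw [abs_div, abs_div, abs_of_pos hL0, ← add_div, div_self hL0.ne']
  have hax : |a / L - χ / L| ≤ ω := by
    rw [← sub_div, abs_div, abs_of_pos hL0, div_le_iff₀ hL0]; exact ha
  have hx1 : |χ / L| ≤ 1 := by linarith [abs_nonneg (ζ / L)]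
  have hz1 : |ζ / L| ≤ 1 := by linarith [abs_nonneg (χ / L)]
  have ha1 : |a / L| ≤ 5 / 4 := by
    have := abs_add_le (a / L - χ / L) (χ / L)
    rw [sub_add_cancel] at this
    linarith
  set x := χ / L
  set z := ζ / L
  set α := a / L
  have hlin : ∀ t ∈ Set.Icc (-T) T, |t| ≤ T := fun t ht => abs_le.2 ht
  have dlin : ∀ t, HasDerivAt (fun t => α + z * t) z t := fun t => by
    simpa using ((hasDerivAt_id t).const_mul z).const_add α
  have hrw : ∀ t, (a + ζ * t) * S t = L * ((α + z * t) * S t) := by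
    intro t; simp only [α, z]; field_simp
  simp_rw [hrw]
  have key := norm_integral_oscillatory_le (a := -T) (b := T) (by linarith)
    (ψ := fun t => (α + z * t) * S t) (ψ' := fun t => z * S t + (α + z * t) * S' t)
    (ψ'' := fun t => (z * S' t + (z * S' t + (α + z * t) * S'' t))) (w := w) (w' := w')
    (fun t => (dlin t).mul (dS t))
    (fun t => ((dS t).const_mul z).add ((dlin t).mul (dS' t))) dw
    (by
      have c1 : Continuous S' := continuous_iff_continuousAt.2 fun t => (dS' t).continuousAt
      fun_prop) cw' (K := K) (K' := 2)
    (fun t ht => by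
      have h1 := hS' t
      have h2 := hS'' t
      have e1 : |z * S' t| ≤ 4 := by
        rw [abs_mul]; nlinarith [abs_nonneg z, abs_nonneg (S' t)]
      have e2 : |α + z * t| ≤ 5 / 4 + T := by
        refine (abs_add_le _ _).trans (add_le_add ha1 ?_)
        rw [abs_mul]; nlinarith [abs_nonneg z, abs_nonneg t, hlin t ht]
      have e3 : |(α + z * t) * S'' t| ≤ (5 / 4 + T) * 24 := by
        rw [abs_mul]; gcongr
      have := abs_add_le (z * S' t) (z * S' t + (α + z * t) * S'' t)
      have := abs_add_le (z * S' t) ((α + z * t) * S'' t)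
      linarith)
    (fun t _ => hw' t) (fun t _ => hw t) hL0 hτ0
  obtain ⟨c, hc⟩ := exists_ball_of_abs_sub_lt hT hx hσ1
  have hlow : ∀ t ∈ Set.Icc (-T) T, σ ≤ |z - x * t| → m ≤ |z * S t + (α + z * t) * S' t| :=
    fun t ht hσt => le_abs_phase_deriv hT0 (hlin t ht) hσ0 hω0.le hω2 hx1 hz1 hax (hS' t)
      (hS0 t ht) (hS0' t ht) hσt
  have hint : ∫ t in (-T)..T, τ ^ 2 / ((z * S t + (α + z * t) * S' t) ^ 2 + τ ^ 2) ≤ ε / 2 := by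
    have cS : Continuous S := continuous_iff_continuousAt.2 fun t => (dS t).continuousAt
    have cS' : Continuous S' := continuous_iff_continuousAt.2 fun t => (dS' t).continuousAt
    have iind : IntervalIntegrable
        ((Metric.ball c (2 * (T + 1) * σ)).indicator (fun _ => (1 : ℝ))) volume (-T) T := by
      refine Integrable.intervalIntegrable ?_
      rw [integrable_indicator_iff Metric.isOpen_ball.measurableSet]
      exact integrableOn_const measure_ball_lt_top.ne
    calc _ ≤ ∫ t in (-T)..T,
          (s ^ 2 + (Metric.ball c (2 * (T + 1) * σ)).indicator (fun _ => (1 : ℝ)) t) := by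
          refine intervalIntegral.integral_mono_on (by linarith) ?_
            (intervalIntegrable_const.add iind) fun t ht => ?_
          · refine Continuous.intervalIntegrable ?_ _ _
            exact continuous_const.div (by fun_prop) fun t => by positivity
          · by_cases h : t ∈ Metric.ball c (2 * (T + 1) * σ)
            · rw [Set.indicator_of_mem h]
              have := sq_div_sq_add_sq_le_one (z * S t + (α + z * t) * S' t) hτ0
              linarith [sq_nonneg s]
            · rw [Set.indicator_of_notMem h, add_zero]
              have hσt : σ ≤ |z - x * t| := by
                by_contra hlt; exact h (hc t ht (not_le.1 hlt))
              exact sq_div_sq_add_sq_le hm0 hs0 (hlow t ht hσt)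
      _ ≤ 2 * T * s ^ 2 + 2 * (2 * (T + 1) * σ) := by
          rw [intervalIntegral.integral_add intervalIntegrable_const iind,
            intervalIntegral.integral_const]
          have := integral_indicator_ball_le (a := -T) (b := T) (by linarith) c
            (r := 2 * (T + 1) * σ) (by positivity)
          rw [smul_eq_mul]
          linarith
      _ ≤ ε / 2 := by linarith
  refine key.trans ?_
  have : 1 / L * Q ≤ ε / 2 := by
    rw [one_div, ← div_eq_inv_mul, div_le_iff₀ hL0]
    have := (div_le_iff₀ hε).1 hM
    linarith
  linarith

/-- Oscillation in the direction transverse to the beam. -/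
lemma exists_norm_integral_transverse_le {V N s₀ : ℝ} (hV : 1 ≤ V) (hN : 0 ≤ N) (hs₀ : 0 < s₀)
    {ε : ℝ} (hε : 0 < ε) :
    ∃ ω > 0, ∃ M > 0, ∀ S S' S'' w w' : ℝ → ℝ, (∀ v, HasDerivAt S (S' v) v) →
      (∀ v, HasDerivAt S' (S'' v) v) → Continuous S'' → (∀ v, HasDerivAt w (w' v) v) →
      Continuous w' → (∀ v, |w v| ≤ 1) → (∀ v, |w' v| ≤ 2) →
      (∀ v ∈ Set.Icc (-V) V, s₀ ≤ S v) → (∀ v, |S' v| ≤ ω) → (∀ v, |S'' v| ≤ 24) →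
      ∀ ξ a : ℝ, M ≤ |ξ| → |a| ≤ N * |ξ| →
        ‖∫ v in (-V)..V, (w v : ℂ) * Complex.exp (Complex.I * ((a - 2 * ξ * v) * S v : ℝ))‖
          ≤ ε := by
  have hV0 : 0 < V := by linarith
  obtain ⟨s, hs0, hs⟩ := exists_small_sq (B := 2 * V) (ε := ε / 2) (by positivity) (by positivity)
  set τ : ℝ := s₀ * s with hτ
  have hτ0 : 0 < τ := by positivity
  set K : ℝ := 16 + (N + 2 * V) * 24 with hK
  set Q : ℝ := 1 / τ + (2 / (2 * τ) + K / τ ^ 2) * (V - -V) with hQ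
  have hQ0 : 0 < Q := by
    have : 0 < V - -V := by linarith
    positivity
  refine ⟨min 4 (s₀ / (N + 2 * V)), by positivity, 2 * Q / ε, by positivity, ?_⟩
  set ω := min 4 (s₀ / (N + 2 * V)) with hω
  have hω0 : 0 < ω := by positivity
  have hω1 : ω ≤ 4 := min_le_left _ _
  have hω2 : ω * (N + 2 * V) ≤ s₀ := by
    rw [← le_div_iff₀ (by positivity)]; exact min_le_right _ _
  intro S S' S'' w w' dS dS' cS'' dw cw' hw hw' hS hS' hS'' ξ a hM ha
  have hL0 : 0 < |ξ| := lt_of_lt_of_le (by positivity) hM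
  set L := |ξ| with hL
  set z := ξ / L with hz
  set α := a / L with hα
  have hz1 : |z| = 1 := by rw [hz, abs_div, abs_of_pos hL0, div_self hL0.ne']
  have ha1 : |α| ≤ N := by rw [hα, abs_div, abs_of_pos hL0, div_le_iff₀ hL0]; exact ha
  have hlin : ∀ v ∈ Set.Icc (-V) V, |α - 2 * z * v| ≤ N + 2 * V := by
    intro v hv
    have h1 : |v| ≤ V := abs_le.2 hv
    refine (abs_sub _ _).trans (add_le_add ha1 ?_)
    rw [abs_mul, abs_mul, hz1, abs_two]; linarith
  have dlin : ∀ v, HasDerivAt (fun v => α - 2 * z * v) (-(2 * z)) v := fun v => by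
    simpa using ((hasDerivAt_id v).const_mul (2 * z)).const_sub α
  have hrw : ∀ v, (a - 2 * ξ * v) * S v = L * ((α - 2 * z * v) * S v) := by
    intro v; simp only [hα, hz]; field_simp
  simp_rw [hrw]
  have cS : Continuous S := continuous_iff_continuousAt.2 fun t => (dS t).continuousAt
  have cS' : Continuous S' := continuous_iff_continuousAt.2 fun t => (dS' t).continuousAt
  have key := norm_integral_oscillatory_le (a := -V) (b := V) (by linarith)
    (ψ := fun v => (α - 2 * z * v) * S v)
    (ψ' := fun v => -(2 * z) * S v + (α - 2 * z * v) * S' v)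
    (ψ'' := fun v => (-(2 * z) * S' v + (-(2 * z) * S' v + (α - 2 * z * v) * S'' v)))
    (w := w) (w' := w') (fun t => (dlin t).mul (dS t))
    (fun t => ((dS t).const_mul _).add ((dlin t).mul (dS' t))) dw (by fun_prop) cw'
    (K := K) (K' := 2)
    (fun v hv => by
      have h1 := (hS' v).trans hω1
      have e1 : |-(2 * z) * S' v| ≤ 8 := by
        rw [abs_mul, abs_neg, abs_mul, hz1, abs_two]; linarith
      have e3 : |(α - 2 * z * v) * S'' v| ≤ (N + 2 * V) * 24 := by
        rw [abs_mul]; gcongr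
        · exact hlin v hv
        · exact hS'' v
      have := abs_add_le (-(2 * z) * S' v) (-(2 * z) * S' v + (α - 2 * z * v) * S'' v)
      have := abs_add_le (-(2 * z) * S' v) ((α - 2 * z * v) * S'' v)
      linarith)
    (fun t _ => hw' t) (fun t _ => hw t) hL0 hτ0
  have hint : ∫ v in (-V)..V, τ ^ 2 / ((-(2 * z) * S v + (α - 2 * z * v) * S' v) ^ 2 + τ ^ 2)
      ≤ ε / 2 := by
    calc _ ≤ ∫ v in (-V)..V, s ^ 2 := by
          refine intervalIntegral.integral_mono_on (by linarith) ?_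
            intervalIntegrable_const fun v hv => ?_
          · refine Continuous.intervalIntegrable ?_ _ _
            exact continuous_const.div (by fun_prop) fun t => by positivity
          -- When ξ dominates there is no stationary point: the derivative is -2z S, of modulus at
          -- least 2 s₀, up to a perturbation of at most s₀.
          · have h1 : s₀ ≤ |-(2 * z) * S v + (α - 2 * z * v) * S' v| := by
              have e1 : 2 * s₀ ≤ |-(2 * z) * S v| := by
                rw [abs_mul, abs_neg, abs_mul, hz1, abs_two]
                have := le_abs_self (S v)
                have := hS v hv
                linarith
              have e2 : |(α - 2 * z * v) * S' v| ≤ (N + 2 * V) * ω := by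
                rw [abs_mul]; gcongr
                · exact hlin v hv
                · exact hS' v
              have := abs_sub_abs_le_abs_sub (-(2 * z) * S v) (-((α - 2 * z * v) * S' v))
              rw [abs_neg, sub_neg_eq_add] at this
              linarith
            exact sq_div_sq_add_sq_le hs₀ hs0 h1
      _ ≤ ε / 2 := by
          rw [intervalIntegral.integral_const, smul_eq_mul]
          linarith
  refine key.trans ?_
  have : 1 / L * Q ≤ ε / 2 := by
    rw [one_div, ← div_eq_inv_mul, div_le_iff₀ hL0]
    have := (div_le_iff₀ hε).1 hM
    linarith
  linarith

/-! ### Stability of the oscillatory integral -/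

/-- Derivatives of the reciprocal of a sum of two distances along a line. -/
lemma exists_deriv_two_div_rad_add {a b a' b' p q p' q' κ : ℝ} (ha : 1 / 2 ≤ a) (ha' : 1 / 2 ≤ a')
    (hq : |q| ≤ κ) (hq' : |q'| ≤ κ) :
    ∃ S' S'' : ℝ → ℝ,
      (∀ u, HasDerivAt (fun u => 2 / (rad a b (p + q * u) + rad a' b' (p' + q' * u))) (S' u) u) ∧
      (∀ u, HasDerivAt S' (S'' u) u) ∧ Continuous S'' ∧ (∀ u, |S' u| ≤ 4 * κ) ∧
      (∀ u, |S'' u| ≤ 24 * κ ^ 2) ∧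
      ∀ u, S' u = -2 * (q * ((p + q * u) / rad a b (p + q * u)) +
        q' * ((p' + q' * u) / rad a' b' (p' + q' * u))) /
          (rad a b (p + q * u) + rad a' b' (p' + q' * u)) ^ 2 := by
  have hκ : 0 ≤ κ := (abs_nonneg _).trans hq
  set f : ℝ → ℝ := fun u => rad a b (p + q * u) + rad a' b' (p' + q' * u) with hf
  set f' : ℝ → ℝ := fun u => q * ((p + q * u) / rad a b (p + q * u)) +
        q' * ((p' + q' * u) / rad a' b' (p' + q' * u)) with hf'
  set f'' : ℝ → ℝ := fun u => q * (q * ((a ^ 2 + b ^ 2) / rad a b (p + q * u) ^ 3)) +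
    q' * (q' * ((a' ^ 2 + b' ^ 2) / rad a' b' (p' + q' * u) ^ 3)) with hf''
  have hf1 : ∀ u, 1 ≤ f u := fun u => by
    have h1 := half_le_rad (b := b) (s := p + q * u) ha
    have h2 := half_le_rad (b := b') (s := p' + q' * u) ha'
    simp only [hf]; linarith
  have dl : ∀ p q u : ℝ, HasDerivAt (fun u => p + q * u) q u := fun p q u => by
    simpa using ((hasDerivAt_id u).const_mul q).const_add p
  have df : ∀ u, HasDerivAt f (f' u) u := fun u => by
    have h1 := (hasDerivAt_rad ha b (p + q * u)).comp u (dl p q u)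
    have h2 := (hasDerivAt_rad ha' b' (p' + q' * u)).comp u (dl p' q' u)
    refine (h1.add h2).congr_deriv ?_
    simp only [hf']; ring
  have df' : ∀ u, HasDerivAt f' (f'' u) u := fun u => by
    have h1 := ((hasDerivAt_div_rad ha b (p + q * u)).comp u (dl p q u)).const_mul q
    have h2 := ((hasDerivAt_div_rad ha' b' (p' + q' * u)).comp u (dl p' q' u)).const_mul q'
    refine (h1.add h2).congr_deriv ?_
    simp only [hf'']; ring
  have cf : Continuous f := continuous_iff_continuousAt.2 fun t => (df t).continuousAt
  have cf' : Continuous f' := continuous_iff_continuousAt.2 fun t => (df' t).continuousAt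
  have cf'' : Continuous f'' := by
    have h1 : ∀ u, rad a b (p + q * u) ^ 3 ≠ 0 := fun u => by
      have := half_le_rad (b := b) (s := p + q * u) ha
      positivity
    have h2 : ∀ u, rad a' b' (p' + q' * u) ^ 3 ≠ 0 := fun u => by
      have := half_le_rad (b := b') (s := p' + q' * u) ha'
      positivity
    have c1 : Continuous fun u => rad a b (p + q * u) :=
      continuous_rad continuous_const continuous_const (by fun_prop)
    have c2 : Continuous fun u => rad a' b' (p' + q' * u) :=
      continuous_rad continuous_const continuous_const (by fun_prop)
    exact ((continuous_const.mul (continuous_const.mul (continuous_const.div (c1.pow 3) h1)))).add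
      (continuous_const.mul (continuous_const.mul (continuous_const.div (c2.pow 3) h2)))
  have bf' : ∀ u, |f' u| ≤ 2 * κ := fun u => by
    have h1 := abs_div_rad_le_one ha b (p + q * u)
    have h2 := abs_div_rad_le_one ha' b' (p' + q' * u)
    refine (abs_add_le _ _).trans ?_
    rw [abs_mul, abs_mul]
    nlinarith [mul_le_mul hq h1 (abs_nonneg _) hκ, mul_le_mul hq' h2 (abs_nonneg _) hκ]
  have bf'' : ∀ u, |f'' u| ≤ 4 * κ ^ 2 := fun u => by
    have h1 := abs_sq_div_rad_cube_le ha b (p + q * u)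
    have h2 := abs_sq_div_rad_cube_le ha' b' (p' + q' * u)
    refine (abs_add_le _ _).trans ?_
    rw [abs_mul, abs_mul, abs_mul, abs_mul]
    have e1 := mul_le_mul hq (mul_le_mul hq h1 (abs_nonneg _) hκ) (by positivity) hκ
    have e2 := mul_le_mul hq' (mul_le_mul hq' h2 (abs_nonneg _) hκ) (by positivity) hκ
    linarith
  refine ⟨fun u => -2 * f' u / f u ^ 2,
    fun u => -2 * f'' u / f u ^ 2 + 4 * f' u ^ 2 / f u ^ 3, fun u => ?_, fun u => ?_, ?_,
    fun u => ?_, fun u => ?_, fun u => rfl⟩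
  · have h0 : f u ≠ 0 := by linarith [hf1 u]
    refine ((hasDerivAt_const u (2 : ℝ)).div (df u) h0).congr_deriv ?_
    simp
  · have h0 : f u ≠ 0 := by linarith [hf1 u]
    refine (((df' u).const_mul (-2)).div ((df u).pow 2) (pow_ne_zero 2 h0)).congr_deriv ?_
    simp only [Pi.pow_apply]
    field_simp
    ring
  · have h0 : ∀ u, f u ≠ 0 := fun u => by linarith [hf1 u]
    exact ((continuous_const.mul cf'').div (cf.pow 2) fun u => pow_ne_zero 2 (h0 u)).add
      ((continuous_const.mul (cf'.pow 2)).div (cf.pow 3) fun u => pow_ne_zero 3 (h0 u))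
  · have h0 : 0 < f u := by linarith [hf1 u]
    rw [abs_div, abs_mul, abs_of_pos (pow_pos h0 2), abs_neg, abs_two]
    refine (div_le_self (by positivity) (one_le_pow₀ (hf1 u))).trans ?_
    linarith [bf' u]
  · have h0 : 0 < f u := by linarith [hf1 u]
    refine (abs_add_le _ _).trans ?_
    have e1 : |-2 * f'' u / f u ^ 2| ≤ 8 * κ ^ 2 := by
      rw [abs_div, abs_mul, abs_of_pos (pow_pos h0 2), abs_neg, abs_two]
      refine (div_le_self (by positivity) (one_le_pow₀ (hf1 u))).trans ?_
      linarith [bf'' u]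
    have e2 : |4 * f' u ^ 2 / f u ^ 3| ≤ 16 * κ ^ 2 := by
      rw [abs_of_nonneg (by positivity)]
      refine (div_le_self (by positivity) (one_le_pow₀ (hf1 u))).trans ?_
      have : f' u ^ 2 ≤ (2 * κ) ^ 2 := by rw [← sq_abs]; gcongr; exact bf' u
      linarith
    linarith

lemma rad_one_zero (t : ℝ) : rad 1 0 t = √(1 + t ^ 2) := by simp [rad]

/-- Both distances are within ω of √(1 + t²) by the Lipschitz property, and the bounds a, a' ≥ 1/2
keep the denominators away from zero. Closeness of the t-derivative is needed as well, because the
oscillation estimate uses the derivative of the phase. -/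
lemma abs_two_div_rad_add_sub_le {a b a' b' h t ω : ℝ} (ha : 1 / 2 ≤ a) (ha' : 1 / 2 ≤ a')
    (hω : |a - 1| + |b| + |h| ≤ ω) (hω' : |a' - 1| + |b'| + |h| ≤ ω) :
    |2 / (rad a b (t + h) + rad a' b' (t - h)) - 1 / √(1 + t ^ 2)| ≤ 2 * ω ∧
    |-2 * ((t + h) / rad a b (t + h) + (t - h) / rad a' b' (t - h)) /
      (rad a b (t + h) + rad a' b' (t - h)) ^ 2 + t / √(1 + t ^ 2) ^ 3| ≤ 24 * ω := by
  rw [← rad_one_zero]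
  have hρ1 : 1 ≤ rad 1 0 t := Real.le_sqrt_of_sq_le (by nlinarith [sq_nonneg t])
  have d1 : |rad a b (t + h) - rad 1 0 t| ≤ ω := by
    refine (abs_rad_sub_rad_le _ _ _ _ _ _).trans ?_
    simpa using hω
  have d2 : |rad a' b' (t - h) - rad 1 0 t| ≤ ω := by
    refine (abs_rad_sub_rad_le _ _ _ _ _ _).trans ?_
    simpa using hω'
  have hh : |h| ≤ ω := by linarith [abs_nonneg (a - 1), abs_nonneg b]
  have hω0 : 0 ≤ ω := (abs_nonneg _).trans hh
  have r1 := half_le_rad (b := b) (s := t + h) ha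
  have r2 := half_le_rad (b := b') (s := t - h) ha'
  have htρ : |t / rad 1 0 t| ≤ 1 := abs_div_rad_le_one (by norm_num) 0 t
  set ρ := rad 1 0 t
  set R := rad a b (t + h)
  set R' := rad a' b' (t - h)
  have hρ0 : 0 < ρ := by linarith
  have hR0 : 0 < R := by linarith
  have hR'0 : 0 < R' := by linarith
  have hS : |2 / (R + R') - 1 / ρ| ≤ 2 * ω := by
    have : 2 / (R + R') - 1 / ρ = -((R - ρ) + (R' - ρ)) / ((R + R') * ρ) := by
      field_simp; ring
    rw [this, abs_div, abs_neg, abs_of_pos (by positivity : 0 < (R + R') * ρ)]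
    refine (div_le_self (abs_nonneg _) ?_).trans ?_
    · nlinarith
    · exact (abs_add_le _ _).trans (by linarith)
  refine ⟨hS, ?_⟩
  have aux : ∀ g y : ℝ, 1 / 2 ≤ y → |y - ρ| ≤ ω → |g| ≤ ω → |(t + g) / y - t / ρ| ≤ 4 * ω := by
    intro g y hy hyρ hg
    have hy0 : 0 < y := by linarith
    have : (t + g) / y - t / ρ = (g - t / ρ * (y - ρ)) / y := by field_simp; ring
    rw [this, abs_div, abs_of_pos hy0, div_le_iff₀ hy0]
    refine (abs_sub _ _).trans ?_
    rw [abs_mul]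
    have := mul_le_mul htρ hyρ (abs_nonneg _) zero_le_one
    nlinarith
  have e1 := aux h R r1 d1 hh
  have e2 := aux (-h) R' r2 d2 (by rwa [abs_neg])
  rw [← sub_eq_add_neg] at e2
  have hsplit : -2 * ((t + h) / R + (t - h) / R') / (R + R') ^ 2 + t / ρ ^ 3 =
      -(2 / (R + R') ^ 2) * (((t + h) / R - t / ρ) + ((t - h) / R' - t / ρ)) -
        (t / ρ) * ((2 / (R + R') - 1 / ρ) * (2 / (R + R') + 1 / ρ)) := by
    field_simp
    ring
  rw [hsplit]
  have f1 : |-(2 / (R + R') ^ 2) * (((t + h) / R - t / ρ) + ((t - h) / R' - t / ρ))| ≤ 16 * ω := by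
    rw [abs_mul, abs_neg, abs_of_pos (by positivity)]
    have g1 : 2 / (R + R') ^ 2 ≤ 2 := div_le_self (by norm_num) (one_le_pow₀ (by linarith))
    have g2 := (abs_add_le ((t + h) / R - t / ρ) ((t - h) / R' - t / ρ)).trans (add_le_add e1 e2)
    calc _ ≤ 2 * (4 * ω + 4 * ω) := by gcongr
      _ = _ := by ring
  have f2 : |t / ρ * ((2 / (R + R') - 1 / ρ) * (2 / (R + R') + 1 / ρ))| ≤ 8 * ω := by
    rw [abs_mul, abs_mul]
    have g1 : |2 / (R + R') + 1 / ρ| ≤ 4 := by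
      rw [abs_of_pos (by positivity)]
      have h1 : 2 / (R + R') ≤ 2 := div_le_self (by norm_num) (by linarith)
      have h2 : 1 / ρ ≤ 1 := div_le_self (by norm_num) hρ1
      linarith
    calc _ ≤ 1 * (2 * ω * 4) := by gcongr
      _ = _ := by ring
  exact (abs_sub _ _).trans (by linarith)

/-- The reciprocal of the mean distance to the two observation points, in the units of the
cross-range offset. -/
def profile (c e h₁ h₂ h₃ v t : ℝ) : ℝ :=
  2 / (rad (c + h₁) (h₂ - e * v) (t + h₃) + rad (c - h₁) (h₂ + e * v) (t - h₃))

lemma profile_one_zero (v t : ℝ) : profile 1 0 0 0 0 v t = 1 / √(1 + t ^ 2) := by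
  rw [← rad_one_zero]
  have : 0 < rad 1 0 t := lt_of_lt_of_le (by norm_num) (half_le_rad (by norm_num))
  simp [profile]
  field_simp
  norm_num

lemma continuous_profile {c e h₁ h₂ h₃ : ℝ} (h : 1 / 2 ≤ c + h₁) (h' : 1 / 2 ≤ c - h₁) :
    Continuous fun q : ℝ × ℝ => profile c e h₁ h₂ h₃ q.1 q.2 := by
  unfold profile
  refine continuous_const.div ?_ fun q => ?_
  · unfold rad; fun_prop
  · have h1 := half_le_rad (b := h₂ - e * q.1) (s := q.2 + h₃) h
    have h2 := half_le_rad (b := h₂ + e * q.1) (s := q.2 - h₃) h'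
    positivity

/-- The integrand of the normalised correlation integral. -/
def corrIntegrand (c e h₁ h₂ h₃ χ ξ ζ v t : ℝ) : ℂ :=
  (Real.exp (-2 * v ^ 2) : ℂ) * (((1 / (1 + t ^ 2) : ℝ) : ℂ) * Complex.exp (Complex.I *
    ((c * χ - 2 * ξ * v + ζ * t) * profile c e h₁ h₂ h₃ v t : ℝ)))

lemma continuous_corrIntegrand {c e h₁ h₂ h₃ : ℝ} (h : 1 / 2 ≤ c + h₁) (h' : 1 / 2 ≤ c - h₁)
    (χ ξ ζ : ℝ) : Continuous fun q : ℝ × ℝ => corrIntegrand c e h₁ h₂ h₃ χ ξ ζ q.1 q.2 := by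
  have h1 := continuous_profile (e := e) (h₂ := h₂) (h₃ := h₃) h h'
  unfold corrIntegrand
  have h2 : Continuous fun q : ℝ × ℝ => (1 / (1 + q.2 ^ 2) : ℝ) :=
    continuous_const.div (by fun_prop) fun q => by positivity
  fun_prop

lemma interval_integral_swap {a b c d : ℝ} (hab : a ≤ b) (hcd : c ≤ d) {f : ℝ → ℝ → ℂ}
    (hf : Continuous fun q : ℝ × ℝ => f q.1 q.2) :
    ∫ x in a..b, ∫ y in c..d, f x y = ∫ y in c..d, ∫ x in a..b, f x y := by
  simp_rw [intervalIntegral.integral_of_le hab, intervalIntegral.integral_of_le hcd]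
  refine integral_integral_swap ?_
  rw [Measure.prod_restrict]
  exact (hf.continuousOn.integrableOn_compact (isCompact_Icc.prod isCompact_Icc)).mono_set
    (Set.prod_mono Set.Ioc_subset_Icc_self Set.Ioc_subset_Icc_self)

/-- Smallness of the deviation from the normalised geometry. -/
structure NearNormalised (e₀ c e h₁ h₂ h₃ : ℝ) : Prop where
  c_le : |c - 1| ≤ e₀
  e_le : |e| ≤ e₀
  h₁_le : |h₁| ≤ e₀
  h₂_le : |h₂| ≤ e₀
  h₃_le : |h₃| ≤ e₀

namespace NearNormalised

variable {e₀ e₁ c e h₁ h₂ h₃ v V : ℝ}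

lemma mono (h : NearNormalised e₀ c e h₁ h₂ h₃) (he : e₀ ≤ e₁) : NearNormalised e₁ c e h₁ h₂ h₃ :=
  ⟨h.c_le.trans he, h.e_le.trans he, h.h₁_le.trans he, h.h₂_le.trans he, h.h₃_le.trans he⟩

lemma refl (he : 0 ≤ e₀) : NearNormalised e₀ 1 0 0 0 0 := by
  constructor <;> simpa

lemma half_le_add (h : NearNormalised e₀ c e h₁ h₂ h₃) (he : e₀ ≤ 1 / 4) : 1 / 2 ≤ c + h₁ := by
  have h1 := abs_le.1 (h.c_le.trans he)
  have h2 := abs_le.1 (h.h₁_le.trans he)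
  linarith

lemma half_le_sub (h : NearNormalised e₀ c e h₁ h₂ h₃) (he : e₀ ≤ 1 / 4) : 1 / 2 ≤ c - h₁ := by
  have h1 := abs_le.1 (h.c_le.trans he)
  have h2 := abs_le.1 (h.h₁_le.trans he)
  linarith

lemma abs_mul_le (h : NearNormalised e₀ c e h₁ h₂ h₃) (hv : |v| ≤ V) : |e * v| ≤ e₀ * V := by
  rw [abs_mul]
  exact mul_le_mul h.e_le hv (abs_nonneg _) ((abs_nonneg _).trans h.e_le)

lemma abs_le_add (h : NearNormalised e₀ c e h₁ h₂ h₃) (hv : |v| ≤ V) :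
    |c + h₁ - 1| + |h₂ - e * v| + |h₃| ≤ e₀ * (4 + V) := by
  have h1 := abs_add_le (c - 1) h₁
  have h2 := abs_sub h₂ (e * v)
  rw [show c - 1 + h₁ = c + h₁ - 1 by ring] at h1
  linarith [h.c_le, h.h₁_le, h.h₂_le, h.h₃_le, h.abs_mul_le hv]

lemma abs_le_sub (h : NearNormalised e₀ c e h₁ h₂ h₃) (hv : |v| ≤ V) :
    |c - h₁ - 1| + |h₂ + e * v| + |h₃| ≤ e₀ * (4 + V) := by
  have h1 := abs_sub (c - 1) h₁
  have h2 := abs_add_le h₂ (e * v)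
  rw [show c - 1 - h₁ = c - h₁ - 1 by ring] at h1
  linarith [h.c_le, h.h₁_le, h.h₂_le, h.h₃_le, h.abs_mul_le hv]

lemma abs_profile_sub_le (h : NearNormalised e₀ c e h₁ h₂ h₃) (he : e₀ ≤ 1 / 4) (hv : |v| ≤ V)
    (t : ℝ) : |profile c e h₁ h₂ h₃ v t - 1 / √(1 + t ^ 2)| ≤ 2 * (e₀ * (4 + V)) :=
  (abs_two_div_rad_add_sub_le (h.half_le_add he) (h.half_le_sub he) (h.abs_le_add hv)
    (h.abs_le_sub hv)).1

lemma abs_profile_le (h : NearNormalised e₀ c e h₁ h₂ h₃) (he : e₀ ≤ 1 / 4) (t : ℝ) :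
    |profile c e h₁ h₂ h₃ v t| ≤ 2 := by
  have h1 := half_le_rad (b := h₂ - e * v) (s := t + h₃) (h.half_le_add he)
  have h2 := half_le_rad (b := h₂ + e * v) (s := t - h₃) (h.half_le_sub he)
  unfold profile
  rw [abs_of_pos (by positivity)]
  exact div_le_self (by norm_num) (by linarith)

end NearNormalised

lemma hasDerivAt_inv_one_add_sq (t : ℝ) :
    HasDerivAt (fun t : ℝ => 1 / (1 + t ^ 2)) (-(2 * t) / (1 + t ^ 2) ^ 2) t := by
  have h1 : HasDerivAt (fun t : ℝ => 1 + t ^ 2) (2 * t) t := by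
    simpa using ((hasDerivAt_id t).pow 2).const_add 1
  refine ((hasDerivAt_const t (1 : ℝ)).div h1 (by positivity)).congr_deriv ?_
  simp

lemma hasDerivAt_exp_neg_two_sq (v : ℝ) :
    HasDerivAt (fun v : ℝ => Real.exp (-2 * v ^ 2)) (-(4 * v) * Real.exp (-2 * v ^ 2)) v := by
  have h1 : HasDerivAt (fun v : ℝ => -2 * v ^ 2) (-(4 * v)) v := by
    refine (((hasDerivAt_id v).pow 2).const_mul (-2 : ℝ)).congr_deriv ?_
    simp; ring
  exact h1.exp.congr_deriv (by ring)

lemma abs_exp_neg_two_sq_le (v : ℝ) : |Real.exp (-2 * v ^ 2)| ≤ 1 := by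
  rw [abs_of_pos (Real.exp_pos _)]
  exact Real.exp_le_one_iff.2 (by nlinarith [sq_nonneg v])

lemma abs_deriv_exp_neg_two_sq_le (v : ℝ) : |-(4 * v) * Real.exp (-2 * v ^ 2)| ≤ 2 := by
  rw [abs_mul, abs_neg, abs_of_pos (Real.exp_pos _), abs_mul, show -2 * v ^ 2 = -(2 * v ^ 2) by ring,
    Real.exp_neg, ← div_eq_mul_inv, div_le_iff₀ (Real.exp_pos _)]
  have := Real.add_one_le_exp (2 * v ^ 2)
  have h4 : |(4 : ℝ)| = 4 := by norm_num
  rw [h4]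
  nlinarith [sq_abs v, sq_nonneg (|v| - 1 / 2)]

lemma abs_inv_one_add_sq_le (t : ℝ) : |1 / (1 + t ^ 2)| ≤ 1 := by
  rw [abs_of_pos (by positivity)]
  exact div_le_self zero_le_one (by nlinarith [sq_nonneg t])

lemma abs_deriv_inv_one_add_sq_le (t : ℝ) : |-(2 * t) / (1 + t ^ 2) ^ 2| ≤ 2 := by
  rw [abs_div, abs_neg, abs_of_pos (by positivity : 0 < (1 + t ^ 2) ^ 2), div_le_iff₀ (by positivity),
    abs_mul, abs_two]
  nlinarith [sq_abs t, sq_nonneg (|t| - 1), sq_nonneg (t ^ 2)]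

/-- When ξ is dominated by |χ| + |ζ|, the term -2ξv is, for each fixed v, a small perturbation of χ
in the phase, so the inner integral in t is already small. -/
lemma exists_norm_corr_le_of_along {V T : ℝ} (hV : 1 ≤ V) (hT : 1 ≤ T) {ε : ℝ} (hε : 0 < ε) :
    ∃ N > 0, ∃ M > 0, ∃ e₀ > 0, e₀ ≤ 1 / 4 ∧ ∀ c e h₁ h₂ h₃,
      NearNormalised e₀ c e h₁ h₂ h₃ → ∀ χ ξ ζ, N * |ξ| ≤ |χ| + |ζ| → M ≤ |χ| + |ζ| →
        ‖∫ v in (-V)..V, ∫ t in (-T)..T, corrIntegrand c e h₁ h₂ h₃ χ ξ ζ v t‖ ≤ ε := by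
  have hV0 : 0 < V := by linarith
  obtain ⟨ω, hω, M, hM, H⟩ := exists_norm_integral_along_le hT (ε := ε / (2 * V)) (by positivity)
  refine ⟨4 * V / ω, by positivity, M, hM, min (1 / 4) (ω / (24 * (4 + V))), by positivity,
    min_le_left _ _, ?_⟩
  set e₀ := min (1 / 4) (ω / (24 * (4 + V)))
  have he0 : 0 < e₀ := by positivity
  have he1 : e₀ ≤ 1 / 4 := min_le_left _ _
  have he2 : 24 * (e₀ * (4 + V)) ≤ ω := by
    have : e₀ ≤ ω / (24 * (4 + V)) := min_le_right _ _
    rw [le_div_iff₀ (by positivity)] at this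
    linarith
  intro c e h₁ h₂ h₃ hn χ ξ ζ hN hL
  have key : ∀ v ∈ Set.uIoc (-V) V,
      ‖∫ t in (-T)..T, corrIntegrand c e h₁ h₂ h₃ χ ξ ζ v t‖ ≤ ε / (2 * V) := by
    intro v hv
    rw [Set.uIoc_of_le (by linarith)] at hv
    have hvV : |v| ≤ V := abs_le.2 ⟨hv.1.le, hv.2⟩
    have ha := hn.half_le_add he1
    have ha' := hn.half_le_sub he1
    obtain ⟨S', S'', d1, d2, c2, b1, b2, e1⟩ := exists_deriv_two_div_rad_add ha ha'
      (b := h₂ - e * v) (b' := h₂ + e * v) (p := h₃) (p' := -h₃) (q := 1) (q' := 1) (κ := 1)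
      (by simp) (by simp)
    have hS : (fun u => 2 / (rad (c + h₁) (h₂ - e * v) (h₃ + 1 * u) +
        rad (c - h₁) (h₂ + e * v) (-h₃ + 1 * u))) = profile c e h₁ h₂ h₃ v := by
      funext u
      unfold profile
      rw [show h₃ + 1 * u = u + h₃ by ring, show -h₃ + 1 * u = u - h₃ by ring]
    rw [hS] at d1
    have hclose := fun t => abs_two_div_rad_add_sub_le (t := t) ha ha' (hn.abs_le_add hvV)
      (hn.abs_le_sub hvV)
    have := H _ S' S'' _ _ d1 d2 c2 hasDerivAt_inv_one_add_sq
      (by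
        refine Continuous.div (by fun_prop) (by fun_prop) fun t => ?_
        positivity)
      abs_inv_one_add_sq_le abs_deriv_inv_one_add_sq_le (fun t => (b1 t).trans (by norm_num))
      (fun t => (b2 t).trans (by norm_num))
      (fun t _ => (hclose t).1.trans (by nlinarith)) (fun t _ => by
        rw [e1 t, show h₃ + 1 * t = t + h₃ by ring, show -h₃ + 1 * t = t - h₃ by ring, one_mul,
          one_mul]
        exact (hclose t).2.trans he2) χ ζ (c * χ - 2 * ξ * v) hL
      (by
        have h1 : c * χ - 2 * ξ * v - χ = (c - 1) * χ - 2 * (ξ * v) := by ring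
        rw [h1]
        refine (abs_sub _ _).trans ?_
        rw [abs_mul, abs_mul, abs_mul, abs_two]
        have h2 : |c - 1| * |χ| ≤ ω / 2 * (|χ| + |ζ|) := by
          gcongr
          · have := hn.c_le
            nlinarith
          · linarith [abs_nonneg ζ]
        have h3 : |ξ| * |v| ≤ |ξ| * V := by gcongr
        rw [div_mul_eq_mul_div, div_le_iff₀ hω] at hN
        nlinarith)
    unfold corrIntegrand
    rw [intervalIntegral.integral_const_mul, norm_mul, Complex.norm_real, Real.norm_eq_abs]
    exact (mul_le_of_le_one_left (norm_nonneg _) (abs_exp_neg_two_sq_le v)).trans this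
  refine (intervalIntegral.norm_integral_le_of_norm_le_const key).trans (le_of_eq ?_)
  rw [sub_neg_eq_add, abs_of_pos (by linarith)]
  field_simp
  norm_num

/-- When ξ dominates, the oscillation is in v, so the order of integration is exchanged. The profile
depends on v only through e v and is thus nearly constant in that variable. -/
lemma exists_norm_corr_le_of_transverse {V T N : ℝ} (hV : 1 ≤ V) (hT : 1 ≤ T) (hN : 0 ≤ N) {ε : ℝ}
    (hε : 0 < ε) :
    ∃ M > 0, ∃ e₀ > 0, e₀ ≤ 1 / 4 ∧ ∀ c e h₁ h₂ h₃,
      NearNormalised e₀ c e h₁ h₂ h₃ → ∀ χ ξ ζ, |χ| + |ζ| ≤ N * |ξ| → M ≤ |ξ| →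
        ‖∫ v in (-V)..V, ∫ t in (-T)..T, corrIntegrand c e h₁ h₂ h₃ χ ξ ζ v t‖ ≤ ε := by
  have hV0 : 0 < V := by linarith
  have hT0 : 0 < T := by linarith
  obtain ⟨ω, hω, M, hM, H⟩ := exists_norm_integral_transverse_le hV (N := (2 + T) * N)
    (by positivity) (s₀ := 1 / (2 * (1 + T))) (by positivity) (ε := ε / (2 * T)) (by positivity)
  refine ⟨M, hM, min (min (1 / 4) (ω / 4)) (1 / (4 * (1 + T) * (4 + V))), by positivity,
    (min_le_left _ _).trans (min_le_left _ _), ?_⟩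
  set e₀ := min (min (1 / 4) (ω / 4)) (1 / (4 * (1 + T) * (4 + V)))
  have he0 : 0 < e₀ := by positivity
  have he1 : e₀ ≤ 1 / 4 := (min_le_left _ _).trans (min_le_left _ _)
  have he2 : 4 * e₀ ≤ ω := by
    have : e₀ ≤ ω / 4 := (min_le_left _ _).trans (min_le_right _ _)
    linarith
  have he3 : 2 * (e₀ * (4 + V)) ≤ 1 / (2 * (1 + T)) := by
    have : e₀ ≤ 1 / (4 * (1 + T) * (4 + V)) := min_le_right _ _
    rw [le_div_iff₀ (by positivity)] at this ⊢
    linarith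
  intro c e h₁ h₂ h₃ hn χ ξ ζ hL hξ
  have ha := hn.half_le_add he1
  have ha' := hn.half_le_sub he1
  rw [interval_integral_swap (by linarith) (by linarith) (continuous_corrIntegrand ha ha' χ ξ ζ)]
  have key : ∀ t ∈ Set.uIoc (-T) T,
      ‖∫ v in (-V)..V, corrIntegrand c e h₁ h₂ h₃ χ ξ ζ v t‖ ≤ ε / (2 * T) := by
    intro t ht
    rw [Set.uIoc_of_le (by linarith)] at ht
    have htT : |t| ≤ T := abs_le.2 ⟨ht.1.le, ht.2⟩
    obtain ⟨S', S'', d1, d2, c2, b1, b2, -⟩ := exists_deriv_two_div_rad_add ha ha'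
      (b := t + h₃) (b' := t - h₃) (p := h₂) (p' := h₂) (q := -e) (q' := e) (κ := |e|)
      (by simp) (by simp)
    have hS : (fun u => 2 / (rad (c + h₁) (t + h₃) (h₂ + -e * u) +
        rad (c - h₁) (t - h₃) (h₂ + e * u))) = fun u => profile c e h₁ h₂ h₃ u t := by
      funext u
      unfold profile
      rw [rad_comm (c + h₁) (t + h₃), rad_comm (c - h₁) (t - h₃), neg_mul, ← sub_eq_add_neg]
    rw [hS] at d1
    have := H _ S' S'' _ _ d1 d2 c2 hasDerivAt_exp_neg_two_sq (by fun_prop)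
      abs_exp_neg_two_sq_le abs_deriv_exp_neg_two_sq_le
      (fun v hv => by
        have h1 := abs_le.1 (hn.abs_profile_sub_le he1 (abs_le.2 hv) t)
        have h2 : 1 / (1 + T) ≤ 1 / √(1 + t ^ 2) := by
          have : √(1 + t ^ 2) ≤ 1 + T :=
            Real.sqrt_le_iff.2 ⟨by positivity, by nlinarith [sq_abs t, abs_nonneg t]⟩
          gcongr
        have h3 : 1 / (1 + T) = 1 / (2 * (1 + T)) + 1 / (2 * (1 + T)) := by field_simp; norm_num
        linarith)
      (fun v => (b1 v).trans (by linarith [hn.e_le]))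
      (fun v => (b2 v).trans (by
        have := hn.e_le.trans he1
        nlinarith [abs_nonneg e])) ξ (c * χ + ζ * t) hξ
      (by
        refine (abs_add_le _ _).trans ?_
        rw [abs_mul, abs_mul]
        have h1 : |c| ≤ 2 := by
          have := abs_le.1 (hn.c_le.trans he1)
          exact abs_le.2 ⟨by linarith, by linarith⟩
        calc |c| * |χ| + |ζ| * |t| ≤ (2 + T) * |χ| + |ζ| * (2 + T) := by gcongr <;> linarith
          _ = (2 + T) * (|χ| + |ζ|) := by ring
          _ ≤ (2 + T) * (N * |ξ|) := by gcongr
          _ = _ := by ring)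
    have hrw : ∀ v, corrIntegrand c e h₁ h₂ h₃ χ ξ ζ v t = ((1 / (1 + t ^ 2) : ℝ) : ℂ) *
        ((Real.exp (-2 * v ^ 2) : ℂ) * Complex.exp (Complex.I *
          ((c * χ + ζ * t - 2 * ξ * v) * profile c e h₁ h₂ h₃ v t : ℝ))) := by
      intro v
      unfold corrIntegrand
      rw [show c * χ + ζ * t - 2 * ξ * v = c * χ - 2 * ξ * v + ζ * t by ring]
      ring
    simp_rw [hrw]
    rw [intervalIntegral.integral_const_mul, norm_mul, Complex.norm_real, Real.norm_eq_abs]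
    exact (mul_le_of_le_one_left (norm_nonneg _) (abs_inv_one_add_sq_le t)).trans this
  refine (intervalIntegral.norm_integral_le_of_norm_le_const key).trans (le_of_eq ?_)
  rw [sub_neg_eq_add, abs_of_pos (by linarith)]
  field_simp
  norm_num

lemma norm_exp_I_mul_sub_le (x y : ℝ) :
    ‖Complex.exp (Complex.I * x) - Complex.exp (Complex.I * y)‖ ≤ |x - y| := by
  have : Complex.exp (Complex.I * x) - Complex.exp (Complex.I * y) =
      Complex.exp (Complex.I * y) * (Complex.exp (Complex.I * (x - y : ℝ)) - 1) := by
    rw [mul_sub, ← Complex.exp_add, mul_one]; congr 2; push_cast; ring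
  rw [this, norm_mul, mul_comm Complex.I, Complex.norm_exp_ofReal_mul_I, one_mul]
  exact Real.norm_exp_I_mul_ofReal_sub_one_le

/-- With bounded frequencies no oscillation is needed: on the box the phases differ by at most a
constant times e₀, and the exponential is 1-Lipschitz on the imaginary axis. -/
lemma exists_norm_corr_sub_le_of_bounded {V T B : ℝ} (hV : 1 ≤ V) (hT : 1 ≤ T) (hB : 0 < B) {ε : ℝ}
    (hε : 0 < ε) :
    ∃ e₀ > 0, e₀ ≤ 1 / 4 ∧ ∀ c e h₁ h₂ h₃,
      NearNormalised e₀ c e h₁ h₂ h₃ → ∀ χ ξ ζ, |χ| + |ζ| ≤ B → |ξ| ≤ B →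
        ‖(∫ v in (-V)..V, ∫ t in (-T)..T, corrIntegrand c e h₁ h₂ h₃ χ ξ ζ v t) -
          ∫ v in (-V)..V, ∫ t in (-T)..T, corrIntegrand 1 0 0 0 0 χ ξ ζ v t‖ ≤ ε := by
  have hV0 : 0 < V := by linarith
  have hT0 : 0 < T := by linarith
  set κ : ℝ := 2 * B + (1 + T + 2 * V) * B * (2 * (4 + V)) with hκ
  have hκ0 : 0 < κ := by positivity
  refine ⟨min (1 / 4) (ε / (2 * V * (2 * T) * κ)), by positivity, min_le_left _ _, ?_⟩
  set e₀ := min (1 / 4) (ε / (2 * V * (2 * T) * κ))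
  have he0 : 0 < e₀ := by positivity
  have he1 : e₀ ≤ 1 / 4 := min_le_left _ _
  have he2 : e₀ * κ * (2 * T) * (2 * V) ≤ ε := by
    have : e₀ ≤ ε / (2 * V * (2 * T) * κ) := min_le_right _ _
    rw [le_div_iff₀ (by positivity)] at this
    linarith
  intro c e h₁ h₂ h₃ hn χ ξ ζ hL hξ
  have c1 := continuous_corrIntegrand (e := e) (h₂ := h₂) (h₃ := h₃) (hn.half_le_add he1)
    (hn.half_le_sub he1) χ ξ ζ
  have c2 := continuous_corrIntegrand (c := 1) (e := 0) (h₁ := 0) (h₂ := 0) (h₃ := 0) (by norm_num)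
    (by norm_num) χ ξ ζ
  have hinner : ∀ {F : ℝ → ℝ → ℂ}, Continuous (fun q : ℝ × ℝ => F q.1 q.2) → ∀ v,
      Continuous (F v) := fun h v => h.comp (Continuous.prodMk_right v)
  have houter : ∀ {F : ℝ → ℝ → ℂ}, Continuous (fun q : ℝ × ℝ => F q.1 q.2) →
      Continuous fun v => ∫ t in (-T)..T, F v t := fun h =>
    intervalIntegral.continuous_parametric_intervalIntegral_of_continuous' h _ _
  rw [← intervalIntegral.integral_sub ((houter c1).intervalIntegrable _ _)
    ((houter c2).intervalIntegrable _ _)]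
  have key : ∀ v ∈ Set.uIoc (-V) V,
      ‖(∫ t in (-T)..T, corrIntegrand c e h₁ h₂ h₃ χ ξ ζ v t) -
        ∫ t in (-T)..T, corrIntegrand 1 0 0 0 0 χ ξ ζ v t‖ ≤ e₀ * κ * (2 * T) := by
    intro v hv
    rw [Set.uIoc_of_le (by linarith)] at hv
    have hvV : |v| ≤ V := abs_le.2 ⟨hv.1.le, hv.2⟩
    rw [← intervalIntegral.integral_sub ((hinner c1 v).intervalIntegrable _ _)
      ((hinner c2 v).intervalIntegrable _ _)]
    have key' : ∀ t ∈ Set.uIoc (-T) T, ‖corrIntegrand c e h₁ h₂ h₃ χ ξ ζ v t -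
        corrIntegrand 1 0 0 0 0 χ ξ ζ v t‖ ≤ e₀ * κ := by
      intro t ht
      rw [Set.uIoc_of_le (by linarith)] at ht
      have htT : |t| ≤ T := abs_le.2 ⟨ht.1.le, ht.2⟩
      unfold corrIntegrand
      rw [← mul_sub, ← mul_sub, norm_mul, norm_mul, Complex.norm_real, Complex.norm_real,
        Real.norm_eq_abs, Real.norm_eq_abs]
      refine (mul_le_of_le_one_left (by positivity) (abs_exp_neg_two_sq_le v)).trans ?_
      refine (mul_le_of_le_one_left (by positivity) (abs_inv_one_add_sq_le t)).trans ?_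
      refine (norm_exp_I_mul_sub_le _ _).trans ?_
      rw [profile_one_zero]
      have h1 := hn.abs_profile_sub_le he1 hvV t
      have h2 := hn.abs_profile_le he1 (v := v) t
      set S := profile c e h₁ h₂ h₃ v t
      have h3 : (c * χ - 2 * ξ * v + ζ * t) * S - (1 * χ - 2 * ξ * v + ζ * t) * (1 / √(1 + t ^ 2)) =
        (c - 1) * χ * S + (χ - 2 * ξ * v + ζ * t) * (S - 1 / √(1 + t ^ 2)) := by ring
      rw [h3]
      refine (abs_add_le _ _).trans ?_
      rw [abs_mul, abs_mul, abs_mul]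
      have hχ : |χ| ≤ B := by linarith [abs_nonneg ζ]
      have hζ : |ζ| ≤ B := by linarith [abs_nonneg χ]
      have h4 : |χ - 2 * ξ * v + ζ * t| ≤ (1 + T + 2 * V) * B := by
        have a1 := abs_add_le (χ - 2 * ξ * v) (ζ * t)
        have a2 := abs_sub χ (2 * ξ * v)
        have a3 : |2 * ξ * v| ≤ 2 * B * V := by rw [abs_mul, abs_mul, abs_two]; gcongr
        have a4 : |ζ * t| ≤ B * T := by rw [abs_mul]; gcongr
        nlinarith
      calc _ ≤ e₀ * B * 2 + (1 + T + 2 * V) * B * (2 * (e₀ * (4 + V))) := by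
            gcongr
            exact hn.c_le
        _ = e₀ * κ := by rw [hκ]; ring
    refine (intervalIntegral.norm_integral_le_of_norm_le_const key').trans (le_of_eq ?_)
    rw [sub_neg_eq_add, abs_of_pos (by linarith)]
    ring
  refine (intervalIntegral.norm_integral_le_of_norm_le_const key).trans (le_of_eq_of_le ?_ he2)
  rw [sub_neg_eq_add, abs_of_pos (by linarith)]
  ring

/-- The correlation integral over a box is uniformly close to its normalised version, whatever the
size of the frequencies. -/
lemma exists_norm_corr_sub_le {V T : ℝ} (hV : 1 ≤ V) (hT : 1 ≤ T) {ε : ℝ} (hε : 0 < ε) :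
    ∃ e₀ > 0, e₀ ≤ 1 / 4 ∧ ∀ c e h₁ h₂ h₃, NearNormalised e₀ c e h₁ h₂ h₃ → ∀ χ ξ ζ,
        ‖(∫ v in (-V)..V, ∫ t in (-T)..T, corrIntegrand c e h₁ h₂ h₃ χ ξ ζ v t) -
          ∫ v in (-V)..V, ∫ t in (-T)..T, corrIntegrand 1 0 0 0 0 χ ξ ζ v t‖ ≤ ε := by
  obtain ⟨N, hN, M, hM, e₁, he₁, he₁', H₁⟩ := exists_norm_corr_le_of_along hV hT (half_pos hε)
  obtain ⟨M', hM', e₂, he₂, -, H₂⟩ :=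
    exists_norm_corr_le_of_transverse hV hT hN.le (half_pos hε)
  -- This bound covers the two cases left by the oscillation estimates: |χ| + |ζ| < M with |ξ| ≤
  -- M/N, and |ξ| < M' with |χ| + |ζ| ≤ N M'.
  obtain ⟨e₃, he₃, -, H₃⟩ := exists_norm_corr_sub_le_of_bounded hV hT
    (B := M + M / N + M' + N * M') (by positivity) hε
  have p1 : 0 < M / N := by positivity
  have p2 : 0 < N * M' := by positivity
  refine ⟨min e₁ (min e₂ e₃), by positivity, (min_le_left _ _).trans he₁', ?_⟩
  intro c e h₁ h₂ h₃ hn χ ξ ζ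
  have n1 := hn.mono (min_le_left _ _)
  have n2 := hn.mono ((min_le_right _ _).trans (min_le_left _ _))
  have n3 := hn.mono ((min_le_right _ _).trans (min_le_right _ _))
  by_cases hA : N * |ξ| ≤ |χ| + |ζ|
  · by_cases hL : M ≤ |χ| + |ζ|
    · have a := H₁ _ _ _ _ _ n1 χ ξ ζ hA hL
      have b := H₁ _ _ _ _ _ (NearNormalised.refl he₁.le) χ ξ ζ hA hL
      exact (norm_sub_le _ _).trans (by linarith)
    · push Not at hL
      refine H₃ _ _ _ _ _ n3 χ ξ ζ (by linarith) ?_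
      have : |ξ| ≤ M / N := by rw [le_div_iff₀ hN]; linarith
      linarith
  · push Not at hA
    by_cases hξ : M' ≤ |ξ|
    · have a := H₂ _ _ _ _ _ n2 χ ξ ζ hA.le hξ
      have b := H₂ _ _ _ _ _ (NearNormalised.refl he₂.le) χ ξ ζ hA.le hξ
      exact (norm_sub_le _ _).trans (by linarith)
    · push Not at hξ
      have : |χ| + |ζ| ≤ N * M' := hA.le.trans (by gcongr)
      exact H₃ _ _ _ _ _ n3 χ ξ ζ (by linarith) (by linarith)

/-! ### The correlation profile as a limit of integrals over boxes -/

/-- Substituting t = tan θ absorbs the weight 1/(1 + t²) and turns 1/√(1 + t²) and t/√(1 + t²) into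
cos θ and sin θ. The angle θ is the elevation of the scatterer seen from the camera. -/
lemma integral_corrIntegrand_one (χ ξ ζ v T : ℝ) :
    ∫ t in (-T)..T, corrIntegrand 1 0 0 0 0 χ ξ ζ v t =
      ∫ θ in (-Real.arctan T)..(Real.arctan T), (Real.exp (-2 * v ^ 2) : ℂ) *
        Complex.exp (Complex.I * ((χ - 2 * ξ * v) * Real.cos θ + ζ * Real.sin θ : ℝ)) := by
  rw [← Real.arctan_neg, ← intervalIntegral.integral_deriv_smul_comp (f := Real.arctan)
    (f' := fun t => 1 / (1 + t ^ 2)) (a := -T) (b := T)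
    (g := fun θ => (Real.exp (-2 * v ^ 2) : ℂ) *
        Complex.exp (Complex.I * ((χ - 2 * ξ * v) * Real.cos θ + ζ * Real.sin θ : ℝ)))
    (fun t _ => Real.hasDerivAt_arctan t) (by
      refine Continuous.continuousOn (continuous_const.div (by fun_prop) fun t => ?_)
      positivity) (by fun_prop)]
  refine intervalIntegral.integral_congr fun t _ => ?_
  simp only [Function.comp_apply, corrIntegrand, profile_one_zero, Real.cos_arctan, Real.sin_arctan]
  rw [show (1 * χ - 2 * ξ * v + ζ * t) * (1 / √(1 + t ^ 2)) =
    (χ - 2 * ξ * v) * (1 / √(1 + t ^ 2)) + ζ * (t / √(1 + t ^ 2)) by ring]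
  rw [Complex.real_smul]
  ring

/-- The change of angle α = π/2 - θ, which exchanges sine and cosine. -/
lemma pi_mul_Psi (χ ξ ζ : ℝ) :
    (Real.pi : ℂ) * Psi χ ξ ζ = ∫ θ in (-(Real.pi / 2))..(Real.pi / 2),
      Complex.exp (Complex.I * (χ * Real.cos θ + ζ * Real.sin θ : ℝ)) *
        (Real.exp (-(ξ ^ 2 / 2) * Real.cos θ ^ 2) : ℂ) := by
  have hpi : (Real.pi : ℂ) ≠ 0 := by exact_mod_cast Real.pi_ne_zero
  unfold Psi
  rw [← mul_assoc, mul_one_div_cancel hpi, one_mul]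
  have h := intervalIntegral.integral_comp_sub_left (a := -(Real.pi / 2)) (b := Real.pi / 2)
    (fun α : ℝ => Complex.exp (Complex.I * ((Real.sin α : ℂ) * (χ : ℂ) + (Real.cos α : ℂ) * (ζ : ℂ))) *
      Complex.exp (-((ξ : ℂ) ^ 2 / 2) * (Real.sin α : ℂ) ^ 2)) (Real.pi / 2)
  rw [show Real.pi / 2 - Real.pi / 2 = 0 by ring, show Real.pi / 2 - -(Real.pi / 2) = Real.pi by ring]
    at h
  rw [← h]
  refine intervalIntegral.integral_congr fun θ _ => ?_
  simp only [Real.sin_pi_div_two_sub, Real.cos_pi_div_two_sub]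
  push_cast
  ring_nf

lemma norm_pi_mul_Psi_le (χ ξ ζ : ℝ) : ‖(Real.pi : ℂ) * Psi χ ξ ζ‖ ≤ Real.pi := by
  rw [pi_mul_Psi]
  have := intervalIntegral.norm_integral_le_of_norm_le_const (a := -(Real.pi / 2))
    (b := Real.pi / 2) (C := 1) (f := fun θ : ℝ =>
      Complex.exp (Complex.I * (χ * Real.cos θ + ζ * Real.sin θ : ℝ)) *
        (Real.exp (-(ξ ^ 2 / 2) * Real.cos θ ^ 2) : ℂ)) (fun θ _ => by
    rw [norm_mul, mul_comm Complex.I, Complex.norm_exp_ofReal_mul_I, one_mul, Complex.norm_real,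
      Real.norm_of_nonneg (Real.exp_pos _).le]
    refine Real.exp_le_one_iff.2 ?_
    nlinarith [sq_nonneg (ξ * Real.cos θ)])
  rwa [one_mul, sub_neg_eq_add, add_halves, abs_of_pos Real.pi_pos] at this

lemma integrable_exp_neg_two_sq : Integrable fun v : ℝ => Real.exp (-2 * v ^ 2) :=
  integrable_exp_neg_mul_sq two_pos

lemma integral_exp_neg_two_sq_le {V : ℝ} (hV : 0 ≤ V) :
    ∫ v in (-V)..V, Real.exp (-2 * v ^ 2) ≤ √(Real.pi / 2) := by
  rw [intervalIntegral.integral_of_le (by linarith), ← integral_gaussian]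
  exact setIntegral_le_integral integrable_exp_neg_two_sq (ae_of_all _ fun v => (Real.exp_pos _).le)

lemma integral_gaussian_mul_exp (a b : ℝ) :
    ∫ v : ℝ, (Real.exp (-2 * v ^ 2) : ℂ) * Complex.exp (Complex.I * (a - 2 * b * v : ℝ)) =
      Complex.exp (Complex.I * a) * ((√(Real.pi / 2) * Real.exp (-(b ^ 2 / 2)) : ℝ) : ℂ) := by
  have h := fourierIntegral_gaussian (b := 2) (by norm_num) (-2 * b : ℂ)
  have h1 : ∀ v : ℝ, (Real.exp (-2 * v ^ 2) : ℂ) * Complex.exp (Complex.I * (a - 2 * b * v : ℝ)) =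
      Complex.exp (Complex.I * a) *
        (Complex.exp (Complex.I * (-2 * b) * v) * Complex.exp (-2 * (v : ℂ) ^ 2)) := by
    intro v
    rw [Complex.ofReal_exp, ← Complex.exp_add, ← Complex.exp_add, ← Complex.exp_add]
    congr 1; push_cast; ring
  simp_rw [h1]
  rw [integral_const_mul, h]
  congr 1
  rw [Complex.ofReal_mul, Complex.ofReal_exp]
  congr 1
  · rw [Real.sqrt_eq_rpow, Complex.ofReal_cpow (by positivity)]
    push_cast; rfl
  · congr 1; push_cast; ring

/-- The truncation error is at most the mass of the Gaussian tail, so it is uniform in the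
frequencies; this is why the box can be chosen before them. -/
lemma norm_integral_gaussian_truncated_sub_le {V : ℝ} (hV : 0 ≤ V) (a b : ℝ) :
    ‖(∫ v in (-V)..V, (Real.exp (-2 * v ^ 2) : ℂ) * Complex.exp (Complex.I * (a - 2 * b * v : ℝ))) -
      Complex.exp (Complex.I * a) * ((√(Real.pi / 2) * Real.exp (-(b ^ 2 / 2)) : ℝ) : ℂ)‖ ≤
      √(Real.pi / 2) - ∫ v in (-V)..V, Real.exp (-2 * v ^ 2) := by
  rw [← integral_gaussian_mul_exp, ← integral_gaussian, intervalIntegral.integral_of_le (by linarith),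
    intervalIntegral.integral_of_le (by linarith)]
  have hn : ∀ v : ℝ, ‖(Real.exp (-2 * v ^ 2) : ℂ) * Complex.exp (Complex.I * (a - 2 * b * v : ℝ))‖ =
      Real.exp (-2 * v ^ 2) := fun v => by
    rw [norm_mul, mul_comm Complex.I, Complex.norm_exp_ofReal_mul_I, mul_one, Complex.norm_real,
      Real.norm_of_nonneg (Real.exp_pos _).le]
  have hi : Integrable fun v : ℝ =>
      (Real.exp (-2 * v ^ 2) : ℂ) * Complex.exp (Complex.I * (a - 2 * b * v : ℝ)) :=
    integrable_exp_neg_two_sq.mono' (Continuous.aestronglyMeasurable (by fun_prop))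
      (ae_of_all _ fun v => (hn v).le)
  have h1 := integral_add_compl (measurableSet_Ioc (a := -V) (b := V)) hi
  have h2 := integral_add_compl (measurableSet_Ioc (a := -V) (b := V)) integrable_exp_neg_two_sq
  rw [← h1, ← h2, sub_add_cancel_left, norm_neg, add_sub_cancel_left]
  refine (norm_integral_le_integral_norm _).trans (le_of_eq ?_)
  simp_rw [hn]

/-- The truncation of t costs the two missing arcs of angle π/2 - arctan T, and the truncation of v
costs the Gaussian tail. In between, the Gaussian integral over v produces the factor exp(-ξ² cos² θ
/ 2). -/
lemma norm_box_sub_Psi_le {V T : ℝ} (hV : 0 ≤ V) (hT : 0 ≤ T) (χ ξ ζ : ℝ) :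
    ‖(∫ v in (-V)..V, ∫ t in (-T)..T, corrIntegrand 1 0 0 0 0 χ ξ ζ v t) -
      (√(Real.pi / 2) : ℂ) * (Real.pi * Psi χ ξ ζ)‖ ≤
      √(Real.pi / 2) * (2 * (Real.pi / 2 - Real.arctan T)) +
        Real.pi * (√(Real.pi / 2) - ∫ v in (-V)..V, Real.exp (-2 * v ^ 2)) := by
  simp_rw [integral_corrIntegrand_one]
  set E : ℝ → ℝ → ℂ := fun v θ => (Real.exp (-2 * v ^ 2) : ℂ) *
    Complex.exp (Complex.I * ((χ - 2 * ξ * v) * Real.cos θ + ζ * Real.sin θ : ℝ)) with hE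
  have hEn : ∀ v θ, ‖E v θ‖ = Real.exp (-2 * v ^ 2) := fun v θ => by
    simp only [hE]
    rw [norm_mul, mul_comm Complex.I, Complex.norm_exp_ofReal_mul_I, mul_one, Complex.norm_real,
      Real.norm_of_nonneg (Real.exp_pos _).le]
  have cE : Continuous fun q : ℝ × ℝ => E q.1 q.2 := by simp only [hE]; fun_prop
  have cE1 : ∀ v, Continuous (E v) := fun v => cE.comp (Continuous.prodMk_right v)
  have cE2 : ∀ a b : ℝ, Continuous fun v => ∫ θ in a..b, E v θ := fun a b =>
    intervalIntegral.continuous_parametric_intervalIntegral_of_continuous' cE _ _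
  have cE3 : Continuous fun θ => ∫ v in (-V)..V, E v θ :=
    intervalIntegral.continuous_parametric_intervalIntegral_of_continuous'
      (f := fun θ v => E v θ) (cE.comp continuous_swap) _ _
  set A := Real.arctan T
  have hA0 : 0 ≤ A := Real.arctan_nonneg.2 hT
  have hA1 : A < Real.pi / 2 := Real.arctan_lt_pi_div_two T
  have e1 : ‖(∫ v in (-V)..V, ∫ θ in (-A)..A, E v θ) -
      ∫ v in (-V)..V, ∫ θ in (-(Real.pi / 2))..(Real.pi / 2), E v θ‖ ≤
      √(Real.pi / 2) * (2 * (Real.pi / 2 - A)) := by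
    rw [← intervalIntegral.integral_sub ((cE2 _ _).intervalIntegrable _ _)
      ((cE2 _ _).intervalIntegrable _ _)]
    refine (intervalIntegral.norm_integral_le_of_norm_le (g := fun v => Real.exp (-2 * v ^ 2) *
      (2 * (Real.pi / 2 - A))) (by linarith) (ae_of_all _ fun v _ => ?_)
      (Continuous.intervalIntegrable (by fun_prop) _ _)).trans ?_
    · rw [intervalIntegral.integral_interval_sub_interval_comm ((cE1 v).intervalIntegrable _ _)
        ((cE1 v).intervalIntegrable _ _) ((cE1 v).intervalIntegrable _ _)]
      have b1 := intervalIntegral.norm_integral_le_of_norm_le_const (a := -A) (b := -(Real.pi / 2))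
        (f := E v) (C := Real.exp (-2 * v ^ 2)) fun θ _ => (hEn v θ).le
      have b2 := intervalIntegral.norm_integral_le_of_norm_le_const (a := A) (b := Real.pi / 2)
        (f := E v) (C := Real.exp (-2 * v ^ 2)) fun θ _ => (hEn v θ).le
      rw [abs_of_neg (by linarith)] at b1
      rw [abs_of_pos (by linarith)] at b2
      refine (norm_sub_le _ _).trans ?_
      linarith
    · rw [intervalIntegral.integral_mul_const]
      exact mul_le_mul_of_nonneg_right (integral_exp_neg_two_sq_le hV) (by linarith)
  have e2 : ‖(∫ v in (-V)..V, ∫ θ in (-(Real.pi / 2))..(Real.pi / 2), E v θ) -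
      (√(Real.pi / 2) : ℂ) * (Real.pi * Psi χ ξ ζ)‖ ≤
      Real.pi * (√(Real.pi / 2) - ∫ v in (-V)..V, Real.exp (-2 * v ^ 2)) := by
    rw [interval_integral_swap (by linarith) (by linarith [Real.pi_pos]) cE, pi_mul_Psi,
      ← intervalIntegral.integral_const_mul, ← intervalIntegral.integral_sub
        (cE3.intervalIntegrable _ _) (Continuous.intervalIntegrable (by fun_prop) _ _)]
    refine (intervalIntegral.norm_integral_le_of_norm_le_const
      (C := √(Real.pi / 2) - ∫ v in (-V)..V, Real.exp (-2 * v ^ 2)) fun θ _ => ?_).trans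
      (le_of_eq ?_)
    · have h := norm_integral_gaussian_truncated_sub_le hV
        (χ * Real.cos θ + ζ * Real.sin θ) (ξ * Real.cos θ)
      refine le_of_eq_of_le ?_ h
      congr 2
      · refine intervalIntegral.integral_congr fun v _ => ?_
        simp only [hE]
        congr 4; ring
      · push_cast
        rw [show -((ξ : ℂ) ^ 2 / 2) * Complex.cos θ ^ 2 = -((ξ * Complex.cos θ) ^ 2 / 2) by ring]
        ring
    · rw [sub_neg_eq_add, add_halves, abs_of_pos Real.pi_pos]; ring
  calc _ = ‖((∫ v in (-V)..V, ∫ θ in (-A)..A, E v θ) -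
      ∫ v in (-V)..V, ∫ θ in (-(Real.pi / 2))..(Real.pi / 2), E v θ) +
      ((∫ v in (-V)..V, ∫ θ in (-(Real.pi / 2))..(Real.pi / 2), E v θ) -
      (√(Real.pi / 2) : ℂ) * (Real.pi * Psi χ ξ ζ))‖ := by congr 1; ring
    _ ≤ _ := (norm_add_le _ _).trans (add_le_add e1 e2)

/-- On large boxes the normalised correlation integral is uniformly close to its limit. -/
lemma exists_norm_box_sub_Psi_le {ε : ℝ} (hε : 0 < ε) :
    ∃ V₀ ≥ 1, ∃ T₀ ≥ 1, ∀ V ≥ V₀, ∀ T ≥ T₀, ∀ χ ξ ζ : ℝ,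
      ‖((∫ v in (-V)..V, Real.exp (-2 * v ^ 2) : ℝ) : ℂ) *
          (∫ v in (-V)..V, ∫ t in (-T)..T, corrIntegrand 1 0 0 0 0 χ ξ ζ v t) -
        (Real.pi ^ 2 / 2 : ℝ) * Psi χ ξ ζ‖ ≤ ε := by
  have h1 : ∀ᶠ T in atTop, Real.pi / 2 - Real.arctan T < ε / 16 := by
    have := (tendsto_const_nhds (x := Real.pi / 2)).sub
      (Real.tendsto_arctan_atTop.mono_right nhdsWithin_le_nhds)
    rw [sub_self] at this
    exact this.eventually_lt_const (by positivity)
  have h2 : ∀ᶠ V in atTop, √(Real.pi / 2) - ∫ v in (-V)..V, Real.exp (-2 * v ^ 2) <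
      ε / (8 * Real.pi) := by
    have := (tendsto_const_nhds (x := √(Real.pi / 2))).sub
      (intervalIntegral_tendsto_integral integrable_exp_neg_two_sq tendsto_neg_atTop_atBot
        tendsto_id)
    rw [integral_gaussian, sub_self] at this
    exact this.eventually_lt_const (by have := Real.pi_pos; positivity)
  obtain ⟨T₀, hT₀⟩ := eventually_atTop.1 h1
  obtain ⟨V₀, hV₀⟩ := eventually_atTop.1 h2
  refine ⟨max 1 V₀, le_max_left _ _, max 1 T₀, le_max_left _ _, fun V hV T hT χ ξ ζ => ?_⟩
  have hV1 : 0 ≤ V := by linarith [le_max_left 1 V₀]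
  have hT1 : 0 ≤ T := by linarith [le_max_left 1 T₀]
  have a1 := hT₀ T ((le_max_right _ _).trans hT)
  have a2 := hV₀ V ((le_max_right _ _).trans hV)
  have hb := norm_box_sub_Psi_le hV1 hT1 χ ξ ζ
  have hg := integral_exp_neg_two_sq_le hV1
  have hg0 : 0 ≤ ∫ v in (-V)..V, Real.exp (-2 * v ^ 2) :=
    intervalIntegral.integral_nonneg (by linarith) fun v _ => (Real.exp_pos _).le
  have hP := norm_pi_mul_Psi_le χ ξ ζ
  have hs : √(Real.pi / 2) ≤ 2 := Real.sqrt_le_iff.2 ⟨by norm_num, by linarith [Real.pi_le_four]⟩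
  have hs2 : √(Real.pi / 2) * √(Real.pi / 2) = Real.pi / 2 :=
    Real.mul_self_sqrt (by linarith [Real.pi_pos])
  have hs0 : 0 ≤ √(Real.pi / 2) := Real.sqrt_nonneg _
  set γ := ∫ v in (-V)..V, Real.exp (-2 * v ^ 2)
  set J := ∫ v in (-V)..V, ∫ t in (-T)..T, corrIntegrand 1 0 0 0 0 χ ξ ζ v t
  set s := √(Real.pi / 2)
  have hpi := Real.pi_pos
  rw [lt_div_iff₀ (by positivity)] at a2
  -- The constant π²/2 is √(π/2) · √(π/2) · π: one Gaussian integral for each cross-range coordinate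
  -- and π from the normalisation of Ψ.
  have hsplit : (γ : ℂ) * J - (Real.pi ^ 2 / 2 : ℝ) * Psi χ ξ ζ =
      γ * (J - s * (Real.pi * Psi χ ξ ζ)) - ((s - γ : ℝ) : ℂ) * (s * (Real.pi * Psi χ ξ ζ)) := by
    have : ((Real.pi ^ 2 / 2 : ℝ) : ℂ) = s * s * Real.pi := by
      rw [← Complex.ofReal_mul, hs2]; push_cast; ring
    rw [this]; push_cast; ring
  rw [hsplit]
  refine (norm_sub_le _ _).trans ?_
  rw [norm_mul, norm_mul, norm_mul, Complex.norm_real, Complex.norm_real, Complex.norm_real,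
    Real.norm_of_nonneg hg0, Real.norm_of_nonneg hs0, Real.norm_of_nonneg (by linarith)]
  have b1 : γ * ‖J - s * (Real.pi * Psi χ ξ ζ)‖ ≤ 2 * (2 * (2 * (ε / 16)) + Real.pi * (s - γ)) := by
    have : 0 ≤ Real.pi / 2 - Real.arctan T := by linarith [Real.arctan_lt_pi_div_two T]
    refine mul_le_mul (by linarith) (hb.trans ?_) (norm_nonneg _) (by norm_num)
    gcongr
  have b2 : (s - γ) * (s * ‖(Real.pi : ℂ) * Psi χ ξ ζ‖) ≤ (s - γ) * (2 * Real.pi) := by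
    have : 0 ≤ s - γ := by linarith
    gcongr
  nlinarith

/-! ### Coordinates adapted to the midpoint -/

/-- The vector of the cross-range plane with coordinates `q` in the frame `(u, u^⊥)`. -/
def frame (u : Plane) (q : ℝ × ℝ) : Plane := q.1 • u + q.2 • rot u

lemma norm_sq_plane (w : Plane) : ‖w‖ ^ 2 = w 0 ^ 2 + w 1 ^ 2 := by
  simp [EuclideanSpace.norm_sq_eq, Fin.sum_univ_two]

lemma norm_rot (u : Plane) : ‖rot u‖ = ‖u‖ := by
  rw [← sq_eq_sq₀ (norm_nonneg _) (norm_nonneg _), norm_sq_plane, norm_sq_plane]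
  simp [rot]; ring

lemma norm_unit {w : Plane} (hw : 0 < ‖w‖) : ‖unit w‖ = 1 := by
  rw [unit, norm_smul, norm_inv, norm_norm, inv_mul_cancel₀ hw.ne']

lemma smul_unit {w : Plane} (hw : 0 < ‖w‖) : ‖w‖ • unit w = w := by
  rw [unit, smul_smul, mul_inv_cancel₀ hw.ne', one_smul]

lemma norm_sq_frame {u : Plane} (hu : ‖u‖ = 1) (q : ℝ × ℝ) :
    ‖frame u q‖ ^ 2 = q.1 ^ 2 + q.2 ^ 2 := by
  have h : u 0 ^ 2 + u 1 ^ 2 = 1 := by rw [← norm_sq_plane, hu]; norm_num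
  rw [norm_sq_plane]
  simp [frame, rot]
  linear_combination (q.1 ^ 2 + q.2 ^ 2) * h

lemma frame_inner {u : Plane} (hu : ‖u‖ = 1) (w : Plane) :
    frame u (inner ℝ u w, inner ℝ (rot u) w) = w := by
  have h : u 0 ^ 2 + u 1 ^ 2 = 1 := by rw [← norm_sq_plane, hu]; norm_num
  ext i
  fin_cases i
  · simp [frame, rot, PiLp.inner_apply, Fin.sum_univ_two]
    linear_combination w 0 * h
  · simp [frame, rot, PiLp.inner_apply, Fin.sum_univ_two]
    linear_combination w 1 * h

lemma frame_injective {u : Plane} (hu : ‖u‖ = 1) : Function.Injective (frame u) := by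
  intro q q' h
  have h0 : frame u (q.1 - q'.1, q.2 - q'.2) = 0 := by
    have : frame u (q.1 - q'.1, q.2 - q'.2) = frame u q - frame u q' := by
      simp only [frame, sub_smul]; abel
    rw [this, h, sub_self]
  have h1 := norm_sq_frame hu (q.1 - q'.1, q.2 - q'.2)
  rw [h0, norm_zero] at h1
  simp only at h1
  have e1 : q.1 - q'.1 = 0 := by nlinarith [sq_nonneg (q.1 - q'.1), sq_nonneg (q.2 - q'.2)]
  have e2 : q.2 - q'.2 = 0 := by nlinarith [sq_nonneg (q.1 - q'.1), sq_nonneg (q.2 - q'.2)]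
  exact Prod.ext (by linarith) (by linarith)

lemma measurePreserving_frame {u : Plane} (hu : ‖u‖ = 1) :
    MeasurePreserving (frame u) (volume.prod volume) volume := by
  let M : Plane →ₗ[ℝ] Plane :=
    { toFun := fun w => frame u (w 0, w 1)
      map_add' := fun w w' => by
        simp only [frame, PiLp.add_apply, add_smul]; abel
      map_smul' := fun c w => by
        simp only [frame, PiLp.smul_apply, smul_eq_mul, mul_smul, smul_add, RingHom.id_apply] }
  let N : Plane →ₗᵢ[ℝ] Plane := ⟨M, fun w => by
    rw [← sq_eq_sq₀ (norm_nonneg _) (norm_nonneg _), norm_sq_plane w]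
    exact norm_sq_frame hu _⟩
  have h1 := (N.toLinearIsometryEquiv rfl).measurePreserving
  have h2 : MeasurePreserving (@WithLp.toLp 2 (Fin 2 → ℝ)) := PiLp.volume_preserving_toLp (Fin 2)
  have h3 := (volume_preserving_finTwoArrow ℝ).symm
  have := h1.comp (h2.comp h3)
  refine this

/-- Coordinates centred at range `Z` on the beam axis, in the frame `u`, with cross-range unit `r`
and range unit `R`. -/
def boxMap (u : Plane) (r R Z : ℝ) (q : ℝ × ℝ × ℝ) : Space :=
  ofCrossRange (frame u (r * q.1, r * q.2.1), Z - R * q.2.2)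

lemma map_boxMap {u : Plane} (hu : ‖u‖ = 1) {r R : ℝ} (hr : 0 < r) (hR : 0 < R) (Z : ℝ) :
    MeasurableEmbedding (boxMap u r R Z) ∧
      Measure.map (boxMap u r R Z) volume = ENNReal.ofReal (1 / (r ^ 2 * R)) • volume := by
  have m0 := measurePreserving_ofCrossRange.comp
    (((measurePreserving_frame hu).prod (MeasurePreserving.id volume)).comp
      (measurePreserving_prodAssoc (volume : Measure ℝ) (volume : Measure ℝ)
        (volume : Measure ℝ)).symm)
  set f : ℝ × ℝ × ℝ → Space := ofCrossRange ∘ Prod.map (frame u) id ∘ MeasurableEquiv.prodAssoc.symm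
    with hf
  set s : ℝ × ℝ × ℝ → ℝ × ℝ × ℝ := Prod.map (r * ·) (Prod.map (r * ·) fun t => Z - R * t) with hs
  have hcomp : boxMap u r R Z = f ∘ s := by
    funext q; rfl
  have ms : Measurable s := by
    refine Measurable.prodMap (by fun_prop) (Measurable.prodMap (by fun_prop) (by fun_prop))
  constructor
  · refine Measurable.measurableEmbedding (by rw [hcomp]; exact m0.measurable.comp ms) ?_
    intro q q' h
    have h1 : (frame u (r * q.1, r * q.2.1), Z - R * q.2.2) =
        (frame u (r * q'.1, r * q'.2.1), Z - R * q'.2.2) :=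
      measurableEmbedding_ofCrossRange.injective h
    have h2 := frame_injective hu (Prod.ext_iff.1 h1).1
    have h3 := (Prod.ext_iff.1 h1).2
    have e1 : r * q.1 = r * q'.1 := (Prod.ext_iff.1 h2).1
    have e2 : r * q.2.1 = r * q'.2.1 := (Prod.ext_iff.1 h2).2
    have e3 : R * q.2.2 = R * q'.2.2 := by simp only at h3; linarith
    exact Prod.ext (mul_left_cancel₀ hr.ne' e1)
      (Prod.ext (mul_left_cancel₀ hr.ne' e2) (mul_left_cancel₀ hR.ne' e3))
  · rw [hcomp, ← Measure.map_map m0.measurable ms]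
    have hz : Measure.map (fun t : ℝ => Z - R * t) volume = ENNReal.ofReal R⁻¹ • volume := by
      have e : (fun t : ℝ => Z - R * t) = (fun t => Z - t) ∘ (R * ·) := rfl
      rw [e, ← Measure.map_map (by fun_prop) (by fun_prop), Real.map_volume_mul_left hR.ne',
        Measure.map_smul, abs_of_pos (inv_pos.2 hR),
        (Measure.measurePreserving_sub_left (volume : Measure ℝ) Z).map_eq]
    have hms : Measure.map s volume = ENNReal.ofReal (1 / (r ^ 2 * R)) • volume := by
      rw [hs]
      change Measure.map _ ((volume : Measure ℝ).prod ((volume : Measure ℝ).prod volume)) = _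
      rw [← Measure.map_prod_map _ _ (by fun_prop) (Measurable.prodMap (by fun_prop) (by fun_prop)),
        ← Measure.map_prod_map _ _ (by fun_prop) (by fun_prop), hz, Real.map_volume_mul_left hr.ne',
        Measure.prod_smul_left, Measure.prod_smul_right, Measure.prod_smul_right,
        Measure.prod_smul_left, Measure.prod_smul_right, smul_smul, smul_smul,
        abs_of_pos (inv_pos.2 hr), ← ENNReal.ofReal_mul (by positivity),
        ← ENNReal.ofReal_mul (by positivity)]
      congr 2
      field_simp
    rw [hms, Measure.map_smul]
    congr 1
    exact m0.map_eq

lemma setIntegral_boxMap {u : Plane} (hu : ‖u‖ = 1) {r R : ℝ} (hr : 0 < r) (hR : 0 < R) (Z : ℝ)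
    (F : Space → ℂ) (B : Set Space) :
    ∫ y in B, F y = (r ^ 2 * R : ℝ) * ∫ q in boxMap u r R Z ⁻¹' B, F (boxMap u r R Z q) := by
  obtain ⟨h1, h2⟩ := map_boxMap hu hr hR Z
  rw [← h1.setIntegral_map, h2, Measure.restrict_smul, integral_smul_measure,
    ENNReal.toReal_ofReal (by positivity), Complex.real_smul, ← mul_assoc, ← Complex.ofReal_mul,
    mul_one_div_cancel (by positivity)]
  simp

lemma integrable_comp_boxMap {u : Plane} (hu : ‖u‖ = 1) {r R : ℝ} (hr : 0 < r) (hR : 0 < R) (Z : ℝ)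
    {F : Space → ℂ} (hF : Integrable F) : Integrable fun q => F (boxMap u r R Z q) := by
  obtain ⟨h1, h2⟩ := map_boxMap hu hr hR Z
  have : Integrable F (Measure.map (boxMap u r R Z) volume) := by
    rw [h2]; exact hF.smul_measure ENNReal.ofReal_ne_top
  exact (h1.integrable_map_iff).1 this

/-- The coordinates of an offset in units of twice the cross-range distance. -/
lemma norm_sub_boxMap {X x : Space} (hR : 0 < ‖cross X‖) (r σ : ℝ) (v v' t : ℝ) :
    ‖X + σ • x - boxMap (unit (cross X)) r ‖cross X‖ (range X) (v, v', t)‖ =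
      ‖cross X‖ * rad (1 - r / ‖cross X‖ * v + σ * inner ℝ (unit (cross X)) (cross x) / ‖cross X‖)
        (σ * inner ℝ (rot (unit (cross X))) (cross x) / ‖cross X‖ - r / ‖cross X‖ * v')
        (t + σ * range x / ‖cross X‖) := by
  set R := ‖cross X‖ with hRd
  set u := unit (cross X) with hu
  have hu1 : ‖u‖ = 1 := norm_unit hR
  set a := inner ℝ u (cross x)
  set b := inner ℝ (rot u) (cross x)
  have hcx : cross x = frame u (a, b) := (frame_inner hu1 _).symm
  have hcX : cross X = frame u (R, 0) := by
    rw [frame, zero_smul, add_zero]; exact (smul_unit hR).symm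
  rw [← sq_eq_sq₀ (norm_nonneg _) (mul_nonneg hR.le (rad_nonneg _ _ _)), mul_pow, rad_sq, norm_sq_eq,
    cross_sub, range_sub, cross_add, range_add, cross_smul, range_smul, boxMap,
    cross_ofCrossRange, range_ofCrossRange]
  have : cross X + σ • cross x - frame u (r * v, r * v') =
      frame u (R + σ * a - r * v, σ * b - r * v') := by
    rw [hcx, hcX]
    simp only [frame, sub_smul, add_smul, mul_smul, smul_add, zero_smul]
    abel
  rw [this, norm_sq_frame hu1]
  field_simp
  ring

/-! ### The second-order integrand in adapted coordinates -/

/-- Both factors contain the same value of the beam, so its phase, wavefront curvature included,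
cancels and only its intensity survives. The remaining phase is the difference of the two path
lengths. -/
lemma greenBeam_mul_conj (p : Params) (x₁ x₂ y : Space) :
    greenBeam p x₁ y * conj (greenBeam p x₂ y) =
      ((‖beam p y‖ ^ 2 * Real.exp (-p.kd * (‖x₁ - y‖ + ‖x₂ - y‖)) /
        (16 * Real.pi ^ 2 * (‖x₁ - y‖ * ‖x₂ - y‖)) : ℝ) : ℂ) *
      Complex.exp (Complex.I * (p.k * (‖x₁ - y‖ - ‖x₂ - y‖) : ℝ)) := by
  have hb : beam p y * conj (beam p y) = ((‖beam p y‖ ^ 2 : ℝ) : ℂ) := by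
    rw [Complex.mul_conj, Complex.normSq_eq_norm_sq]
  unfold greenBeam green
  simp only [map_mul, map_div₀, map_one, ← Complex.exp_conj, map_sub, Complex.conj_I,
    Complex.conj_ofReal, map_ofNat]
  set r₁ := ‖x₁ - y‖
  set r₂ := ‖x₂ - y‖
  have he : Complex.exp ((Complex.I * (p.k : ℂ) - (p.kd : ℂ)) * (r₁ : ℂ)) *
      Complex.exp ((-Complex.I * (p.k : ℂ) - (p.kd : ℂ)) * (r₂ : ℂ)) =
      (Real.exp (-p.kd * (r₁ + r₂)) : ℂ) * Complex.exp (Complex.I * (p.k * (r₁ - r₂) : ℝ)) := by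
    rw [Complex.ofReal_exp, ← Complex.exp_add, ← Complex.exp_add]
    congr 1; push_cast; ring
  calc _ = (1 / (4 * (Real.pi : ℂ) * r₁) * (1 / (4 * (Real.pi : ℂ) * r₂))) *
        (Complex.exp ((Complex.I * (p.k : ℂ) - (p.kd : ℂ)) * (r₁ : ℂ)) *
        Complex.exp ((-Complex.I * (p.k : ℂ) - (p.kd : ℂ)) * (r₂ : ℂ))) *
        (beam p y * conj (beam p y)) := by ring
    _ = _ := by
      rw [he, hb]
      push_cast
      rw [div_mul_div_comm, show 4 * (Real.pi : ℂ) * r₁ * (4 * Real.pi * r₂) =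
        16 * (Real.pi : ℂ) ^ 2 * (r₁ * r₂) by ring]
      ring

lemma rad_neg_second (a b s : ℝ) : rad a (-b) s = rad a b s := by
  unfold rad; congr 1; ring

/-- The difference of the squared distances is four times the affine form in parentheses; dividing
by the sum of the distances gives that form times the profile. The identity is exact, so no Taylor
remainder is ever multiplied by the large wavenumber. -/
lemma rad_sub_rad_eq {c e h₁ h₂ h₃ v t : ℝ} (h : 1 / 2 ≤ c + h₁) (h' : 1 / 2 ≤ c - h₁) :
    rad (c + h₁) (h₂ - e * v) (t + h₃) - rad (c - h₁) (h₂ + e * v) (t - h₃) =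
      2 * (c * h₁ - h₂ * e * v + t * h₃) * profile c e h₁ h₂ h₃ v t := by
  have h1 := half_le_rad (b := h₂ - e * v) (s := t + h₃) h
  have h2 := half_le_rad (b := h₂ + e * v) (s := t - h₃) h'
  have e1 := rad_sq (c + h₁) (h₂ - e * v) (t + h₃)
  have e2 := rad_sq (c - h₁) (h₂ + e * v) (t - h₃)
  unfold profile
  set ρ₁ := rad (c + h₁) (h₂ - e * v) (t + h₃)
  set ρ₂ := rad (c - h₁) (h₂ + e * v) (t - h₃)
  have : 0 < ρ₁ + ρ₂ := by linarith
  field_simp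
  linear_combination e1 - e2

/-- The amplitude of the second-order integrand, relative to its value at the midpoint. -/
def corrAmplitude (κ b e h₁ h₂ h₃ v v' t : ℝ) : ℝ :=
  1 / (rad (1 - e * v + h₁) (h₂ - e * v') (t + h₃) *
    rad (1 - e * v - h₁) (h₂ + e * v') (t - h₃)) * (1 / b * Real.exp (-2 * (v ^ 2 + v' ^ 2) / b)) *
    Real.exp (-(κ * (rad (1 - e * v + h₁) (h₂ - e * v') (t + h₃) +
      rad (1 - e * v - h₁) (h₂ + e * v') (t - h₃) - 2 * t)))

/-- Still an exact identity: a common factor, a real amplitude and a phase that has the form of the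
normalised one with slightly perturbed geometric parameters. Approximation starts only afterwards,
separately for amplitude and phase. -/
lemma greenBeam_boxMap (p : Params) (hro : 0 < p.ro) {X x : Space} (hR : 0 < ‖cross X‖) {v v' t : ℝ}
    (hz : 0 < range X - ‖cross X‖ * t)
    (h : 1 / 2 ≤ 1 - p.ro / ‖cross X‖ * v + inner ℝ (unit (cross X)) (cross x) / (2 * ‖cross X‖))
    (h' : 1 / 2 ≤ 1 - p.ro / ‖cross X‖ * v - inner ℝ (unit (cross X)) (cross x) / (2 * ‖cross X‖)) :
    greenBeam p (X + (1 / 2 : ℝ) • x)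
        (boxMap (unit (cross X)) p.ro ‖cross X‖ (range X) (v, v', t)) *
      conj (greenBeam p (X - (1 / 2 : ℝ) • x)
        (boxMap (unit (cross X)) p.ro ‖cross X‖ (range X) (v, v', t))) =
    ((Real.exp (-2 * p.kd * range X) / (16 * Real.pi ^ 2 * ‖cross X‖ ^ 2) : ℝ) : ℂ) *
      (((corrAmplitude (p.kd * ‖cross X‖)
        (beamNormSq p (range X - ‖cross X‖ * t) / (p.ro ^ 2) ^ 2) (p.ro / ‖cross X‖)
        (inner ℝ (unit (cross X)) (cross x) / (2 * ‖cross X‖))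
        (inner ℝ (rot (unit (cross X))) (cross x) / (2 * ‖cross X‖))
        (range x / (2 * ‖cross X‖)) v v' t : ℝ) : ℂ) *
      Complex.exp (Complex.I * (((1 - p.ro / ‖cross X‖ * v) *
          (p.k * inner ℝ (unit (cross X)) (cross x)) -
          2 * (p.k * p.ro / (2 * ‖cross X‖) * inner ℝ (rot (unit (cross X))) (cross x)) * v' +
          p.k * range x * t) *
        profile (1 - p.ro / ‖cross X‖ * v) (p.ro / ‖cross X‖)
          (inner ℝ (unit (cross X)) (cross x) / (2 * ‖cross X‖))
          (inner ℝ (rot (unit (cross X))) (cross x) / (2 * ‖cross X‖))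
          (range x / (2 * ‖cross X‖)) v' t : ℝ))) := by
  have n1 := norm_sub_boxMap (x := x) hR p.ro (1 / 2) v v' t
  have n2 := norm_sub_boxMap (x := x) hR p.ro (-(1 / 2)) v v' t
  rw [neg_smul, ← sub_eq_add_neg] at n2
  have hu1 : ‖unit (cross X)‖ = 1 := norm_unit hR
  set R := ‖cross X‖
  set a := inner ℝ (unit (cross X)) (cross x)
  set b := inner ℝ (rot (unit (cross X))) (cross x)
  set e := p.ro / R with he
  rw [show 1 - e * v + 1 / 2 * a / R = 1 - e * v + a / (2 * R) by ring,
    show 1 / 2 * b / R - e * v' = b / (2 * R) - e * v' by ring,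
    show t + 1 / 2 * range x / R = t + range x / (2 * R) by ring] at n1
  rw [show 1 - e * v + -(1 / 2) * a / R = 1 - e * v - a / (2 * R) by ring,
    show -(1 / 2) * b / R - e * v' = -(b / (2 * R) + e * v') by ring, rad_neg_second,
    show t + -(1 / 2) * range x / R = t - range x / (2 * R) by ring] at n2
  have hd := rad_sub_rad_eq (e := e) (h₂ := b / (2 * R)) (h₃ := range x / (2 * R)) (v := v') (t := t)
    h h'
  have r1 := half_le_rad (b := b / (2 * R) - e * v') (s := t + range x / (2 * R)) h
  have r2 := half_le_rad (b := b / (2 * R) + e * v') (s := t - range x / (2 * R)) h'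
  have hrange : range (boxMap (unit (cross X)) p.ro R (range X) (v, v', t)) = range X - R * t := by
    simp [boxMap]
  have hcross : ‖cross (boxMap (unit (cross X)) p.ro R (range X) (v, v', t))‖ ^ 2 =
      p.ro ^ 2 * (v ^ 2 + v' ^ 2) := by
    rw [boxMap, cross_ofCrossRange, norm_sq_frame hu1]; ring
  rw [greenBeam_mul_conj, n1, n2, norm_beam_sq p hro (by rwa [hrange]), hrange, hcross, corrAmplitude]
  set S := profile (1 - e * v) e (a / (2 * R)) (b / (2 * R)) (range x / (2 * R)) v' t
  set ρ₁ := rad (1 - e * v + a / (2 * R)) (b / (2 * R) - e * v') (t + range x / (2 * R))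
  set ρ₂ := rad (1 - e * v - a / (2 * R)) (b / (2 * R) + e * v') (t - range x / (2 * R))
  have hph : p.k * (R * ρ₁ - R * ρ₂) = ((1 - e * v) * (p.k * a) - 2 * (p.k * p.ro / (2 * R) * b) * v' +
      p.k * range x * t) * S := by
    rw [← mul_sub, hd, he]; field_simp
  rw [hph]
  refine Eq.trans ?_ (mul_assoc _ _ _)
  rw [← Complex.ofReal_mul]
  congr 2
  set β := beamNormSq p (range X - R * t) with hβ
  have hβ0 : 0 < β := beamNormSq_pos p hro _
  -- The damping along the beam, 2 k_d (Z - R t), and along the two return paths, k_d R(ρ₁ + ρ₂),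
  -- regroup as 2 k_d Z plus a term proportional to k_d R, which is small.
  have e1 : Real.exp (-(2 * p.ro ^ 2 / β) * (p.ro ^ 2 * (v ^ 2 + v' ^ 2)) -
      2 * p.kd * (range X - R * t)) * Real.exp (-p.kd * (R * ρ₁ + R * ρ₂)) =
      Real.exp (-2 * p.kd * range X) * (Real.exp (-2 * (v ^ 2 + v' ^ 2) / (β / (p.ro ^ 2) ^ 2)) *
        Real.exp (-(p.kd * R * (ρ₁ + ρ₂ - 2 * t)))) := by
    rw [← Real.exp_add, ← Real.exp_add, ← Real.exp_add]
    congr 1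
    field_simp
    ring
  have hρ1 : 0 < ρ₁ := by linarith
  have hρ2 : 0 < ρ₂ := by linarith
  rw [mul_assoc, e1]
  set E1 := Real.exp (-2 * p.kd * range X)
  set E2 := Real.exp (-2 * (v ^ 2 + v' ^ 2) / (β / (p.ro ^ 2) ^ 2))
  set E3 := Real.exp (-(p.kd * R * (ρ₁ + ρ₂ - 2 * t)))
  field_simp

lemma abs_exp_neg_sub_exp_neg_le {x y : ℝ} (hx : 0 ≤ x) (hy : 0 ≤ y) :
    |Real.exp (-x) - Real.exp (-y)| ≤ |x - y| := by
  wlog hxy : x ≤ y generalizing x y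
  · rw [abs_sub_comm, abs_sub_comm x y]; exact this hy hx (le_of_not_ge hxy)
  rw [abs_of_nonneg (sub_nonneg.2 (Real.exp_le_exp.2 (by linarith))), abs_of_nonpos (by linarith)]
  have h1 : Real.exp (-y) = Real.exp (-x) * Real.exp (-(y - x)) := by
    rw [← Real.exp_add]; congr 1; ring
  have h2 := Real.add_one_le_exp (-(y - x))
  have h3 : Real.exp (-x) ≤ 1 := Real.exp_le_one_iff.2 (by linarith)
  have h4 := Real.exp_pos (-x)
  rw [h1]
  nlinarith

/-- Telescoping over the three factors, the inverse distances, the spread of the beam and the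
damping, each bounded by 1 or compared with its limit separately. -/
lemma abs_amplitude_sub_le {ρ ρ₁ ρ₂ ω b β s D d : ℝ} (hρ : 1 ≤ ρ) (hρ₁ : 1 / 2 ≤ ρ₁)
    (hρ₂ : 1 / 2 ≤ ρ₂) (h₁ : |ρ₁ - ρ| ≤ ω) (h₂ : |ρ₂ - ρ| ≤ ω) (hb : 1 ≤ b) (hbβ : b ≤ 1 + β)
    (hs : 0 ≤ s) (hD : 0 ≤ D) (hDd : D ≤ d) :
    |1 / (ρ₁ * ρ₂) * (1 / b * Real.exp (-2 * s / b)) * Real.exp (-D) -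
      1 / ρ ^ 2 * Real.exp (-2 * s)| ≤ 6 * ω + (1 + 2 * s) * β + d := by
  have hρ0 : 0 < ρ := by linarith
  have hρ₁0 : 0 < ρ₁ := by linarith
  have hρ₂0 : 0 < ρ₂ := by linarith
  have hb0 : 0 < b := by linarith
  have i0 : |1 / ρ| ≤ 1 := by
    rw [abs_of_pos (by positivity)]; exact div_le_self zero_le_one hρ
  have i2 : |1 / ρ₂| ≤ 2 := by
    rw [abs_of_pos (by positivity), div_le_iff₀ hρ₂0]; linarith
  have inv_sub : ∀ y, 1 / 2 ≤ y → |y - ρ| ≤ ω → |1 / y - 1 / ρ| ≤ 2 * ω := by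
    intro y hy hyω
    have hy0 : 0 < y := by linarith
    have : 1 / y - 1 / ρ = -(y - ρ) / (y * ρ) := by field_simp; ring
    rw [this, abs_div, abs_neg, abs_of_pos (by positivity : 0 < y * ρ), div_le_iff₀ (by positivity)]
    have h0 : 0 ≤ ω := (abs_nonneg _).trans hyω
    have : 1 ≤ 2 * (y * ρ) := by nlinarith
    nlinarith
  have p1 : |1 / (ρ₁ * ρ₂) - 1 / ρ ^ 2| ≤ 6 * ω := by
    have : 1 / (ρ₁ * ρ₂) - 1 / ρ ^ 2 =
        (1 / ρ₁ - 1 / ρ) * (1 / ρ₂) + 1 / ρ * (1 / ρ₂ - 1 / ρ) := by field_simp; ring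
    rw [this]
    refine (abs_add_le _ _).trans ?_
    rw [abs_mul, abs_mul]
    have a1 := mul_le_mul (inv_sub ρ₁ hρ₁ h₁) i2 (abs_nonneg _) ((abs_nonneg _).trans
      (inv_sub ρ₁ hρ₁ h₁))
    have a2 := mul_le_mul i0 (inv_sub ρ₂ hρ₂ h₂) (abs_nonneg _) zero_le_one
    linarith
  have hb1 : 0 ≤ 1 - 1 / b := by rw [sub_nonneg, div_le_one hb0]; exact hb
  have hb2 : 1 - 1 / b ≤ β := by
    have : 1 - 1 / b = (b - 1) / b := by field_simp
    rw [this]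
    exact (div_le_self (by linarith) hb).trans (by linarith)
  have e1 : Real.exp (-2 * s / b) ≤ 1 := Real.exp_le_one_iff.2
    (div_nonpos_of_nonpos_of_nonneg (by linarith) hb0.le)
  have p2 : |1 / b * Real.exp (-2 * s / b) - Real.exp (-2 * s)| ≤ (1 + 2 * s) * β := by
    have h3 := abs_exp_neg_sub_exp_neg_le (x := 2 * s / b) (y := 2 * s) (by positivity)
      (by positivity)
    have h4 : |2 * s / b - 2 * s| ≤ 2 * s * β := by
      have : 2 * s / b - 2 * s = -(2 * s * (1 - 1 / b)) := by ring
      rw [this, abs_neg, abs_of_nonneg (by positivity)]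
      gcongr
    rw [← neg_div, ← neg_mul] at h3
    have : 1 / b * Real.exp (-2 * s / b) - Real.exp (-2 * s) =
        -((1 - 1 / b) * Real.exp (-2 * s / b)) + (Real.exp (-2 * s / b) - Real.exp (-2 * s)) := by
      ring
    rw [this]
    refine (abs_add_le _ _).trans ?_
    rw [abs_neg, abs_of_nonneg (mul_nonneg hb1 (Real.exp_pos _).le)]
    nlinarith [Real.exp_pos (-2 * s / b)]
  have p3 : |Real.exp (-D) - 1| ≤ d := by
    have := abs_exp_neg_sub_exp_neg_le hD le_rfl
    rw [neg_zero, Real.exp_zero, sub_zero, abs_of_nonneg hD] at this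
    linarith
  have q2 : |1 / b * Real.exp (-2 * s / b)| ≤ 1 := by
    rw [abs_of_pos (by positivity)]
    exact mul_le_one₀ ((div_le_one hb0).2 hb) (Real.exp_pos _).le e1
  have q3 : |Real.exp (-D)| ≤ 1 := by
    rw [abs_of_pos (Real.exp_pos _)]; exact Real.exp_le_one_iff.2 (by linarith)
  have q4 : |1 / ρ ^ 2| ≤ 1 := by
    rw [abs_of_pos (by positivity)]; exact div_le_self zero_le_one (one_le_pow₀ hρ)
  have q5 : |Real.exp (-2 * s)| ≤ 1 := by
    rw [abs_of_pos (Real.exp_pos _)]; exact Real.exp_le_one_iff.2 (by linarith)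
  set P1 := 1 / (ρ₁ * ρ₂)
  set P2 := 1 / b * Real.exp (-2 * s / b)
  set P3 := Real.exp (-D)
  set Q1 := 1 / ρ ^ 2
  set Q2 := Real.exp (-2 * s)
  have : P1 * P2 * P3 - Q1 * Q2 = (P1 - Q1) * (P2 * P3) + (Q1 * ((P2 - Q2) * P3) +
      Q1 * (Q2 * (P3 - 1))) := by ring
  rw [this]
  refine (abs_add_le _ _).trans ?_
  have t1 : |(P1 - Q1) * (P2 * P3)| ≤ 6 * ω := by
    rw [abs_mul, abs_mul]
    exact (mul_le_of_le_one_right (abs_nonneg _) (mul_le_one₀ q2 (abs_nonneg _) q3)).trans p1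
  have t2 : |Q1 * ((P2 - Q2) * P3)| ≤ (1 + 2 * s) * β := by
    rw [abs_mul, abs_mul]
    exact (mul_le_of_le_one_left (by positivity) q4).trans
      ((mul_le_of_le_one_right (abs_nonneg _) q3).trans p2)
  have t3 : |Q1 * (Q2 * (P3 - 1))| ≤ d := by
    rw [abs_mul, abs_mul]
    exact (mul_le_of_le_one_left (by positivity) q4).trans
      ((mul_le_of_le_one_left (abs_nonneg _) q5).trans p3)
  have := abs_add_le (Q1 * ((P2 - Q2) * P3)) (Q1 * (Q2 * (P3 - 1)))
  linarith

/-! ### The contribution of a box around the beam -/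

/-- A narrow, weakly damped beam, two nearby observation points far from the beam axis in units of
the beam radius, and a range well below the Rayleigh length. -/
structure Narrow (e₀ : ℝ) (p : Params) (X x : Space) : Prop where
  ro_pos : 0 < p.ro
  k_pos : 0 < p.k
  kd_pos : 0 < p.kd
  cross_pos : 0 < ‖cross X‖
  ro_le : p.ro ≤ e₀ * ‖cross X‖
  x_le : ‖x‖ ≤ e₀ * ‖cross X‖
  cross_le : ‖cross X‖ ≤ e₀ * range X
  range_le : 2 * range X ≤ e₀ * (p.k * p.ro ^ 2)
  kd_le : p.kd * ‖cross X‖ ≤ e₀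

namespace Narrow

variable {e₀ e₁ : ℝ} {p : Params} {X x : Space}

lemma pos (h : Narrow e₀ p X x) : 0 < e₀ := by
  by_contra hn
  have := mul_nonpos_of_nonpos_of_nonneg (not_lt.1 hn) h.cross_pos.le
  linarith [h.ro_le, h.ro_pos]

lemma range_pos (h : Narrow e₀ p X x) : 0 < range X :=
  pos_of_mul_pos_right (h.cross_pos.trans_le h.cross_le) h.pos.le

lemma mono (h : Narrow e₀ p X x) (he : e₀ ≤ e₁) : Narrow e₁ p X x where
  ro_pos := h.ro_pos
  k_pos := h.k_pos
  kd_pos := h.kd_pos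
  cross_pos := h.cross_pos
  ro_le := h.ro_le.trans (mul_le_mul_of_nonneg_right he h.cross_pos.le)
  x_le := h.x_le.trans (mul_le_mul_of_nonneg_right he h.cross_pos.le)
  cross_le := h.cross_le.trans (mul_le_mul_of_nonneg_right he h.range_pos.le)
  range_le := h.range_le.trans (mul_le_mul_of_nonneg_right he
    (mul_nonneg h.k_pos.le (sq_nonneg _)))
  kd_le := h.kd_le.trans he

lemma abs_div_le (h : Narrow e₀ p X x) {a : ℝ} (ha : |a| ≤ ‖x‖) :
    |a / (2 * ‖cross X‖)| ≤ e₀ := by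
  have := h.cross_pos
  rw [abs_div, abs_of_pos (by positivity : 0 < 2 * ‖cross X‖), div_le_iff₀ (by positivity)]
  have h1 := h.x_le
  have h2 := norm_nonneg x
  linarith

lemma abs_inner_le {u : Plane} (hu : ‖u‖ = 1) (x : Space) : |inner ℝ u (cross x)| ≤ ‖x‖ := by
  refine (abs_real_inner_le_norm _ _).trans ?_
  rw [hu, one_mul]
  exact norm_cross_le x

/-- The coordinate v enters the geometry through c = 1 - (r_o/R) v, so the tolerance must be
multiplied by the half-width of the box. -/
lemma near (h : Narrow e₀ p X x) {v V : ℝ} (hV : 1 ≤ V) (hv : |v| ≤ V) :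
    NearNormalised (e₀ * V) (1 - p.ro / ‖cross X‖ * v) (p.ro / ‖cross X‖)
      (inner ℝ (unit (cross X)) (cross x) / (2 * ‖cross X‖))
      (inner ℝ (rot (unit (cross X))) (cross x) / (2 * ‖cross X‖)) (range x / (2 * ‖cross X‖)) := by
  have hR := h.cross_pos
  have hu := norm_unit hR
  have he : |p.ro / ‖cross X‖| ≤ e₀ := by
    rw [abs_div, abs_of_pos h.ro_pos, abs_of_pos hR, div_le_iff₀ hR]; exact h.ro_le
  have hle : e₀ ≤ e₀ * V := le_mul_of_one_le_right h.pos.le hV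
  refine ⟨?_, he.trans hle, (h.abs_div_le (abs_inner_le hu x)).trans hle,
    (h.abs_div_le (abs_inner_le ((norm_rot _).trans hu) x)).trans hle,
    (h.abs_div_le (abs_range_le x)).trans hle⟩
  rw [show 1 - p.ro / ‖cross X‖ * v - 1 = -(p.ro / ‖cross X‖ * v) by ring, abs_neg, abs_mul]
  exact mul_le_mul he hv (abs_nonneg _) h.pos.le

end Narrow

lemma beamNormSq_div_eq (p : Params) (hro : 0 < p.ro) (z : ℝ) :
    beamNormSq p z / (p.ro ^ 2) ^ 2 = 1 + (2 * z / (p.k * p.ro ^ 2)) ^ 2 := by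
  unfold beamNormSq
  rw [add_div, div_self (by positivity)]
  congr 1
  rw [← div_pow, div_div]

lemma Narrow.beamNormSq_div_le {e₀ : ℝ} {p : Params} {X x : Space} (h : Narrow e₀ p X x)
    (he : e₀ ≤ 1 / 4) {z : ℝ} (hz : 0 ≤ z) (hzX : z ≤ 2 * range X) :
    beamNormSq p z / (p.ro ^ 2) ^ 2 ≤ 1 + e₀ := by
  have hk : 0 < p.k * p.ro ^ 2 := mul_pos h.k_pos (pow_pos h.ro_pos 2)
  rw [beamNormSq_div_eq p h.ro_pos]
  have h1 : 2 * z / (p.k * p.ro ^ 2) ≤ 2 * e₀ := by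
    rw [div_le_iff₀ hk]; linarith [h.range_le]
  have h0 : 0 ≤ 2 * z / (p.k * p.ro ^ 2) := by positivity
  have := h.pos
  nlinarith

/-- The condition e₀ T ≤ 1/2 keeps the box at ranges between Z/2 and 3Z/2, where the beam has not
spread appreciably. The damping term is nonnegative because each of the two distances is at least
its range component and their sum is thus at least 2t. -/
lemma Narrow.abs_corrAmplitude_sub_le {e₀ V T : ℝ} {p : Params} {X x : Space}
    (h : Narrow e₀ p X x) (hV : 1 ≤ V) (hT : 1 ≤ T) (he1 : e₀ * V ≤ 1 / 4) (he2 : e₀ * T ≤ 1 / 2)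
    {v v' t : ℝ} (hv : |v| ≤ V) (hv' : |v'| ≤ V) (ht : |t| ≤ T) :
    |corrAmplitude (p.kd * ‖cross X‖)
      (beamNormSq p (range X - ‖cross X‖ * t) / (p.ro ^ 2) ^ 2) (p.ro / ‖cross X‖)
      (inner ℝ (unit (cross X)) (cross x) / (2 * ‖cross X‖))
      (inner ℝ (rot (unit (cross X))) (cross x) / (2 * ‖cross X‖))
      (range x / (2 * ‖cross X‖)) v v' t -
      1 / (1 + t ^ 2) * Real.exp (-2 * (v ^ 2 + v' ^ 2))| ≤
      e₀ * (6 * (V * (4 + V)) + (1 + 2 * (2 * V ^ 2)) + (4 * T + 4 + V)) := by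
  have hn := h.near hV hv
  have hR := h.cross_pos
  have ha := hn.half_le_add he1
  have ha' := hn.half_le_sub he1
  have c1 := hn.abs_le_add hv'
  have c2 := hn.abs_le_sub hv'
  have hRT : |‖cross X‖ * t| ≤ range X / 2 := by
    rw [abs_mul, abs_of_pos hR]
    calc ‖cross X‖ * |t| ≤ e₀ * range X * T := by
          have := h.cross_le
          have := h.range_pos
          have := h.pos
          gcongr
      _ = e₀ * T * range X := by ring
      _ ≤ 1 / 2 * range X := by have := h.range_pos; gcongr
      _ = _ := by ring
  have hRT' := abs_le.1 hRT
  have hX0 := h.range_pos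
  set R := ‖cross X‖
  set h₁ := inner ℝ (unit (cross X)) (cross x) / (2 * R)
  set h₂ := inner ℝ (rot (unit (cross X))) (cross x) / (2 * R)
  set h₃ := range x / (2 * R)
  set e := p.ro / R
  unfold corrAmplitude
  have d1 : |rad (1 - e * v + h₁) (h₂ - e * v') (t + h₃) - √(1 + t ^ 2)| ≤ e₀ * V * (4 + V) := by
    rw [← rad_one_zero]
    refine (abs_rad_sub_rad_le _ _ _ _ _ _).trans ?_
    simpa using c1
  have d2 : |rad (1 - e * v - h₁) (h₂ + e * v') (t - h₃) - √(1 + t ^ 2)| ≤ e₀ * V * (4 + V) := by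
    rw [← rad_one_zero]
    refine (abs_rad_sub_rad_le _ _ _ _ _ _).trans ?_
    simpa using c2
  have r1 := half_le_rad (b := h₂ - e * v') (s := t + h₃) ha
  have r2 := half_le_rad (b := h₂ + e * v') (s := t - h₃) ha'
  have l1 := (le_abs_self _).trans (abs_third_le_rad (1 - e * v + h₁) (h₂ - e * v') (t + h₃))
  have l2 := (le_abs_self _).trans (abs_third_le_rad (1 - e * v - h₁) (h₂ + e * v') (t - h₃))
  have hρ1 : 1 ≤ √(1 + t ^ 2) := Real.one_le_sqrt.2 (by nlinarith [sq_nonneg t])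
  have hρT : √(1 + t ^ 2) ≤ 1 + T :=
    Real.sqrt_le_iff.2 ⟨by positivity, by nlinarith [sq_abs t, abs_nonneg t]⟩
  have hρ2 : √(1 + t ^ 2) ^ 2 = 1 + t ^ 2 := Real.sq_sqrt (by positivity)
  set ρ₁ := rad (1 - e * v + h₁) (h₂ - e * v') (t + h₃)
  set ρ₂ := rad (1 - e * v - h₁) (h₂ + e * v') (t - h₃)
  have hz : 0 ≤ range X - R * t := by linarith
  have hb := h.beamNormSq_div_le ((le_mul_of_one_le_right h.pos.le hV).trans he1) hz (by linarith)
  have he0 := h.pos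
  have hb1 : 1 ≤ beamNormSq p (range X - R * t) / (p.ro ^ 2) ^ 2 := by
    rw [beamNormSq_div_eq p h.ro_pos]; linarith [sq_nonneg (2 * (range X - R * t) / (p.k * p.ro ^ 2))]
  have hs : v ^ 2 + v' ^ 2 ≤ 2 * V ^ 2 := by
    nlinarith [sq_abs v, sq_abs v', abs_nonneg v, abs_nonneg v']
  have hkd : 0 ≤ p.kd * R := mul_nonneg h.kd_pos.le hR.le
  have hD : p.kd * R * (ρ₁ + ρ₂ - 2 * t) ≤ e₀ * (4 * T + 4 + V) := by
    have b1 := (abs_le.1 d1).2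
    have b2 := (abs_le.1 d2).2
    have b3 := (abs_le.1 ht).1
    calc _ ≤ p.kd * R * (4 * T + 4 + V) := by
          gcongr
          nlinarith
      _ ≤ _ := by have := h.kd_le; gcongr
  have := abs_amplitude_sub_le hρ1 r1 r2 d1 d2 hb1 hb (s := v ^ 2 + v' ^ 2) (by positivity)
    (mul_nonneg hkd (by linarith)) hD
  rw [hρ2] at this
  refine this.trans ?_
  have : (1 + 2 * (v ^ 2 + v' ^ 2)) * e₀ ≤ (1 + 2 * (2 * V ^ 2)) * e₀ := by gcongr
  linarith

lemma exists_box_tolerance {V T : ℝ} (hV : 1 ≤ V) (hT : 1 ≤ T) {ε : ℝ} (hε : 0 < ε) :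
    ∃ e₀ > 0, e₀ * V ≤ 1 / 4 ∧ e₀ * T ≤ 1 / 2 ∧
      e₀ * (6 * (V * (4 + V)) + (1 + 2 * (2 * V ^ 2)) + (4 * T + 4 + V)) ≤ ε := by
  set κ : ℝ := 6 * (V * (4 + V)) + (1 + 2 * (2 * V ^ 2)) + (4 * T + 4 + V) with hκ
  have hκ0 : 0 < κ := by positivity
  refine ⟨min (1 / (4 * V)) (min (1 / (2 * T)) (ε / κ)), by positivity, ?_, ?_, ?_⟩
  · calc _ ≤ 1 / (4 * V) * V := by gcongr; exact min_le_left _ _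
      _ = 1 / 4 := by field_simp
  · calc _ ≤ 1 / (2 * T) * T := by
          gcongr; exact (min_le_right _ _).trans (min_le_left _ _)
      _ = 1 / 2 := by field_simp
  · calc _ ≤ ε / κ * κ := by
          gcongr; exact (min_le_right _ _).trans (min_le_right _ _)
      _ = ε := by field_simp

/-- The box `[-V, V] × [-V, V] × [-T, T]`. -/
def box (V T : ℝ) : Set (ℝ × ℝ × ℝ) := Set.Icc (-V) V ×ˢ Set.Icc (-V) V ×ˢ Set.Icc (-T) T

lemma isCompact_box (V T : ℝ) : IsCompact (box V T) :=
  isCompact_Icc.prod (isCompact_Icc.prod isCompact_Icc)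

lemma volume_real_box {V T : ℝ} (hV : 0 ≤ V) (hT : 0 ≤ T) :
    (volume : Measure (ℝ × ℝ × ℝ)).real (box V T) = 2 * V * (2 * V * (2 * T)) := by
  unfold box
  rw [Measure.volume_eq_prod, measureReal_prod_prod, Measure.volume_eq_prod, measureReal_prod_prod,
    Real.volume_real_Icc_of_le (by linarith), Real.volume_real_Icc_of_le (by linarith)]
  ring

lemma setIntegral_box {V T : ℝ} (hV : 0 ≤ V) (hT : 0 ≤ T) {f : ℝ × ℝ × ℝ → ℂ}
    (hf : ContinuousOn f (box V T)) :
    ∫ q in box V T, f q =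
      ∫ v in Set.Icc (-V) V, ∫ v' in (-V)..V, ∫ t in (-T)..T, f (v, v', t) := by
  unfold box at hf ⊢
  rw [Measure.volume_eq_prod, setIntegral_prod _ (hf.integrableOn_compact (isCompact_box V T))]
  refine setIntegral_congr_fun measurableSet_Icc fun v hv => ?_
  have hc : ContinuousOn (fun q : ℝ × ℝ => f (v, q)) (Set.Icc (-V) V ×ˢ Set.Icc (-T) T) :=
    hf.comp (by fun_prop) fun q hq => ⟨hv, hq⟩
  rw [Measure.volume_eq_prod, setIntegral_prod _
    (hc.integrableOn_compact (isCompact_Icc.prod isCompact_Icc)),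
    intervalIntegral.integral_of_le (by linarith), ← integral_Icc_eq_integral_Ioc]
  refine setIntegral_congr_fun measurableSet_Icc fun v' _ => ?_
  rw [intervalIntegral.integral_of_le (by linarith), ← integral_Icc_eq_integral_Ioc]

lemma continuousOn_exp_mul_corrIntegrand {e₀ e h₁ h₂ h₃ V : ℝ} (he₀ : e₀ ≤ 1 / 4)
    (hn : ∀ v, |v| ≤ V → NearNormalised e₀ (1 - e * v) e h₁ h₂ h₃) (T χ ξ ζ : ℝ) :
    ContinuousOn (fun q : ℝ × ℝ × ℝ => (Real.exp (-2 * q.1 ^ 2) : ℂ) *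
      corrIntegrand (1 - e * q.1) e h₁ h₂ h₃ χ ξ ζ q.2.1 q.2.2) (box V T) := by
  have hp : ContinuousOn (fun q : ℝ × ℝ × ℝ => profile (1 - e * q.1) e h₁ h₂ h₃ q.2.1 q.2.2)
      (box V T) := by
    unfold profile
    refine ContinuousOn.div continuousOn_const ?_ fun q hq => ?_
    · refine Continuous.continuousOn ?_
      unfold rad; fun_prop
    · have hq1 : |q.1| ≤ V := abs_le.2 hq.1
      have h1 := half_le_rad (b := h₂ - e * q.2.1) (s := q.2.2 + h₃) ((hn _ hq1).half_le_add he₀)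
      have h2 := half_le_rad (b := h₂ + e * q.2.1) (s := q.2.2 - h₃) ((hn _ hq1).half_le_sub he₀)
      positivity
  unfold corrIntegrand
  have h2 : Continuous fun q : ℝ × ℝ × ℝ => (1 / (1 + q.2.2 ^ 2) : ℝ) :=
    continuous_const.div (by fun_prop) fun q => by positivity
  refine ContinuousOn.mul (Continuous.continuousOn (by fun_prop)) (ContinuousOn.mul
    (Continuous.continuousOn (by fun_prop)) (ContinuousOn.mul ?_ ?_))
  · exact (Complex.continuous_ofReal.comp h2).continuousOn
  · refine ContinuousOn.cexp (continuousOn_const.mul ?_)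
    refine Complex.continuous_ofReal.comp_continuousOn (ContinuousOn.mul ?_ hp)
    exact Continuous.continuousOn (by fun_prop)

lemma integrable_greenBeam_mul_conj (p : Params) (hro : 0 < p.ro) (hkd : 0 < p.kd) (x₁ x₂ : Space) :
    Integrable fun y => greenBeam p x₁ y * conj (greenBeam p x₂ y) :=
  (memLp_greenBeam p hro hkd x₁).integrable_mul (memLp_greenBeam p hro hkd x₂).star

/-- The contribution of the box, with its limit amplitude and phase. -/
lemma exists_norm_box_integral_sub_le {V T : ℝ} (hV : 1 ≤ V) (hT : 1 ≤ T) {ε : ℝ} (hε : 0 < ε) :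
    ∃ e₀ > 0, ∀ p X x, Narrow e₀ p X x →
      ‖(∫ q in box V T, greenBeam p (X + (1 / 2 : ℝ) • x)
            (boxMap (unit (cross X)) p.ro ‖cross X‖ (range X) q) *
          conj (greenBeam p (X - (1 / 2 : ℝ) • x)
            (boxMap (unit (cross X)) p.ro ‖cross X‖ (range X) q))) -
        ((Real.exp (-2 * p.kd * range X) / (16 * Real.pi ^ 2 * ‖cross X‖ ^ 2) : ℝ) : ℂ) *
          (((∫ v in (-V)..V, Real.exp (-2 * v ^ 2) : ℝ) : ℂ) *
            ∫ v in (-V)..V, ∫ t in (-T)..T, corrIntegrand 1 0 0 0 0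
              (p.k * inner ℝ (unit (cross X)) (cross x))
              (p.k * p.ro / (2 * ‖cross X‖) * inner ℝ (rot (unit (cross X))) (cross x))
              (p.k * range x) v t)‖ ≤
        Real.exp (-2 * p.kd * range X) / (16 * Real.pi ^ 2 * ‖cross X‖ ^ 2) * ε := by
  have hV0 : 0 < V := by linarith
  have hT0 : 0 < T := by linarith
  set W : ℝ := 2 * V * (2 * V * (2 * T)) with hW
  have hW0 : 0 < W := by positivity
  obtain ⟨e₁, he₁, he₁V, he₁T, he₁ε⟩ := exists_box_tolerance hV hT
    (ε := ε / (2 * W)) (by positivity)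
  obtain ⟨e₂, he₂, -, H₂⟩ := exists_norm_corr_sub_le hV hT (ε := ε / (4 * V)) (by positivity)
  refine ⟨min e₁ (e₂ / V), by positivity, fun p X x h => ?_⟩
  have n1 := h.mono (min_le_left _ _)
  have n2 : ∀ v, |v| ≤ V → _ := fun v hv => ((h.mono (min_le_right _ _)).near hV hv)
  -- The division of e₂ by V was made to compensate the factor V in `Narrow.near`.
  rw [div_mul_cancel₀ _ hV0.ne'] at n2
  have hR := h.cross_pos
  set R := ‖cross X‖ with hRd
  set a := inner ℝ (unit (cross X)) (cross x)
  set b := inner ℝ (rot (unit (cross X))) (cross x)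
  set e := p.ro / R
  set χ := p.k * a with hχ
  set ξ := p.k * p.ro / (2 * R) * b with hξ
  set ζ := p.k * range x with hζ
  set c₀ : ℝ := Real.exp (-2 * p.kd * range X) / (16 * Real.pi ^ 2 * R ^ 2) with hc₀
  have hc0 : 0 < c₀ := by have := Real.pi_pos; positivity
  set F : ℝ × ℝ × ℝ → ℂ := fun q => greenBeam p (X + (1 / 2 : ℝ) • x)
            (boxMap (unit (cross X)) p.ro R (range X) q) *
          conj (greenBeam p (X - (1 / 2 : ℝ) • x)
            (boxMap (unit (cross X)) p.ro R (range X) q)) with hF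
  set f : ℝ × ℝ × ℝ → ℂ := fun q => (Real.exp (-2 * q.1 ^ 2) : ℂ) *
      corrIntegrand (1 - e * q.1) e (a / (2 * R)) (b / (2 * R)) (range x / (2 * R)) χ ξ ζ q.2.1 q.2.2
      with hf
  set g : ℝ × ℝ × ℝ → ℂ := fun q => (Real.exp (-2 * q.1 ^ 2) : ℂ) *
      corrIntegrand 1 0 0 0 0 χ ξ ζ q.2.1 q.2.2 with hg
  have cf : ContinuousOn f (box V T) := continuousOn_exp_mul_corrIntegrand he₁V
    (fun v hv => n1.near hV hv) T χ ξ ζ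
  have cg : ContinuousOn g (box V T) := by
    have := continuousOn_exp_mul_corrIntegrand (e₀ := 0) (e := 0) (h₁ := 0) (h₂ := 0) (h₃ := 0)
      (V := V) (by norm_num) (fun v _ => by
        rw [zero_mul, sub_zero]; exact NearNormalised.refl le_rfl) T χ ξ ζ
    simp only [hg]
    simpa using this
  -- Only the amplitude is replaced here, with the true phase kept, so the pointwise error does not
  -- depend on the frequencies.
  have hpt : ∀ q ∈ box V T, ‖F q - c₀ * f q‖ ≤ c₀ * (ε / (2 * W)) := by
    rintro ⟨v, v', t⟩ ⟨hv, hv', ht⟩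
    have hv1 : |v| ≤ V := abs_le.2 hv
    have hv1' : |v'| ≤ V := abs_le.2 hv'
    have ht1 : |t| ≤ T := abs_le.2 ht
    have hn := n1.near hV hv1
    have hz : 0 < range X - R * t := by
      have b1 : R * t ≤ R * T := by gcongr; exact ht.2
      have b2 : R * T ≤ e₁ * range X * T := by have := n1.cross_le; gcongr
      have b3 : e₁ * range X * T ≤ 1 / 2 * range X := by
        rw [mul_right_comm]; have := n1.range_pos; gcongr
      linarith [n1.range_pos]
    have hA := (n1.abs_corrAmplitude_sub_le hV hT he₁V he₁T hv1 hv1' ht1).trans he₁ε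
    have hgb := greenBeam_boxMap p h.ro_pos (X := X) (x := x) hR (v := v) (v' := v') (t := t) hz
      (hn.half_le_add he₁V) (hn.half_le_sub he₁V)
    simp only [hF, hf]
    rw [hgb]
    unfold corrIntegrand
    simp only [← hRd] at hA ⊢
    set Am := corrAmplitude (p.kd * R) (beamNormSq p (range X - R * t) / (p.ro ^ 2) ^ 2) (p.ro / R)
      (a / (2 * R)) (b / (2 * R)) (range x / (2 * R)) v v' t
    set φ := ((1 - e * v) * χ - 2 * ξ * v' + ζ * t) *
      profile (1 - e * v) e (a / (2 * R)) (b / (2 * R)) (range x / (2 * R)) v' t with hφ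
    have hsplit : (c₀ : ℂ) * ((Am : ℂ) * Complex.exp (Complex.I * (φ : ℝ))) -
        c₀ * ((Real.exp (-2 * v ^ 2) : ℂ) * ((Real.exp (-2 * v' ^ 2) : ℂ) *
          (((1 / (1 + t ^ 2) : ℝ) : ℂ) * Complex.exp (Complex.I * (φ : ℝ))))) =
        ((c₀ * (Am - 1 / (1 + t ^ 2) * Real.exp (-2 * (v ^ 2 + v' ^ 2))) : ℝ) : ℂ) *
          Complex.exp (Complex.I * (φ : ℝ)) := by
      rw [show -2 * (v ^ 2 + v' ^ 2) = -2 * v ^ 2 + -2 * v' ^ 2 by ring, Real.exp_add]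
      push_cast
      ring
    have hn2 : ‖(c₀ : ℂ) * ((Am : ℂ) * Complex.exp (Complex.I * (φ : ℝ))) -
        c₀ * ((Real.exp (-2 * v ^ 2) : ℂ) * ((Real.exp (-2 * v' ^ 2) : ℂ) *
          (((1 / (1 + t ^ 2) : ℝ) : ℂ) * Complex.exp (Complex.I * (φ : ℝ)))))‖ ≤
          c₀ * (ε / (2 * W)) := by
      rw [hsplit, norm_mul, mul_comm Complex.I, Complex.norm_exp_ofReal_mul_I, mul_one,
        Complex.norm_real, Real.norm_eq_abs, abs_mul, abs_of_pos hc0]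
      gcongr
    exact hn2
  have hif : IntegrableOn f (box V T) := cf.integrableOn_compact (isCompact_box V T)
  have hig : IntegrableOn g (box V T) := cg.integrableOn_compact (isCompact_box V T)
  have hms : MeasurableSet (box V T) := (isCompact_box V T).isClosed.measurableSet
  have hfin : volume (box V T) < ∞ := (isCompact_box V T).measure_lt_top
  have hiF : IntegrableOn F (box V T) := by
    exact (integrable_comp_boxMap (norm_unit hR) h.ro_pos hR (range X)
      (integrable_greenBeam_mul_conj p h.ro_pos h.kd_pos _ _)).integrableOn
  have s1 : ‖(∫ q in box V T, F q) - c₀ * ∫ q in box V T, f q‖ ≤ c₀ * (ε / 2) := by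
    rw [← integral_const_mul, ← integral_sub hiF (hif.const_mul _)]
    refine (norm_setIntegral_le_of_norm_le_const hfin hpt).trans (le_of_eq ?_)
    rw [volume_real_box hV0.le hT0.le, ← hW]
    field_simp
  -- Replacement of the phase. For frozen v the variable enters only through c = 1 - e v, so the
  -- two-dimensional estimate, uniform in the frequencies, applies to each slice; a pointwise
  -- comparison would fail for large frequencies.
  have s2 : ‖(∫ q in box V T, f q) - ∫ q in box V T, g q‖ ≤ ε / 2 := by
    rw [← integral_sub hif hig]
    refine (congrArg norm (setIntegral_box hV0.le hT0.le (cf.sub cg))).trans_le ?_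
    refine (norm_setIntegral_le_of_norm_le_const (C := ε / (4 * V)) measure_Icc_lt_top
      fun v hv => ?_).trans (le_of_eq ?_)
    · have hv1 : |v| ≤ V := abs_le.2 hv
      have hn := n2 v hv1
      have hn1 := n1.near hV hv1
      have k1 := continuous_corrIntegrand (e := e) (h₂ := b / (2 * R)) (h₃ := range x / (2 * R))
        (hn1.half_le_add he₁V) (hn1.half_le_sub he₁V) χ ξ ζ
      have k2 := continuous_corrIntegrand (c := 1) (e := 0) (h₁ := 0) (h₂ := 0) (h₃ := 0)
        (by norm_num) (by norm_num) χ ξ ζ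
      have := H₂ _ _ _ _ _ hn χ ξ ζ
      have hinner : ∀ {F : ℝ → ℝ → ℂ}, Continuous (fun q : ℝ × ℝ => F q.1 q.2) → ∀ v,
          Continuous (F v) := fun h v => h.comp (Continuous.prodMk_right v)
      have houter : ∀ {F : ℝ → ℝ → ℂ}, Continuous (fun q : ℝ × ℝ => F q.1 q.2) →
          Continuous fun v => ∫ t in (-T)..T, F v t := fun h =>
        intervalIntegral.continuous_parametric_intervalIntegral_of_continuous' h _ _
      have heq : ∫ v' in (-V)..V, ∫ t in (-T)..T, (f (v, v', t) - g (v, v', t)) =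
          (Real.exp (-2 * v ^ 2) : ℂ) * ((∫ v' in (-V)..V, ∫ t in (-T)..T,
            corrIntegrand (1 - e * v) e (a / (2 * R)) (b / (2 * R)) (range x / (2 * R)) χ ξ ζ v' t) -
            ∫ v' in (-V)..V, ∫ t in (-T)..T, corrIntegrand 1 0 0 0 0 χ ξ ζ v' t) := by
        rw [← intervalIntegral.integral_sub ((houter k1).intervalIntegrable _ _)
          ((houter k2).intervalIntegrable _ _), ← intervalIntegral.integral_const_mul]
        refine intervalIntegral.integral_congr fun v' _ => ?_
        rw [← intervalIntegral.integral_sub ((hinner k1 v').intervalIntegrable _ _)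
          ((hinner k2 v').intervalIntegrable _ _), ← intervalIntegral.integral_const_mul]
        refine intervalIntegral.integral_congr fun t _ => ?_
        simp only [hf, hg]
        ring
      change ‖∫ v' in (-V)..V, ∫ t in (-T)..T, (f (v, v', t) - g (v, v', t))‖ ≤ _
      rw [heq, norm_mul, Complex.norm_real, Real.norm_eq_abs]
      exact (mul_le_of_le_one_left (norm_nonneg _) (abs_exp_neg_two_sq_le v)).trans this
    · rw [Real.volume_real_Icc_of_le (by linarith)]
      field_simp
      norm_num
  have s3 : ∫ q in box V T, g q = ((∫ v in (-V)..V, Real.exp (-2 * v ^ 2) : ℝ) : ℂ) *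
      ∫ v in (-V)..V, ∫ t in (-T)..T, corrIntegrand 1 0 0 0 0 χ ξ ζ v t := by
    rw [setIntegral_box hV0.le hT0.le cg, integral_Icc_eq_integral_Ioc,
      ← intervalIntegral.integral_of_le (by linarith), ← intervalIntegral.integral_ofReal,
      ← intervalIntegral.integral_mul_const]
    refine intervalIntegral.integral_congr fun v _ => ?_
    simp only [hg]
    rw [← intervalIntegral.integral_const_mul]
    refine intervalIntegral.integral_congr fun v' _ => ?_
    rw [← intervalIntegral.integral_const_mul]
  rw [← s3]
  have hsplit : (∫ q in box V T, F q) - c₀ * ∫ q in box V T, g q =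
      ((∫ q in box V T, F q) - c₀ * ∫ q in box V T, f q) +
        c₀ * ((∫ q in box V T, f q) - ∫ q in box V T, g q) := by ring
  rw [hsplit]
  refine (norm_add_le _ _).trans ?_
  rw [norm_mul, Complex.norm_real, Real.norm_of_nonneg hc0.le]
  have := mul_le_mul_of_nonneg_left s2 hc0.le
  linarith

/-! ### The contribution of the exterior of the box -/

/-- The part of space described by `box V T` in adapted coordinates. -/
def boxRegion (p : Params) (X : Space) (V T : ℝ) : Set Space :=
  {y | |inner ℝ (unit (cross X)) (cross y)| ≤ p.ro * V ∧
    |inner ℝ (rot (unit (cross X))) (cross y)| ≤ p.ro * V ∧ |range y - range X| ≤ ‖cross X‖ * T}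

lemma measurableSet_boxRegion (p : Params) (X : Space) (V T : ℝ) :
    MeasurableSet (boxRegion p X V T) := by
  refine IsClosed.measurableSet ?_
  unfold boxRegion
  simp only [Set.ofPred_and]
  exact (isClosed_le (by fun_prop) (by fun_prop)).inter ((isClosed_le (by fun_prop)
    (by fun_prop)).inter (isClosed_le (by fun_prop) (by fun_prop)))

lemma preimage_boxRegion (p : Params) (hro : 0 < p.ro) {X : Space} (hR : 0 < ‖cross X‖) (V T : ℝ) :
    boxMap (unit (cross X)) p.ro ‖cross X‖ (range X) ⁻¹' boxRegion p X V T = box V T := by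
  have hu := norm_unit hR
  have hin : ∀ q, inner ℝ (unit (cross X)) (frame (unit (cross X)) q) = q.1 ∧
      inner ℝ (rot (unit (cross X))) (frame (unit (cross X)) q) = q.2 := fun q => by
    have := frame_injective hu (frame_inner hu (frame (unit (cross X)) q))
    exact ⟨(Prod.ext_iff.1 this).1, (Prod.ext_iff.1 this).2⟩
  ext ⟨v, v', t⟩
  have h1 := hin (p.ro * v, p.ro * v')
  simp only [Set.mem_preimage, boxRegion, Set.mem_ofPred_eq, boxMap, cross_ofCrossRange,
    range_ofCrossRange, h1.1, h1.2, box, Set.mem_prod, Set.mem_Icc, ← abs_le]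
  rw [abs_mul, abs_mul, abs_of_pos hro, show range X - ‖cross X‖ * t - range X = -(‖cross X‖ * t) by
    ring, abs_neg, abs_mul, abs_of_pos hR, mul_le_mul_iff_right₀ hro, mul_le_mul_iff_right₀ hro,
    mul_le_mul_iff_right₀ hR]

lemma not_mem_boxRegion {p : Params} {X y : Space} (hR : 0 < ‖cross X‖) {V T : ℝ}
    (hy : y ∉ boxRegion p X V T) :
    ‖cross X‖ * T < |range y - range X| ∨ p.ro * V < ‖cross y‖ := by
  by_contra hc
  push Not at hc
  have hu := norm_unit hR
  refine hy ⟨?_, ?_, hc.1⟩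
  · refine (abs_real_inner_le_norm _ _).trans ?_
    rw [hu, one_mul]; exact hc.2
  · refine (abs_real_inner_le_norm _ _).trans ?_
    rw [norm_rot, hu, one_mul]; exact hc.2

/-- The profile of the intensity of the beam in the section at range `z`. -/
def sectionProfile (p : Params) (w : Plane) (z : ℝ) : ℝ :=
  (p.ro ^ 2) ^ 2 / beamNormSq p z * Real.exp (-(2 * p.ro ^ 2 / beamNormSq p z) * ‖w‖ ^ 2)

lemma sectionProfile_nonneg (p : Params) (hro : 0 < p.ro) (w : Plane) (z : ℝ) :
    0 ≤ sectionProfile p w z := by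
  have := beamNormSq_pos p hro z
  unfold sectionProfile; positivity

lemma measurable_sectionProfile (p : Params) :
    Measurable fun q : Plane × ℝ => sectionProfile p q.1 q.2 := by
  unfold sectionProfile beamNormSq; fun_prop

lemma integrable_sectionProfile (p : Params) (hro : 0 < p.ro) (z : ℝ) :
    Integrable fun w => sectionProfile p w z := by
  have := beamNormSq_pos p hro z
  exact (integrable_exp_neg_norm_sq_plane (by positivity)).const_mul _

/-- Up to the damping, the power through a section does not depend on its range. The spreading of
the beam at large range is therefore harmless in the tail, where nothing bounds z by the Rayleigh
length. -/
lemma integral_sectionProfile (p : Params) (hro : 0 < p.ro) (z : ℝ) :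
    ∫ w, sectionProfile p w z = Real.pi * p.ro ^ 2 / 2 := by
  have := beamNormSq_pos p hro z
  unfold sectionProfile
  rw [integral_const_mul, integral_exp_neg_norm_sq_plane (by positivity)]
  field_simp

lemma sectionProfile_le (p : Params) (hro : 0 < p.ro) (w : Plane) {z : ℝ}
    (hz : beamNormSq p z / (p.ro ^ 2) ^ 2 ≤ 2) :
    sectionProfile p w z ≤ Real.exp (-(‖w‖ ^ 2 / p.ro ^ 2)) := by
  have h0 := beamNormSq_pos p hro z
  have h1 := le_beamNormSq p z
  have h2 : 0 < p.ro ^ 2 := by positivity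
  rw [div_le_iff₀ (by positivity)] at hz
  unfold sectionProfile
  refine (mul_le_of_le_one_left (Real.exp_pos _).le ((div_le_one h0).2 h1)).trans ?_
  rw [Real.exp_le_exp, neg_mul, neg_le_neg_iff, div_mul_eq_mul_div, div_le_div_iff₀ h2 h0]
  calc ‖w‖ ^ 2 * beamNormSq p z ≤ ‖w‖ ^ 2 * (2 * (p.ro ^ 2) ^ 2) := by gcongr
    _ = _ := by ring

/-- Each distance is at least its range component, so r₁ + r₂ ≥ 2(Z - z), and the total damping is
at most e^{-2 k_d Z} wherever the particle is. -/
lemma norm_greenBeam_mul_conj_le (p : Params) (hro : 0 < p.ro) (hkd : 0 < p.kd) (X x : Space)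
    {y : Space} (hy : 0 < range y) :
    ‖greenBeam p (X + (1 / 2 : ℝ) • x) y * conj (greenBeam p (X - (1 / 2 : ℝ) • x) y)‖ ≤
      Real.exp (-2 * p.kd * range X) / (16 * Real.pi ^ 2) *
        (1 / (‖X + (1 / 2 : ℝ) • x - y‖ * ‖X - (1 / 2 : ℝ) • x - y‖) *
          sectionProfile p (cross y) (range y)) := by
  have a1 := (le_abs_self _).trans (abs_range_le (X + (1 / 2 : ℝ) • x - y))
  have a2 := (le_abs_self _).trans (abs_range_le (X - (1 / 2 : ℝ) • x - y))
  rw [range_sub, range_add, range_smul] at a1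
  rw [range_sub, range_sub, range_smul] at a2
  rw [greenBeam_mul_conj, norm_mul, mul_comm Complex.I, Complex.norm_exp_ofReal_mul_I, mul_one,
    Complex.norm_real, Real.norm_of_nonneg (by positivity), norm_beam_sq p hro hy]
  set r₁ := ‖X + (1 / 2 : ℝ) • x - y‖
  set r₂ := ‖X - (1 / 2 : ℝ) • x - y‖
  have h0 := beamNormSq_pos p hro (range y)
  have he : Real.exp (-(2 * p.ro ^ 2 / beamNormSq p (range y)) * ‖cross y‖ ^ 2 -
      2 * p.kd * range y) * Real.exp (-p.kd * (r₁ + r₂)) ≤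
      Real.exp (-2 * p.kd * range X) *
        Real.exp (-(2 * p.ro ^ 2 / beamNormSq p (range y)) * ‖cross y‖ ^ 2) := by
    rw [← Real.exp_add, ← Real.exp_add, Real.exp_le_exp]
    have : p.kd * (2 * (range X - range y)) ≤ p.kd * (r₁ + r₂) := by gcongr; linarith
    linarith
  unfold sectionProfile
  set N := beamNormSq p (range y)
  set E1 := Real.exp (-(2 * p.ro ^ 2 / N) * ‖cross y‖ ^ 2 - 2 * p.kd * range y)
  set E2 := Real.exp (-p.kd * (r₁ + r₂))
  set E3 := Real.exp (-2 * p.kd * range X)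
  set E4 := Real.exp (-(2 * p.ro ^ 2 / N) * ‖cross y‖ ^ 2)
  calc (p.ro ^ 2) ^ 2 / N * E1 * E2 / (16 * Real.pi ^ 2 * (r₁ * r₂)) =
      (p.ro ^ 2) ^ 2 / N * (E1 * E2) / (16 * Real.pi ^ 2 * (r₁ * r₂)) := by ring
    _ ≤ (p.ro ^ 2) ^ 2 / N * (E3 * E4) / (16 * Real.pi ^ 2 * (r₁ * r₂)) := by gcongr
    _ = _ := by rw [div_mul_eq_div_div]; ring

lemma integral_comp_cross_range {h : Plane × ℝ → ℝ} (hm : Measurable h) (h0 : ∀ q, 0 ≤ h q)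
    (hs : ∀ z, Integrable fun w => h (w, z)) {φ : ℝ → ℝ} (hφ : Integrable φ)
    (he : ∀ z, ∫ w, h (w, z) = φ z) :
    Integrable (fun y : Space => h (cross y, range y)) ∧
      ∫ y : Space, h (cross y, range y) = ∫ z, φ z := by
  have hi : Integrable h ((volume : Measure Plane).prod volume) := by
    rw [integrable_prod_iff' hm.aestronglyMeasurable]
    refine ⟨ae_of_all _ hs, ?_⟩
    refine hφ.congr (ae_of_all _ fun z => ?_)
    simp only [Real.norm_of_nonneg (h0 _)]
    exact (he z).symm
  refine ⟨measurePreserving_cross_range.integrable_comp_of_integrable hi, ?_⟩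
  have hemb : MeasurableEmbedding fun y : Space => (cross y, range y) := by
    refine Measurable.measurableEmbedding (by fun_prop) fun y y' hyy => ?_
    rw [← ofCrossRange_cross_range y, ← ofCrossRange_cross_range y']
    exact congrArg ofCrossRange hyy
  rw [measurePreserving_cross_range.integral_comp hemb h, integral_prod_symm _ hi]
  exact integral_congr_ae (ae_of_all _ he)

lemma integrable_inv_sq_add_sq {D : ℝ} (hD : 0 < D) (Z : ℝ) :
    Integrable (fun z : ℝ => 1 / ((z - Z) ^ 2 + D ^ 2)) ∧
      ∫ z : ℝ, 1 / ((z - Z) ^ 2 + D ^ 2) = Real.pi / D := by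
  have e : ∀ z : ℝ, 1 / ((z - Z) ^ 2 + D ^ 2) = (1 / D ^ 2) * (1 + (D⁻¹ * (z - Z)) ^ 2)⁻¹ := by
    intro z; field_simp; ring
  simp_rw [e]
  constructor
  · have := (integrable_inv_one_add_sq.comp_mul_left' (inv_ne_zero hD.ne')).comp_sub_right Z
    exact this.const_mul _
  · rw [integral_const_mul, integral_sub_right_eq_self (fun z => (1 + (D⁻¹ * z) ^ 2)⁻¹) Z,
      Measure.integral_comp_mul_left (fun z => (1 + z ^ 2)⁻¹), integral_univ_inv_one_add_sq, inv_inv,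
      abs_of_pos hD, smul_eq_mul]
    field_simp

lemma one_div_mul_le {r₁ r₂ : ℝ} :
    1 / (r₁ * r₂) ≤ 1 / 2 * (1 / r₁ ^ 2 + 1 / r₂ ^ 2) := by
  have := two_mul_le_add_sq (1 / r₁) (1 / r₂)
  rw [div_pow, div_pow, one_pow, mul_assoc, div_mul_div_comm, one_mul] at this
  linarith

lemma one_div_sq_le_indicator {r R : ℝ} (hR : 0 < R) (hr : 0 ≤ r) :
    1 / r ^ 2 ≤ 16 / R ^ 2 + (Set.Iio (R / 4)).indicator (fun r => 1 / r ^ 2) r := by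
  by_cases h : r < R / 4
  · rw [Set.indicator_of_mem (show r ∈ Set.Iio (R / 4) from h)]
    have : 0 ≤ 16 / R ^ 2 := by positivity
    linarith
  · rw [Set.indicator_of_notMem (show r ∉ Set.Iio (R / 4) from h), add_zero]
    push Not at h
    have : 0 < r := by linarith
    rw [div_le_div_iff₀ (by positivity) (by positivity)]
    nlinarith

/-- A dominating function for the second-order integrand outside the box. -/
def tailBound (p : Params) (X x : Space) (V T : ℝ) (y : Space) : ℝ :=
  8 * (1 / ((range y - range X) ^ 2 + (‖cross X‖ * T) ^ 2)) * sectionProfile p (cross y) (range y) +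
  (16 / ‖cross X‖ ^ 2 * Real.exp (-(V ^ 2 / 2)) *
    (Set.Icc (range X - ‖cross X‖ * T) (range X + ‖cross X‖ * T)).indicator (fun _ => 1) (range y) *
    Real.exp (-(1 / (2 * p.ro ^ 2)) * ‖cross y‖ ^ 2) +
  1 / 2 * Real.exp (-(‖cross X‖ ^ 2 / (4 * p.ro ^ 2))) *
    ((Set.Iio (‖cross X‖ / 4)).indicator (fun r => 1 / r ^ 2) ‖X + (1 / 2 : ℝ) • x - y‖ +
      (Set.Iio (‖cross X‖ / 4)).indicator (fun r => 1 / r ^ 2) ‖X - (1 / 2 : ℝ) • x - y‖))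

lemma indicator_inv_sq_nonneg (R r : ℝ) :
    0 ≤ (Set.Iio R).indicator (fun r : ℝ => 1 / r ^ 2) r :=
  Set.indicator_nonneg (fun r _ => by positivity) r

lemma tailBound_nonneg (p : Params) (hro : 0 < p.ro) (X x : Space) (V T : ℝ) (y : Space) :
    0 ≤ tailBound p X x V T y := by
  have h1 := sectionProfile_nonneg p hro (cross y) (range y)
  have h2 := indicator_inv_sq_nonneg (‖cross X‖ / 4) ‖X + (1 / 2 : ℝ) • x - y‖
  have h3 := indicator_inv_sq_nonneg (‖cross X‖ / 4) ‖X - (1 / 2 : ℝ) • x - y‖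
  have h4 : 0 ≤ (Set.Icc (range X - ‖cross X‖ * T) (range X + ‖cross X‖ * T)).indicator
      (fun _ => (1 : ℝ)) (range y) := Set.indicator_nonneg (fun _ _ => zero_le_one) _
  unfold tailBound
  positivity

/-- A particle within R/4 of an observation point is at distance at least R/2 from the axis, where
the Gaussian is already below exp(-R²/(4 r_o²)). The singularity 1/r² is kept, since it is
integrable. -/
lemma exp_mul_indicator_le {p : Params} (hro : 0 < p.ro) {R : ℝ} {c y : Space} (hR : 0 < R)
    (hc : 3 / 4 * R ≤ ‖cross c‖) :
    Real.exp (-(‖cross y‖ ^ 2 / p.ro ^ 2)) *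
        (Set.Iio (R / 4)).indicator (fun r => 1 / r ^ 2) ‖c - y‖ ≤
      Real.exp (-(R ^ 2 / (4 * p.ro ^ 2))) *
        (Set.Iio (R / 4)).indicator (fun r => 1 / r ^ 2) ‖c - y‖ := by
  by_cases h : ‖c - y‖ < R / 4
  · refine mul_le_mul_of_nonneg_right ?_ (indicator_inv_sq_nonneg _ _)
    have h1 := norm_cross_le (c - y)
    rw [cross_sub] at h1
    have h2 := norm_sub_norm_le (cross c) (cross y)
    have h3 : R / 2 ≤ ‖cross y‖ := by linarith
    rw [Real.exp_le_exp, neg_le_neg_iff, div_le_div_iff₀ (by positivity) (by positivity)]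
    have h4 : R ^ 2 ≤ 4 * ‖cross y‖ ^ 2 := by nlinarith
    nlinarith [sq_nonneg p.ro]
  · rw [Set.indicator_of_notMem (show ‖c - y‖ ∉ Set.Iio (R / 4) from h)]
    simp

/-- Outside the box there are two ways to be small. If the range differs from Z by more than R T,
both distances are at least half of that difference. Otherwise the particle is farther than r_o V
from the axis: 1/(r₁ r₂) is split by the arithmetic-geometric inequality and bounded by 16/R² away
from the observation points, and half of the Gaussian exponent yields e^{-V²/2} while the other half
is left for integrability. -/
lemma Narrow.norm_le_tailBound {e₀ V T : ℝ} {p : Params} {X x : Space} (h : Narrow e₀ p X x)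
    (he : e₀ ≤ 1 / 4) (hV : 0 ≤ V) (hT : 1 ≤ T) (heT : e₀ * T ≤ 1 / 2) {y : Space}
    (hy : y ∉ boxRegion p X V T) :
    ‖greenBeam p (X + (1 / 2 : ℝ) • x) y * conj (greenBeam p (X - (1 / 2 : ℝ) • x) y)‖ ≤
      Real.exp (-2 * p.kd * range X) / (16 * Real.pi ^ 2) * tailBound p X x V T y := by
  by_cases hpos : 0 < range y
  swap
  · have : ‖greenBeam p (X + (1 / 2 : ℝ) • x) y * conj (greenBeam p (X - (1 / 2 : ℝ) • x) y)‖ = 0 := by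
      simp [greenBeam, beam_of_nonpos p (not_lt.1 hpos)]
    rw [this]
    exact mul_nonneg (by positivity) (tailBound_nonneg p h.ro_pos X x V T y)
  refine (norm_greenBeam_mul_conj_le p h.ro_pos h.kd_pos X x hpos).trans ?_
  refine mul_le_mul_of_nonneg_left ?_ (by positivity)
  have hR := h.cross_pos
  have hro := h.ro_pos
  have hX0 := h.range_pos
  have hxR : ‖x‖ ≤ ‖cross X‖ / 4 := by
    have := h.x_le
    nlinarith
  have hn1 := abs_range_le (X + (1 / 2 : ℝ) • x - y)
  have hn2 := abs_range_le (X - (1 / 2 : ℝ) • x - y)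
  have hc1 : 3 / 4 * ‖cross X‖ ≤ ‖cross (X + (1 / 2 : ℝ) • x)‖ := by
    have h1 := norm_sub_norm_le (cross X) (-((1 / 2 : ℝ) • cross x))
    rw [norm_neg, sub_neg_eq_add, norm_smul, Real.norm_of_nonneg (by norm_num)] at h1
    rw [cross_add, cross_smul]
    linarith [norm_cross_le x]
  have hc2 : 3 / 4 * ‖cross X‖ ≤ ‖cross (X - (1 / 2 : ℝ) • x)‖ := by
    have h1 := norm_sub_norm_le (cross X) ((1 / 2 : ℝ) • cross x)
    rw [norm_smul, Real.norm_of_nonneg (by norm_num)] at h1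
    rw [cross_sub, cross_smul]
    linarith [norm_cross_le x]
  have hi1 := exp_mul_indicator_le (y := y) hro hR hc1
  have hi2 := exp_mul_indicator_le (y := y) hro hR hc2
  have hs1 := one_div_sq_le_indicator hR (norm_nonneg (X + (1 / 2 : ℝ) • x - y))
  have hs2 := one_div_sq_le_indicator hR (norm_nonneg (X - (1 / 2 : ℝ) • x - y))
  rw [range_sub, range_add, range_smul] at hn1
  rw [range_sub, range_sub, range_smul] at hn2
  have i1 := indicator_inv_sq_nonneg (‖cross X‖ / 4) ‖X + (1 / 2 : ℝ) • x - y‖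
  have i2 := indicator_inv_sq_nonneg (‖cross X‖ / 4) ‖X - (1 / 2 : ℝ) • x - y‖
  have i3 : 0 ≤ (Set.Icc (range X - ‖cross X‖ * T) (range X + ‖cross X‖ * T)).indicator
      (fun _ => (1 : ℝ)) (range y) := Set.indicator_nonneg (fun _ _ => zero_le_one) _
  have hS0 := sectionProfile_nonneg p hro (cross y) (range y)
  unfold tailBound
  set r₁ := ‖X + (1 / 2 : ℝ) • x - y‖
  set r₂ := ‖X - (1 / 2 : ℝ) • x - y‖
  set R := ‖cross X‖
  set S := sectionProfile p (cross y) (range y)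
  set N₁ := (Set.Iio (R / 4)).indicator (fun r => 1 / r ^ 2) r₁
  set N₂ := (Set.Iio (R / 4)).indicator (fun r => 1 / r ^ 2) r₂
  by_cases hD : R * T < |range y - range X|
  · refine le_add_of_le_of_nonneg ?_ (by positivity)
    refine mul_le_mul_of_nonneg_right ?_ hS0
    have hxr := abs_range_le x
    have hRT : R ≤ R * T := le_mul_of_one_le_right hR.le hT
    set d := |range y - range X| with hd
    have hd0 : 0 < d := by linarith
    have e1 : d / 2 ≤ r₁ := by
      have h1 := abs_sub (range X + 1 / 2 * range x - range y) (1 / 2 * range x)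
      rw [show range X + 1 / 2 * range x - range y - 1 / 2 * range x = -(range y - range X) by ring,
        abs_neg, abs_mul, abs_of_pos (by norm_num : (0 : ℝ) < 1 / 2)] at h1
      linarith
    have e2 : d / 2 ≤ r₂ := by
      have h1 := abs_add_le (range X - 1 / 2 * range x - range y) (1 / 2 * range x)
      rw [show range X - 1 / 2 * range x - range y + 1 / 2 * range x = -(range y - range X) by ring,
        abs_neg, abs_mul, abs_of_pos (by norm_num : (0 : ℝ) < 1 / 2)] at h1
      linarith
    have e3 : d / 2 * (d / 2) ≤ r₁ * r₂ := by gcongr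
    have e4 : (R * T) ^ 2 ≤ d ^ 2 := by gcongr
    have e5 : (range y - range X) ^ 2 = d ^ 2 := by rw [hd, sq_abs]
    rw [e5, mul_one_div, div_le_div_iff₀ (lt_of_lt_of_le (by positivity) e3) (by positivity)]
    nlinarith
  · refine le_add_of_nonneg_of_le (by positivity) ?_
    have hw : p.ro * V < ‖cross y‖ := (not_mem_boxRegion hR hy).resolve_left hD
    push Not at hD
    have hmem : range y ∈ Set.Icc (range X - R * T) (range X + R * T) := by
      have := abs_le.1 hD
      exact ⟨by linarith, by linarith⟩
    rw [Set.indicator_of_mem hmem, mul_one]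
    have hRT : R * T ≤ range X / 2 := by
      calc R * T ≤ e₀ * range X * T := by have := h.cross_le; gcongr
        _ = e₀ * T * range X := by ring
        _ ≤ 1 / 2 * range X := by gcongr
        _ = _ := by ring
    have hb := h.beamNormSq_div_le he hpos.le (by linarith [hmem.2])
    have hS : S ≤ Real.exp (-(‖cross y‖ ^ 2 / p.ro ^ 2)) :=
      sectionProfile_le p hro (cross y) (by linarith)
    have hE : Real.exp (-(‖cross y‖ ^ 2 / p.ro ^ 2)) ≤
        Real.exp (-(V ^ 2 / 2)) * Real.exp (-(1 / (2 * p.ro ^ 2)) * ‖cross y‖ ^ 2) := by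
      rw [← Real.exp_add, Real.exp_le_exp]
      have : V ^ 2 ≤ ‖cross y‖ ^ 2 / p.ro ^ 2 := by
        rw [le_div_iff₀ (by positivity), ← mul_pow]
        gcongr
        linarith
      have e : -(1 / (2 * p.ro ^ 2)) * ‖cross y‖ ^ 2 = -(‖cross y‖ ^ 2 / p.ro ^ 2 / 2) := by
        field_simp
      rw [e]; linarith
    set E := Real.exp (-(‖cross y‖ ^ 2 / p.ro ^ 2))
    have hE0 : 0 < E := Real.exp_pos _
    calc 1 / (r₁ * r₂) * S ≤ 1 / (r₁ * r₂) * E := by gcongr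
      _ ≤ (1 / 2 * ((16 / R ^ 2 + N₁) + (16 / R ^ 2 + N₂))) * E := by
          gcongr
          exact one_div_mul_le.trans (by gcongr)
      _ = 16 / R ^ 2 * E + 1 / 2 * (E * N₁ + E * N₂) := by ring
      _ ≤ 16 / R ^ 2 * (Real.exp (-(V ^ 2 / 2)) *
          Real.exp (-(1 / (2 * p.ro ^ 2)) * ‖cross y‖ ^ 2)) +
          1 / 2 * (Real.exp (-(R ^ 2 / (4 * p.ro ^ 2))) * N₁ +
            Real.exp (-(R ^ 2 / (4 * p.ro ^ 2))) * N₂) := by gcongr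
      _ = _ := by ring

/-- The constant in the contribution of the neighbourhoods of the observation points. -/
def nearConst : ℝ := 3 * (volume : Measure Space).real (Metric.ball 0 1)

lemma integral_tailBound {p : Params} (hro : 0 < p.ro) {X : Space} (hR : 0 < ‖cross X‖) (x : Space)
    (V : ℝ) {T : ℝ} (hT : 0 < T) :
    Integrable (tailBound p X x V T) ∧ ∫ y, tailBound p X x V T y =
      4 * Real.pi ^ 2 * p.ro ^ 2 / (‖cross X‖ * T) +
      (64 * Real.pi * T * p.ro ^ 2 * Real.exp (-(V ^ 2 / 2)) / ‖cross X‖ +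
        nearConst * ‖cross X‖ / 4 * Real.exp (-(‖cross X‖ ^ 2 / (4 * p.ro ^ 2)))) := by
  set R := ‖cross X‖
  have hD : 0 < R * T := by positivity
  obtain ⟨k1, k2⟩ := integrable_inv_sq_add_sq hD (range X)
  obtain ⟨a1, a2⟩ := integral_comp_cross_range
    (h := fun q => 8 * (1 / ((q.2 - range X) ^ 2 + (R * T) ^ 2)) * sectionProfile p q.1 q.2)
    (φ := fun z => 8 * (1 / ((z - range X) ^ 2 + (R * T) ^ 2)) * (Real.pi * p.ro ^ 2 / 2))
    (by have := measurable_sectionProfile p; fun_prop)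
    (fun q => mul_nonneg (by positivity) (sectionProfile_nonneg p hro _ _))
    (fun z => (integrable_sectionProfile p hro z).const_mul
      (8 * (1 / ((z - range X) ^ 2 + (R * T) ^ 2))))
    ((k1.const_mul 8).mul_const _)
    (fun z => by simp only; rw [integral_const_mul, integral_sectionProfile p hro])
  rw [integral_mul_const, integral_const_mul, k2] at a2
  have hb : 0 < 1 / (2 * p.ro ^ 2) := by positivity
  have hI : Integrable ((Set.Icc (range X - R * T) (range X + R * T)).indicator
      (fun _ => (1 : ℝ))) := by
    rw [integrable_indicator_iff measurableSet_Icc]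
    exact integrableOn_const measure_Icc_lt_top.ne
  have hIv : ∫ z, (Set.Icc (range X - R * T) (range X + R * T)).indicator (fun _ => (1 : ℝ)) z =
      2 * (R * T) := by
    rw [integral_indicator measurableSet_Icc, setIntegral_const,
      Real.volume_real_Icc_of_le (by linarith), smul_eq_mul]
    ring
  obtain ⟨b1, b2⟩ := integral_comp_cross_range
    (h := fun q => 16 / R ^ 2 * Real.exp (-(V ^ 2 / 2)) *
      (Set.Icc (range X - R * T) (range X + R * T)).indicator (fun _ => 1) q.2 *
      Real.exp (-(1 / (2 * p.ro ^ 2)) * ‖q.1‖ ^ 2))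
    (φ := fun z => 16 / R ^ 2 * Real.exp (-(V ^ 2 / 2)) *
      (Set.Icc (range X - R * T) (range X + R * T)).indicator (fun _ => 1) z *
        (Real.pi / (1 / (2 * p.ro ^ 2))))
    (by
      have : Measurable ((Set.Icc (range X - R * T) (range X + R * T)).indicator
        (fun _ => (1 : ℝ))) := measurable_const.indicator measurableSet_Icc
      fun_prop)
    (fun q => by
      have : 0 ≤ (Set.Icc (range X - R * T) (range X + R * T)).indicator (fun _ => (1 : ℝ)) q.2 :=
        Set.indicator_nonneg (fun _ _ => zero_le_one) _
      positivity)
    (fun z => (integrable_exp_neg_norm_sq_plane hb).const_mul (16 / R ^ 2 * Real.exp (-(V ^ 2 / 2)) *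
      (Set.Icc (range X - R * T) (range X + R * T)).indicator (fun _ => 1) z))
    ((hI.const_mul _).mul_const _)
    (fun z => by simp only; rw [integral_const_mul, integral_exp_neg_norm_sq_plane hb])
  rw [integral_mul_const, integral_const_mul, hIv] at b2
  have hN : ∀ c : Space, Integrable (fun y => (Set.Iio (R / 4)).indicator (fun r => 1 / r ^ 2) ‖c - y‖)
      ∧ ∫ y : Space, (Set.Iio (R / 4)).indicator (fun r => 1 / r ^ 2) ‖c - y‖ =
        nearConst * (R / 4) := fun c => by
    refine ⟨(integrable_inv_norm_sq_ball (R / 4)).comp_sub_left c, ?_⟩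
    rw [integral_sub_left_eq_self
      (fun w : Space => (Set.Iio (R / 4)).indicator (fun r => 1 / r ^ 2) ‖w‖) volume c,
      integral_inv_norm_sq_ball (by positivity), nearConst]
  obtain ⟨c1, c2⟩ := hN (X + (1 / 2 : ℝ) • x)
  obtain ⟨d1, d2⟩ := hN (X - (1 / 2 : ℝ) • x)
  have hg3 := (c1.add d1).const_mul (1 / 2 * Real.exp (-(R ^ 2 / (4 * p.ro ^ 2))))
  refine ⟨a1.add (b1.add hg3), ?_⟩
  have e1 := integral_add a1 (b1.add hg3)
  have e2 := integral_add b1 hg3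
  have e3 : ∫ y, 1 / 2 * Real.exp (-(R ^ 2 / (4 * p.ro ^ 2))) *
      ((Set.Iio (R / 4)).indicator (fun r => 1 / r ^ 2) ‖X + (1 / 2 : ℝ) • x - y‖ +
      (Set.Iio (R / 4)).indicator (fun r => 1 / r ^ 2) ‖X - (1 / 2 : ℝ) • x - y‖) =
      1 / 2 * Real.exp (-(R ^ 2 / (4 * p.ro ^ 2))) *
        (nearConst * (R / 4) + nearConst * (R / 4)) := by
    rw [integral_const_mul, integral_add c1 d1, c2, d2]
  have e4 : ∫ y, tailBound p X x V T y = 8 * (Real.pi / (R * T)) * (Real.pi * p.ro ^ 2 / 2) +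
      (16 / R ^ 2 * Real.exp (-(V ^ 2 / 2)) * (2 * (R * T)) * (Real.pi / (1 / (2 * p.ro ^ 2))) +
      1 / 2 * Real.exp (-(R ^ 2 / (4 * p.ro ^ 2))) *
        (nearConst * (R / 4) + nearConst * (R / 4))) := by
    rw [← e3, ← b2, ← a2]
    exact e1.trans (congrArg _ e2)
  rw [e4]
  field_simp
  ring

lemma Narrow.norm_integral_compl_le {e₀ V T : ℝ} {p : Params} {X x : Space} (h : Narrow e₀ p X x)
    (he : e₀ ≤ 1 / 4) (hV : 0 ≤ V) (hT : 1 ≤ T) (heT : e₀ * T ≤ 1 / 2) :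
    ‖∫ y in (boxRegion p X V T)ᶜ,
        greenBeam p (X + (1 / 2 : ℝ) • x) y * conj (greenBeam p (X - (1 / 2 : ℝ) • x) y)‖ ≤
      Real.exp (-2 * p.kd * range X) * p.ro ^ 2 / (16 * Real.pi ^ 2 * ‖cross X‖) *
        (4 * Real.pi ^ 2 / T + 64 * Real.pi * T * Real.exp (-(V ^ 2 / 2)) +
          8 * nearConst * e₀ ^ 2) := by
  have hR := h.cross_pos
  have hro := h.ro_pos
  obtain ⟨i1, i2⟩ := integral_tailBound hro hR x V (by linarith : 0 < T)
  have i3 := i1.const_mul (Real.exp (-2 * p.kd * range X) / (16 * Real.pi ^ 2))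
  refine (norm_integral_le_of_norm_le i3.integrableOn
    ((ae_restrict_iff' (measurableSet_boxRegion p X V T).compl).2 (ae_of_all _ fun y hy =>
      h.norm_le_tailBound he hV hT heT hy))).trans ?_
  refine (setIntegral_le_integral i3 (ae_of_all _ fun y =>
    mul_nonneg (by positivity) (tailBound_nonneg p hro X x V T y))).trans ?_
  rw [integral_const_mul, i2]
  set R := ‖cross X‖
  set c := Real.exp (-2 * p.kd * range X)
  have hn : 0 ≤ nearConst := by unfold nearConst; positivity
  -- The neighbourhoods of the observation points contribute R times an exponential of -(R/r_o)².
  -- The quadratic lower bound of the exponential gives (r_o/R)⁴, which leaves r_o²/R, the size of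
  -- the main term, times a factor of order e₀².
  have key : nearConst * R / 4 * Real.exp (-(R ^ 2 / (4 * p.ro ^ 2))) ≤
      p.ro ^ 2 / R * (8 * nearConst * e₀ ^ 2) := by
    have h1 := Real.quadratic_le_exp_of_nonneg (x := R ^ 2 / (4 * p.ro ^ 2)) (by positivity)
    have h2 : (R ^ 2 / (4 * p.ro ^ 2)) ^ 2 / 2 ≤ Real.exp (R ^ 2 / (4 * p.ro ^ 2)) := by
      have : 0 ≤ R ^ 2 / (4 * p.ro ^ 2) := by positivity
      linarith
    have h3 : Real.exp (-(R ^ 2 / (4 * p.ro ^ 2))) ≤ 32 * (p.ro ^ 2) ^ 2 / (R ^ 2) ^ 2 := by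
      rw [Real.exp_neg, inv_le_comm₀ (Real.exp_pos _) (by positivity)]
      refine le_of_eq_of_le ?_ h2
      field_simp
      norm_num
    have h4 : p.ro ^ 2 ≤ e₀ ^ 2 * R ^ 2 := by
      rw [← mul_pow]; have := h.ro_le; gcongr
    calc _ ≤ nearConst * R / 4 * (32 * (p.ro ^ 2) ^ 2 / (R ^ 2) ^ 2) := by gcongr
      _ = 8 * nearConst * (p.ro ^ 2 / R) * (p.ro ^ 2 / R ^ 2) := by field_simp; ring
      _ ≤ 8 * nearConst * (p.ro ^ 2 / R) * (e₀ ^ 2 * R ^ 2 / R ^ 2) := by gcongr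
      _ = _ := by field_simp
  have hT0 : 0 < T := by linarith
  calc _ ≤ c / (16 * Real.pi ^ 2) * (4 * Real.pi ^ 2 * p.ro ^ 2 / (R * T) +
      (64 * Real.pi * T * p.ro ^ 2 * Real.exp (-(V ^ 2 / 2)) / R +
        p.ro ^ 2 / R * (8 * nearConst * e₀ ^ 2))) := by gcongr
    _ = _ := by field_simp; ring

/-! ### The second-order correlation integral -/

/-- T is fixed before V, since the Gaussian tail is multiplied by the length of the box in range.
The crude bound e^{-V²/2} ≤ 2/V suffices. -/
lemma exists_box_size {V₀ T₀ ε : ℝ} (hV₀ : 1 ≤ V₀) (hT₀ : 1 ≤ T₀) (hε : 0 < ε) :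
    ∃ V ≥ V₀, ∃ T ≥ T₀, 4 * Real.pi ^ 2 / T + 64 * Real.pi * T * Real.exp (-(V ^ 2 / 2)) ≤
      2 / 3 * ε := by
  have hpi := Real.pi_pos
  set T := max T₀ (12 * Real.pi ^ 2 / ε)
  have hT : 0 < T := lt_of_lt_of_le (by linarith) (le_max_left T₀ _)
  set V := max V₀ (384 * Real.pi * T / ε)
  have hV1 : 1 ≤ V := hV₀.trans (le_max_left _ _)
  have hV : 0 < V := by linarith
  refine ⟨V, le_max_left _ _, T, le_max_left _ _, ?_⟩
  have h1 : 4 * Real.pi ^ 2 / T ≤ ε / 3 := by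
    have : 12 * Real.pi ^ 2 / ε ≤ T := le_max_right _ _
    rw [div_le_iff₀ hε] at this
    rw [div_le_iff₀ hT]
    linarith
  have h2 : 64 * Real.pi * T * Real.exp (-(V ^ 2 / 2)) ≤ ε / 3 := by
    have h3 : 384 * Real.pi * T / ε ≤ V := le_max_right _ _
    rw [div_le_iff₀ hε] at h3
    have h4 : Real.exp (-(V ^ 2 / 2)) ≤ 2 / V := by
      rw [Real.exp_neg, inv_le_comm₀ (Real.exp_pos _) (by positivity), inv_div]
      have := Real.add_one_le_exp (V ^ 2 / 2)
      nlinarith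
    calc _ ≤ 64 * Real.pi * T * (2 / V) := by gcongr
      _ = 128 * Real.pi * T / V := by ring
      _ ≤ ε / 3 := by rw [div_le_iff₀ hV]; linarith
  linarith

/-- The second-order correlation integral of the single-scattering kernel. -/
lemma exists_norm_correlation_sub_le {ε : ℝ} (hε : 0 < ε) :
    ∃ e₀ > 0, ∀ p X x, Narrow e₀ p X x →
      ‖(∫ y, greenBeam p (X + (1 / 2 : ℝ) • x) y * conj (greenBeam p (X - (1 / 2 : ℝ) • x) y)) -
        ((p.ro ^ 2 * Real.exp (-2 * p.kd * range X) / (32 * ‖cross X‖) : ℝ) : ℂ) *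
          Psi (p.k * inner ℝ (unit (cross X)) (cross x))
            (p.k * p.ro / (2 * ‖cross X‖) * inner ℝ (rot (unit (cross X))) (cross x))
            (p.k * range x)‖ ≤
      p.ro ^ 2 * Real.exp (-2 * p.kd * range X) / (32 * ‖cross X‖) * ε := by
  have hpi := Real.pi_pos
  obtain ⟨V₀, hV₀, T₀, hT₀, hΨ⟩ := exists_norm_box_sub_Psi_le hε
  obtain ⟨V, hV, T, hT, hVT⟩ := exists_box_size hV₀ hT₀ hε
  have hV1 : 1 ≤ V := hV₀.trans hV
  have hT1 : 1 ≤ T := hT₀.trans hT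
  have hT0 : 0 < T := by linarith
  obtain ⟨e₁, he₁, H⟩ := exists_norm_box_integral_sub_le hV1 hT1 hε
  have hn : 0 ≤ nearConst := by unfold nearConst; positivity
  obtain ⟨e₂, he₂, he₂'⟩ := exists_small_sq (B := 8 * nearConst) (ε := ε / 3) (by positivity)
    (by positivity)
  refine ⟨min (min e₁ e₂) (min (1 / 4) (1 / (2 * T))), by positivity, fun p X x h => ?_⟩
  set e₀ := min (min e₁ e₂) (min (1 / 4) (1 / (2 * T)))
  have he0 : 0 < e₀ := by positivity
  have h1 : e₀ ≤ e₁ := (min_le_left _ _).trans (min_le_left _ _)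
  have h2 : e₀ ≤ e₂ := (min_le_left _ _).trans (min_le_right _ _)
  have h3 : e₀ ≤ 1 / 4 := (min_le_right _ _).trans (min_le_left _ _)
  have h4 : e₀ * T ≤ 1 / 2 := by
    have : e₀ ≤ 1 / (2 * T) := (min_le_right _ _).trans (min_le_right _ _)
    rw [le_div_iff₀ (by positivity)] at this
    linarith
  have hR := h.cross_pos
  have hro := h.ro_pos
  have hB := H p X x (h.mono h1)
  have htail := h.norm_integral_compl_le h3 (by linarith : (0 : ℝ) ≤ V) hT1 h4
  have hΨ' := hΨ V hV T hT (p.k * inner ℝ (unit (cross X)) (cross x))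
    (p.k * p.ro / (2 * ‖cross X‖) * inner ℝ (rot (unit (cross X))) (cross x)) (p.k * range x)
  have hI := integrable_greenBeam_mul_conj p hro h.kd_pos (X + (1 / 2 : ℝ) • x)
    (X - (1 / 2 : ℝ) • x)
  have hsplit := integral_add_compl (measurableSet_boxRegion p X V T) hI
  rw [setIntegral_boxMap (norm_unit hR) hro hR (range X), preimage_boxRegion p hro hR] at hsplit
  rw [← hsplit]
  set J := ∫ q in box V T, greenBeam p (X + (1 / 2 : ℝ) • x)
      (boxMap (unit (cross X)) p.ro ‖cross X‖ (range X) q) *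
    conj (greenBeam p (X - (1 / 2 : ℝ) • x)
      (boxMap (unit (cross X)) p.ro ‖cross X‖ (range X) q))
  set τ := ∫ y in (boxRegion p X V T)ᶜ,
    greenBeam p (X + (1 / 2 : ℝ) • x) y * conj (greenBeam p (X - (1 / 2 : ℝ) • x) y)
  set ψ := Psi (p.k * inner ℝ (unit (cross X)) (cross x))
    (p.k * p.ro / (2 * ‖cross X‖) * inner ℝ (rot (unit (cross X))) (cross x)) (p.k * range x)
  set M := ((∫ v in (-V)..V, Real.exp (-2 * v ^ 2) : ℝ) : ℂ) *
    ∫ v in (-V)..V, ∫ t in (-T)..T, corrIntegrand 1 0 0 0 0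
      (p.k * inner ℝ (unit (cross X)) (cross x))
      (p.k * p.ro / (2 * ‖cross X‖) * inner ℝ (rot (unit (cross X))) (cross x)) (p.k * range x) v t
  set R := ‖cross X‖
  set E := Real.exp (-2 * p.kd * range X)
  have hE : 0 < E := Real.exp_pos _
  set Q := E * p.ro ^ 2 / (16 * Real.pi ^ 2 * R) with hQ
  have hQ0 : 0 < Q := by positivity
  -- The Jacobian r_o² R, the prefactor 1/(16 π² R²) and the limit constant π²/2 multiply to
  -- r_o²/(32 R).
  have q1 : p.ro ^ 2 * E / (32 * R) = Q * (Real.pi ^ 2 / 2) := by rw [hQ]; field_simp; norm_num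
  have q2 : p.ro ^ 2 * R * (E / (16 * Real.pi ^ 2 * R ^ 2)) = Q := by rw [hQ]; field_simp
  rw [q1]
  have hdec : ((p.ro ^ 2 * R : ℝ) : ℂ) * J + τ - ((Q * (Real.pi ^ 2 / 2) : ℝ) : ℂ) * ψ =
      ((p.ro ^ 2 * R : ℝ) : ℂ) * (J - ((E / (16 * Real.pi ^ 2 * R ^ 2) : ℝ) : ℂ) * M) +
        ((Q : ℂ) * (M - ((Real.pi ^ 2 / 2 : ℝ) : ℂ) * ψ) + τ) := by
    rw [mul_sub, ← mul_assoc, ← Complex.ofReal_mul, q2]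
    push_cast; ring
  rw [hdec]
  have n1 : ‖((p.ro ^ 2 * R : ℝ) : ℂ) * (J - ((E / (16 * Real.pi ^ 2 * R ^ 2) : ℝ) : ℂ) * M)‖ ≤
      Q * ε := by
    rw [norm_mul, Complex.norm_real, Real.norm_of_nonneg (by positivity)]
    calc _ ≤ p.ro ^ 2 * R * (E / (16 * Real.pi ^ 2 * R ^ 2) * ε) := by gcongr
      _ = Q * ε := by rw [← mul_assoc, q2]
  have n2 : ‖(Q : ℂ) * (M - ((Real.pi ^ 2 / 2 : ℝ) : ℂ) * ψ)‖ ≤ Q * ε := by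
    rw [norm_mul, Complex.norm_real, Real.norm_of_nonneg hQ0.le]
    gcongr
  have n3 : ‖τ‖ ≤ Q * ε := by
    refine htail.trans ?_
    gcongr
    have : 8 * nearConst * e₀ ^ 2 ≤ 8 * nearConst * e₂ ^ 2 := by gcongr
    linarith
  -- Three errors of size Q ε, from the box, the limit of the box integral and the exterior, fit in
  -- the target Q ε π²/2.
  have hpi2 : 3 ≤ Real.pi ^ 2 / 2 := by nlinarith [Real.pi_gt_three]
  calc _ ≤ Q * ε + (Q * ε + Q * ε) :=
        (norm_add_le _ _).trans (add_le_add n1 ((norm_add_le _ _).trans (add_le_add n2 n3)))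
    _ = Q * ε * 3 := by ring
    _ ≤ Q * ε * (Real.pi ^ 2 / 2) := by gcongr
    _ = _ := by ring

/-! ### The scaling regime -/

/-- The midpoint need not belong to the aperture, but it is within d_A ≤ δ r_o of it, so the bounds
on cross-range and range survive up to a factor 2. The worst constant, 2C², comes from comparing |X|
with L_x, L_x with L_z and L_z with Z. -/
lemma Regime.narrow {C δ e₀ : ℝ} {p : Params} {A : Set Space} (h : Regime δ p) (hC : 1 ≤ C)
    (hδ0 : 0 < δ) (hδC : δ * C ≤ 1) (he : 2 * C ^ 2 * δ ≤ e₀) (hA : IsAperture C p A) {X x : Space}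
    (h₁ : X + (1 / 2 : ℝ) • x ∈ A) (h₂ : X - (1 / 2 : ℝ) • x ∈ A) :
    Narrow e₀ p X x ∧ p.Lx ≤ 2 * C * ‖cross X‖ := by
  have hro := h.ro_pos
  have hLx := h.Lx_pos
  have hLz := h.Lz_pos
  have hk : 0 < p.k := div_pos Real.two_pi_pos h.lam_pos
  have hC0 : 0 < C := by linarith
  have hδ1 : δ ≤ 1 := by nlinarith
  have hx : ‖x‖ ≤ δ * p.ro := by
    have := (hA.dist_le _ h₁ _ h₂).trans h.dA_ro
    rwa [dist_eq_norm, show X + (1 / 2 : ℝ) • x - (X - (1 / 2 : ℝ) • x) = (2 * (1 / 2) : ℝ) • x by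
      rw [mul_smul, two_smul]; abel, mul_one_div_cancel two_ne_zero, one_smul] at this
  have hcx := norm_cross_le x
  have a1 := hA.le_cross _ h₁
  have a2 := hA.cross_le _ h₁
  have b1 := hA.le_range _ h₁
  have b2 := hA.range_le _ h₁
  have b3 := hA.le_range _ h₂
  have b4 := hA.range_le _ h₂
  rw [cross_add, cross_smul] at a1 a2
  rw [range_add, range_smul] at b1 b2
  rw [range_sub, range_smul] at b3 b4
  have n1 := norm_add_le (cross X) ((1 / 2 : ℝ) • cross x)
  have n2 := norm_sub_le (cross X + (1 / 2 : ℝ) • cross x) ((1 / 2 : ℝ) • cross x)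
  rw [add_sub_cancel_right] at n2
  rw [norm_smul, Real.norm_of_nonneg (by norm_num)] at n1 n2
  have hroLx : p.ro ≤ δ * p.Lx := h.ro_Lx
  have hxLx : ‖x‖ ≤ δ * p.Lx := hx.trans
    ((mul_le_of_le_one_left hro.le hδ1).trans hroLx)
  have hδLx : δ * p.Lx ≤ p.Lx / C := by
    rw [le_div_iff₀ hC0]; nlinarith
  have hLR : p.Lx / C ≤ 2 * ‖cross X‖ := by linarith
  have hLR' : p.Lx ≤ 2 * C * ‖cross X‖ := by
    rw [div_le_iff₀ hC0] at hLR; linarith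
  have hR : 0 < ‖cross X‖ := by
    have : 0 < p.Lx / C := by positivity
    linarith
  have hRL : ‖cross X‖ ≤ 2 * C * p.Lx := by
    have : δ * p.Lx ≤ C * p.Lx := mul_le_mul_of_nonneg_right (by linarith) hLx.le
    linarith
  have hZ : p.Lz ≤ C * range X := by
    have : p.Lz / C ≤ range X := by linarith
    rw [div_le_iff₀ hC0] at this; linarith
  have hZ0 : 0 < range X := pos_of_mul_pos_right (hLz.trans_le hZ) hC0.le
  have hCC : C ≤ C ^ 2 := by nlinarith
  have hCδ : 2 * C * δ ≤ e₀ := le_trans (by gcongr) he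
  refine ⟨⟨hro, hk, h.kd_pos, hR, ?_, ?_, ?_, ?_, ?_⟩, hLR'⟩
  · calc p.ro ≤ δ * (2 * C * ‖cross X‖) := hroLx.trans (by gcongr)
      _ = 2 * C * δ * ‖cross X‖ := by ring
      _ ≤ e₀ * ‖cross X‖ := by gcongr
  · calc ‖x‖ ≤ δ * (2 * C * ‖cross X‖) := hxLx.trans (by gcongr)
      _ = 2 * C * δ * ‖cross X‖ := by ring
      _ ≤ e₀ * ‖cross X‖ := by gcongr
  · calc ‖cross X‖ ≤ 2 * C * (δ * (C * range X)) := by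
          refine hRL.trans ?_
          gcongr
          exact h.Lx_Lz.trans (by gcongr)
      _ = 2 * C ^ 2 * δ * range X := by ring
      _ ≤ e₀ * range X := by gcongr
  · have : p.Lz ≤ δ * (p.k * p.ro ^ 2 / 2) := h.Lz_rayleigh
    have hkr : 0 ≤ p.k * p.ro ^ 2 := by positivity
    calc 2 * range X ≤ 2 * (C * (δ * (p.k * p.ro ^ 2 / 2))) := by
          have : range X ≤ C * p.Lz := by linarith
          nlinarith
      _ = C * δ * (p.k * p.ro ^ 2) := by ring
      _ ≤ e₀ * (p.k * p.ro ^ 2) := by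
          gcongr
          have : 0 ≤ C * δ := by positivity
          linarith
  · calc p.kd * ‖cross X‖ ≤ p.kd * (2 * C * p.Lx) := by have := h.kd_pos; gcongr
      _ = 2 * C * (p.kd * p.Lx) := by ring
      _ ≤ 2 * C * δ := by have := h.kd_Lx; gcongr
      _ ≤ e₀ := hCδ

/-! ### The mean field -/

/-- The constant in the bound of the mean field. -/
def meanConst : ℝ := crossConst + farConst

lemma crossConst_nonneg : 0 ≤ crossConst := by
  have := Real.pi_pos
  unfold crossConst; positivity

lemma farConst_nonneg : 0 ≤ farConst := by unfold farConst; positivity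

lemma Narrow.hundred_twenty_eight_mul_le {e₀ : ℝ} {p : Params} {X x : Space} (h : Narrow e₀ p X x)
    (he : e₀ ≤ 1 / 128) : 128 * (‖cross X‖ + range X) ≤ p.k * p.ro ^ 2 := by
  have h1 := h.cross_le
  have h2 := h.range_le
  have h3 := h.range_pos
  have h4 : 0 < p.k * p.ro ^ 2 := mul_pos h.k_pos (pow_pos h.ro_pos 2)
  nlinarith

/-- Both Z/k and 1/k² are at most e₀ r_o²: the former because the range is well below the Rayleigh
length, the latter because the wavelength is much smaller than the beam. -/
lemma Narrow.norm_integral_greenBeam_le {e₀ : ℝ} {p : Params} {X x : Space} (h : Narrow e₀ p X x)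
    (he : e₀ ≤ 1 / 128) :
    ‖∫ y, greenBeam p X y‖ ≤ meanConst * e₀ * p.ro ^ 2 * Real.exp (-p.kd * range X) *
      Real.exp (-(‖cross X‖ ^ 2 / (64 * p.ro ^ 2))) := by
  have hk := h.k_pos
  have hro := h.ro_pos
  have hZ := h.range_pos
  have he0 := h.pos
  refine (LaserBeam.norm_integral_greenBeam_le p hk h.kd_pos hro hZ h.cross_pos
    (h.hundred_twenty_eight_mul_le he)).trans ?_
  have h1 : range X / p.k ≤ e₀ * p.ro ^ 2 := by
    rw [div_le_iff₀ hk]; nlinarith [h.range_le]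
  -- That k r_o is large is not an assumption of `Narrow`: chaining r_o ≤ e₀ R, R ≤ e₀ Z and 2Z ≤ e₀
  -- k r_o² gives 2 ≤ e₀³ k r_o.
  have h2 : 1 / p.k ^ 2 ≤ e₀ * p.ro ^ 2 := by
    have a1 : p.ro ≤ e₀ ^ 2 * range X := by
      have := h.ro_le.trans (mul_le_mul_of_nonneg_left h.cross_le he0.le)
      linarith
    have a2 : 2 * p.ro ≤ e₀ ^ 3 * (p.k * p.ro ^ 2) := by
      have := mul_le_mul_of_nonneg_left h.range_le (sq_nonneg e₀)
      linarith
    have a3 : 2 ≤ e₀ ^ 3 * (p.k * p.ro) := by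
      have : p.ro * 2 ≤ p.ro * (e₀ ^ 3 * (p.k * p.ro)) := by linarith
      exact le_of_mul_le_mul_left this hro
    have a4 : e₀ ^ 3 ≤ e₀ := by
      have : e₀ ^ 2 ≤ 1 := by nlinarith
      nlinarith
    have a5 : 1 ≤ e₀ * (p.k * p.ro) := by
      have : e₀ ^ 3 * (p.k * p.ro) ≤ e₀ * (p.k * p.ro) := by gcongr
      linarith
    rw [div_le_iff₀ (by positivity)]
    have a6 : 1 ≤ (e₀ * (p.k * p.ro)) ^ 2 := one_le_pow₀ a5
    have a7 : (e₀ * (p.k * p.ro)) ^ 2 ≤ e₀ * (p.k * p.ro) ^ 2 := by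
      rw [mul_pow]; gcongr; nlinarith
    calc (1 : ℝ) ≤ e₀ * (p.k * p.ro) ^ 2 := a6.trans a7
      _ = _ := by ring
  have hc := crossConst_nonneg
  have hf := farConst_nonneg
  gcongr
  calc crossConst * range X / p.k + farConst / p.k ^ 2 =
      crossConst * (range X / p.k) + farConst * (1 / p.k ^ 2) := by ring
    _ ≤ crossConst * (e₀ * p.ro ^ 2) + farConst * (e₀ * p.ro ^ 2) := by gcongr
    _ = _ := by unfold meanConst; ring

/-- The oscillatory bound is e₀ r_o² e^{-k_d Z} up to a constant and the absolute integral is at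
least `lowerConst` times r_o² e^{-k_d Z}, so the relative size of the mean is O(e₀). The Gaussian
gain is not needed here. -/
lemma Narrow.norm_integral_greenBeam_le_mul {e₀ ε : ℝ} {p : Params} {X x : Space}
    (h : Narrow e₀ p X x) (he : e₀ ≤ 1 / 128) (hε : meanConst * e₀ ≤ ε * lowerConst) :
    ‖∫ y, greenBeam p X y‖ ≤ ε * ∫ y, ‖greenBeam p X y‖ := by
  have he0 := h.pos
  have hR := h.cross_pos
  have hm : 0 ≤ meanConst := add_nonneg crossConst_nonneg farConst_nonneg
  have hε0 : 0 ≤ ε := nonneg_of_mul_nonneg_left ((mul_nonneg hm he0.le).trans hε) lowerConst_pos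
  have hlow := le_integral_norm_greenBeam p h.k_pos h.kd_pos h.ro_pos (x := X)
    (by have := h.cross_le; have := h.range_pos; nlinarith) (by have := h.ro_le; nlinarith)
    (by have := h.kd_le; linarith) (h.hundred_twenty_eight_mul_le he)
  refine (h.norm_integral_greenBeam_le he).trans (le_trans ?_ (mul_le_mul_of_nonneg_left hlow hε0))
  have h1 : Real.exp (-(‖cross X‖ ^ 2 / (64 * p.ro ^ 2))) ≤ 1 :=
    Real.exp_le_one_iff.2 (neg_nonpos.2 (by positivity))
  calc _ ≤ meanConst * e₀ * p.ro ^ 2 * Real.exp (-p.kd * range X) * 1 := by gcongr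
    _ ≤ ε * lowerConst * p.ro ^ 2 * Real.exp (-p.kd * range X) * 1 := by gcongr
    _ = _ := by ring

/-- The squared mean carries one more factor ρ than the variance, so the number ρ r_o² R = (r_o/ℓ)³
(R/r_o) has to be beaten. The squared mean contains the inverse square of the exponential gain: one
power pays for (r_o/ℓ)³ by assumption, the other for R/r_o. -/
lemma Narrow.sq_norm_integral_greenBeam_le {e₀ : ℝ} {p : Params} {X x : Space}
    (h : Narrow e₀ p X x) (he : e₀ ≤ 1 / 128) (hell : 0 < p.ell)
    (hexp : (p.ro / p.ell) ^ 3 ≤ Real.exp (‖cross X‖ ^ 2 / (64 * p.ro ^ 2))) :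
    p.rho * ‖∫ y, greenBeam p X y‖ ^ 2 ≤ (12 * meanConst * e₀) ^ 2 *
      (p.ro ^ 2 * Real.exp (-2 * p.kd * range X) / (32 * ‖cross X‖)) := by
  have he0 := h.pos
  have hR := h.cross_pos
  have hro := h.ro_pos
  have hm : 0 ≤ meanConst := add_nonneg crossConst_nonneg farConst_nonneg
  have hρ : 0 < p.rho := by unfold Params.rho; positivity
  have hb := h.norm_integral_greenBeam_le he
  set R := ‖cross X‖
  have hG : Real.exp (-(R ^ 2 / (64 * p.ro ^ 2))) =
      (Real.exp (R ^ 2 / (64 * p.ro ^ 2)))⁻¹ := Real.exp_neg _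
  set G := Real.exp (R ^ 2 / (64 * p.ro ^ 2)) with hGd
  have hG0 : 0 < G := Real.exp_pos _
  have hE : Real.exp (-p.kd * range X) ^ 2 = Real.exp (-2 * p.kd * range X) := by
    rw [← Real.exp_nat_mul]; congr 1; push_cast; ring
  set E := Real.exp (-p.kd * range X)
  have key : p.rho * p.ro ^ 2 * R ≤ 4 * G ^ 2 := by
    have e1 : p.rho * p.ro ^ 2 * R = (p.ro / p.ell) ^ 3 * (R / p.ro) := by
      unfold Params.rho; field_simp
    -- With u = R/r_o, the inequality u ≤ 4(1 + u²/64) is (u - 8)² ≥ 0.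
    have e2 : R / p.ro ≤ 4 * G := by
      have := Real.add_one_le_exp (R ^ 2 / (64 * p.ro ^ 2))
      have e3 : R ^ 2 / (64 * p.ro ^ 2) = (R / p.ro) ^ 2 / 64 := by field_simp
      rw [← hGd, e3] at this
      nlinarith [sq_nonneg (R / p.ro - 8)]
    rw [e1]
    calc _ ≤ G * (4 * G) := by gcongr
      _ = _ := by ring
  calc p.rho * ‖∫ y, greenBeam p X y‖ ^ 2 ≤
      p.rho * (meanConst * e₀ * p.ro ^ 2 * E * G⁻¹) ^ 2 := by rw [← hG]; gcongr
    _ = (p.rho * p.ro ^ 2 * R) * ((meanConst * e₀) ^ 2 * p.ro ^ 2 * E ^ 2 / (R * G ^ 2)) := by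
        field_simp
    _ ≤ 4 * G ^ 2 * ((meanConst * e₀) ^ 2 * p.ro ^ 2 * E ^ 2 / (R * G ^ 2)) := by gcongr
    _ = 128 * ((meanConst * e₀) ^ 2 * (p.ro ^ 2 * E ^ 2 / (32 * R))) := by field_simp; ring
    -- 128 is rounded up to the square of 12 so that the square root of the bound is free of
    -- radicals.
    _ ≤ 144 * ((meanConst * e₀) ^ 2 * (p.ro ^ 2 * E ^ 2 / (32 * R))) := by gcongr; norm_num
    _ = _ := by rw [hE]; ring

/-! ### Moments of the scattered field -/

section Moments

variable {Ω : Type*} [MeasurableSpace Ω] {P : Measure Ω} {pts : ℕ → Ω → Space} {p : Params}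

lemma integral_scattered (h : IsPoissonCloud P p.rho pts) (hρ : 0 ≤ p.rho) (hro : 0 < p.ro)
    (hkd : 0 < p.kd) (x : Space) :
    ∫ ω, scattered p pts x ω ∂P = p.rho * (((p.k ^ 2 * p.eta : ℝ) : ℂ) * ∫ y, greenBeam p x y) := by
  rw [← integral_const_mul]
  simp_rw [← singleScatter_eq]
  exact h.integral_tsum hρ (integrable_singleScatter p hro hkd x)

lemma norm_integral_scattered (h : IsPoissonCloud P p.rho pts) (hρ : 0 ≤ p.rho) (hro : 0 < p.ro)
    (hkd : 0 < p.kd) (x : Space) :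
    ‖∫ ω, scattered p pts x ω ∂P‖ = p.rho * (|p.k ^ 2 * p.eta| * ‖∫ y, greenBeam p x y‖) := by
  rw [integral_scattered h hρ hro hkd, norm_mul, norm_mul, Complex.norm_real, Complex.norm_real,
    Real.norm_of_nonneg hρ, Real.norm_eq_abs]

lemma integral_tsum_norm_singleScatter (h : IsPoissonCloud P p.rho pts) (hρ : 0 ≤ p.rho)
    (hro : 0 < p.ro) (hkd : 0 < p.kd) (x : Space) :
    ∫ ω, ∑' j, ‖singleScatter p x (pts j ω)‖ ∂P =
      p.rho * (|p.k ^ 2 * p.eta| * ∫ y, ‖greenBeam p x y‖) := by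
  rw [h.integral_tsum_norm hρ (integrable_singleScatter p hro hkd x)]
  congr 1
  rw [← integral_const_mul]
  simp_rw [singleScatter_eq, norm_mul, Complex.norm_real, Real.norm_eq_abs]

lemma integral_singleScatter_mul_conj (p : Params) (x₁ x₂ : Space) :
    ∫ y, singleScatter p x₁ y * conj (singleScatter p x₂ y) =
      (((p.k ^ 2 * p.eta) ^ 2 : ℝ) : ℂ) * ∫ y, greenBeam p x₁ y * conj (greenBeam p x₂ y) := by
  rw [← integral_const_mul]
  congr 1
  funext y
  rw [singleScatter_eq, singleScatter_eq, map_mul, Complex.conj_ofReal]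
  push_cast
  ring

lemma meanIntensity_eq (p : Params) (X : Space) :
    meanIntensity p X = p.rho * (p.k ^ 2 * p.eta) ^ 2 *
      (p.ro ^ 2 * Real.exp (-2 * p.kd * range X) / (32 * ‖cross X‖)) := by
  unfold meanIntensity; ring

lemma covariance_scattered [IsProbabilityMeasure P] (h : IsPoissonCloud P p.rho pts)
    (hρ : 0 ≤ p.rho) (hro : 0 < p.ro) (hkd : 0 < p.kd) (x₁ x₂ : Space) :
    ∫ ω, (scattered p pts x₁ ω - ∫ ω', scattered p pts x₁ ω' ∂P) *
        conj (scattered p pts x₂ ω - ∫ ω', scattered p pts x₂ ω' ∂P) ∂P =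
      ((p.rho * (p.k ^ 2 * p.eta) ^ 2 : ℝ) : ℂ) *
        ∫ y, greenBeam p x₁ y * conj (greenBeam p x₂ y) := by
  have := h.covariance hρ (integrable_singleScatter p hro hkd x₁)
    (integrable_singleScatter p hro hkd x₂) (memLp_singleScatter p hro hkd x₁)
    (memLp_singleScatter p hro hkd x₂) (measurable_singleScatter p x₁)
    (measurable_singleScatter p x₂)
  rw [integral_singleScatter_mul_conj, ← mul_assoc, ← Complex.ofReal_mul] at this
  exact this

lemma secondMoment_scattered (h : IsPoissonCloud P p.rho pts)
    (hρ : 0 ≤ p.rho) (hro : 0 < p.ro) (hkd : 0 < p.kd) (x₁ x₂ : Space) :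
    ∫ ω, scattered p pts x₁ ω * conj (scattered p pts x₂ ω) ∂P =
      ((p.rho * (p.k ^ 2 * p.eta) ^ 2 : ℝ) : ℂ) *
        (∫ y, greenBeam p x₁ y * conj (greenBeam p x₂ y)) +
        (∫ ω, scattered p pts x₁ ω ∂P) * conj (∫ ω, scattered p pts x₂ ω ∂P) := by
  have := h.integral_tsum_mul_conj_tsum hρ (integrable_singleScatter p hro hkd x₁)
    (integrable_singleScatter p hro hkd x₂) (memLp_singleScatter p hro hkd x₁)
    (memLp_singleScatter p hro hkd x₂) (measurable_singleScatter p x₁)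
    (measurable_singleScatter p x₂)
  rw [integral_singleScatter_mul_conj, ← mul_assoc, ← Complex.ofReal_mul,
    ← h.integral_tsum hρ (integrable_singleScatter p hro hkd x₁),
    ← h.integral_tsum hρ (integrable_singleScatter p hro hkd x₂)] at this
  exact this

lemma norm_sub_covModel_le {ε : ℝ} {X x : Space} (hρ : 0 ≤ p.rho)
    (hN : ‖(∫ y, greenBeam p (X + (1 / 2 : ℝ) • x) y *
        conj (greenBeam p (X - (1 / 2 : ℝ) • x) y)) -
      ((p.ro ^ 2 * Real.exp (-2 * p.kd * range X) / (32 * ‖cross X‖) : ℝ) : ℂ) *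
        Psi (p.k * inner ℝ (unit (cross X)) (cross x))
          (p.k * p.ro / (2 * ‖cross X‖) * inner ℝ (rot (unit (cross X))) (cross x))
          (p.k * range x)‖ ≤
      p.ro ^ 2 * Real.exp (-2 * p.kd * range X) / (32 * ‖cross X‖) * ε) :
    ‖((p.rho * (p.k ^ 2 * p.eta) ^ 2 : ℝ) : ℂ) * (∫ y, greenBeam p (X + (1 / 2 : ℝ) • x) y *
        conj (greenBeam p (X - (1 / 2 : ℝ) • x) y)) - covModel p X x‖ ≤
      ε * meanIntensity p X := by
  have hc : 0 ≤ p.rho * (p.k ^ 2 * p.eta) ^ 2 := by positivity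
  rw [covModel, meanIntensity_eq]
  set c := p.rho * (p.k ^ 2 * p.eta) ^ 2
  rw [Complex.ofReal_mul c, mul_assoc (c : ℂ), ← mul_sub, norm_mul, Complex.norm_real,
    Real.norm_of_nonneg hc]
  refine (mul_le_mul_of_nonneg_left hN hc).trans (le_of_eq (by ring))

lemma meanIntensity_nonneg (p : Params) (hρ : 0 ≤ p.rho) (X : Space) : 0 ≤ meanIntensity p X := by
  rw [meanIntensity_eq]; positivity

lemma Narrow.norm_mean_le {e₀ κ : ℝ} {X x : Space} (hn : Narrow e₀ p X x)
    (h : IsPoissonCloud P p.rho pts) (he : e₀ ≤ 1 / 128) (hκ : 12 * meanConst * e₀ ≤ κ)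
    (hell : 0 < p.ell)
    (hexp : (p.ro / p.ell) ^ 3 ≤ Real.exp (‖cross X‖ ^ 2 / (64 * p.ro ^ 2))) :
    ‖∫ ω, scattered p pts X ω ∂P‖ ≤ κ * √(meanIntensity p X) := by
  have hρ : 0 < p.rho := by unfold Params.rho; positivity
  have hm : 0 ≤ 12 * meanConst * e₀ := by
    have := hn.pos
    have : 0 ≤ meanConst := add_nonneg crossConst_nonneg farConst_nonneg
    positivity
  refine le_trans ?_ (mul_le_mul_of_nonneg_right hκ (Real.sqrt_nonneg _))
  refine abs_le_of_sq_le_sq' ?_ (mul_nonneg hm (Real.sqrt_nonneg _)) |>.2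
  rw [mul_pow, Real.sq_sqrt (meanIntensity_nonneg p hρ.le X),
    norm_integral_scattered h hρ.le hn.ro_pos hn.kd_pos, meanIntensity_eq]
  have key := hn.sq_norm_integral_greenBeam_le he hell hexp
  calc _ = p.rho * (p.k ^ 2 * p.eta) ^ 2 * (p.rho * ‖∫ y, greenBeam p X y‖ ^ 2) := by
        rw [mul_pow, mul_pow, sq_abs]; ring
    _ ≤ p.rho * (p.k ^ 2 * p.eta) ^ 2 * ((12 * meanConst * e₀) ^ 2 *
        (p.ro ^ 2 * Real.exp (-2 * p.kd * range X) / (32 * ‖cross X‖))) := by gcongr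
    _ = _ := by ring

end Moments

/-- The exponential factors at the two symmetric points multiply exactly to the square of the one at
the midpoint, and both cross-range distances are at least half of that of the midpoint. -/
lemma Narrow.sqrt_meanIntensity_mul_le {e₀ : ℝ} {p : Params} {X x : Space} (h : Narrow e₀ p X x)
    (he : e₀ ≤ 1 / 128) (hρ : 0 ≤ p.rho) :
    √(meanIntensity p (X + (1 / 2 : ℝ) • x)) * √(meanIntensity p (X - (1 / 2 : ℝ) • x)) ≤
      2 * meanIntensity p X := by
  have hR := h.cross_pos
  have hx := (norm_cross_le x).trans h.x_le
  have hxR : ‖cross x‖ ≤ ‖cross X‖ := by nlinarith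
  have n1 := norm_sub_norm_le (cross X) (-((1 / 2 : ℝ) • cross x))
  have n2 := norm_sub_norm_le (cross X) ((1 / 2 : ℝ) • cross x)
  rw [norm_neg, sub_neg_eq_add] at n1
  rw [norm_smul, Real.norm_of_nonneg (by norm_num)] at n1 n2
  rw [← Real.sqrt_mul (meanIntensity_nonneg p hρ _)]
  refine Real.sqrt_le_iff.2 ⟨mul_nonneg two_pos.le (meanIntensity_nonneg p hρ _), ?_⟩
  rw [meanIntensity_eq, meanIntensity_eq, meanIntensity_eq, cross_add, cross_sub, cross_smul,
    range_add, range_sub, range_smul]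
  set R₁ := ‖cross X + (1 / 2 : ℝ) • cross x‖
  set R₂ := ‖cross X - (1 / 2 : ℝ) • cross x‖
  set R := ‖cross X‖
  have hR1 : R / 2 ≤ R₁ := by linarith
  have hR2 : R / 2 ≤ R₂ := by linarith
  have hE : Real.exp (-2 * p.kd * (range X + 1 / 2 * range x)) *
      Real.exp (-2 * p.kd * (range X - 1 / 2 * range x)) = Real.exp (-2 * p.kd * range X) ^ 2 := by
    rw [← Real.exp_add, ← Real.exp_nat_mul]; congr 1; push_cast; ring
  set E₁ := Real.exp (-2 * p.kd * (range X + 1 / 2 * range x))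
  set E₂ := Real.exp (-2 * p.kd * (range X - 1 / 2 * range x))
  set E := Real.exp (-2 * p.kd * range X)
  set c := p.rho * (p.k ^ 2 * p.eta) ^ 2
  calc c * (p.ro ^ 2 * E₁ / (32 * R₁)) * (c * (p.ro ^ 2 * E₂ / (32 * R₂))) =
      (c * p.ro ^ 2 / 32) ^ 2 * (E₁ * E₂) / (R₁ * R₂) := by
        field_simp
    _ ≤ (c * p.ro ^ 2 / 32) ^ 2 * (E₁ * E₂) / (R / 2 * (R / 2)) := by gcongr
    _ = _ := by rw [hE]; field_simp

end LaserBeam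

end

/-! ### Choice of the small parameter and assembly of the four items -/

theorem proposition3p2 (C : ℝ) (hC : 1 ≤ C) (ε : ℝ) (hε : 0 < ε) :
    ∃ δ : ℝ, 0 < δ ∧ ∀ p : LaserBeam.Params, LaserBeam.Regime δ p →
      ∀ A : Set LaserBeam.Space, LaserBeam.IsAperture C p A →
      ∀ (Ω : Type*) [MeasurableSpace Ω] (P : Measure Ω) [IsProbabilityMeasure P]
        (pts : ℕ → Ω → LaserBeam.Space), LaserBeam.IsPoissonCloud P p.rho pts →
      -- the scattered field is a well-defined square-integrable random variable
      (∀ x ∈ A,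
        (∀ᵐ ω ∂P, Summable fun j => LaserBeam.singleScatter p x (pts j ω)) ∧
        MemLp (LaserBeam.scattered p pts x) 2 P) ∧
      -- the mean is negligible: the contributions of the particles cancel by phase averaging
      (∀ x ∈ A,
        Integrable (fun ω => ∑' j, ‖LaserBeam.singleScatter p x (pts j ω)‖) P ∧
        ‖∫ ω, LaserBeam.scattered p pts x ω ∂P‖ ≤
          ε * ∫ ω, ∑' j, ‖LaserBeam.singleScatter p x (pts j ω)‖ ∂P) ∧
      -- the centred covariance
      (∀ X x : LaserBeam.Space, X + (1 / 2 : ℝ) • x ∈ A → X - (1 / 2 : ℝ) • x ∈ A →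
        ‖(∫ ω, (LaserBeam.scattered p pts (X + (1 / 2 : ℝ) • x) ω
                - ∫ ω', LaserBeam.scattered p pts (X + (1 / 2 : ℝ) • x) ω' ∂P) *
              conj (LaserBeam.scattered p pts (X - (1 / 2 : ℝ) • x) ω
                - ∫ ω', LaserBeam.scattered p pts (X - (1 / 2 : ℝ) • x) ω' ∂P) ∂P)
            - LaserBeam.covModel p X x‖ ≤ ε * LaserBeam.meanIntensity p X) ∧
      -- unless `r_o / ℓ` is exponentially large in `(L_x / r_o)²`, the mean is also negligible
      -- with respect to the standard deviation, and the second moment has the same limit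
      (Real.log (p.ro / p.ell) ≤ δ * (p.Lx / p.ro) ^ 2 →
        (∀ x ∈ A, ‖∫ ω, LaserBeam.scattered p pts x ω ∂P‖ ≤
          ε * Real.sqrt (LaserBeam.meanIntensity p x)) ∧
        (∀ X x : LaserBeam.Space, X + (1 / 2 : ℝ) • x ∈ A → X - (1 / 2 : ℝ) • x ∈ A →
          ‖(∫ ω, LaserBeam.scattered p pts (X + (1 / 2 : ℝ) • x) ω *
                conj (LaserBeam.scattered p pts (X - (1 / 2 : ℝ) • x) ω) ∂P)
              - LaserBeam.covModel p X x‖ ≤ ε * LaserBeam.meanIntensity p X)) := by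
  have hm : 0 ≤ LaserBeam.meanConst :=
    add_nonneg LaserBeam.crossConst_nonneg LaserBeam.farConst_nonneg
  have hl := LaserBeam.lowerConst_pos
  obtain ⟨e₁, he₁, hcorr⟩ := LaserBeam.exists_norm_correlation_sub_le (half_pos hε)
  -- κ bounds the ratio of the mean to the standard deviation. The product of the two means is then
  -- at most 2κ² I(X), the factor 2 coming from the passage to the midpoint, which fits in the half
  -- of ε left by the covariance estimate.
  obtain ⟨κ, hκ0, hκε, hκ2⟩ : ∃ κ : ℝ, 0 < κ ∧ κ ≤ ε ∧ 2 * κ ^ 2 ≤ ε / 2 := by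
    refine ⟨min ε (1 / 4), by positivity, min_le_left _ _, ?_⟩
    have h1 := min_le_left ε (1 / 4)
    have h2 := min_le_right ε (1 / 4)
    have h3 : 0 < min ε (1 / 4) := by positivity
    nlinarith
  obtain ⟨e₀, he0, hee₁, he128, hemean, heκ⟩ : ∃ e₀ : ℝ, 0 < e₀ ∧ e₀ ≤ e₁ ∧ e₀ ≤ 1 / 128 ∧
      LaserBeam.meanConst * e₀ ≤ ε * LaserBeam.lowerConst ∧
      12 * LaserBeam.meanConst * e₀ ≤ κ := by
    refine ⟨min (min e₁ (1 / 128)) (min (ε * LaserBeam.lowerConst / (LaserBeam.meanConst + 1))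
      (κ / (12 * LaserBeam.meanConst + 1))), by positivity,
      (min_le_left _ _).trans (min_le_left _ _), (min_le_left _ _).trans (min_le_right _ _), ?_, ?_⟩
    · have h := (min_le_right (min e₁ (1 / 128)) _).trans (min_le_left
        (ε * LaserBeam.lowerConst / (LaserBeam.meanConst + 1))
        (κ / (12 * LaserBeam.meanConst + 1)))
      refine (mul_le_mul_of_nonneg_left h hm).trans ?_
      rw [mul_div_assoc', div_le_iff₀ (by positivity)]
      nlinarith [mul_pos hε hl]
    · have h := (min_le_right (min e₁ (1 / 128)) _).trans (min_le_right
        (ε * LaserBeam.lowerConst / (LaserBeam.meanConst + 1))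
        (κ / (12 * LaserBeam.meanConst + 1)))
      refine (mul_le_mul_of_nonneg_left h (by positivity)).trans ?_
      rw [mul_div_assoc', div_le_iff₀ (by positivity)]
      nlinarith
  have hC0 : 0 < C := by linarith
  -- The constant 768 is 3 · 4 · 64: the exponent 3 in (r_o/ℓ)³, the square of the factor 2 in L_x ≤
  -- 2C|x|, and the 64 of the Gaussian gain.
  obtain ⟨δ, hδ0, hδC, hδe, hδexp⟩ : ∃ δ : ℝ, 0 < δ ∧ δ * C ≤ 1 ∧ 2 * C ^ 2 * δ ≤ e₀ ∧
      δ * (768 * C ^ 2) ≤ 1 := by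
    refine ⟨min (1 / C) (min (e₀ / (2 * C ^ 2)) (1 / (768 * C ^ 2))), by positivity, ?_, ?_, ?_⟩
    · exact (le_div_iff₀ hC0).1 (min_le_left _ _)
    · rw [mul_comm]
      exact (le_div_iff₀ (by positivity)).1 ((min_le_right _ _).trans (min_le_left _ _))
    · exact (le_div_iff₀ (by positivity)).1 ((min_le_right _ _).trans (min_le_right _ _))
  refine ⟨δ, hδ0, fun p hp A hA Ω _ P _ pts h => ?_⟩
  have hro := hp.ro_pos
  have hkd := hp.kd_pos
  have hell := hp.ell_pos
  have hρ : 0 ≤ p.rho := by unfold LaserBeam.Params.rho; positivity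
  have hnarrow {X x : LaserBeam.Space} (h₁ : X + (1 / 2 : ℝ) • x ∈ A)
      (h₂ : X - (1 / 2 : ℝ) • x ∈ A) := hp.narrow hC hδ0 hδC hδe hA h₁ h₂
  -- One-point estimates are the case of zero offset, in which the midpoint is the observation point
  -- itself.
  have hpoint {x : LaserBeam.Space} (hx : x ∈ A) :
      LaserBeam.Narrow e₀ p x 0 ∧ p.Lx ≤ 2 * C * ‖LaserBeam.cross x‖ :=
    hnarrow (by simpa using hx) (by simpa using hx)
  have hcov {X x : LaserBeam.Space} (h₁ : X + (1 / 2 : ℝ) • x ∈ A)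
      (h₂ : X - (1 / 2 : ℝ) • x ∈ A) :=
    LaserBeam.norm_sub_covModel_le hρ (hcorr p X x ((hnarrow h₁ h₂).1.mono hee₁))
  refine ⟨fun x _ => ⟨?_, ?_⟩, fun x hx => ⟨?_, ?_⟩, fun X x h₁ h₂ => ?_, fun hlog => ?_⟩
  · filter_upwards [LaserBeam.ae_summable_norm_comp h.measurable
      (h.integrable_sum_map (LaserBeam.integrable_singleScatter p hro hkd x))] with ω hω
    exact hω.of_norm
  · exact h.memLp_tsum (LaserBeam.integrable_singleScatter p hro hkd x)
      (LaserBeam.memLp_singleScatter p hro hkd x) (LaserBeam.measurable_singleScatter p x)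
  · exact LaserBeam.integrable_tsum_comp (F := fun y => ‖LaserBeam.singleScatter p x y‖)
      h.measurable
      (h.integrable_sum_map (LaserBeam.integrable_singleScatter p hro hkd x).norm)
  · rw [LaserBeam.norm_integral_scattered h hρ hro hkd,
      LaserBeam.integral_tsum_norm_singleScatter h hρ hro hkd]
    calc _ ≤ p.rho * (|p.k ^ 2 * p.eta| * (ε * ∫ y, ‖LaserBeam.greenBeam p x y‖)) := by
          gcongr
          exact (hpoint hx).1.norm_integral_greenBeam_le_mul he128 hemean
      _ = _ := by ring
  · rw [LaserBeam.covariance_scattered h hρ hro hkd]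
    exact (hcov h₁ h₂).trans (mul_le_mul_of_nonneg_right (by linarith)
      (LaserBeam.meanIntensity_nonneg p hρ X))
  · have hmean {x : LaserBeam.Space} (hx : x ∈ A) : ‖∫ ω, LaserBeam.scattered p pts x ω ∂P‖ ≤
        κ * Real.sqrt (LaserBeam.meanIntensity p x) := by
      obtain ⟨hn, hLR⟩ := hpoint hx
      refine hn.norm_mean_le h he128 heκ hell ?_
      have hq : 0 < p.ro / p.ell := by positivity
      have hLx := hp.Lx_pos
      -- Here the assumption on log(r_o/ℓ) becomes the domination of (r_o/ℓ)³ by the Gaussian gain.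
      rw [← Real.exp_log (pow_pos hq 3), Real.exp_le_exp, Real.log_pow]
      calc ((3 : ℕ) : ℝ) * Real.log (p.ro / p.ell) ≤ 3 * (δ * (p.Lx / p.ro) ^ 2) := by
            push_cast; gcongr
        _ ≤ 3 * (δ * (2 * C * ‖LaserBeam.cross x‖ / p.ro) ^ 2) := by gcongr
        _ = δ * (768 * C ^ 2) * (‖LaserBeam.cross x‖ ^ 2 / (64 * p.ro ^ 2)) := by
            field_simp; ring
        _ ≤ 1 * (‖LaserBeam.cross x‖ ^ 2 / (64 * p.ro ^ 2)) := by gcongr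
        _ = _ := one_mul _
    refine ⟨fun x hx => (hmean hx).trans
      (mul_le_mul_of_nonneg_right hκε (Real.sqrt_nonneg _)), fun X x h₁ h₂ => ?_⟩
    have hI := LaserBeam.meanIntensity_nonneg p hρ X
    rw [LaserBeam.secondMoment_scattered h hρ hro hkd, add_sub_right_comm]
    refine (norm_add_le _ _).trans ?_
    rw [norm_mul, RCLike.norm_conj]
    calc _ ≤ ε / 2 * LaserBeam.meanIntensity p X +
          κ * Real.sqrt (LaserBeam.meanIntensity p (X + (1 / 2 : ℝ) • x)) *
          (κ * Real.sqrt (LaserBeam.meanIntensity p (X - (1 / 2 : ℝ) • x))) :=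
          add_le_add (hcov h₁ h₂) (mul_le_mul (hmean h₁) (hmean h₂) (norm_nonneg _)
            (mul_nonneg hκ0.le (Real.sqrt_nonneg _)))
      _ = ε / 2 * LaserBeam.meanIntensity p X + κ ^ 2 *
          (Real.sqrt (LaserBeam.meanIntensity p (X + (1 / 2 : ℝ) • x)) *
          Real.sqrt (LaserBeam.meanIntensity p (X - (1 / 2 : ℝ) • x))) := by ring
      _ ≤ ε / 2 * LaserBeam.meanIntensity p X + κ ^ 2 * (2 * LaserBeam.meanIntensity p X) := by
          exact add_le_add_right (mul_le_mul_of_nonneg_left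
            ((hnarrow h₁ h₂).1.sqrt_meanIntensity_mul_le he128 hρ) (sq_nonneg κ)) _
      _ = (ε / 2 + 2 * κ ^ 2) * LaserBeam.meanIntensity p X := by ring
      _ ≤ _ := mul_le_mul_of_nonneg_right (by linarith) hI
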